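/- **Setting.** Let $u$ be a Leray–Hopf weak solution of the Navier–Stokes equations $\partial_t u-\Delta u+u\cdot\nabla u+\nabla p=0$, $\operatorname{div}u=0$ on $\mathbb R^3\times(0,1)$ with initial datum $u_0\in L^2$. That is: - $u\in L^\infty(0,1;L^2)\cap L^2(0,1;H^1)$ and $\operatorname{div}u=0$; - $\int_0^1\!\int_{\mathbb R^3}\{-u\cdot\partial_t\phi+\nabla u\cdot\nabla\phi+(u\cdot\nabla u)\cdot\phi\}\,dx\,dt=0$ for all divergence-free $\phi\in C_0^\infty(\mathbb R^3\times(0,1))$; - $t\mapsto u(t)$ is weakly continuous in $L^2$ on $[0,1)$, with $u(0)=u_0$ and $\|u(t)-u_0\|_{L^2}\to0$ as $t\downarrow0$. Assume that $u$ is bounded before time $1$: $u$ is bounded on $\mathbb R^3\times[s,r]$ whenever $0<s\le r<1$. Put $$w(y,\tau)=(1-t)^{1/2}u(x,t),\qquad y=\frac{x}{(1-t)^{1/2}},\qquad \tau=-\ln(1-t)\in[0,\infty).$$ Let $\varphi\in C_0^\infty(\mathbb R^3,[0,1])$ be radial with $\varphi=1$ for $|\xi|\le1$, $\varphi=0$ for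 $|\xi|\ge2$ and $\xi\cdot\nabla\varphi\le0$. Let $\alpha\in(0,\frac18)$ and $\chi(\xi)=\min(|\xi|,\tfrac12+\alpha)^{\frac12+2\alpha}\varphi(\xi)$. With $\mathcal F$ the Fourier transform with kernel $e^{-ix\cdot\xi}$, set $$\underline w=\mathcal F^{-1}[\varphi\,\mathcal F w],\quad \overline w=\mathcal F^{-1}[(1-\varphi)\mathcal F w],\quad \tilde\Delta_{-1}w=\mathcal F^{-1}[\chi\,\mathcal F w],\quad \tilde{\overline w}=\mathcal F^{-1}\big[\sqrt{1-\varphi^2}\,\mathcal F w\big],$$ $$E(\tau)=\|\tilde\Delta_{-1}w(\tau)\|_{L^2(\mathbb R^3)}^2+\|\tilde{\overline w}(\tau)\|_{L^2(\mathbb R^3)}^2 .$$ **Statement.** There are $\delta_0>0$ and constants $C$ and $C(\beta)$ ($\beta\in\mathbb N^3$), depending only on $\varphi$ and $\alpha$ (and on $\beta$ in the case of $C(\beta)$), such that the following holds for all $\delta\in(0,\delta_0]$ and all $u$ as above. If $\|u_0\|_{L^2}^2\le\delta$, then $E(0)\le\delta$. If $E(0)\le\delta$, then: 1. $E$ is differentiable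 at every $\tau>0$ and $\frac{d}{d\tau}E(\tau)\le-\alpha E(\tau)$; moreover $E(\tau)\le e^{-\alpha\tau}E(0)$ for all $\tau\ge0$. 2. $w(\tau)=\underline w(\tau)+\overline w(\tau)$ for all $\tau\geq 0$, and for every $m\in[4,\infty]$ $$\|D^\beta\underline w(\tau)\|_{L^m(\mathbb R^3)}\le C(\beta)\,\delta^{1/2}\quad\text{for all }\tau>0\text{ and all }\beta,\qquad \lim_{\tau\to\infty}\|\underline w(\tau)\|_{L^m(\mathbb R^3)}=0 .$$ 3. $$\sup_{\tau\ge0}\int_{\mathbb R^3}|\overline w(y,\tau)|^2dy+\int_0^\infty\!\!\int_{\mathbb R^3}|\nabla\overline w(y,\tau)|^2dy\,d\tau\le C\delta,\qquad \lim_{\tau\to\infty}\int_{\mathbb R^3}|\overline w(y,\tau)|^2dy=0 .$$ -/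

import Mathlib

open MeasureTheory Set Filter Topology
open scoped ENNReal NNReal ContDiff FourierTransform SchwartzMap LineDeriv

noncomputable section

namespace NSE

/-- The physical space (and frequency space) `ℝ³`. -/
abbrev V3 := EuclideanSpace ℝ (Fin 3)

/-- Complex vectors, the values of Fourier transforms of vector fields. -/
abbrev C3 := EuclideanSpace ℂ (Fin 3)

/-- The standard basis vector `e_j` of `ℝ³`. -/
def e (j : Fin 3) : V3 := EuclideanSpace.single j 1

/-- The inclusion `ℝ³ ⊆ ℂ³`. -/
def complexify (v : V3) : C3 := WithLp.toLp 2 (fun i => (v i : ℂ))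

/-! ### Weak solutions of the Navier-Stokes equations on `ℝ³ × (0,1)` -/

/-- Smooth, compactly supported, divergence-free test fields on the space-time `(0,1) × ℝ³`. -/
structure IsTestField (φ : ℝ × V3 → V3) : Prop where
  smooth : ContDiff ℝ ∞ φ
  compact : HasCompactSupport φ
  supp : tsupport φ ⊆ Ioo (0 : ℝ) 1 ×ˢ univ
  div_free : ∀ t x, ∑ j : Fin 3, (fderiv ℝ (fun z => φ (t, z)) x (e j)) j = 0

/-- `G` is the weak (distributional) gradient of `f` on `ℝ³`: `G x (e j)` is `∂_j f (x)`. -/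
def IsWeakGradient (f : V3 → V3) (G : V3 → V3 →L[ℝ] V3) : Prop :=
  ∀ (j : Fin 3) (ψ : V3 → ℝ), ContDiff ℝ ∞ ψ → HasCompactSupport ψ →
    ∫ x, (fderiv ℝ ψ x (e j)) • f x = - ∫ x, ψ x • G x (e j)

/-- The distributional equation `div f = 0` on `ℝ³`. -/
def IsWeaklyDivFree (f : V3 → V3) : Prop :=
  ∀ ψ : V3 → ℝ, ContDiff ℝ ∞ ψ → HasCompactSupport ψ → ∫ x, fderiv ℝ ψ x (f x) = 0

/-- The space-time measure on `(0,1) × ℝ³`. -/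
def spaceTime : Measure (ℝ × V3) := volume.restrict (Ioo (0 : ℝ) 1 ×ˢ univ)

/-- `u` (with weak spatial gradient `G`) is a Leray-Hopf weak solution of
`∂_t u - Δu + u·∇u + ∇p = 0`, `div u = 0` on `ℝ³ × (0,1)` with initial datum `u₀`.
As usual, `u` is normalized on null sets of times so as to be weakly continuous in `L²`. -/
structure IsLerayHopfWith (u₀ : V3 → V3) (u : ℝ → V3 → V3) (G : ℝ → V3 → V3 →L[ℝ] V3) :
    Prop where
  /-- `u ∈ L^∞(0,1; L²)` -/
  memLp : ∀ t ∈ Ico (0 : ℝ) 1, MemLp (u t) 2 volume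
  bounded_L2 : ∃ M : ℝ≥0, ∀ t ∈ Ico (0 : ℝ) 1, eLpNorm (u t) 2 volume ≤ M
  measurable : AEStronglyMeasurable (fun p : ℝ × V3 => u p.1 p.2) spaceTime
  /-- `u ∈ L²(0,1; H¹)` -/
  grad_memLp : MemLp (fun p : ℝ × V3 => G p.1 p.2) 2 spaceTime
  weak_grad : ∀ᵐ t ∂(volume.restrict (Ioo (0 : ℝ) 1)), IsWeakGradient (u t) (G t)
  div_free : ∀ t ∈ Ioo (0 : ℝ) 1, IsWeaklyDivFree (u t)
  /-- the equation, tested against divergence-free fields -/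
  equation : ∀ φ : ℝ × V3 → V3, IsTestField φ →
    ∫ p, (- inner ℝ (u p.1 p.2) (fderiv ℝ φ p (1, 0))
      + ∑ j : Fin 3, inner ℝ (G p.1 p.2 (e j)) (fderiv ℝ φ p (0, e j))
      + inner ℝ (G p.1 p.2 (u p.1 p.2)) (φ p)) ∂spaceTime = 0
  weakly_continuous : ∀ v : V3 → V3, MemLp v 2 volume →
    ContinuousOn (fun t => ∫ x, inner ℝ (u t x) (v x)) (Ico (0 : ℝ) 1)
  /-- the initial datum, attained in `L²` -/
  initial : u 0 =ᵐ[volume] u₀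
  initial_L2 : Tendsto (fun t => eLpNorm (u t - u₀) 2 volume) (𝓝[>] (0 : ℝ)) (𝓝 0)

/-- Leray-Hopf weak solution on `ℝ³ × (0,1)` with initial datum `u₀`. -/
def IsLerayHopf (u₀ : V3 → V3) (u : ℝ → V3 → V3) : Prop :=
  ∃ G : ℝ → V3 → V3 →L[ℝ] V3, IsLerayHopfWith u₀ u G

/-- `u` is bounded before time `1`: bounded on `ℝ³ × [s,r]` whenever `0 < s ≤ r < 1`
(nothing is required as `t → 0` or as `t → 1`). -/
def BoundedBeforeOne (u : ℝ → V3 → V3) : Prop :=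
  ∀ s r : ℝ, 0 < s → r < 1 → ∃ M : ℝ, ∀ t ∈ Icc s r, ∀ᵐ x, ‖u t x‖ ≤ M

/-! ### Self-similar variables -/

/-- `w(y,τ) = (1-t)^{1/2} u(x,t)` with `y = x/(1-t)^{1/2}` and `τ = -log(1-t)`. -/
def rescale (u : ℝ → V3 → V3) (τ : ℝ) (y : V3) : V3 :=
  Real.exp (-τ / 2) • u (1 - Real.exp (-τ)) (Real.exp (-τ / 2) • y)

/-! ### Fourier multipliers on `L²` -/

open Classical in
/-- The class in `L²(ℝ³; ℂ³)` of a square integrable real vector field (and `0` for a field that is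
not square integrable). -/
def toL2 (f : V3 → V3) : Lp C3 2 (volume : Measure V3) :=
  if h : MemLp (fun x => complexify (f x)) 2 (volume : Measure V3) then h.toLp else 0

open Classical in
/-- Multiplication by `ζ ↦ σ (2πζ)` on `L²` (only used for bounded `σ`). -/
def mulL2 (σ : V3 → ℝ) (g : Lp C3 2 (volume : Measure V3)) : Lp C3 2 (volume : Measure V3) :=
  if h : MemLp (fun ζ => (σ ((2 * Real.pi) • ζ) : ℂ) • g ζ) 2 (volume : Measure V3)
  then h.toLp else 0

/-- The operator `f ↦ F⁻¹[σ(ξ) F[f](ξ)]` on `L²`, where `F` is the Fourier transform with kernel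
`exp (-i x·ξ)`. The transform `𝓕` used here has kernel `exp (-2πi x·ζ)`, so `ξ = 2πζ`. -/
def multiplier (σ : V3 → ℝ) (f : Lp C3 2 (volume : Measure V3)) :
    Lp C3 2 (volume : Measure V3) :=
  𝓕⁻ (mulL2 σ (𝓕 f))

/-- The smooth radial cutoff functions `φ` of the low frequencies. -/
structure IsCutoff (φ : V3 → ℝ) : Prop where
  smooth : ContDiff ℝ ∞ φ
  radial : ∀ ξ η : V3, ‖ξ‖ = ‖η‖ → φ ξ = φ η
  mem_unit : ∀ ξ, φ ξ ∈ Icc (0 : ℝ) 1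
  eq_one : ∀ ξ, ‖ξ‖ ≤ 1 → φ ξ = 1
  eq_zero : ∀ ξ, 2 ≤ ‖ξ‖ → φ ξ = 0
  decreasing : ∀ ξ, fderiv ℝ φ ξ ξ ≤ 0

/-- The modified low frequency symbol
`χ(ξ) = min(|ξ|, 1/2 + α)^{1/2 + 2α} φ(ξ)`. -/
def chi (φ : V3 → ℝ) (α : ℝ) (ξ : V3) : ℝ :=
  if ‖ξ‖ ≤ 1 / 2 + α then ‖ξ‖ ^ (1 / 2 + 2 * α) * φ ξ
  else (1 / 2 + α) ^ (1 / 2 + 2 * α) * φ ξ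

/-- The low frequency part `w̲ = Δ₋₁ w` of the rescaled velocity `w` at time `τ`. -/
def low (φ : V3 → ℝ) (u : ℝ → V3 → V3) (τ : ℝ) : Lp C3 2 (volume : Measure V3) :=
  multiplier φ (toL2 (rescale u τ))

/-- The high frequency part `w̄ = Δ₀ w`. -/
def high (φ : V3 → ℝ) (u : ℝ → V3 → V3) (τ : ℝ) : Lp C3 2 (volume : Measure V3) :=
  multiplier (fun ξ => 1 - φ ξ) (toL2 (rescale u τ))

/-- `Δ̃₋₁ w = F⁻¹[χ F[w]]`. -/
def lowTilde (φ : V3 → ℝ) (α : ℝ) (u : ℝ → V3 → V3) (τ : ℝ) : Lp C3 2 (volume : Measure V3) :=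
  multiplier (chi φ α) (toL2 (rescale u τ))

/-- The high frequency part with symbol `√(1 - φ²)`. -/
def highTilde (φ : V3 → ℝ) (u : ℝ → V3 → V3) (τ : ℝ) : Lp C3 2 (volume : Measure V3) :=
  multiplier (fun ξ => √(1 - φ ξ ^ 2)) (toL2 (rescale u τ))

/-- The energy of `w` at time `τ`: the sum of the squared `L²` norms of `lowTilde` and
`highTilde`. -/
def energy (φ : V3 → ℝ) (α : ℝ) (u : ℝ → V3 → V3) (τ : ℝ) : ℝ :=
  ‖lowTilde φ α u τ‖ ^ 2 + ‖highTilde φ u τ‖ ^ 2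

/-! ### Derivatives of `L²` functions, in the sense of tempered distributions -/

/-- `D^β T = ∂₁^{β₁} ∂₂^{β₂} ∂₃^{β₃} T`. -/
def multiDeriv (β : Fin 3 → ℕ) (T : 𝓢'(V3, C3)) : 𝓢'(V3, C3) :=
  (fun S : 𝓢'(V3, C3) => ∂_{e 0} S)^[β 0]
    ((fun S : 𝓢'(V3, C3) => ∂_{e 1} S)^[β 1] ((fun S : 𝓢'(V3, C3) => ∂_{e 2} S)^[β 2] T))

/-- `g = D^β f` weakly. -/
def IsWeakDeriv (β : Fin 3 → ℕ) (f g : Lp C3 2 (volume : Measure V3)) : Prop :=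
  (g : 𝓢'(V3, C3)) = multiDeriv β (f : 𝓢'(V3, C3))

/-- `‖∇f‖²` in `L²`, which is `∞` when the distribution `∇f` is not in `L²`. (The infimum
is over at most one element.) -/
def gradSq (f : Lp C3 2 (volume : Measure V3)) : ℝ≥0∞ :=
  ⨅ (g : Fin 3 → Lp C3 2 (volume : Measure V3))
    (_ : ∀ j, (g j : 𝓢'(V3, C3)) = ∂_{e j} (f : 𝓢'(V3, C3))),
    ∑ j : Fin 3, ENNReal.ofReal (‖g j‖ ^ 2)

end NSE

end

/-!
The energy is read off in frequency space: by Plancherel (`energy_eq`) it is `∫ m |F w|²` with the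
symbol `m = χ² + 1 - φ²` (`symb`), which is `|ξ|^(1 + 4α)` for `|ξ| < 1/2 + α`, is radially
increasing, and equals `1` for `|ξ| ≥ 2`. Since `w` is a rescaling of `u` with ratio
`s = (1 - t)^(1/2)`, it is also `s⁻¹ ∫ m(2πsζ) |𝓕 u(t)|²` (`energy_eq_scaled`), so that it can be
differentiated through the evolution of `𝓕 u` in `t` and the dependence of the symbol on `s`.

*Regularity.* The momentum equation determines the increments of `𝓕 u` up to a multiple of `ζ`, the
pressure, which is orthogonal to solenoidal fields (`inner_fourier_vel_sub`). At bounded frequencies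
`-Δ` is a bounded operator and `t ↦ 𝓕 u(t)` is absolutely continuous, whence an energy identity for
every weight of compact support (`energy_identity_cut`). As `u` is bounded before time `1`,
`u · ∇u` is square integrable in space-time; with the weight `|2πζ|²` on annuli, Young's inequality
shows that `H¹` regularity propagates from almost every time, with uniformly small high frequencies
(`integrable_lap`). So `u` is a continuous curve in `H¹` (`continuousOn_weighted`), all energies
`∫ b |𝓕 u|²` with bounded `b` are differentiable (`hasDerivAt_weighted_energy`), and so is `E`
(`hasDerivAt_energy`). No smoothness of `u` is needed.

*The linear part.* It contributes `½ (m - ξ · ∇m) - 2 m |ξ|²` to the symbol of `E'`. At low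
frequencies the scaling gives `½ (m - ξ · ∇m) = -2α m`; at high frequencies `ξ · ∇m ≥ 0`, and the
dissipation wins because `2 (1/2 + α)² > 1/2 + 2α`. In both regions a multiple of the dissipation
is left over (`linear_symb_le`).

*The nonlinear part.* Since `∫ (w · ∇w) · w = 0` (`trilinear_one`), `m` may be replaced by `m - 1`,
which is supported in `|ξ| ≤ 2`. One of the three factors is then a low frequency field, and low
frequency fields are bounded in `L⁴` and in `L^∞` by a multiple of `√E`
(`exists_lowFrequency_bound`): by the Cauchy-Schwarz and Young inequalities for Fourier transforms
this requires `1 / m ∈ L¹ ∩ L²(|ξ| ≤ 2)`, which holds as `α < 1/8`. The nonlinear part is therefore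
at most of order `E^(3/2)` (`exists_trilinear_bound`), and for small `E` the linear decay absorbs it
(`exists_energy_threshold`).

*Conclusion.* A continuity argument (`le_exp_of_deriv_le_below`) keeps `E` below the threshold and
gives the exponential decay. The low frequencies and their derivatives are then bounded by the `L⁴`
and `L^∞` estimates, the high frequencies by `E` itself, and the dissipation that was left over,
integrated in time, controls `∇` of the high frequencies (`gradSq_high_le`).
-/

noncomputable section

namespace NSE

/-! ### Test functions and tempered distributions -/

/-- Cutting a Schwartz function off at radius `n` converges to it in the Schwartz topology: the
derivatives of the rescaled cutoff `χ (n⁻¹ • ·)` are bounded uniformly in `n`, and the difference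
lives in `‖x‖ ≥ n`, where one power of `‖x‖` gains a factor `n⁻¹`. -/
theorem exists_tendsto_hasCompactSupport (κ : 𝓢(V3, ℂ)) :
    ∃ κ' : ℕ → 𝓢(V3, ℂ), (∀ n, HasCompactSupport (κ' n)) ∧ Tendsto κ' atTop (𝓝 κ) := by
  let b : ContDiffBump (0 : V3) := ⟨1, 2, one_pos, one_lt_two⟩
  let c : ℕ → ℝ := fun n => ((n : ℝ) + 1)⁻¹
  have hc0 : ∀ n, 0 < c n := fun n => by positivity
  have hc1 : ∀ n, c n ≤ 1 := fun n => inv_le_one_of_one_le₀ (by simp)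
  have hbc : ∀ n, ContDiff ℝ ∞ (fun x : V3 => b (c n • x)) := fun n =>
    b.contDiff.comp (contDiff_const_smul _)
  have hsupp : ∀ n, HasCompactSupport (fun x : V3 => b (c n • x)) := fun n =>
    b.hasCompactSupport.comp_homeomorph (Homeomorph.smulOfNeZero (c n) (hc0 n).ne')
  have htg : ∀ n, (fun x : V3 => b (c n • x)).HasTemperateGrowth := fun n =>
    (hsupp n).hasTemperateGrowth (hbc n)
  refine ⟨fun n => SchwartzMap.smulLeftCLM ℂ (fun x : V3 => b (c n • x)) κ, fun n => ?_, ?_⟩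
  · rw [SchwartzMap.smulLeftCLM_apply (htg n)]
    exact (hsupp n).smul_right
  rw [(schwartz_withSeminorms ℝ V3 ℂ).tendsto_nhds]
  rintro ⟨k, l⟩ ε hε
  -- the complementary cutoff `1 - b` and a bound for its derivatives up to order `l`
  let g : V3 → ℝ := fun x => b x - 1
  have hg : ContDiff ℝ ∞ g := b.contDiff.sub contDiff_const
  have hgB : ∀ i, ∃ C, ∀ x, ‖iteratedFDeriv ℝ i g x‖ ≤ C := by
    intro i
    have h1 : Continuous (iteratedFDeriv ℝ i g) :=
      hg.continuous_iteratedFDeriv (by exact_mod_cast le_top)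
    have h2 : ∃ C, ∀ x ∈ Metric.closedBall (0 : V3) 3, ‖iteratedFDeriv ℝ i g x‖ ≤ C :=
      (isCompact_closedBall _ _).exists_bound_of_continuousOn h1.continuousOn
    obtain ⟨C, hC⟩ := h2
    refine ⟨max C ‖iteratedFDeriv ℝ i (fun _ : V3 => (-1 : ℝ)) 0‖, fun x => ?_⟩
    by_cases hx : x ∈ Metric.closedBall (0 : V3) 3
    · exact (hC x hx).trans (le_max_left _ _)
    · refine le_trans (le_of_eq ?_) (le_max_right _ _)
      have : g =ᶠ[𝓝 x] fun _ => (-1 : ℝ) := by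
        have : (Metric.closedBall (0 : V3) 3)ᶜ ∈ 𝓝 x :=
          Metric.isClosed_closedBall.isOpen_compl.mem_nhds hx
        filter_upwards [this] with y hy
        have : b y = 0 := b.zero_of_le_dist (by
          simp only [mem_compl_iff, Metric.mem_closedBall, not_le] at hy
          change (2 : ℝ) ≤ _
          linarith)
        simp [g, this]
      rw [(this.iteratedFDeriv (𝕜 := ℝ) i).self_of_nhds]
      cases i with
      | zero => simp [iteratedFDeriv_zero_eq_comp]
      | succ i => simp [iteratedFDeriv_const_of_ne]
  choose C hC using hgB
  let M : ℝ := ∑ i ∈ Finset.range (l + 1), (l.choose i : ℝ) * C i *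
    SchwartzMap.seminorm ℝ (k + 1) (l - i) κ
  have hM0 : 0 ≤ M := Finset.sum_nonneg fun i _ => by
    have : 0 ≤ C i := (norm_nonneg _).trans (hC i 0)
    positivity
  have key : ∀ n, SchwartzMap.seminorm ℝ k l
      (SchwartzMap.smulLeftCLM ℂ (fun x : V3 => b (c n • x)) κ - κ) ≤ c n * M := by
    intro n
    refine SchwartzMap.seminorm_le_bound ℝ k l _ (by have := hc0 n; positivity) fun x => ?_
    have hfun : ⇑(SchwartzMap.smulLeftCLM ℂ (fun x : V3 => b (c n • x)) κ - κ)
        = fun x => g (c n • x) • κ x := by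
      ext x
      simp [SchwartzMap.smulLeftCLM_apply_apply (htg n), g, sub_smul]
    rw [hfun]
    have hgn : ContDiff ℝ ∞ (fun x : V3 => g (c n • x)) := hg.comp (contDiff_const_smul _)
    by_cases hx : ‖x‖ < n + 1
    · have : (fun x => g (c n • x) • κ x) =ᶠ[𝓝 x] fun _ => (0 : ℂ) := by
        have : Metric.ball (0 : V3) (n + 1) ∈ 𝓝 x :=
          Metric.isOpen_ball.mem_nhds (by simpa using hx)
        filter_upwards [this] with y hy
        have : b (c n • y) = 1 := b.one_of_mem_closedBall (by
          simp only [Metric.mem_ball, dist_zero_right] at hy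
          simp only [Metric.mem_closedBall, dist_zero_right, norm_smul, Real.norm_eq_abs,
            abs_of_pos (hc0 n)]
          change c n * ‖y‖ ≤ 1
          simp only [c]
          rw [inv_mul_le_iff₀ (by positivity)]
          linarith)
        simp [g, this]
      rw [(this.iteratedFDeriv (𝕜 := ℝ) l).self_of_nhds]
      have h0 : iteratedFDeriv ℝ l (fun _ : V3 => (0 : ℂ)) x = 0 := by simp
      rw [h0]
      have := hc0 n
      simp only [norm_zero, mul_zero]
      positivity
    · have hx' : 1 ≤ c n * ‖x‖ := by
        simp only [c]
        rw [← div_eq_inv_mul, le_div_iff₀ (by positivity)]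
        linarith
      calc ‖x‖ ^ k * ‖iteratedFDeriv ℝ l (fun x => g (c n • x) • κ x) x‖
          ≤ ‖x‖ ^ k * ∑ i ∈ Finset.range (l + 1), (l.choose i : ℝ) *
            ‖iteratedFDeriv ℝ i (fun x => g (c n • x)) x‖ * ‖iteratedFDeriv ℝ (l - i) κ x‖ := by
            gcongr
            exact norm_iteratedFDeriv_smul_le hgn (κ.smooth ⊤) x (by exact_mod_cast le_top)
        _ ≤ (c n * ‖x‖) * (‖x‖ ^ k * ∑ i ∈ Finset.range (l + 1), (l.choose i : ℝ) *
            C i * ‖iteratedFDeriv ℝ (l - i) κ x‖) := by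
            refine le_trans ?_ (le_mul_of_one_le_left ?_ hx')
            · gcongr with i hi
              rw [iteratedFDeriv_comp_const_smul (c n) (hg.of_le (by exact_mod_cast le_top))]
              simp only [norm_smul, norm_pow, Real.norm_eq_abs, abs_of_pos (hc0 n)]
              calc c n ^ i * _ ≤ 1 * C i := by
                    gcongr
                    · exact pow_le_one₀ (hc0 n).le (hc1 n)
                    · exact hC i _
                _ = C i := one_mul _
            · refine mul_nonneg (by positivity) (Finset.sum_nonneg fun i _ => ?_)
              have : 0 ≤ C i := (norm_nonneg _).trans (hC i 0)
              positivity
        _ = c n * ∑ i ∈ Finset.range (l + 1), (l.choose i : ℝ) *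
            C i * (‖x‖ ^ (k + 1) * ‖iteratedFDeriv ℝ (l - i) κ x‖) := by
            rw [Finset.mul_sum, Finset.mul_sum, Finset.mul_sum]
            refine Finset.sum_congr rfl fun i _ => ?_
            ring
        _ ≤ c n * M := by
            refine mul_le_mul_of_nonneg_left (Finset.sum_le_sum fun i _ => ?_) (hc0 n).le
            have : 0 ≤ C i := (norm_nonneg _).trans (hC i 0)
            gcongr
            exact SchwartzMap.le_seminorm ℝ _ _ κ x
  have hlim : Tendsto (fun n => c n * M) atTop (𝓝 0) := by
    have : Tendsto c atTop (𝓝 0) := by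
      simpa [c, one_div] using tendsto_one_div_add_atTop_nhds_zero_nat (𝕜 := ℝ)
    simpa using this.mul_const M
  filter_upwards [hlim.eventually (gt_mem_nhds hε)] with n hn
  exact (key n).trans_lt hn

/-- The Schwartz function given by a real test function. -/
def testSchwartz (ψ : V3 → ℝ) (h₁ : ContDiff ℝ ∞ ψ) (h₂ : HasCompactSupport ψ) : 𝓢(V3, ℂ) :=
  HasCompactSupport.toSchwartzMap (f := fun x => (ψ x : ℂ)) (h₂.comp_left Complex.ofReal_zero)
    (Complex.ofRealCLM.contDiff.comp h₁)

@[simp]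
theorem testSchwartz_apply (ψ : V3 → ℝ) (h₁ : ContDiff ℝ ∞ ψ) (h₂ : HasCompactSupport ψ) (x : V3) :
    testSchwartz ψ h₁ h₂ x = (ψ x : ℂ) := rfl

/-- A tempered distribution that vanishes on real test functions is zero. -/
theorem tempered_eq_zero {F : Type*} [NormedAddCommGroup F] [NormedSpace ℂ F] (T : 𝓢'(V3, F))
    (hT : ∀ (ψ : V3 → ℝ) (h₁ : ContDiff ℝ ∞ ψ) (h₂ : HasCompactSupport ψ),
      T (testSchwartz ψ h₁ h₂) = 0) : T = 0 := by
  have hcs : ∀ κ : 𝓢(V3, ℂ), HasCompactSupport κ → T κ = 0 := by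
    intro κ hκ
    have hre : ContDiff ℝ ∞ (fun x => (κ x).re) := Complex.reCLM.contDiff.comp (κ.smooth ⊤)
    have him : ContDiff ℝ ∞ (fun x => (κ x).im) := Complex.imCLM.contDiff.comp (κ.smooth ⊤)
    have hre' : HasCompactSupport (fun x => (κ x).re) := hκ.comp_left Complex.zero_re
    have him' : HasCompactSupport (fun x => (κ x).im) := hκ.comp_left Complex.zero_im
    have : κ = testSchwartz _ hre hre' + Complex.I • testSchwartz _ him him' := by
      ext x
      simp [mul_comm Complex.I, Complex.re_add_im]
    rw [this, map_add, map_smul, hT, hT]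
    simp
  ext κ
  obtain ⟨κ', h1, h2⟩ := exists_tendsto_hasCompactSupport κ
  have h3 : Tendsto (fun n => T (κ' n)) atTop (𝓝 (T κ)) := (T.continuous.tendsto κ).comp h2
  have h4 : (fun n => T (κ' n)) = fun _ => 0 := funext fun n => hcs _ (h1 n)
  rw [h4] at h3
  exact tendsto_nhds_unique h3 tendsto_const_nhds

/-! ### The Fourier transform on `L²` -/

section FourierL2

variable {F G : Type*} [NormedAddCommGroup F] [InnerProductSpace ℂ F] [CompleteSpace F]
  [NormedAddCommGroup G] [InnerProductSpace ℂ G] [CompleteSpace G]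

/-- The symbol `2πi ζ_j` of `∂_j` for the Fourier transform with kernel `exp (-2πi x·ζ)`. -/
def dsym (j : Fin 3) (ζ : V3) : ℂ := 2 * Real.pi * Complex.I * (ζ j : ℂ)

theorem inner_e (ζ : V3) (j : Fin 3) : inner ℝ ζ (e j) = ζ j := by
  simp [e, EuclideanSpace.inner_single_right]

theorem dsym_hasTemperateGrowth (j : Fin 3) : (dsym j).HasTemperateGrowth := by
  have : dsym j = fun ζ => (2 * Real.pi * Complex.I) * ((inner ℝ ζ (e j) : ℝ) : ℂ) := by
    ext ζ; simp [dsym, inner_e]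
  rw [this]
  fun_prop

theorem continuous_dsym (j : Fin 3) : Continuous (dsym j) := by
  unfold dsym
  fun_prop

theorem Lp_injective_tempered {f g : Lp F 2 (volume : Measure V3)}
    (h : (f : 𝓢'(V3, F)) = g) : f = g := by
  have := LinearMap.ker_eq_bot.mp (Lp.ker_toTemperedDistributionCLM_eq_bot (F := F)
    (μ := (volume : Measure V3)) (p := 2))
  exact this h

/-- A function with `L²` class `g` is the Fourier transform of `f ∈ L²` as soon as it is so when
tested against Schwartz functions. -/
theorem fourier_eq_of_forall {f g : Lp F 2 (volume : Measure V3)}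
    (h : ∀ κ : 𝓢(V3, ℂ), ∫ x, (𝓕 κ) x • f x = ∫ x, κ x • g x) : 𝓕 f = g := by
  apply Lp_injective_tempered
  rw [← Lp.fourier_toTemperedDistribution_eq]
  ext κ
  simpa using h κ

theorem integral_fourier_smul_Lp (f : Lp F 2 (volume : Measure V3)) (κ : 𝓢(V3, ℂ)) :
    ∫ x, (𝓕 κ) x • f x = ∫ x, κ x • (𝓕 f : Lp F 2 (volume : Measure V3)) x := by
  have := congrArg (fun T : 𝓢'(V3, F) => T κ) (Lp.fourier_toTemperedDistribution_eq f)
  simpa using this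

theorem integral_fourierInv_smul_Lp (f : Lp F 2 (volume : Measure V3)) (κ : 𝓢(V3, ℂ)) :
    ∫ x, (𝓕⁻ κ) x • f x = ∫ x, κ x • (𝓕⁻ f : Lp F 2 (volume : Measure V3)) x := by
  have := congrArg (fun T : 𝓢'(V3, F) => T κ) (Lp.fourierInv_toTemperedDistribution_eq f)
  simpa using this

theorem integrable_schwartz_smul {F : Type*} [NormedAddCommGroup F] [NormedSpace ℂ F]
    (κ : 𝓢(V3, ℂ)) {f : V3 → F} (hf : MemLp f 2 volume) :
    Integrable (fun x => κ x • f x) :=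
  memLp_one_iff_integrable.mp (hf.smul (κ.memLp 2 volume))

/-- The class of a function in `L²` is determined by testing against Schwartz functions, with
locally integrable functions allowed for one side. -/
theorem ae_eq_of_forall_schwartz {f g : V3 → F} (hf : LocallyIntegrable f) (hg : LocallyIntegrable g)
    (h : ∀ κ : 𝓢(V3, ℂ), ∫ x, κ x • f x = ∫ x, κ x • g x) : f =ᵐ[volume] g := by
  refine ae_eq_of_integral_contDiff_smul_eq hf hg fun ψ h₁ h₂ => ?_
  simpa using h (testSchwartz ψ h₁ h₂)

theorem locallyIntegrable_smul_Lp {F : Type*} [NormedAddCommGroup F] [NormedSpace ℂ F] {b : V3 → ℂ} (hb : Continuous b) {f : V3 → F}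
    (hf : MemLp f 2 volume) : LocallyIntegrable (fun x => b x • f x) :=
  (hf.locallyIntegrable one_le_two).continuous_smul hb

/-- `g = ∑_j ∂_j f_j` in the weak sense, in terms of Fourier transforms. -/
theorem fourier_weak_divergence_iff {f : Fin 3 → Lp F 2 (volume : Measure V3)}
    {g : Lp F 2 (volume : Measure V3)} :
    (∀ κ : 𝓢(V3, ℂ), ∑ j, ∫ x, (∂_{e j} κ) x • f j x = - ∫ x, κ x • g x) ↔
      (𝓕 g : Lp F 2 (volume : Measure V3)) =ᵐ[volume]
        fun ζ => ∑ j, dsym j ζ • (𝓕 (f j) : Lp F 2 (volume : Measure V3)) ζ := by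
  have hsm : ∀ (κ : 𝓢(V3, ℂ)) (j : Fin 3),
      ∫ x, (∂_{e j} (𝓕 κ)) x • f j x =
        - ∫ ζ, κ ζ • dsym j ζ • (𝓕 (f j) : Lp F 2 (volume : Measure V3)) ζ := by
    intro κ j
    rw [SchwartzMap.lineDerivOp_fourier_eq, integral_fourier_smul_Lp, ← integral_neg]
    congr 1
    ext ζ
    have : (inner ℝ · (e j) : V3 → ℝ).HasTemperateGrowth := by fun_prop
    have h1 : (-(2 * Real.pi * Complex.I) • SchwartzMap.smulLeftCLM ℂ (inner ℝ · (e j)) κ) ζ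
        = -(dsym j ζ * κ ζ) := by
      rw [smul_apply, SchwartzMap.smulLeftCLM_apply_apply this, inner_e]
      simp [dsym]
      ring
    rw [h1, neg_smul, smul_smul, mul_comm]
  have hint : ∀ (κ : 𝓢(V3, ℂ)) (j : Fin 3), Integrable
      (fun ζ => κ ζ • dsym j ζ • (𝓕 (f j) : Lp F 2 (volume : Measure V3)) ζ) := by
    intro κ j
    have := integrable_schwartz_smul (SchwartzMap.smulLeftCLM ℂ (dsym j) κ)
      (Lp.memLp (𝓕 (f j) : Lp F 2 (volume : Measure V3)))
    refine this.congr (Eventually.of_forall fun ζ => ?_)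
    simp only [SchwartzMap.smulLeftCLM_apply_apply (dsym_hasTemperateGrowth j), smul_smul,
      smul_eq_mul, mul_comm]
  constructor
  · intro h
    refine ae_eq_of_forall_schwartz ((Lp.memLp _).locallyIntegrable one_le_two) ?_ ?_
    · have : (fun ζ => ∑ j, dsym j ζ • (𝓕 (f j) : Lp F 2 (volume : Measure V3)) ζ)
          = ∑ j, fun ζ => dsym j ζ • (𝓕 (f j) : Lp F 2 (volume : Measure V3)) ζ := by
        ext ζ; simp
      rw [this]
      exact Finset.sum_induction _ (fun f => LocallyIntegrable f volume)
        (fun _ _ => LocallyIntegrable.add) locallyIntegrable_zero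
        fun j _ => locallyIntegrable_smul_Lp (continuous_dsym j) (Lp.memLp _)
    · intro κ
      have h1 := h (𝓕 κ)
      rw [integral_fourier_smul_Lp] at h1
      simp only [hsm, Finset.sum_neg_distrib, neg_inj] at h1
      simp only [Finset.smul_sum]
      rw [← h1, integral_finsetSum _ fun j _ => hint κ j]
  · intro h κ
    obtain ⟨κ, rfl⟩ : ∃ κ' : 𝓢(V3, ℂ), κ = 𝓕 κ' := ⟨𝓕⁻ κ, by simp⟩
    rw [integral_fourier_smul_Lp]
    simp only [hsm, Finset.sum_neg_distrib, neg_inj]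
    rw [← integral_finsetSum _ fun j _ => hint κ j]
    refine integral_congr_ae ?_
    filter_upwards [h] with ζ hζ
    rw [hζ, Finset.smul_sum]

/-- `g = ∂_j f` in the sense of tempered distributions, in terms of Fourier transforms. -/
theorem eq_lineDeriv_iff {f g : Lp F 2 (volume : Measure V3)} {j : Fin 3} :
    (g : 𝓢'(V3, F)) = ∂_{e j} (f : 𝓢'(V3, F)) ↔
      (𝓕 g : Lp F 2 (volume : Measure V3)) =ᵐ[volume]
        fun ζ => dsym j ζ • (𝓕 f : Lp F 2 (volume : Measure V3)) ζ := by
  have h := fourier_weak_divergence_iff (f := fun i => if i = j then f else 0) (g := g)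
  have e1 : (∀ κ : 𝓢(V3, ℂ), ∑ i, ∫ x, (∂_{e i} κ) x •
      (if i = j then f else 0 : Lp F 2 (volume : Measure V3)) x = - ∫ x, κ x • g x) ↔
      (g : 𝓢'(V3, F)) = ∂_{e j} (f : 𝓢'(V3, F)) := by
    have hext : (g : 𝓢'(V3, F)) = ∂_{e j} (f : 𝓢'(V3, F)) ↔
        ∀ κ, (g : 𝓢'(V3, F)) κ = (∂_{e j} (f : 𝓢'(V3, F))) κ :=
      ⟨fun h κ => by rw [h], fun h => by ext κ; exact h κ⟩
    rw [hext]
    refine forall_congr' fun κ => ?_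
    have h2 : ∀ i, ∫ x, (∂_{e i} κ) x •
        (if i = j then f else 0 : Lp F 2 (volume : Measure V3)) x =
        if i = j then ∫ x, (∂_{e j} κ) x • f x else 0 := by
      intro i
      split_ifs with hi
      · rw [hi]
      · rw [integral_eq_zero_of_ae]
        exact Eventually.of_forall fun x => by simp
    simp only [h2, Finset.sum_ite_eq', Finset.mem_univ, if_true,
      TemperedDistribution.lineDerivOp_apply_apply, Lp.toTemperedDistribution_apply, map_neg]
    constructor
    · intro h; rw [h, neg_neg]
    · intro h; rw [h, neg_neg]
  have e2 : (fun ζ => ∑ i, dsym i ζ • (𝓕 (if i = j then f else 0 : Lp F 2 (volume : Measure V3)) :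
      Lp F 2 (volume : Measure V3)) ζ) =ᵐ[volume]
      fun ζ => dsym j ζ • (𝓕 f : Lp F 2 (volume : Measure V3)) ζ := by
    have h0 : (𝓕 (0 : Lp F 2 (volume : Measure V3)) : Lp F 2 (volume : Measure V3)) = 0 :=
      (Lp.fourierTransformₗᵢ V3 F).map_zero
    filter_upwards [Lp.coeFn_zero F 2 (volume : Measure V3)] with ζ hζ
    rw [Finset.sum_eq_single j]
    · simp
    · intro i _ hi
      rw [if_neg hi, h0, hζ]
      simp
    · simp
  rw [← e1, h]
  exact ⟨fun h => h.trans e2, fun h => h.trans e2.symm⟩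

/-- The Fourier transform commutes with linear maps of the values. -/
theorem fourier_compLp (L : F →L[ℂ] G) (f : Lp F 2 (volume : Measure V3)) :
    𝓕 (L.compLp f) = L.compLp (𝓕 f : Lp F 2 (volume : Measure V3)) := by
  apply fourier_eq_of_forall
  intro κ
  have key : ∀ (κ : 𝓢(V3, ℂ)) (f : Lp F 2 (volume : Measure V3)),
      ∫ x, κ x • L.compLp f x = L (∫ x, κ x • f x) := by
    intro κ f
    rw [← L.integral_comp_comm (integrable_schwartz_smul κ (Lp.memLp f))]
    refine integral_congr_ae ?_
    filter_upwards [L.coeFn_compLp f] with x hx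
    rw [hx, map_smul]
  rw [key, key, integral_fourier_smul_Lp]

/-- On `L¹ ∩ L²` the Fourier transform is given by the integral. -/
theorem fourier_toLp_ae_eq {f : V3 → F} (h1 : Integrable f) (h2 : MemLp f 2 volume) :
    (𝓕 h2.toLp : Lp F 2 (volume : Measure V3)) =ᵐ[volume] 𝓕 f := by
  have hc : Continuous (𝓕 f) :=
    VectorFourier.fourierIntegral_continuous Real.continuous_fourierChar
      (by exact continuous_inner) h1
  refine ae_eq_of_forall_schwartz ((Lp.memLp _).locallyIntegrable one_le_two)
    hc.locallyIntegrable fun κ => ?_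
  rw [← integral_fourier_smul_Lp]
  have : ∫ x, (𝓕 κ) x • h2.toLp f x = ∫ x, (𝓕 κ) x • f x := by
    refine integral_congr_ae ?_
    filter_upwards [h2.coeFn_toLp] with x hx
    rw [hx]
  rw [this]
  have := VectorFourier.integral_fourierIntegral_smul_eq_flip (L := innerₗ V3)
    (μ := volume) (ν := volume) Real.continuous_fourierChar
    (by exact continuous_inner) κ.integrable h1
  rw [SchwartzMap.fourier_coe]
  rw [flip_innerₗ] at this
  exact this

/-- On `L¹ ∩ L²` the inverse Fourier transform is given by the integral. -/
theorem fourierInv_toLp_ae_eq {f : V3 → F} (h1 : Integrable f) (h2 : MemLp f 2 volume) :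
    (𝓕⁻ h2.toLp : Lp F 2 (volume : Measure V3)) =ᵐ[volume] 𝓕⁻ f := by
  have hL : Continuous fun p : V3 × V3 => (-innerₗ V3) p.1 p.2 := by
    simp only [LinearMap.neg_apply]
    exact continuous_inner.neg
  have hc : Continuous (𝓕⁻ f) :=
    VectorFourier.fourierIntegral_continuous Real.continuous_fourierChar hL h1
  refine ae_eq_of_forall_schwartz ((Lp.memLp _).locallyIntegrable one_le_two)
    hc.locallyIntegrable fun κ => ?_
  rw [← integral_fourierInv_smul_Lp]
  have : ∫ x, (𝓕⁻ κ) x • h2.toLp f x = ∫ x, (𝓕⁻ κ) x • f x := by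
    refine integral_congr_ae ?_
    filter_upwards [h2.coeFn_toLp] with x hx
    rw [hx]
  rw [this]
  have := VectorFourier.integral_fourierIntegral_smul_eq_flip (L := -innerₗ V3)
    (μ := volume) (ν := volume) Real.continuous_fourierChar hL κ.integrable h1
  have hflip : (-innerₗ V3).flip = -innerₗ V3 := by
    ext x y
    simp [real_inner_comm]
  rw [hflip] at this
  rw [SchwartzMap.fourierInv_coe]
  exact this

/-- An `L²` function with integrable Fourier transform is bounded by the `L¹` norm of the latter. -/
theorem norm_le_integral_fourier {f : Lp F 2 (volume : Measure V3)}
    (h : Integrable (𝓕 f : Lp F 2 (volume : Measure V3))) :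
    ∀ᵐ x, ‖f x‖ ≤ ∫ ζ, ‖(𝓕 f : Lp F 2 (volume : Measure V3)) ζ‖ := by
  have h1 := fourierInv_toLp_ae_eq h (Lp.memLp _)
  rw [Lp.toLp_coeFn, FourierTransform.fourierInv_fourier_eq] at h1
  filter_upwards [h1] with x hx
  rw [hx]
  exact VectorFourier.norm_fourierIntegral_le_integral_norm _ _ _ _ _

end FourierL2

/-! ### Dilations -/

section Dilation

theorem map_smul_volume {c : ℝ} (hc : 0 < c) :
    Measure.map (fun x : V3 => c • x) volume = ENNReal.ofReal (c ^ 3)⁻¹ • volume := by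
  have := Measure.map_addHaar_smul (volume : Measure V3) hc.ne'
  simpa [abs_of_pos (inv_pos.mpr (pow_pos hc 3))] using this

theorem ae_comp_smul {c : ℝ} (hc : 0 < c) {p : V3 → Prop} (h : ∀ᵐ x, p x) :
    ∀ᵐ x, p (c • x) := by
  have : ∀ᵐ x ∂(Measure.map (fun x : V3 => c • x) volume), p x := by
    rw [map_smul_volume hc]
    exact Measure.ae_smul_measure h _
  exact ae_of_ae_map (by fun_prop) this

theorem MemLp_comp_smul {F : Type*} [NormedAddCommGroup F] {c : ℝ} (hc : 0 < c) {f : V3 → F}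
    {p : ℝ≥0∞} (h : MemLp f p volume) : MemLp (fun x => f (c • x)) p volume := by
  have h1 : MemLp f p (Measure.map (fun x : V3 => c • x) volume) := by
    rw [map_smul_volume hc]
    exact h.smul_measure ENNReal.ofReal_ne_top
  exact (memLp_map_measure_iff h1.1 (by fun_prop)).mp h1

theorem integral_comp_smul_V3 {F : Type*} [NormedAddCommGroup F] [NormedSpace ℝ F] {c : ℝ}
    (hc : 0 < c) (f : V3 → F) : ∫ x, f (c • x) = (c ^ 3)⁻¹ • ∫ x, f x := by
  have := Measure.integral_comp_smul (volume : Measure V3) f c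
  simpa [abs_of_pos (inv_pos.mpr (pow_pos hc 3)), -inv_pow] using this

variable {F : Type*} [NormedAddCommGroup F] [InnerProductSpace ℂ F] [CompleteSpace F]

theorem schwartz_fourier_comp_smul {c : ℝ} (hc : 0 < c) (κ κ' : 𝓢(V3, ℂ))
    (h : ∀ x, κ' x = κ (c • x)) (y : V3) : (𝓕 κ') y = (c ^ 3)⁻¹ • (𝓕 κ) (c⁻¹ • y) := by
  rw [SchwartzMap.fourier_coe, SchwartzMap.fourier_coe, Real.fourier_eq, Real.fourier_eq,
    ← integral_comp_smul_V3 hc]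
  congr 1
  ext x
  rw [h, inner_smul_left, inner_smul_right]
  congr 3
  simp
  field_simp

/-- The Fourier transform of a dilated function. -/
theorem fourier_comp_smul {c : ℝ} (hc : 0 < c) {f g : Lp F 2 (volume : Measure V3)}
    (h : g =ᵐ[volume] fun x => f (c • x)) :
    (𝓕 g : Lp F 2 (volume : Measure V3)) =ᵐ[volume]
      fun ζ => (c ^ 3)⁻¹ • (𝓕 f : Lp F 2 (volume : Measure V3)) (c⁻¹ • ζ) := by
  have hm : MemLp (fun ζ => (c ^ 3)⁻¹ • (𝓕 f : Lp F 2 (volume : Measure V3)) (c⁻¹ • ζ))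
      2 volume := (MemLp_comp_smul (inv_pos.mpr hc) (Lp.memLp _)).const_smul _
  suffices H : 𝓕 g = hm.toLp by rw [H]; exact hm.coeFn_toLp
  apply fourier_eq_of_forall
  intro κ
  let κ' : 𝓢(V3, ℂ) := SchwartzMap.compCLMOfContinuousLinearEquiv ℂ
    (ContinuousLinearEquiv.smulLeft (Units.mk0 c hc.ne') : V3 ≃L[ℝ] V3) κ
  have hκ' : ∀ x, κ' x = κ (c • x) := fun x => rfl
  calc ∫ x, (𝓕 κ) x • g x = ∫ x, (fun y => (𝓕 κ) (c⁻¹ • y) • f y) (c • x) := by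
        refine integral_congr_ae ?_
        filter_upwards [h] with x hx
        simp only [hx, smul_smul, inv_mul_cancel₀ hc.ne', one_smul]
    _ = ∫ y, (𝓕 κ') y • f y := by
        refine (integral_comp_smul_V3 hc (fun y => (𝓕 κ) (c⁻¹ • y) • f y)).trans ?_
        rw [← integral_smul]
        congr 1
        ext y
        rw [schwartz_fourier_comp_smul hc κ κ' hκ', smul_assoc]
    _ = ∫ ζ, κ' ζ • (𝓕 f : Lp F 2 (volume : Measure V3)) ζ := integral_fourier_smul_Lp f κ'
    _ = ∫ ζ, (fun η => κ η • (𝓕 f : Lp F 2 (volume : Measure V3)) (c⁻¹ • η)) (c • ζ) := by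
        congr 1
        ext ζ
        simp only [hκ', smul_smul, inv_mul_cancel₀ hc.ne', one_smul]
    _ = ∫ η, κ η • hm.toLp _ η := by
        refine (integral_comp_smul_V3 hc
          (fun η => κ η • (𝓕 f : Lp F 2 (volume : Measure V3)) (c⁻¹ • η))).trans ?_
        rw [← integral_smul]
        refine integral_congr_ae ?_
        filter_upwards [hm.coeFn_toLp] with η hη
        rw [hη, smul_comm]

end Dilation

/-! ### From the Fourier transform to `L^m`, `4 ≤ m ≤ ∞` -/

section FourierLm

/-- Young's inequality `‖g * k‖₂ ≤ ‖g‖₁ ‖k‖₂` for nonnegative functions. -/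
theorem lintegral_conv_sq_le {g k : V3 → ℝ≥0∞} (hg : Measurable g) (hk : Measurable k) :
    ∫⁻ ξ, (∫⁻ η, g η * k (ξ - η)) ^ 2 ≤ (∫⁻ η, g η) ^ 2 * ∫⁻ η, k η ^ 2 := by
  have h1 : ∀ ξ, (∫⁻ η, g η * k (ξ - η)) ^ 2 ≤ (∫⁻ η, g η) * ∫⁻ η, g η * k (ξ - η) ^ 2 := by
    intro ξ
    have hm : Measurable fun η => g η * k (ξ - η) ^ 2 :=
      hg.mul ((hk.comp (measurable_const.sub measurable_id)).pow_const 2)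
    have h2 := ENNReal.lintegral_mul_norm_pow_le (μ := (volume : Measure V3)) hg.aemeasurable
      hm.aemeasurable (p := 1 / 2) (q := 1 / 2) (by norm_num) (by norm_num) (by norm_num)
    have h3 : ∀ η, g η ^ (1 / 2 : ℝ) * (g η * k (ξ - η) ^ 2) ^ (1 / 2 : ℝ) = g η * k (ξ - η) := by
      intro η
      rw [ENNReal.mul_rpow_of_nonneg _ _ (by norm_num), ← mul_assoc,
        ← ENNReal.rpow_add_of_nonneg _ _ (by norm_num) (by norm_num), ← ENNReal.rpow_natCast,
        ← ENNReal.rpow_mul]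
      norm_num
    simp only [h3] at h2
    calc (∫⁻ η, g η * k (ξ - η)) ^ 2 ≤ _ := pow_le_pow_left' h2 2
      _ = _ := by
        rw [mul_pow, ← ENNReal.rpow_natCast, ← ENNReal.rpow_mul, ← ENNReal.rpow_natCast,
          ← ENNReal.rpow_mul]
        norm_num
  calc ∫⁻ ξ, (∫⁻ η, g η * k (ξ - η)) ^ 2
      ≤ ∫⁻ ξ, (∫⁻ η, g η) * ∫⁻ η, g η * k (ξ - η) ^ 2 := lintegral_mono h1
    _ = (∫⁻ η, g η) * ∫⁻ ξ, ∫⁻ η, g η * k (ξ - η) ^ 2 := by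
        refine lintegral_const_mul _ (Measurable.lintegral_prod_right' (f := fun p : V3 × V3 =>
          g p.2 * k (p.1 - p.2) ^ 2) ?_)
        exact (hg.comp measurable_snd).mul
          ((hk.comp (measurable_fst.sub measurable_snd)).pow_const 2)
    _ = (∫⁻ η, g η) * ∫⁻ η, ∫⁻ ξ, g η * k (ξ - η) ^ 2 := by
        rw [lintegral_lintegral_swap]
        exact ((hg.comp measurable_snd).mul
          ((hk.comp (measurable_fst.sub measurable_snd)).pow_const 2)).aemeasurable
    _ = (∫⁻ η, g η) * ∫⁻ η, g η * ∫⁻ ξ, k ξ ^ 2 := by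
        congr 1
        refine lintegral_congr fun η => ?_
        rw [lintegral_const_mul]
        · congr 1
          exact lintegral_sub_right_eq_self (fun ξ => k ξ ^ 2) η
        · exact (hk.comp (measurable_id.sub_const η)).pow_const 2
    _ = (∫⁻ η, g η) ^ 2 * ∫⁻ η, k η ^ 2 := by
        rw [lintegral_mul_const _ hg, sq, mul_assoc]

/-- If `f ≤ √(g k)`, then `f * f ≤ g * k`, by the Cauchy-Schwarz inequality and the symmetry of
`g * k`. -/
theorem lintegral_self_conv_le {f g k : V3 → ℝ≥0∞} (hg : Measurable g) (hk : Measurable k)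
    (h : ∀ᵐ η, f η ≤ g η ^ (1 / 2 : ℝ) * k η ^ (1 / 2 : ℝ)) (ξ : V3) :
    ∫⁻ η, f η * f (ξ - η) ≤ ∫⁻ η, g η * k (ξ - η) := by
  have h' : ∀ᵐ η, f (ξ - η) ≤ g (ξ - η) ^ (1 / 2 : ℝ) * k (ξ - η) ^ (1 / 2 : ℝ) :=
    (Measure.measurePreserving_sub_left volume ξ).quasiMeasurePreserving.ae h
  have e1 : ∫⁻ η, g (ξ - η) * k η = ∫⁻ η, g η * k (ξ - η) := by
    rw [← lintegral_sub_left_eq_self _ ξ]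
    simp
  calc ∫⁻ η, f η * f (ξ - η)
      ≤ ∫⁻ η, (g η * k (ξ - η)) ^ (1 / 2 : ℝ) * (g (ξ - η) * k η) ^ (1 / 2 : ℝ) := by
        refine lintegral_mono_ae ?_
        filter_upwards [h, h'] with η h1 h2
        refine (mul_le_mul' h1 h2).trans (le_of_eq ?_)
        rw [ENNReal.mul_rpow_of_nonneg _ _ (by norm_num), ENNReal.mul_rpow_of_nonneg _ _
          (by norm_num)]
        ring
    _ ≤ (∫⁻ η, g η * k (ξ - η)) ^ (1 / 2 : ℝ) * (∫⁻ η, g (ξ - η) * k η) ^ (1 / 2 : ℝ) := by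
        refine ENNReal.lintegral_mul_norm_pow_le ?_ ?_ (by norm_num) (by norm_num) (by norm_num)
        · exact (hg.mul (hk.comp (measurable_const.sub measurable_id))).aemeasurable
        · exact ((hg.comp (measurable_const.sub measurable_id)).mul hk).aemeasurable
    _ = ∫⁻ η, g η * k (ξ - η) := by
        rw [e1, ← ENNReal.rpow_add_of_nonneg _ _ (by norm_num) (by norm_num)]
        norm_num

theorem lintegral_le_of_le_sqrt {f g k : V3 → ℝ≥0∞} (hg : Measurable g) (hk : Measurable k)
    (h : ∀ᵐ η, f η ≤ g η ^ (1 / 2 : ℝ) * k η ^ (1 / 2 : ℝ)) :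
    ∫⁻ η, f η ≤ (∫⁻ η, g η) ^ (1 / 2 : ℝ) * (∫⁻ η, k η) ^ (1 / 2 : ℝ) :=
  (lintegral_mono_ae h).trans (ENNReal.lintegral_mul_norm_pow_le hg.aemeasurable hk.aemeasurable
    (by norm_num) (by norm_num) (by norm_num))

theorem enorm_norm_sq_L2 {F : Type*} [NormedAddCommGroup F] {f : V3 → F} (h : MemLp f 2 volume) :
    ‖h.toLp f‖ₑ ^ 2 = ∫⁻ x, ‖f x‖ₑ ^ 2 := by
  rw [Lp.enorm_toLp, eLpNorm_eq_lintegral_rpow_enorm_toReal (by norm_num) (by norm_num),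
    ← ENNReal.rpow_natCast, ← ENNReal.rpow_mul]
  norm_num

/-- The square of a function is the inverse Fourier transform of a convolution; so its `L²` norm,
the square of an `L⁴` norm, is bounded by means of the convolution of the Fourier transforms. -/
theorem lintegral_pow_four_le_scalar {p : Lp ℂ 2 (volume : Measure V3)} {g k : V3 → ℝ≥0∞}
    (hg : Measurable g) (hk : Measurable k) (hg1 : ∫⁻ ζ, g ζ ≠ ⊤) (hk1 : ∫⁻ ζ, k ζ ≠ ⊤)
    (hk2 : ∫⁻ ζ, k ζ ^ 2 ≠ ⊤)
    (h : ∀ᵐ ζ, ‖(𝓕 p : Lp ℂ 2 (volume : Measure V3)) ζ‖ₑ ≤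
      g ζ ^ (1 / 2 : ℝ) * k ζ ^ (1 / 2 : ℝ)) :
    ∫⁻ x, ‖p x‖ₑ ^ 4 ≤ (∫⁻ ζ, g ζ) ^ 2 * ∫⁻ ζ, k ζ ^ 2 := by
  let P : V3 → ℂ := (𝓕 p : Lp ℂ 2 (volume : Measure V3))
  have hPm : AEStronglyMeasurable P volume := (Lp.memLp _).1
  have hP1 : Integrable P := by
    refine ⟨hPm, (lintegral_le_of_le_sqrt hg hk h).trans_lt ?_⟩
    exact ENNReal.mul_lt_top (ENNReal.rpow_lt_top_of_nonneg (by norm_num) hg1)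
      (ENNReal.rpow_lt_top_of_nonneg (by norm_num) hk1)
  let C : V3 → ℂ := convolution P P (ContinuousLinearMap.mul ℂ ℂ) volume
  have hC1 : Integrable C := hP1.integrable_convolution _ hP1
  have hCb : ∫⁻ ξ, ‖C ξ‖ₑ ^ 2 ≤ (∫⁻ ζ, g ζ) ^ 2 * ∫⁻ ζ, k ζ ^ 2 := by
    refine le_trans (lintegral_mono fun ξ => ?_) (lintegral_conv_sq_le hg hk)
    refine pow_le_pow_left' ?_ 2
    refine (enorm_integral_le_lintegral_enorm _).trans ?_
    simp only [ContinuousLinearMap.mul_apply', enorm_mul]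
    exact lintegral_self_conv_le hg hk h ξ
  have hC2 : MemLp C 2 volume := by
    refine ⟨hC1.1, ?_⟩
    rw [eLpNorm_lt_top_iff_lintegral_rpow_enorm_lt_top (by norm_num) (by norm_num)]
    have : ∫⁻ ξ, ‖C ξ‖ₑ ^ 2 < ⊤ := hCb.trans_lt
      (ENNReal.mul_lt_top (ENNReal.pow_lt_top hg1.lt_top) hk2.lt_top)
    simpa using this
  have h1 := fourier_toLp_ae_eq hC1 hC2
  have h2 : ∀ x, 𝓕 C x = 𝓕 P x * 𝓕 P x := fun x =>
    Real.fourier_mul_convolution_eq hP1 hP1 x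
  have h3 := fourierInv_toLp_ae_eq hP1 (Lp.memLp _)
  rw [Lp.toLp_coeFn, FourierTransform.fourierInv_fourier_eq] at h3
  calc ∫⁻ x, ‖p x‖ₑ ^ 4 = ∫⁻ x, ‖𝓕⁻ P x‖ₑ ^ 4 := by
        refine lintegral_congr_ae ?_
        filter_upwards [h3] with x hx
        rw [hx]
    _ = ∫⁻ x, ‖𝓕 P x‖ₑ ^ 4 := by
        rw [← lintegral_neg_eq_self (fun x => ‖𝓕 P x‖ₑ ^ 4)]
        simp only [Real.fourierInv_eq_fourier_neg]
    _ = ∫⁻ x, ‖(𝓕 hC2.toLp : Lp ℂ 2 (volume : Measure V3)) x‖ₑ ^ 2 := by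
        refine lintegral_congr_ae ?_
        filter_upwards [h1] with x hx
        rw [hx, h2, enorm_mul]
        ring
    _ = ∫⁻ ξ, ‖C ξ‖ₑ ^ 2 := by
        rw [← enorm_norm_sq_L2 (Lp.memLp _), ← enorm_norm_sq_L2 hC2, Lp.toLp_coeFn,
          ← ofReal_norm, ← ofReal_norm, Lp.norm_fourier_eq]
    _ ≤ _ := hCb

/-- The coordinates of `ℂ³`. -/
def projC (i : Fin 3) : C3 →L[ℂ] ℂ := EuclideanSpace.proj i

@[simp] theorem projC_apply (i : Fin 3) (v : C3) : projC i v = v i := rfl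

theorem norm_coord_le (v : C3) (i : Fin 3) : ‖v i‖ ≤ ‖v‖ := PiLp.norm_apply_le v i

theorem enorm_pow_four_le (v : C3) : ‖v‖ₑ ^ 4 ≤ 3 * ∑ i, ‖v i‖ₑ ^ 4 := by
  have h : ‖v‖ ^ 4 ≤ 3 * ∑ i, ‖v i‖ ^ 4 := by
    have h1 : ‖v‖ ^ 2 = ∑ i, ‖v i‖ ^ 2 := EuclideanSpace.norm_sq_eq v
    have h2 : ‖v‖ ^ 4 = (∑ i, ‖v i‖ ^ 2) ^ 2 := by rw [← h1]; ring
    rw [h2, Fin.sum_univ_three, Fin.sum_univ_three]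
    nlinarith [sq_nonneg (‖v 0‖ ^ 2 - ‖v 1‖ ^ 2), sq_nonneg (‖v 0‖ ^ 2 - ‖v 2‖ ^ 2),
      sq_nonneg (‖v 1‖ ^ 2 - ‖v 2‖ ^ 2)]
  have h' := ENNReal.ofReal_le_ofReal h
  rw [ENNReal.ofReal_mul (by norm_num), ENNReal.ofReal_sum_of_nonneg fun i _ => by positivity,
    ENNReal.ofReal_pow (norm_nonneg _)] at h'
  simpa [ENNReal.ofReal_pow, ofReal_norm] using h'

/-- The vector-valued version, component by component. -/
theorem lintegral_pow_four_le {f : Lp C3 2 (volume : Measure V3)} {g k : V3 → ℝ≥0∞}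
    (hg : Measurable g) (hk : Measurable k) (hg1 : ∫⁻ ζ, g ζ ≠ ⊤) (hk1 : ∫⁻ ζ, k ζ ≠ ⊤)
    (hk2 : ∫⁻ ζ, k ζ ^ 2 ≠ ⊤)
    (h : ∀ᵐ ζ, ‖(𝓕 f : Lp C3 2 (volume : Measure V3)) ζ‖ₑ ≤
      g ζ ^ (1 / 2 : ℝ) * k ζ ^ (1 / 2 : ℝ)) :
    ∫⁻ x, ‖f x‖ₑ ^ 4 ≤ 9 * ((∫⁻ ζ, g ζ) ^ 2 * ∫⁻ ζ, k ζ ^ 2) := by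
  have h1 : ∀ i, ∫⁻ x, ‖f x i‖ₑ ^ 4 ≤ (∫⁻ ζ, g ζ) ^ 2 * ∫⁻ ζ, k ζ ^ 2 := by
    intro i
    have := lintegral_pow_four_le_scalar (p := (projC i).compLp f) hg hk hg1 hk1 hk2 (by
      rw [fourier_compLp]
      filter_upwards [h, (projC i).coeFn_compLp (𝓕 f : Lp C3 2 (volume : Measure V3))]
        with ζ h1 h2
      rw [h2]
      refine le_trans ?_ h1
      rw [enorm_le_iff_norm_le]
      exact norm_coord_le _ i)
    refine le_trans (le_of_eq (lintegral_congr_ae ?_)) this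
    filter_upwards [(projC i).coeFn_compLp f] with x hx
    rw [hx]
    rfl
  have hm : ∀ i : Fin 3, AEMeasurable (fun x => ‖f x i‖ₑ ^ 4) (volume : Measure V3) := fun i =>
    (((projC i).continuous.comp_aestronglyMeasurable (Lp.memLp f).1).enorm).pow_const 4
  calc ∫⁻ x, ‖f x‖ₑ ^ 4 ≤ ∫⁻ x, 3 * ∑ i, ‖f x i‖ₑ ^ 4 :=
        lintegral_mono fun x => enorm_pow_four_le _
    _ = 3 * ∑ i, ∫⁻ x, ‖f x i‖ₑ ^ 4 := by
        rw [lintegral_const_mul'' _ (Finset.aemeasurable_fun_sum _ fun i _ => hm i),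
          lintegral_finsetSum' _ fun i _ => hm i]
    _ ≤ 3 * ∑ _i : Fin 3, ((∫⁻ ζ, g ζ) ^ 2 * ∫⁻ ζ, k ζ ^ 2) := by
        gcongr with i
        exact h1 i
    _ = 9 * ((∫⁻ ζ, g ζ) ^ 2 * ∫⁻ ζ, k ζ ^ 2) := by
        simp only [Finset.sum_const, Finset.card_univ, Fintype.card_fin, nsmul_eq_mul]
        rw [← mul_assoc]
        norm_num

/-- Interpolation between `L⁴` and `L^∞`. -/
theorem eLpNorm_le_of_four_of_top {F : Type*} [NormedAddCommGroup F] {f : V3 → F} {B : ℝ≥0∞}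
    (hB : B ≠ ⊤) (h4 : ∫⁻ x, ‖f x‖ₑ ^ 4 ≤ B ^ 4) (hinf : ∀ᵐ x, ‖f x‖ₑ ≤ B) {m : ℝ≥0∞}
    (hm : 4 ≤ m) : eLpNorm f m volume ≤ B := by
  rcases eq_or_ne m ⊤ with rfl | hm'
  · exact eLpNormEssSup_le_of_ae_enorm_bound hinf
  have hm0 : m ≠ 0 := (lt_of_lt_of_le (by norm_num) hm).ne'
  have hr : 4 ≤ m.toReal := by
    have := (ENNReal.toReal_le_toReal (by norm_num) hm').mpr hm
    simpa using this
  rw [eLpNorm_eq_lintegral_rpow_enorm_toReal hm0 hm', one_div,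
    ENNReal.rpow_inv_le_iff (by linarith)]
  calc ∫⁻ x, ‖f x‖ₑ ^ m.toReal ≤ ∫⁻ x, B ^ (m.toReal - 4) * ‖f x‖ₑ ^ 4 := by
        refine lintegral_mono_ae ?_
        filter_upwards [hinf] with x hx
        have : ‖f x‖ₑ ^ m.toReal = ‖f x‖ₑ ^ (m.toReal - 4) * ‖f x‖ₑ ^ (4 : ℝ) := by
          rw [← ENNReal.rpow_add_of_nonneg _ _ (by linarith) (by norm_num)]
          congr 1
          ring
        rw [this]
        have h4 : ‖f x‖ₑ ^ (4 : ℝ) = ‖f x‖ₑ ^ 4 := by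
          rw [← ENNReal.rpow_natCast]; norm_num
        rw [h4]
        gcongr
    _ = B ^ (m.toReal - 4) * ∫⁻ x, ‖f x‖ₑ ^ 4 :=
        lintegral_const_mul' _ _ (ENNReal.rpow_ne_top_of_nonneg (by linarith) hB)
    _ ≤ B ^ (m.toReal - 4) * B ^ (4 : ℝ) := by
        have : B ^ (4 : ℝ) = B ^ 4 := by rw [← ENNReal.rpow_natCast]; norm_num
        rw [this]
        gcongr
    _ = B ^ m.toReal := by
        rw [← ENNReal.rpow_add_of_nonneg _ _ (by linarith) (by norm_num)]
        congr 1
        ring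

end FourierLm

/-! ### Multiplication operators and real vector fields in `L²(ℝ³; ℂ³)` -/

/-- The space `L²(ℝ³; ℂ³)`, used both in physical and in frequency space. -/
abbrev H : Type := Lp C3 2 (volume : Measure V3)

section Multiplication

/-- Multiplication by an essentially bounded function on `L²(ℝ³; ℂ³)`. -/
def mulC (b : V3 → ℂ) (hb : MemLp b ⊤ (volume : Measure V3)) : H →L[ℂ] H :=
  (ContinuousLinearMap.lsmul ℂ ℂ : ℂ →L[ℂ] C3 →L[ℂ] C3).holderL volume ⊤ 2 2 (hb.toLp b)

theorem coeFn_mulC {b : V3 → ℂ} (hb : MemLp b ⊤ (volume : Measure V3)) (f : H) :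
    mulC b hb f =ᵐ[volume] fun ζ => b ζ • f ζ := by
  have h := (ContinuousLinearMap.lsmul ℂ ℂ : ℂ →L[ℂ] C3 →L[ℂ] C3).coeFn_holder
    (r := 2) (hb.toLp b) f
  filter_upwards [h, hb.coeFn_toLp] with ζ h1 h2
  change ((ContinuousLinearMap.lsmul ℂ ℂ : ℂ →L[ℂ] C3 →L[ℂ] C3).holder 2 (hb.toLp b) f : H) ζ = _
  rw [h1, h2]
  rfl

theorem memLp_top_of_bdd {b : V3 → ℂ} (hm : Measurable b) {K : ℝ} (hK : ∀ ζ, ‖b ζ‖ ≤ K) :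
    MemLp b ⊤ (volume : Measure V3) :=
  memLp_top_of_bound hm.aestronglyMeasurable K (Eventually.of_forall hK)

theorem norm_sq_L2 (f : H) : ‖f‖ ^ 2 = ∫ ζ, ‖f ζ‖ ^ 2 := by
  have h := L2.inner_def (𝕜 := ℂ) f f
  rw [inner_self_eq_norm_sq_to_K] at h
  have h2 : ∫ ζ, inner ℂ (f ζ) (f ζ) = ((∫ ζ, ‖f ζ‖ ^ 2 : ℝ) : ℂ) := by
    rw [← integral_complex_ofReal]
    congr 1
    ext ζ
    rw [inner_self_eq_norm_sq_to_K]
    simp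
  rw [h2] at h
  change (‖f‖ : ℂ) ^ 2 = _ at h
  exact_mod_cast h

theorem integrable_norm_sq (f : H) : Integrable fun ζ => ‖f ζ‖ ^ 2 :=
  (memLp_two_iff_integrable_sq_norm (Lp.memLp f).1).mp (Lp.memLp f)

/-- The `L²` norm is monotone in the pointwise norm. -/
theorem norm_le_of_ae_norm_le {f g : H} (h : ∀ᵐ ζ, ‖f ζ‖ ≤ ‖g ζ‖) : ‖f‖ ≤ ‖g‖ :=
  Lp.norm_le_norm_of_ae_le h

theorem mulL2_eq {σ : V3 → ℝ} (hb : MemLp (fun ζ => (σ ((2 * Real.pi) • ζ) : ℂ)) ⊤ volume) (g : H) :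
    mulL2 σ g = mulC _ hb g := by
  have hm : MemLp (fun ζ => (σ ((2 * Real.pi) • ζ) : ℂ) • g ζ) 2 (volume : Measure V3) :=
    (Lp.memLp (mulC _ hb g)).ae_eq (coeFn_mulC hb g)
  rw [mulL2, dif_pos hm]
  apply Lp.ext
  filter_upwards [hm.coeFn_toLp, coeFn_mulC hb g] with ζ h1 h2
  rw [h1, h2]

end Multiplication

section RealFields

theorem norm_complexify (v : V3) : ‖complexify v‖ = ‖v‖ := by
  rw [EuclideanSpace.norm_eq, EuclideanSpace.norm_eq]
  simp [complexify]

/-- `complexify` as a continuous linear map. -/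
def complexifyL : V3 →L[ℝ] C3 :=
  LinearMap.toContinuousLinearMap
    { toFun := complexify
      map_add' := fun v w => by ext i; simp [complexify]
      map_smul' := fun c v => by ext i; simp [complexify] }

@[simp] theorem complexifyL_apply (v : V3) : complexifyL v = complexify v := rfl

@[simp] theorem complexify_apply (v : V3) (i : Fin 3) : complexify v i = (v i : ℂ) := rfl

theorem inner_complexify (v w : V3) :
    inner ℂ (complexify v) (complexify w) = ((inner ℝ v w : ℝ) : ℂ) := by
  simp [PiLp.inner_apply, complexify]

theorem memLp_complexify {f : V3 → V3} {p : ℝ≥0∞} (h : MemLp f p volume) :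
    MemLp (fun x => complexify (f x)) p volume :=
  h.of_le (complexifyL.continuous.comp_aestronglyMeasurable h.1)
    (Eventually.of_forall fun _ => (norm_complexify _).le)

theorem toL2_eq {f : V3 → V3} (h : MemLp f 2 volume) : toL2 f = (memLp_complexify h).toLp :=
  dif_pos _

theorem coeFn_toL2 {f : V3 → V3} (h : MemLp f 2 volume) :
    toL2 f =ᵐ[volume] fun x => complexify (f x) := by
  rw [toL2_eq h]
  exact MemLp.coeFn_toLp _

theorem toL2_sub {f g : V3 → V3} (hf : MemLp f 2 volume) (hg : MemLp g 2 volume) :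
    toL2 (fun x => f x - g x) = toL2 f - toL2 g := by
  apply Lp.ext
  filter_upwards [coeFn_toL2 hf, coeFn_toL2 hg, coeFn_toL2 (hf.sub hg),
    Lp.coeFn_sub (toL2 f) (toL2 g)] with x h1 h2 h3 h4
  have h5 : toL2 (fun x => f x - g x) x = complexify (f x - g x) := h3
  rw [h4, h5, Pi.sub_apply, h1, h2]
  exact complexifyL.map_sub _ _

theorem enorm_toL2 {f : V3 → V3} (h : MemLp f 2 volume) : ‖toL2 f‖ₑ = eLpNorm f 2 volume := by
  rw [toL2_eq h, Lp.enorm_toLp]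
  exact eLpNorm_congr_norm_ae (Eventually.of_forall fun x => norm_complexify _)

theorem toL2_congr {f g : V3 → V3} (h : f =ᵐ[volume] g) : toL2 f = toL2 g := by
  have hc : (fun x => complexify (f x)) =ᵐ[volume] fun x => complexify (g x) := by
    filter_upwards [h] with x hx
    rw [hx]
  unfold toL2
  by_cases hf : MemLp (fun x => complexify (f x)) 2 (volume : Measure V3)
  · rw [dif_pos hf, dif_pos (hf.ae_eq hc)]
    exact MemLp.toLp_congr _ _ hc
  · rw [dif_neg hf, dif_neg fun hg => hf (hg.ae_eq hc.symm)]

theorem norm_sq_toL2 {f : V3 → V3} (h : MemLp f 2 volume) : ‖toL2 f‖ ^ 2 = ∫ x, ‖f x‖ ^ 2 := by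
  rw [norm_sq_L2]
  refine integral_congr_ae ?_
  filter_upwards [coeFn_toL2 h] with x hx
  rw [hx, norm_complexify]

/-- The product of a scalar component of a bounded field with an `L²` field. -/
theorem memLp_coord_smul {F : Type*} [NormedAddCommGroup F] [NormedSpace ℂ F] {w : V3 → V3} {M : ℝ}
    (hw : AEStronglyMeasurable w volume) (hM : ∀ᵐ x, ‖w x‖ ≤ M) {f : V3 → F}
    (hf : MemLp f 2 volume) (j : Fin 3) : MemLp (fun x => (w x j : ℂ) • f x) 2 volume := by
  refine hf.of_le_mul (c := M) ?_ ?_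
  · refine AEStronglyMeasurable.smul ?_ hf.1
    exact (Complex.continuous_ofReal.comp
      (EuclideanSpace.proj j : V3 →L[ℝ] ℝ).continuous).comp_aestronglyMeasurable hw
  · filter_upwards [hM] with x hx
    rw [norm_smul, Complex.norm_real]
    gcongr
    exact (PiLp.norm_apply_le _ _).trans hx

end RealFields

/-! ### Products of solenoidal fields -/

section Solenoidal

theorem lineDeriv_mul_schwartz (κ κ' : 𝓢(V3, ℂ)) (v x : V3) :
    (∂_{v} (SchwartzMap.smulLeftCLM ℂ κ κ')) x = κ x * (∂_{v} κ') x + (∂_{v} κ) x * κ' x := by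
  have h : ⇑(SchwartzMap.smulLeftCLM ℂ κ κ') = fun x => κ x * κ' x := by
    ext y
    simp [SchwartzMap.smulLeftCLM_apply_apply κ.hasTemperateGrowth]
  simp only [SchwartzMap.lineDerivOp_apply_eq_fderiv, h]
  rw [fderiv_fun_mul κ.differentiableAt κ'.differentiableAt]
  simp [mul_comm]

/-- The divergence form of the convection term: `∑_j w_j ∂_j w = ∑_j ∂_j (w_j w)` for bounded
`w ∈ H¹` with `div w = 0`. Testing against `κ`, this amounts to `∫ w · ∇f = 0` for the components
`f` of `κ w`, which is `ζ · 𝓕 w = 0` in terms of Fourier transforms. -/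
theorem fourier_convection {w : V3 → V3} (hw : MemLp w 2 volume) {M : ℝ}
    (hM : ∀ᵐ x, ‖w x‖ ≤ M) {D Q : Fin 3 → H} {Γ : H}
    (hD : ∀ j, (𝓕 (D j) : H) =ᵐ[volume] fun ζ => dsym j ζ • (𝓕 (toL2 w) : H) ζ)
    (hdiv : ∀ᵐ ζ : V3, ∑ j, (ζ j : ℂ) * (𝓕 (toL2 w) : H) ζ j = 0)
    (hΓ : Γ =ᵐ[volume] fun x => ∑ j, (w x j : ℂ) • D j x)
    (hQ : ∀ j, Q j =ᵐ[volume] fun x => (w x j : ℂ) • complexify (w x)) :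
    (𝓕 Γ : H) =ᵐ[volume] fun ζ => ∑ j, dsym j ζ • (𝓕 (Q j) : H) ζ := by
  refine fourier_weak_divergence_iff.mp fun κ => ?_
  have hW := coeFn_toL2 hw
  have hcoord : ∀ {f : V3 → C3} (_ : Integrable f) (i : Fin 3), (∫ x, f x) i = ∫ x, f x i :=
    fun {f} hf i => ((projC i).integral_comp_comm hf).symm
  have hκc : ∀ (κ : 𝓢(V3, ℂ)) {F : Type} [NormedAddCommGroup F] [NormedSpace ℂ F] {g : V3 → F},
      MemLp g 2 volume → MemLp (fun x => κ x • g x) 2 volume := by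
    intro κ F _ _ g hg
    exact hg.smul (p := ⊤) (q := 2) κ.memLp_top
  ext i
  -- the scalar `κ w_i` and its derivatives
  have hwi : MemLp (fun x => (toL2 w x) i) 2 volume := (projC i).comp_memLp' (Lp.memLp (toL2 w))
  have hDi : ∀ j, MemLp (fun x => (D j x) i) 2 volume := fun j =>
    (projC i).comp_memLp' (Lp.memLp (D j))
  have hfm : MemLp (fun x => κ x • (toL2 w x) i) 2 volume := hκc κ hwi
  have hfjm : ∀ j, MemLp (fun x => (∂_{e j} κ) x • (toL2 w x) i + κ x • (D j x) i) 2 volume :=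
    fun j => (hκc (∂_{e j} κ) hwi).add (hκc κ (hDi j))
  have hweak : ∀ j, (𝓕 ((hfjm j).toLp) : Lp ℂ 2 (volume : Measure V3)) =ᵐ[volume]
      fun ζ => dsym j ζ • (𝓕 (hfm.toLp) : Lp ℂ 2 (volume : Measure V3)) ζ := by
    intro j
    refine eq_lineDeriv_iff.mp ?_
    ext κ'
    have h1 := congrArg (fun T : 𝓢'(V3, C3) => (T (SchwartzMap.smulLeftCLM ℂ κ κ')) i)
      (eq_lineDeriv_iff.mpr (hD j))
    simp only [TemperedDistribution.lineDerivOp_apply_apply, Lp.toTemperedDistribution_apply,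
      map_neg, PiLp.neg_apply] at h1 ⊢
    rw [hcoord (integrable_schwartz_smul _ (Lp.memLp _)),
      hcoord (integrable_schwartz_smul _ (Lp.memLp _))] at h1
    have e1 : ∫ x, κ' x • (hfjm j).toLp _ x =
        (∫ x, κ' x • (∂_{e j} κ) x • (toL2 w x) i) + ∫ x, κ' x • κ x • (D j x) i := by
      rw [← integral_add (integrable_schwartz_smul κ' (hκc _ hwi))
        (integrable_schwartz_smul κ' (hκc _ (hDi j)))]
      refine integral_congr_ae ?_
      filter_upwards [(hfjm j).coeFn_toLp] with x hx
      rw [hx, smul_add]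
    have e2 : ∫ x, (∂_{e j} κ') x • hfm.toLp _ x = ∫ x, (∂_{e j} κ') x • κ x • (toL2 w x) i := by
      refine integral_congr_ae ?_
      filter_upwards [hfm.coeFn_toLp] with x hx
      rw [hx]
    have e3 : ∫ x, ((∂_{e j} (SchwartzMap.smulLeftCLM ℂ κ κ')) x • toL2 w x) i =
        (∫ x, (∂_{e j} κ') x • κ x • (toL2 w x) i) +
          ∫ x, κ' x • (∂_{e j} κ) x • (toL2 w x) i := by
      rw [← integral_add (integrable_schwartz_smul _ (hκc _ hwi))
        (integrable_schwartz_smul κ' (hκc _ hwi))]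
      congr 1
      ext x
      simp only [PiLp.smul_apply, lineDeriv_mul_schwartz, smul_eq_mul]
      ring
    have e4 : ∫ x, (SchwartzMap.smulLeftCLM ℂ κ κ' x • D j x) i =
        ∫ x, κ' x • κ x • (D j x) i := by
      congr 1
      ext x
      simp only [PiLp.smul_apply, SchwartzMap.smulLeftCLM_apply_apply κ.hasTemperateGrowth,
        smul_eq_mul]
      ring
    rw [e1, e2, ← e4, h1, e3]
    ring
  -- `∑_j ∫ w_j ∂_j (κ w_i) = 0`
  have hzero : ∑ j, ∫ x, (w x j : ℂ) * ((∂_{e j} κ) x • (toL2 w x) i + κ x • (D j x) i) = 0 := by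
    have h1 : ∀ j, ∫ x, (w x j : ℂ) * ((∂_{e j} κ) x • (toL2 w x) i + κ x • (D j x) i) =
        ∫ ζ, inner ℂ ((𝓕 (toL2 w) : H) ζ j)
          (dsym j ζ • (𝓕 (hfm.toLp) : Lp ℂ 2 (volume : Measure V3)) ζ) := by
      intro j
      have h2 := Lp.inner_fourier_eq ((projC j).compLp (toL2 w)) ((hfjm j).toLp)
      rw [fourier_compLp, L2.inner_def, L2.inner_def] at h2
      have h3 : ∫ x, (w x j : ℂ) * ((∂_{e j} κ) x • (toL2 w x) i + κ x • (D j x) i) =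
          ∫ x, inner ℂ ((projC j).compLp (toL2 w) x) ((hfjm j).toLp _ x) := by
        refine integral_congr_ae ?_
        filter_upwards [(hfjm j).coeFn_toLp, (projC j).coeFn_compLp (toL2 w), hW] with x a1 a2 a3
        rw [a1, a2, a3]
        simp [mul_comm]
      rw [h3, ← h2]
      refine integral_congr_ae ?_
      filter_upwards [hweak j, (projC j).coeFn_compLp (𝓕 (toL2 w) : H)] with ζ a1 a2
      rw [a1, a2]
      rfl
    simp only [h1]
    rw [← integral_finsetSum]
    · rw [integral_eq_zero_of_ae]
      filter_upwards [hdiv] with ζ hζ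
      have : ∑ j, inner ℂ ((𝓕 (toL2 w) : H) ζ j)
          (dsym j ζ • (𝓕 (hfm.toLp) : Lp ℂ 2 (volume : Measure V3)) ζ) =
          2 * Real.pi * Complex.I * (starRingEnd ℂ) (∑ j, (ζ j : ℂ) * (𝓕 (toL2 w) : H) ζ j) *
            (𝓕 (hfm.toLp) : Lp ℂ 2 (volume : Measure V3)) ζ := by
        rw [map_sum, Finset.mul_sum, Finset.sum_mul]
        refine Finset.sum_congr rfl fun j _ => ?_
        simp [dsym]
        ring
      rw [this, hζ]
      simp
    · intro j _
      refine (L2.integrable_inner (𝕜 := ℂ) ((projC j).compLp (𝓕 (toL2 w) : H))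
        (𝓕 ((hfjm j).toLp))).congr ?_
      filter_upwards [hweak j, (projC j).coeFn_compLp (𝓕 (toL2 w) : H)] with ζ a1 a2
      rw [a1, a2]
      rfl
  have hI1 : ∀ j, Integrable fun x => (∂_{e j} κ) x • Q j x := fun j =>
    integrable_schwartz_smul _ (Lp.memLp _)
  have hI2 : Integrable fun x => κ x • Γ x := integrable_schwartz_smul _ (Lp.memLp _)
  have hI3 : ∀ j, Integrable fun x => (κ x • (w x j : ℂ) • D j x) i := fun j =>
    (projC i).integrable_comp
      (integrable_schwartz_smul κ (memLp_coord_smul hw.1 hM (Lp.memLp (D j)) j))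
  have g1 : (∑ j, ∫ x, (∂_{e j} κ) x • Q j x) i = ∑ j, ∫ x, ((∂_{e j} κ) x • Q j x) i := by
    have : (∑ j, ∫ x, (∂_{e j} κ) x • Q j x) i = ∑ j, (∫ x, (∂_{e j} κ) x • Q j x) i := by
      simp
    rw [this]
    exact Finset.sum_congr rfl fun j _ => hcoord (hI1 j) i
  rw [g1, PiLp.neg_apply, hcoord hI2, eq_neg_iff_add_eq_zero, ← hzero]
  have g2 : ∫ x, (κ x • Γ x) i = ∑ j, ∫ x, (κ x • (w x j : ℂ) • D j x) i := by
    rw [← integral_finsetSum _ fun j _ => hI3 j]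
    refine integral_congr_ae ?_
    filter_upwards [hΓ] with x hx
    rw [hx, Finset.smul_sum]
    simp
  rw [g2, ← Finset.sum_add_distrib]
  refine Finset.sum_congr rfl fun j _ => ?_
  have hI4 : Integrable fun x => ((∂_{e j} κ) x • Q j x) i := (projC i).integrable_comp (hI1 j)
  rw [← integral_add hI4 (hI3 j)]
  refine integral_congr_ae ?_
  filter_upwards [hQ j, hW] with x a1 a2
  simp only [PiLp.smul_apply, a1, a2, complexify_apply, smul_eq_mul]
  ring

end Solenoidal

/-! ### Measurability of curves in `L²` -/

section Curves

theorem measurable_of_measurable_edist {T X : Type*} [MeasurableSpace T] [PseudoEMetricSpace X]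
    [SecondCountableTopology X] [MeasurableSpace X] [BorelSpace X] {Φ : T → X}
    (h : ∀ y, Measurable fun t => edist (Φ t) y) : Measurable Φ := by
  refine measurable_of_isOpen fun s hs => ?_
  let S : Set (Set X) := {B | ∃ y r, B = Metric.eball y r ∧ B ⊆ s}
  have hS : ⋃₀ S = s := by
    refine subset_antisymm (sUnion_subset fun B hB => ?_) fun x hx => ?_
    · obtain ⟨y, r, -, h⟩ := hB
      exact h
    · obtain ⟨r, hr, hrs⟩ := EMetric.isOpen_iff.mp hs x hx
      exact ⟨_, ⟨x, r, rfl, hrs⟩, Metric.mem_eball_self hr⟩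
  obtain ⟨T', hT', hTS, hU⟩ := TopologicalSpace.isOpen_sUnion_countable S (by
    rintro B ⟨y, r, rfl, -⟩
    exact Metric.isOpen_eball)
  rw [← hS, ← hU, preimage_sUnion]
  refine MeasurableSet.biUnion hT' fun B hB => ?_
  obtain ⟨y, r, rfl, -⟩ := hTS hB
  exact measurableSet_lt (h y) measurable_const

/-- A jointly measurable function with square integrable slices is a strongly measurable curve in
`L²`. -/
theorem aestronglyMeasurable_curve {μ : Measure ℝ} [SFinite μ] {f : ℝ × V3 → C3}
    (hf : AEStronglyMeasurable f (μ.prod volume)) {Φ : ℝ → H}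
    (h : ∀ᵐ t ∂μ, Φ t =ᵐ[volume] fun x => f (t, x)) : AEStronglyMeasurable Φ μ := by
  classical
  have : Fact ((2 : ℝ≥0∞) ≠ ⊤) := ⟨by norm_num⟩
  have : SecondCountableTopology H := inferInstance
  borelize H
  obtain ⟨f', hf', hff'⟩ := hf
  have hslice : ∀ t, StronglyMeasurable fun x => f' (t, x) := fun t =>
    hf'.comp_measurable measurable_prodMk_left
  let Ψ : ℝ → H := fun t =>
    if ht : MemLp (fun x => f' (t, x)) 2 (volume : Measure V3) then ht.toLp else 0
  have hmeas : ∀ k : V3 → C3, StronglyMeasurable k →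
      Measurable fun t => ∫⁻ x, ‖f' (t, x) - k x‖ₑ ^ 2 := by
    intro k hk
    refine Measurable.lintegral_prod_right' (f := fun p : ℝ × V3 => ‖f' p - k p.2‖ₑ ^ 2) ?_
    exact ((hf'.sub (hk.comp_measurable measurable_snd)).enorm).pow_const 2
  have hset : MeasurableSet {t | MemLp (fun x => f' (t, x)) 2 (volume : Measure V3)} := by
    have : {t | MemLp (fun x => f' (t, x)) 2 (volume : Measure V3)} =
        {t | ∫⁻ x, ‖f' (t, x) - (0 : V3 → C3) x‖ₑ ^ 2 < ⊤} := by
      ext t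
      constructor
      · intro ht
        have := (eLpNorm_lt_top_iff_lintegral_rpow_enorm_lt_top (by norm_num) (by norm_num)).mp ht.2
        simpa using this
      · intro ht
        refine ⟨(hslice t).aestronglyMeasurable, ?_⟩
        rw [eLpNorm_lt_top_iff_lintegral_rpow_enorm_lt_top (by norm_num) (by norm_num)]
        simpa using ht
    rw [this]
    exact measurableSet_lt (hmeas 0 stronglyMeasurable_zero) measurable_const
  have hΨ : Measurable Ψ := by
    refine measurable_of_measurable_edist fun y => ?_
    have : (fun t => edist (Ψ t) y) = fun t =>
        if MemLp (fun x => f' (t, x)) 2 (volume : Measure V3) then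
          (∫⁻ x, ‖f' (t, x) - y x‖ₑ ^ 2) ^ (1 / 2 : ℝ) else edist 0 y := by
      ext t
      by_cases ht : MemLp (fun x => f' (t, x)) 2 (volume : Measure V3)
      · simp only [Ψ, dif_pos ht, if_pos ht]
        rw [edist_eq_enorm_sub]
        have hsub : ht.toLp - y = (ht.sub (Lp.memLp y)).toLp := by
          rw [MemLp.toLp_sub ht (Lp.memLp y), Lp.toLp_coeFn]
        have h2 := enorm_norm_sq_L2 (ht.sub (Lp.memLp y))
        rw [← hsub] at h2
        have h3 : ∫⁻ x, ‖f' (t, x) - y x‖ₑ ^ 2 = ‖ht.toLp - y‖ₑ ^ 2 := h2.symm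
        rw [h3, ← ENNReal.rpow_natCast, ← ENNReal.rpow_mul]
        norm_num
      · simp only [Ψ, dif_neg ht, if_neg ht]
    rw [this]
    exact Measurable.ite hset ((hmeas _ (Lp.stronglyMeasurable y)).pow_const _) measurable_const
  refine ⟨Ψ, hΨ.stronglyMeasurable, ?_⟩
  filter_upwards [h, Measure.ae_ae_of_ae_prod hff'] with t h1 h2
  have h3 : Φ t =ᵐ[volume] fun x => f' (t, x) := h1.trans h2
  have h4 : MemLp (fun x => f' (t, x)) 2 (volume : Measure V3) := (Lp.memLp (Φ t)).ae_eq h3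
  simp only [Ψ, dif_pos h4]
  exact Lp.ext (h3.trans h4.coeFn_toLp.symm)

end Curves

/-! ### The du Bois-Reymond lemma -/

section DuBoisReymond

/-- A smooth transition from `0` to `1` on the interval `[a, a + 1 / (n + 1)]`. -/
def smoothStep (a : ℝ) (n : ℕ) (x : ℝ) : ℝ := Real.smoothTransition (((n : ℝ) + 1) * (x - a))

theorem contDiff_smoothStep (a : ℝ) (n : ℕ) : ContDiff ℝ ∞ (smoothStep a n) :=
  Real.smoothTransition.contDiff.comp (by fun_prop)

theorem smoothStep_eq_zero {a : ℝ} {n : ℕ} {x : ℝ} (h : x ≤ a) : smoothStep a n x = 0 :=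
  Real.smoothTransition.zero_of_nonpos (mul_nonpos_of_nonneg_of_nonpos (by positivity) (by linarith))

theorem smoothStep_eq_one {a : ℝ} {n : ℕ} {x : ℝ} (h : a + 1 / ((n : ℝ) + 1) ≤ x) :
    smoothStep a n x = 1 := by
  refine Real.smoothTransition.one_of_one_le ?_
  have h1 : 1 / ((n : ℝ) + 1) ≤ x - a := by linarith
  rwa [div_le_iff₀' (by positivity)] at h1

theorem monotone_smoothStep (a : ℝ) (n : ℕ) : Monotone (smoothStep a n) := fun x y h =>
  Real.smoothTransition.monotone (by gcongr)

theorem deriv_smoothStep_eq_zero {a : ℝ} {n : ℕ} {x : ℝ}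
    (h : x < a ∨ a + 1 / ((n : ℝ) + 1) < x) : deriv (smoothStep a n) x = 0 := by
  rcases h with h | h
  · have : smoothStep a n =ᶠ[𝓝 x] fun _ => 0 := by
      filter_upwards [gt_mem_nhds h] with y hy using smoothStep_eq_zero hy.le
    rw [this.deriv_eq, deriv_const]
  · have : smoothStep a n =ᶠ[𝓝 x] fun _ => 1 := by
      filter_upwards [lt_mem_nhds h] with y hy using smoothStep_eq_one hy.le
    rw [this.deriv_eq, deriv_const]

theorem continuous_deriv_smoothStep (a : ℝ) (n : ℕ) : Continuous (deriv (smoothStep a n)) :=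
  (contDiff_smoothStep a n).continuous_deriv (by exact_mod_cast le_top)

theorem eventually_one_div_lt {ε : ℝ} (hε : 0 < ε) : ∀ᶠ n : ℕ in atTop, 1 / ((n : ℝ) + 1) < ε :=
  tendsto_one_div_add_atTop_nhds_zero_nat.eventually (gt_mem_nhds hε)

theorem tendsto_integral_deriv_smoothStep {s r a : ℝ} (hs : s ≤ a) (hr : a < r) {f : ℝ → ℝ}
    (hf : ContinuousOn f (Icc s r)) :
    Tendsto (fun n => ∫ x in s..r, deriv (smoothStep a n) x * f x) atTop (𝓝 (f a)) := by
  simp only [intervalIntegral.integral_of_le (hs.trans hr.le), ← integral_Icc_eq_integral_Ioc]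
  refine tendsto_setIntegral_peak_smul_of_integrableOn_of_tendsto (x₀ := a) (t := Icc s r)
    measurableSet_Icc measurableSet_Icc subset_rfl self_mem_nhdsWithin
    (by simp) (Eventually.of_forall fun n x _ => (monotone_smoothStep a n).deriv_nonneg) ?_ ?_
    (Eventually.of_forall fun n => (continuous_deriv_smoothStep a n).aestronglyMeasurable)
    (hf.integrableOn_Icc) (hf a ⟨hs, hr.le⟩)
  · intro u hu hau
    obtain ⟨ε, hε, hεu⟩ := Metric.isOpen_iff.mp hu a hau
    rw [Metric.tendstoUniformlyOn_iff]
    intro η hη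
    filter_upwards [eventually_one_div_lt hε] with n hn x hx
    have hx' : ε ≤ |x - a| := by
      by_contra! h
      exact hx.2 (hεu (by simpa [Real.dist_eq] using h))
    have : deriv (smoothStep a n) x = 0 := by
      refine deriv_smoothStep_eq_zero ?_
      rcases le_abs.mp hx' with h | h
      · right; linarith
      · left; linarith
    simpa [this] using hη
  · refine tendsto_const_nhds.congr' ?_
    filter_upwards [eventually_one_div_lt (sub_pos.mpr hr)] with n hn
    rw [integral_Icc_eq_integral_Ioc, ← intervalIntegral.integral_of_le (hs.trans hr.le),
      intervalIntegral.integral_deriv_eq_sub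
        (fun x _ => ((contDiff_smoothStep a n).differentiable (by simp)).differentiableAt)
        ((continuous_deriv_smoothStep a n).intervalIntegrable _ _),
      smoothStep_eq_zero hs, smoothStep_eq_one (by linarith)]
    norm_num

/-- The lemma of du Bois-Reymond: a continuous function `f` with weak derivative `-p` satisfies the
fundamental theorem of calculus. The test functions are smoothed indicator functions of `[s, t]`. -/
theorem sub_eq_neg_integral_of_weak {f p : ℝ → ℝ} (hf : ContinuousOn f (Ioo 0 1))
    (hp : ∀ s r : ℝ, 0 < s → r < 1 → IntegrableOn p (Icc s r))
    (h : ∀ θ : ℝ → ℝ, ContDiff ℝ ∞ θ → HasCompactSupport θ → tsupport θ ⊆ Ioo 0 1 →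
      ∫ t in Ioo (0 : ℝ) 1, (- deriv θ t * f t + θ t * p t) = 0)
    {s t : ℝ} (hs : 0 < s) (hst : s ≤ t) (ht : t < 1) : f t - f s = - ∫ σ in s..t, p σ := by
  rcases hst.eq_or_lt with rfl | hst
  · simp
  obtain ⟨r, htr, hr⟩ := exists_between ht
  have hfc : ContinuousOn f (Icc s r) := hf.mono fun x hx => ⟨hs.trans_le hx.1, hx.2.trans_lt hr⟩
  have hpi : IntegrableOn p (Icc s r) := hp s r hs hr
  have hsr : s ≤ r := (hst.trans htr).le
  let θ : ℕ → ℝ → ℝ := fun n x => smoothStep s n x - smoothStep t n x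
  have hθ0 : ∀ᶠ n in atTop, ∀ x, x ∉ Icc s r → θ n x = 0 := by
    filter_upwards [eventually_one_div_lt (sub_pos.mpr htr)] with n hn x hx
    simp only [mem_Icc, not_and_or, not_le] at hx
    rcases hx with hx | hx
    · simp [θ, smoothStep_eq_zero hx.le, smoothStep_eq_zero (hx.le.trans hst.le)]
    · have h1 : t + 1 / ((n : ℝ) + 1) ≤ x := by linarith
      simp [θ, smoothStep_eq_one h1, smoothStep_eq_one (a := s) (n := n) (x := x) (by linarith)]
  have hθc : ∀ n, ContDiff ℝ ∞ (θ n) := fun n =>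
    (contDiff_smoothStep s n).sub (contDiff_smoothStep t n)
  have hdθ : ∀ n x, deriv (θ n) x = deriv (smoothStep s n) x - deriv (smoothStep t n) x := by
    intro n x
    exact deriv_fun_sub ((contDiff_smoothStep s n).differentiable (by simp)).differentiableAt
      ((contDiff_smoothStep t n).differentiable (by simp)).differentiableAt
  have hθb : ∀ n x, |θ n x| ≤ 1 := by
    intro n x
    have h1 := Real.smoothTransition.nonneg (((n : ℝ) + 1) * (x - s))
    have h2 := Real.smoothTransition.nonneg (((n : ℝ) + 1) * (x - t))
    have h3 := Real.smoothTransition.le_one (((n : ℝ) + 1) * (x - s))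
    have h4 := Real.smoothTransition.le_one (((n : ℝ) + 1) * (x - t))
    simp only [θ, smoothStep]
    rw [abs_le]
    constructor <;> linarith
  have key : ∀ᶠ n in atTop, (∫ x in s..r, deriv (smoothStep s n) x * f x) -
      (∫ x in s..r, deriv (smoothStep t n) x * f x) = ∫ x in s..r, θ n x * p x := by
    filter_upwards [hθ0] with n hn
    have hts : tsupport (θ n) ⊆ Icc s r :=
      closure_minimal (fun x hx => by_contra fun hx' => hx (hn x hx')) isClosed_Icc
    have hsub : Icc s r ⊆ Ioo 0 1 := fun x hx => ⟨hs.trans_le hx.1, hx.2.trans_lt hr⟩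
    have h1 := h (θ n) (hθc n) (isCompact_Icc.of_isClosed_subset (isClosed_tsupport _) hts)
      (hts.trans hsub)
    rw [setIntegral_eq_of_subset_of_forall_sdiff_eq_zero measurableSet_Ioo hsub,
      integral_Icc_eq_integral_Ioc, ← intervalIntegral.integral_of_le hsr] at h1
    · have i1 : ∀ a, IntervalIntegrable (fun x => deriv (smoothStep a n) x * f x) volume s r := by
        intro a
        refine ContinuousOn.intervalIntegrable ?_
        rw [uIcc_of_le hsr]
        exact (continuous_deriv_smoothStep a n).continuousOn.mul hfc
      have i2 : IntervalIntegrable (fun x => θ n x * p x) volume s r := by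
        rw [intervalIntegrable_iff_integrableOn_Icc_of_le hsr]
        exact hpi.bdd_mul (c := 1) (hθc n).continuous.aestronglyMeasurable
          (Eventually.of_forall fun x => hθb n x)
      rw [← intervalIntegral.integral_sub (i1 s) (i1 t), ← sub_eq_zero, ← neg_eq_zero, neg_sub,
        ← intervalIntegral.integral_sub i2 ((i1 s).sub (i1 t)), ← h1]
      congr 1
      ext x
      rw [hdθ]
      ring
    · intro x hx
      have hx' : x ∉ tsupport (θ n) := fun hx' => hx.2 (hts hx')
      rw [image_eq_zero_of_notMem_tsupport hx',
        image_eq_zero_of_notMem_tsupport fun hx'' => hx' (tsupport_deriv_subset hx'')]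
      simp
  have lim1 := (tendsto_integral_deriv_smoothStep le_rfl (hst.trans htr) hfc).sub
    (tendsto_integral_deriv_smoothStep hst.le htr hfc)
  have lim2 : Tendsto (fun n => ∫ x in s..r, θ n x * p x) atTop
      (𝓝 (∫ x in s..r, (Ioc s t).indicator p x)) := by
    refine intervalIntegral.tendsto_integral_filter_of_dominated_convergence (fun x => ‖p x‖) ?_ ?_ ?_ ?_
    · refine Eventually.of_forall fun n => (hθc n).continuous.aestronglyMeasurable.mul ?_
      rw [uIoc_of_le hsr]
      exact (hpi.mono_set Ioc_subset_Icc_self).1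
    · refine Eventually.of_forall fun n => Eventually.of_forall fun x _ => ?_
      rw [norm_mul]
      exact mul_le_of_le_one_left (norm_nonneg _) (hθb n x)
    · rw [intervalIntegrable_iff_integrableOn_Icc_of_le hsr]
      exact hpi.norm
    · refine Eventually.of_forall fun x hx => ?_
      rw [uIoc_of_le hsr] at hx
      refine tendsto_const_nhds.congr' ?_
      by_cases hxt : x ≤ t
      · filter_upwards [eventually_one_div_lt (sub_pos.mpr hx.1)] with n hn
        rw [indicator_of_mem (show x ∈ Ioc s t from ⟨hx.1, hxt⟩)]
        simp [θ, smoothStep_eq_zero hxt, smoothStep_eq_one (a := s) (n := n) (x := x) (by linarith)]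
      · push Not at hxt
        filter_upwards [eventually_one_div_lt (sub_pos.mpr hxt)] with n hn
        rw [indicator_of_notMem fun h' => h'.2.not_gt hxt]
        simp [θ, smoothStep_eq_one (a := t) (n := n) (x := x) (by linarith),
          smoothStep_eq_one (a := s) (n := n) (x := x) (by linarith)]
  have h2 := tendsto_nhds_unique (lim1.congr' key) lim2
  rw [intervalIntegral.integral_of_le hsr, setIntegral_indicator measurableSet_Ioc,
    inter_eq_right.mpr (Ioc_subset_Ioc_right htr.le), ← intervalIntegral.integral_of_le hst.le] at h2
  rw [← h2]
  ring

end DuBoisReymond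

/-! ### The curves in `L²` of a Leray-Hopf solution -/

section Curves

theorem spaceTime_eq : spaceTime = (volume.restrict (Ioo (0 : ℝ) 1)).prod (volume : Measure V3) := by
  rw [spaceTime, Measure.volume_eq_prod, ← Measure.prod_restrict, Measure.restrict_univ]

theorem inner_toL2 {a b : V3 → V3} (ha : MemLp a 2 volume) (hb : MemLp b 2 volume) :
    inner ℂ (toL2 a) (toL2 b) = ((∫ x, inner ℝ (a x) (b x) : ℝ) : ℂ) := by
  rw [L2.inner_def, ← integral_complex_ofReal]
  refine integral_congr_ae ?_
  filter_upwards [coeFn_toL2 ha, coeFn_toL2 hb] with x h1 h2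
  rw [h1, h2, inner_complexify]

variable {u₀ : V3 → V3} {u : ℝ → V3 → V3} {G : ℝ → V3 → V3 →L[ℝ] V3}

/-- The velocity as a curve in `L²`. -/
def vel (u : ℝ → V3 → V3) (t : ℝ) : H := toL2 (u t)

/-- The partial derivatives of the velocity as curves in `L²`. -/
def pderiv (G : ℝ → V3 → V3 →L[ℝ] V3) (j : Fin 3) (t : ℝ) : H := toL2 fun x => G t x (e j)

/-- The convection term `u · ∇u` as a curve in `L²`. -/
def conv (u : ℝ → V3 → V3) (G : ℝ → V3 → V3 →L[ℝ] V3) (t : ℝ) : H := toL2 fun x => G t x (u t x)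

theorem norm_e (j : Fin 3) : ‖e j‖ = 1 := by simp [e]

theorem clm_apply_eq_sum (L : V3 →L[ℝ] V3) (v : V3) : L v = ∑ j, v j • L (e j) := by
  have : v = ∑ j, v j • e j := by
    ext i
    simp [e, Finset.sum_apply, Pi.single_apply]
  conv_lhs => rw [this]
  simp

namespace IsLerayHopfWith

theorem ae_memLp_grad (h : IsLerayHopfWith u₀ u G) :
    ∀ᵐ t ∂(volume.restrict (Ioo (0 : ℝ) 1)), MemLp (G t) 2 volume := by
  have h1 := h.grad_memLp
  rw [spaceTime_eq] at h1
  have h2 := (memLp_two_iff_integrable_sq_norm h1.1).mp h1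
  filter_upwards [h2.prod_right_ae, h1.1.prodMk_left] with t h3 h4
  exact (memLp_two_iff_integrable_sq_norm h4).mpr h3

theorem integrable_grad (h : IsLerayHopfWith u₀ u G) :
    Integrable (fun t => ∫ x, ‖G t x‖ ^ 2) (volume.restrict (Ioo (0 : ℝ) 1)) := by
  have h1 := h.grad_memLp
  rw [spaceTime_eq] at h1
  exact ((memLp_two_iff_integrable_sq_norm h1.1).mp h1).integral_prod_left

theorem memLp' (h : IsLerayHopfWith u₀ u G) {t : ℝ} (ht : t ∈ Ioo (0 : ℝ) 1) :
    MemLp (u t) 2 volume := h.memLp t (Ioo_subset_Ico_self ht)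

theorem exists_norm_vel_le (h : IsLerayHopfWith u₀ u G) :
    ∃ M : ℝ, 0 ≤ M ∧ ∀ t ∈ Ico (0 : ℝ) 1, ‖vel u t‖ ≤ M := by
  obtain ⟨M, hM⟩ := h.bounded_L2
  refine ⟨M, M.2, fun t ht => ?_⟩
  have := hM t ht
  rw [← enorm_toL2 (h.memLp t ht), ← ofReal_norm, ENNReal.ofReal_le_iff_le_toReal (by simp)] at this
  simpa [vel] using this

theorem _root_.NSE.memLp_grad_apply {Gt : V3 → V3 →L[ℝ] V3} (hG : MemLp Gt 2 volume) {v : V3 → V3}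
    (hv : AEStronglyMeasurable v volume) {M : ℝ} (hM : ∀ᵐ x, ‖v x‖ ≤ M) :
    MemLp (fun x => Gt x (v x)) 2 volume ∧
      ∫ x, ‖Gt x (v x)‖ ^ 2 ≤ M ^ 2 * ∫ x, ‖Gt x‖ ^ 2 := by
  have hb : ∀ᵐ x, ‖Gt x (v x)‖ ≤ M * ‖Gt x‖ := by
    filter_upwards [hM] with x hx
    rw [mul_comm]
    exact (Gt x).le_of_opNorm_le_of_le le_rfl hx
  have h1 : MemLp (fun x => Gt x (v x)) 2 volume := by
    refine hG.of_le_mul ?_ hb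
    exact isBoundedBilinearMap_apply.continuous.comp_aestronglyMeasurable (hG.1.prodMk hv)
  refine ⟨h1, ?_⟩
  rw [← integral_const_mul]
  refine integral_mono_ae ((memLp_two_iff_integrable_sq_norm h1.1).mp h1)
    (((memLp_two_iff_integrable_sq_norm hG.1).mp hG).const_mul _) ?_
  filter_upwards [hb] with x hx
  calc ‖Gt x (v x)‖ ^ 2 ≤ (M * ‖Gt x‖) ^ 2 := by gcongr
    _ = M ^ 2 * ‖Gt x‖ ^ 2 := by ring

theorem _root_.NSE.BoundedBeforeOne.exists_bound (hb : BoundedBeforeOne u) {t : ℝ}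
    (ht : t ∈ Ioo (0 : ℝ) 1) : ∃ M : ℝ, ∀ᵐ x, ‖u t x‖ ≤ M := by
  obtain ⟨M, hM⟩ := hb t t ht.1 ht.2
  exact ⟨M, hM t ⟨le_rfl, le_rfl⟩⟩

/-- For almost every time, the classes of `∂_j u` and of `u · ∇u` are not junk values. -/
theorem ae_memLp_pderiv (h : IsLerayHopfWith u₀ u G) :
    ∀ᵐ t ∂(volume.restrict (Ioo (0 : ℝ) 1)), ∀ j, MemLp (fun x => G t x (e j)) 2 volume := by
  filter_upwards [h.ae_memLp_grad] with t ht j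
  exact (memLp_grad_apply ht aestronglyMeasurable_const (M := 1)
    (Eventually.of_forall fun _ => (norm_e j).le)).1

theorem ae_memLp_conv (h : IsLerayHopfWith u₀ u G) (hb : BoundedBeforeOne u) :
    ∀ᵐ t ∂(volume.restrict (Ioo (0 : ℝ) 1)), MemLp (fun x => G t x (u t x)) 2 volume := by
  filter_upwards [h.ae_memLp_grad, ae_restrict_mem measurableSet_Ioo] with t ht h1
  obtain ⟨M, hM⟩ := hb.exists_bound h1
  exact (memLp_grad_apply ht (h.memLp' h1).1 hM).1

theorem aestronglyMeasurable_vel (h : IsLerayHopfWith u₀ u G) :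
    AEStronglyMeasurable (vel u) (volume.restrict (Ioo (0 : ℝ) 1)) := by
  have h1 := h.measurable
  rw [spaceTime_eq] at h1
  refine aestronglyMeasurable_curve (complexifyL.continuous.comp_aestronglyMeasurable h1) ?_
  filter_upwards [ae_restrict_mem measurableSet_Ioo] with t ht
  exact coeFn_toL2 (h.memLp' ht)

theorem aestronglyMeasurable_grad_apply (h : IsLerayHopfWith u₀ u G) (v : V3) :
    AEStronglyMeasurable (fun p : ℝ × V3 => G p.1 p.2 v) spaceTime :=
  isBoundedBilinearMap_apply.continuous.comp_aestronglyMeasurable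
    (h.grad_memLp.1.prodMk aestronglyMeasurable_const)

theorem aestronglyMeasurable_pderiv (h : IsLerayHopfWith u₀ u G) (j : Fin 3) :
    AEStronglyMeasurable (pderiv G j) (volume.restrict (Ioo (0 : ℝ) 1)) := by
  have h1 := h.aestronglyMeasurable_grad_apply (e j)
  rw [spaceTime_eq] at h1
  refine aestronglyMeasurable_curve (complexifyL.continuous.comp_aestronglyMeasurable h1) ?_
  filter_upwards [h.ae_memLp_pderiv] with t ht
  exact coeFn_toL2 (ht j)

theorem aestronglyMeasurable_grad_vel (h : IsLerayHopfWith u₀ u G) :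
    AEStronglyMeasurable (fun p : ℝ × V3 => G p.1 p.2 (u p.1 p.2)) spaceTime :=
  isBoundedBilinearMap_apply.continuous.comp_aestronglyMeasurable
    (h.grad_memLp.1.prodMk h.measurable)

theorem aestronglyMeasurable_conv (h : IsLerayHopfWith u₀ u G) (hb : BoundedBeforeOne u) :
    AEStronglyMeasurable (conv u G) (volume.restrict (Ioo (0 : ℝ) 1)) := by
  have h1 := h.aestronglyMeasurable_grad_vel
  rw [spaceTime_eq] at h1
  refine aestronglyMeasurable_curve (complexifyL.continuous.comp_aestronglyMeasurable h1) ?_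
  filter_upwards [h.ae_memLp_conv hb] with t ht
  exact coeFn_toL2 ht

theorem memLp_pderiv (h : IsLerayHopfWith u₀ u G) (j : Fin 3) :
    MemLp (pderiv G j) 2 (volume.restrict (Ioo (0 : ℝ) 1)) := by
  rw [memLp_two_iff_integrable_sq_norm (h.aestronglyMeasurable_pderiv j)]
  refine h.integrable_grad.mono' ((h.aestronglyMeasurable_pderiv j).norm.pow 2) ?_
  filter_upwards [h.ae_memLp_grad] with t ht
  have h1 := memLp_grad_apply ht (v := fun _ => e j) aestronglyMeasurable_const (M := 1)
    (Eventually.of_forall fun _ => (norm_e j).le)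
  rw [pderiv, norm_sq_toL2 h1.1, Real.norm_of_nonneg (integral_nonneg fun _ => by positivity)]
  simpa using h1.2

theorem Icc_subset_Ioo_unit {s r : ℝ} (hs : 0 < s) (hr : r < 1) : Icc s r ⊆ Ioo (0 : ℝ) 1 :=
  fun _ hx => ⟨hs.trans_le hx.1, hx.2.trans_lt hr⟩

theorem memLp_conv (h : IsLerayHopfWith u₀ u G) (hb : BoundedBeforeOne u) {s r : ℝ} (hs : 0 < s)
    (hr : r < 1) : MemLp (conv u G) 2 (volume.restrict (Icc s r)) := by
  have hle : volume.restrict (Icc s r) ≤ volume.restrict (Ioo (0 : ℝ) 1) :=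
    Measure.restrict_mono (Icc_subset_Ioo_unit hs hr) le_rfl
  have hm := (h.aestronglyMeasurable_conv hb).mono_measure hle
  obtain ⟨M, hM⟩ := hb s r hs hr
  rw [memLp_two_iff_integrable_sq_norm hm]
  refine ((h.integrable_grad.mono_measure hle).const_mul (M ^ 2)).mono' (hm.norm.pow 2) ?_
  filter_upwards [ae_mono hle h.ae_memLp_grad, ae_restrict_mem measurableSet_Icc] with t ht h1
  have h2 := memLp_grad_apply ht (h.memLp' (Icc_subset_Ioo_unit hs hr h1)).1 (hM t h1)
  rw [conv, norm_sq_toL2 h2.1, Real.norm_of_nonneg (integral_nonneg fun _ => by positivity)]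
  exact h2.2

theorem memLp_vel (h : IsLerayHopfWith u₀ u G) :
    MemLp (vel u) 2 (volume.restrict (Ioo (0 : ℝ) 1)) := by
  obtain ⟨M, -, hM⟩ := h.exists_norm_vel_le
  refine MemLp.of_bound h.aestronglyMeasurable_vel M ?_
  filter_upwards [ae_restrict_mem measurableSet_Ioo] with t ht
  exact hM t (Ioo_subset_Ico_self ht)

theorem integrableOn_conv (h : IsLerayHopfWith u₀ u G) (hb : BoundedBeforeOne u) {s r : ℝ}
    (hs : 0 < s) (hr : r < 1) : IntegrableOn (conv u G) (Icc s r) :=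
  (h.memLp_conv hb hs hr).integrable one_le_two

theorem integrable_pderiv (h : IsLerayHopfWith u₀ u G) (j : Fin 3) :
    IntegrableOn (pderiv G j) (Ioo (0 : ℝ) 1) :=
  (h.memLp_pderiv j).integrable one_le_two

theorem integrable_vel (h : IsLerayHopfWith u₀ u G) : IntegrableOn (vel u) (Ioo (0 : ℝ) 1) :=
  h.memLp_vel.integrable one_le_two

end IsLerayHopfWith

end Curves

/-! ### The momentum equation tested against solenoidal fields -/

section Momentum

theorem integral_norm_mul_norm_le {a b : V3 → V3} (ha : MemLp a 2 volume) (hb : MemLp b 2 volume) :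
    ∫ x, ‖a x‖ * ‖b x‖ ≤ ‖toL2 a‖ * ‖toL2 b‖ := by
  have h := integral_mul_norm_le_Lp_mul_Lq (μ := (volume : Measure V3)) (f := a) (g := b)
    (p := 2) (q := 2) ⟨by norm_num, by norm_num, by norm_num⟩ (by simpa using ha) (by simpa using hb)
  have hn : ∀ {c : V3 → V3}, MemLp c 2 volume → (∫ x, ‖c x‖ ^ (2 : ℝ)) ^ (1 / 2 : ℝ) = ‖toL2 c‖ := by
    intro c hc
    have : ∫ x, ‖c x‖ ^ (2 : ℝ) = ‖toL2 c‖ ^ 2 := by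
      rw [norm_sq_toL2 hc]
      simp
    rw [this, ← Real.sqrt_eq_rpow, Real.sqrt_sq (norm_nonneg _)]
  rwa [hn ha, hn hb] at h

/-- Integrability on space-time from integrability in time of the `L²` norms of the slices. -/
theorem integrable_smul_inner {μ : Measure ℝ} [SFinite μ] {g : ℝ × V3 → V3}
    (hg : AEStronglyMeasurable g (μ.prod volume))
    (hs : ∀ᵐ t ∂μ, MemLp (fun x => g (t, x)) 2 volume) {θ : ℝ → ℝ} (hθ : Continuous θ)
    (hint : Integrable (fun t => θ t * ‖toL2 fun x => g (t, x)‖) μ) {a : V3 → V3}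
    (ha : MemLp a 2 volume) :
    Integrable (fun p : ℝ × V3 => θ p.1 * inner ℝ (g p) (a p.2)) (μ.prod volume) := by
  have hm : AEStronglyMeasurable (fun p : ℝ × V3 => θ p.1 * inner ℝ (g p) (a p.2))
      (μ.prod volume) :=
    ((hθ.comp continuous_fst).aestronglyMeasurable).mul (hg.inner ha.1.comp_snd)
  rw [integrable_prod_iff hm]
  have hsl : ∀ᵐ t ∂μ, Integrable (fun x => ‖g (t, x)‖ * ‖a x‖) volume := by
    filter_upwards [hs] with t ht
    exact ht.norm.integrable_mul ha.norm
  constructor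
  · filter_upwards [hs, hsl] with t ht h1
    refine Integrable.const_mul ?_ _
    refine h1.mono' (ht.1.inner ha.1) (Eventually.of_forall fun x => ?_)
    exact norm_inner_le_norm (𝕜 := ℝ) _ _
  · refine (hint.norm.mul_const ‖toL2 a‖).mono' hm.norm.integral_prod_right' ?_
    filter_upwards [hs, hsl] with t ht h1
    rw [Real.norm_of_nonneg (integral_nonneg fun _ => norm_nonneg _)]
    calc ∫ x, ‖θ t * inner ℝ (g (t, x)) (a x)‖ ≤ ∫ x, |θ t| * (‖g (t, x)‖ * ‖a x‖) := by
          refine integral_mono_of_nonneg (Eventually.of_forall fun _ => norm_nonneg _)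
            (h1.const_mul _) (Eventually.of_forall fun x => ?_)
          simp only [norm_mul, Real.norm_eq_abs]
          gcongr
          exact norm_inner_le_norm (𝕜 := ℝ) _ _
      _ ≤ |θ t| * (‖toL2 fun x => g (t, x)‖ * ‖toL2 a‖) := by
          rw [integral_const_mul]
          gcongr
          exact integral_norm_mul_norm_le ht ha
      _ = ‖θ t * ‖toL2 fun x => g (t, x)‖‖ * ‖toL2 a‖ := by
          rw [norm_mul, Real.norm_eq_abs, norm_norm]
          ring

/-- A function that is integrable on compact subsets of `(0,1)` may be multiplied by a test
function. -/
theorem integrable_test_mul {q : ℝ → ℝ}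
    (hq : ∀ s r : ℝ, 0 < s → r < 1 → IntegrableOn q (Icc s r)) {θ : ℝ → ℝ} (hθ : Continuous θ)
    (hc : HasCompactSupport θ) (hs : tsupport θ ⊆ Ioo 0 1) :
    Integrable (fun t => θ t * q t) (volume.restrict (Ioo (0 : ℝ) 1)) := by
  obtain ⟨s, r, h1, h2, h3⟩ : ∃ s r : ℝ, 0 < s ∧ r < 1 ∧ tsupport θ ⊆ Icc s r := by
    rcases (tsupport θ).eq_empty_or_nonempty with h | h
    · exact ⟨1 / 2, 1 / 2, by norm_num, by norm_num, by simp [h]⟩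
    · obtain ⟨s, hs1, hs2⟩ := hc.isCompact.exists_isLeast h
      obtain ⟨r, hr1, hr2⟩ := hc.isCompact.exists_isGreatest h
      exact ⟨s, r, (hs hs1).1, (hs hr1).2, fun x hx => ⟨hs2 hx, hr2 hx⟩⟩
  obtain ⟨K, hK⟩ := hθ.bounded_above_of_compact_support hc
  have h4 : IntegrableOn (fun t => θ t * q t) (Icc s r) :=
    (hq s r h1 h2).bdd_mul (c := K) hθ.aestronglyMeasurable (Eventually.of_forall hK)
  have h5 : Integrable (fun t => θ t * q t) volume := by
    refine (integrableOn_iff_integrable_of_support_subset fun t ht => ?_).mp h4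
    by_contra h
    exact ht (by simp [image_eq_zero_of_notMem_tsupport fun h' => h (h3 h')])
  exact h5.integrableOn

variable {u₀ : V3 → V3} {u : ℝ → V3 → V3} {G : ℝ → V3 → V3 →L[ℝ] V3}

theorem memLp_test {a : V3 → V3} (ha : Continuous a) (hac : HasCompactSupport a) :
    MemLp a 2 volume := ha.memLp_of_hasCompactSupport hac

theorem contDiff_fderiv_apply {F : Type*} [NormedAddCommGroup F] [NormedSpace ℝ F] {a : V3 → F}
    (ha : ContDiff ℝ ∞ a) (v : V3) :
    ContDiff ℝ ∞ fun x => fderiv ℝ a x v :=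
  (ha.fderiv_right (m := ∞) (by simp)).clm_apply contDiff_const

theorem isTestField_smul {a : V3 → V3} (ha : ContDiff ℝ ∞ a) (hac : HasCompactSupport a)
    (hdiv : ∀ x, ∑ j, (fderiv ℝ a x (e j)) j = 0) {θ : ℝ → ℝ} (hθ : ContDiff ℝ ∞ θ)
    (hθc : HasCompactSupport θ) (hθs : tsupport θ ⊆ Ioo 0 1) :
    IsTestField fun p : ℝ × V3 => θ p.1 • a p.2 := by
  have hsupp : tsupport (fun p : ℝ × V3 => θ p.1 • a p.2) ⊆ tsupport θ ×ˢ tsupport a := by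
    refine closure_minimal (fun p hp => ?_) ((isClosed_tsupport _).prod (isClosed_tsupport _))
    refine ⟨subset_tsupport _ fun h => hp ?_, subset_tsupport _ fun h => hp ?_⟩
    · simp [h]
    · simp [h]
  refine ⟨(hθ.comp contDiff_fst).smul (ha.comp contDiff_snd), ?_, ?_, fun t x => ?_⟩
  · exact (hθc.isCompact.prod hac.isCompact).of_isClosed_subset (isClosed_tsupport _) hsupp
  · exact hsupp.trans (prod_mono hθs (subset_univ _))
  · have : ∀ j, fderiv ℝ (fun z => θ t • a z) x (e j) = θ t • fderiv ℝ a x (e j) := by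
      intro j
      rw [fderiv_fun_const_smul (ha.differentiable (by simp)).differentiableAt]
      rfl
    simp only [this, PiLp.smul_apply, smul_eq_mul, ← Finset.mul_sum, hdiv, mul_zero]

theorem fderiv_smul_prod {a : V3 → V3} (ha : ContDiff ℝ ∞ a) {θ : ℝ → ℝ} (hθ : ContDiff ℝ ∞ θ)
    (p q : ℝ × V3) : fderiv ℝ (fun p : ℝ × V3 => θ p.1 • a p.2) p q =
      (q.1 * deriv θ p.1) • a p.2 + θ p.1 • fderiv ℝ a p.2 q.2 := by
  have h1 : HasFDerivAt (fun p : ℝ × V3 => θ p.1)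
      ((ContinuousLinearMap.toSpanSingleton ℝ (deriv θ p.1)).comp
        (ContinuousLinearMap.fst ℝ ℝ V3)) p :=
    (hθ.differentiable (by simp)).differentiableAt.hasDerivAt.hasFDerivAt.comp p hasFDerivAt_fst
  have h2 : HasFDerivAt (fun p : ℝ × V3 => a p.2)
      ((fderiv ℝ a p.2).comp (ContinuousLinearMap.snd ℝ ℝ V3)) p :=
    (ha.differentiable (by simp)).differentiableAt.hasFDerivAt.comp p hasFDerivAt_snd
  rw [(h1.fun_smul h2).fderiv]
  simp [add_comm]

namespace IsLerayHopfWith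

/-- The weak form of the momentum equation between two times. -/
theorem inner_vel_sub (h : IsLerayHopfWith u₀ u G) (hb : BoundedBeforeOne u) {a : V3 → V3}
    (ha : ContDiff ℝ ∞ a) (hac : HasCompactSupport a)
    (hdiv : ∀ x, ∑ j, (fderiv ℝ a x (e j)) j = 0) {s t : ℝ} (hs : 0 < s) (hst : s ≤ t)
    (ht : t < 1) :
    inner ℂ (toL2 a) (vel u t - vel u s) = -∫ σ in s..t,
      (∑ k, inner ℂ (toL2 fun x => fderiv ℝ a x (e k)) (pderiv G k σ)
        + inner ℂ (toL2 a) (conv u G σ)) := by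
  have hdc : ∀ k, HasCompactSupport fun x => fderiv ℝ a x (e k) := fun k =>
    hac.fderiv_apply (𝕜 := ℝ) (e k)
  have hdm : ∀ k, MemLp (fun x => fderiv ℝ a x (e k)) 2 volume := fun k =>
    memLp_test (contDiff_fderiv_apply ha _).continuous (hdc k)
  have ham : MemLp a 2 volume := memLp_test ha.continuous hac
  set μ := (volume : Measure ℝ).restrict (Ioo (0 : ℝ) 1) with hμ
  let p : ℝ → ℝ := fun σ => ∑ k, (inner ℂ (toL2 fun x => fderiv ℝ a x (e k)) (pderiv G k σ)).re
    + (inner ℂ (toL2 a) (conv u G σ)).re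
  let f : ℝ → ℝ := fun σ => ∫ x, inner ℝ (u σ x) (a x)
  have hf : ContinuousOn f (Ioo 0 1) := (h.weakly_continuous a ham).mono Ioo_subset_Ico_self
  have hsub : ∀ {s r : ℝ}, 0 < s → r < 1 → volume.restrict (Icc s r) ≤ μ := fun hs hr =>
    Measure.restrict_mono (Icc_subset_Ioo_unit hs hr) le_rfl
  have hp : ∀ s r : ℝ, 0 < s → r < 1 → IntegrableOn p (Icc s r) := by
    intro s r hs hr
    refine Integrable.add (integrable_finsetSum _ fun k _ => ?_) ?_
    · exact Complex.reCLM.integrable_comp (((h.integrable_pderiv k).mono_set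
        (Icc_subset_Ioo_unit hs hr)).const_inner (𝕜 := ℂ) (toL2 fun x => fderiv ℝ a x (e k)))
    · exact Complex.reCLM.integrable_comp
        ((h.integrableOn_conv hb hs hr).const_inner (𝕜 := ℂ) (toL2 a))
  have key : ∀ θ : ℝ → ℝ, ContDiff ℝ ∞ θ → HasCompactSupport θ → tsupport θ ⊆ Ioo 0 1 →
      ∫ t in Ioo (0 : ℝ) 1, (- deriv θ t * f t + θ t * p t) = 0 := by
    intro θ hθ hθc hθs
    have hθ' : Continuous (deriv θ) := hθ.continuous_deriv (by exact_mod_cast le_top)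
    have h0 := h.equation _ (isTestField_smul ha hac hdiv hθ hθc hθs)
    have hm1 := h.measurable
    have hm2 := fun k => h.aestronglyMeasurable_grad_apply (e k)
    have hm3 := h.aestronglyMeasurable_grad_vel
    rw [spaceTime_eq] at h0 hm1 hm3
    simp only [spaceTime_eq] at hm2
    have I1 := integrable_smul_inner (μ := μ) hm1 (by
        filter_upwards [ae_restrict_mem measurableSet_Ioo] with t ht using h.memLp' ht)
      (θ := fun t => - deriv θ t) hθ'.neg
      (integrable_test_mul (q := fun t => ‖vel u t‖) (fun s r hs hr =>
        (h.integrable_vel.mono_set (Icc_subset_Ioo_unit hs hr)).norm) hθ'.neg (by exact hθc.deriv.neg)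
        ((by
          have : tsupport (fun t => - deriv θ t) = tsupport (deriv θ) := by
            simp only [tsupport, Function.support_fun_neg]
          rw [this]
          exact (tsupport_deriv_subset).trans hθs))) ham
    have I2 := fun k => integrable_smul_inner (μ := μ) (hm2 k) (by
        filter_upwards [h.ae_memLp_pderiv] with t ht using ht k) hθ.continuous
      (integrable_test_mul (q := fun t => ‖pderiv G k t‖) (fun s r hs hr =>
        ((h.integrable_pderiv k).mono_set (Icc_subset_Ioo_unit hs hr)).norm) hθ.continuous hθc hθs) (hdm k)
    have I3 := integrable_smul_inner (μ := μ) hm3 (h.ae_memLp_conv hb) hθ.continuous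
      (integrable_test_mul (q := fun t => ‖conv u G t‖) (fun s r hs hr =>
        (h.integrableOn_conv hb hs hr).norm) hθ.continuous hθc hθs) ham
    have hF : (fun p : ℝ × V3 => - inner ℝ (u p.1 p.2)
          (fderiv ℝ (fun p : ℝ × V3 => θ p.1 • a p.2) p (1, 0))
        + ∑ j : Fin 3, inner ℝ (G p.1 p.2 (e j))
          (fderiv ℝ (fun p : ℝ × V3 => θ p.1 • a p.2) p (0, e j))
        + inner ℝ (G p.1 p.2 (u p.1 p.2)) (θ p.1 • a p.2)) =
        fun p : ℝ × V3 => - deriv θ p.1 * inner ℝ (u p.1 p.2) (a p.2)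
          + ∑ j : Fin 3, θ p.1 * inner ℝ (G p.1 p.2 (e j)) (fderiv ℝ a p.2 (e j))
          + θ p.1 * inner ℝ (G p.1 p.2 (u p.1 p.2)) (a p.2) := by
      ext p
      simp [fderiv_smul_prod ha hθ, inner_smul_right]
    rw [hF] at h0
    have I2' := integrable_finsetSum Finset.univ fun k _ => I2 k
    have I4 : Integrable (fun p : ℝ × V3 => - deriv θ p.1 * inner ℝ (u p.1 p.2) (a p.2)
          + ∑ j : Fin 3, θ p.1 * inner ℝ (G p.1 p.2 (e j)) (fderiv ℝ a p.2 (e j))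
          + θ p.1 * inner ℝ (G p.1 p.2 (u p.1 p.2)) (a p.2)) (μ.prod volume) :=
      (I1.add I2').add I3
    rw [integral_prod _ I4] at h0
    refine Eq.trans ?_ h0
    refine integral_congr_ae ?_
    filter_upwards [ae_restrict_mem measurableSet_Ioo, h.ae_memLp_pderiv, h.ae_memLp_conv hb,
      I1.prod_right_ae, ae_all_iff.mpr fun k => (I2 k).prod_right_ae, I3.prod_right_ae]
      with t ht h1 h2 j1 j2 j3
    have j2' : Integrable (fun x => ∑ k, θ t * inner ℝ (G t x (e k)) (fderiv ℝ a x (e k))) volume :=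
      integrable_finsetSum Finset.univ fun k _ => j2 k
    refine Eq.trans ?_ (integral_add (j1.add j2') j3).symm
    simp only [Pi.add_apply]
    rw [integral_add j1 j2',
      integral_finsetSum _ fun k _ => j2 k]
    simp only [integral_const_mul]
    rw [add_assoc]
    simp only [p, mul_add, Finset.mul_sum]
    congr 2
    · refine Finset.sum_congr rfl fun k _ => ?_
      rw [pderiv, inner_toL2 (hdm k) (h1 k), Complex.ofReal_re]
      simp only [real_inner_comm]
    · rw [conv, inner_toL2 ham h2, Complex.ofReal_re]
      simp only [real_inner_comm]
  have hmain := sub_eq_neg_integral_of_weak hf hp key hs hst ht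
  have hst' : ∀ {σ : ℝ}, σ ∈ Icc s t → σ ∈ Ioo (0 : ℝ) 1 := fun hσ =>
    Icc_subset_Ioo_unit hs ht hσ
  have e1 : ∀ σ ∈ Icc s t, inner ℂ (toL2 a) (vel u σ) = (f σ : ℂ) := by
    intro σ hσ
    rw [vel, inner_toL2 ham (h.memLp' (hst' hσ))]
    simp only [f, real_inner_comm]
  rw [inner_sub_right, e1 t ⟨hst, le_rfl⟩, e1 s ⟨le_rfl, hst⟩, ← Complex.ofReal_sub, hmain,
    Complex.ofReal_neg, ← intervalIntegral.integral_ofReal]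
  congr 1
  refine intervalIntegral.integral_congr_ae ?_
  have hae : ∀ᵐ σ ∂(volume.restrict (Icc s t)), (∀ k, MemLp (fun x => G σ x (e k)) 2 volume) ∧
      MemLp (fun x => G σ x (u σ x)) 2 volume :=
    ae_mono (hsub hs ht) (h.ae_memLp_pderiv.and (h.ae_memLp_conv hb))
  rw [ae_restrict_iff' measurableSet_Icc] at hae
  filter_upwards [hae] with σ hσ hσ'
  rw [uIoc_of_le hst] at hσ'
  obtain ⟨h1, h2⟩ := hσ (Ioc_subset_Icc_self hσ')
  simp only [p, pderiv, conv, inner_toL2 ham h2, fun k => inner_toL2 (hdm k) (h1 k),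
    Complex.ofReal_re]
  push_cast
  rfl

end IsLerayHopfWith

end Momentum

/-! ### The equations in terms of Fourier transforms -/

section FourierEquations

theorem lineDeriv_testSchwartz {ψ : V3 → ℝ} (h₁ : ContDiff ℝ ∞ ψ) (h₂ : HasCompactSupport ψ)
    (j : Fin 3) : ∂_{e j} (testSchwartz ψ h₁ h₂) =
      testSchwartz (fun x => fderiv ℝ ψ x (e j)) ((h₁.fderiv_right (m := ∞) (by simp)).clm_apply
        contDiff_const) (h₂.fderiv_apply (𝕜 := ℝ) (e j)) := by
  ext x
  rw [SchwartzMap.lineDerivOp_apply_eq_fderiv, testSchwartz_apply]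
  have h : HasFDerivAt (fun x => (ψ x : ℂ)) (Complex.ofRealCLM.comp (fderiv ℝ ψ x)) x :=
    Complex.ofRealCLM.hasFDerivAt.comp x (h₁.differentiable (by simp)).differentiableAt.hasFDerivAt
  have h' : fderiv ℝ (testSchwartz ψ h₁ h₂) x = Complex.ofRealCLM.comp (fderiv ℝ ψ x) := h.fderiv
  rw [h']
  rfl

/-- A weak gradient in `L²` in terms of Fourier transforms. -/
theorem fourier_weakGradient {f : V3 → V3} {g : V3 → V3 →L[ℝ] V3} (hf : MemLp f 2 volume)
    (hg : ∀ j, MemLp (fun x => g x (e j)) 2 volume) (h : IsWeakGradient f g) (j : Fin 3) :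
    (𝓕 (toL2 fun x => g x (e j)) : H) =ᵐ[volume] fun ζ => dsym j ζ • (𝓕 (toL2 f) : H) ζ := by
  refine eq_lineDeriv_iff.mp ?_
  rw [← sub_eq_zero]
  refine tempered_eq_zero _ fun ψ h₁ h₂ => ?_
  have h3 : ∀ (ψ : V3 → ℝ) (h₁ : ContDiff ℝ ∞ ψ) (h₂ : HasCompactSupport ψ) {a : V3 → V3},
      MemLp a 2 volume → ∫ x, testSchwartz ψ h₁ h₂ x • toL2 a x = complexifyL (∫ x, ψ x • a x) := by
    intro ψ h₁ h₂ a ha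
    rw [← complexifyL.integral_comp_comm]
    · refine integral_congr_ae ?_
      filter_upwards [coeFn_toL2 ha] with x hx
      rw [hx]
      simp
    · exact memLp_one_iff_integrable.mp
        (ha.smul (p := 2) (h₁.continuous.memLp_of_hasCompactSupport h₂))
  have h4 := h j ψ h₁ h₂
  change ((toL2 fun x => g x (e j) : H) : 𝓢'(V3, C3)) (testSchwartz ψ h₁ h₂) -
    (∂_{e j} ((toL2 f : H) : 𝓢'(V3, C3))) (testSchwartz ψ h₁ h₂) = 0
  rw [TemperedDistribution.lineDerivOp_apply_apply, Lp.toTemperedDistribution_apply, map_neg,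
    Lp.toTemperedDistribution_apply, lineDeriv_testSchwartz, h3 ψ h₁ h₂ (hg j), h3 _ _ _ hf, h4]
  simp [-complexifyL_apply]

/-- A weakly solenoidal field in terms of Fourier transforms. -/
theorem fourier_weaklyDivFree {f : V3 → V3} (hf : MemLp f 2 volume) (h : IsWeaklyDivFree f) :
    ∀ᵐ ζ : V3, ∑ j, (ζ j : ℂ) * (𝓕 (toL2 f) : H) ζ j = 0 := by
  let P : Fin 3 → Lp ℂ 2 (volume : Measure V3) := fun j => (projC j).compLp (toL2 f)
  have hT : ∑ j, ∂_{e j} (P j : 𝓢'(V3, ℂ)) = 0 := by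
    refine tempered_eq_zero _ fun ψ h₁ h₂ => ?_
    have h1 : ∀ j, (∂_{e j} (P j : 𝓢'(V3, ℂ))) (testSchwartz ψ h₁ h₂) =
        -((∫ x, fderiv ℝ ψ x (e j) * f x j : ℝ) : ℂ) := by
      intro j
      rw [TemperedDistribution.lineDerivOp_apply_apply, map_neg, Lp.toTemperedDistribution_apply,
        lineDeriv_testSchwartz, ← integral_complex_ofReal]
      congr 1
      refine integral_congr_ae ?_
      filter_upwards [coeFn_toL2 hf, (projC j).coeFn_compLp (toL2 f)] with x h1 h2
      rw [h2, h1]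
      simp
    have h2 : (∑ j, ∂_{e j} (P j : 𝓢'(V3, ℂ))) (testSchwartz ψ h₁ h₂) =
        ∑ j, (∂_{e j} (P j : 𝓢'(V3, ℂ))) (testSchwartz ψ h₁ h₂) := by
      simp [Fin.sum_univ_three]
    rw [h2]
    simp only [h1, Finset.sum_neg_distrib]
    rw [neg_eq_zero, ← Complex.ofReal_sum, Complex.ofReal_eq_zero, ← integral_finsetSum]
    · rw [← h ψ h₁ h₂]
      congr 1
      ext x
      have : f x = ∑ j, f x j • e j := by
        ext i
        simp [e, Finset.sum_apply, Pi.single_apply]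
      conv_rhs => rw [this]
      simp [mul_comm]
    · intro j _
      have hj : MemLp (fun x => f x j) 2 volume :=
        (EuclideanSpace.proj j : V3 →L[ℝ] ℝ).comp_memLp' hf
      exact MemLp.integrable_mul (p := 2) (q := 2) ((contDiff_fderiv_apply h₁ _).continuous.memLp_of_hasCompactSupport
        (h₂.fderiv_apply (𝕜 := ℝ) (e j))) hj
  have h1 := (fourier_weak_divergence_iff (f := P) (g := 0)).mp fun κ => by
    have h2 := congrArg (fun T : 𝓢'(V3, ℂ) => T κ) hT
    have h3 : ∫ x, κ x • (0 : Lp ℂ 2 (volume : Measure V3)) x = 0 := by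
      refine integral_eq_zero_of_ae ?_
      filter_upwards [Lp.coeFn_zero ℂ 2 (volume : Measure V3)] with x hx
      rw [hx, Pi.zero_apply, smul_zero]
    rw [h3]
    simp only [Fin.sum_univ_three, add_apply, TemperedDistribution.lineDerivOp_apply_apply, map_neg,
      Lp.toTemperedDistribution_apply, zero_apply] at h2 ⊢
    linear_combination -h2
  have h0 : (𝓕 (0 : Lp ℂ 2 (volume : Measure V3)) : Lp ℂ 2 (volume : Measure V3)) = 0 :=
    (Lp.fourierTransformₗᵢ V3 ℂ).map_zero
  rw [h0] at h1
  filter_upwards [h1, Lp.coeFn_zero ℂ 2 (volume : Measure V3),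
    ae_all_iff.mpr fun j => (projC j).coeFn_compLp (𝓕 (toL2 f) : H)] with ζ h2 h3 h4
  rw [h3] at h2
  simp only [P, fourier_compLp, h4, dsym] at h2
  have h5 : (2 * Real.pi * Complex.I) * ∑ j, (ζ j : ℂ) * (𝓕 (toL2 f) : H) ζ j = 0 := by
    rw [Finset.mul_sum]
    refine Eq.trans ?_ h2.symm
    refine Finset.sum_congr rfl fun j _ => ?_
    simp [mul_assoc]
  exact (mul_eq_zero.mp h5).resolve_left (by simp [Real.pi_ne_zero])

end FourierEquations

/-! ### The momentum equation in terms of Fourier transforms -/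

section FourierMomentum

/-- The test field `∂_i ψ e_j - ∂_j ψ e_i`, a curl. -/
def curlField (ψ : V3 → ℝ) (i j : Fin 3) (x : V3) : V3 :=
  fderiv ℝ ψ x (e i) • e j - fderiv ℝ ψ x (e j) • e i

theorem contDiff_curlField {ψ : V3 → ℝ} (h₁ : ContDiff ℝ ∞ ψ) (i j : Fin 3) :
    ContDiff ℝ ∞ (curlField ψ i j) :=
  ((contDiff_fderiv_apply h₁ _).smul contDiff_const).sub
    ((contDiff_fderiv_apply h₁ _).smul contDiff_const)

theorem hasCompactSupport_curlField {ψ : V3 → ℝ} (h₂ : HasCompactSupport ψ) (i j : Fin 3) :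
    HasCompactSupport (curlField ψ i j) :=
  ((h₂.fderiv_apply (𝕜 := ℝ) (e i)).smul_right).sub ((h₂.fderiv_apply (𝕜 := ℝ) (e j)).smul_right)

theorem fderiv_curlField {ψ : V3 → ℝ} (h₁ : ContDiff ℝ ∞ ψ) (i j : Fin 3) (x v : V3) :
    fderiv ℝ (curlField ψ i j) x v = fderiv ℝ (fun y => fderiv ℝ ψ y (e i)) x v • e j -
      fderiv ℝ (fun y => fderiv ℝ ψ y (e j)) x v • e i := by
  have h : ∀ k, HasFDerivAt (fun y => fderiv ℝ ψ y (e k))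
      (fderiv ℝ (fun y => fderiv ℝ ψ y (e k)) x) x := fun k =>
    ((contDiff_fderiv_apply h₁ (e k)).differentiable (by simp)).differentiableAt.hasFDerivAt
  have h2 := ((h i).smul_const (e j)).sub ((h j).smul_const (e i))
  have h3 : HasFDerivAt (curlField ψ i j) _ x := h2
  rw [h3.fderiv]
  simp

theorem div_curlField {ψ : V3 → ℝ} (h₁ : ContDiff ℝ ∞ ψ) (i j : Fin 3) (x : V3) :
    ∑ k, (fderiv ℝ (curlField ψ i j) x (e k)) k = 0 := by
  have hsymm : fderiv ℝ (fun y => fderiv ℝ ψ y (e i)) x (e j) =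
      fderiv ℝ (fun y => fderiv ℝ ψ y (e j)) x (e i) := by
    have hd : DifferentiableAt ℝ (fderiv ℝ ψ) x :=
      ((h₁.fderiv_right (m := ∞) (by simp)).differentiable (by simp)).differentiableAt
    have h : ∀ v w, fderiv ℝ (fun y => fderiv ℝ ψ y v) x w = fderiv ℝ (fderiv ℝ ψ) x w v := by
      intro v w
      rw [fderiv_clm_apply hd (differentiableAt_const _)]
      simp
    rw [h, h]
    exact (h₁.contDiffAt (x := x)).isSymmSndFDerivAt
      (by simpa using (ENat.LEInfty.out : (2 : WithTop ℕ∞) ≤ _)) _ _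
  simp only [fderiv_curlField h₁, e, PiLp.sub_apply, PiLp.smul_apply, smul_eq_mul,
    PiLp.single_apply, Finset.sum_sub_distrib, mul_ite, mul_one, mul_zero,
    Finset.sum_ite_eq', Finset.mem_univ, if_true]
  exact sub_eq_zero.mpr hsymm

/-- The components of a vector-valued `L²` function. -/
def compL2 (j : Fin 3) (f : H) : Lp ℂ 2 (volume : Measure V3) := (projC j).compLp f

theorem coeFn_compL2 (j : Fin 3) (f : H) : compL2 j f =ᵐ[volume] fun x => f x j :=
  (projC j).coeFn_compLp f

theorem inner_toL2_combination {ψ₁ ψ₂ : V3 → ℝ} (h₁ : ContDiff ℝ ∞ ψ₁) (h₁' : HasCompactSupport ψ₁)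
    (h₂ : ContDiff ℝ ∞ ψ₂) (h₂' : HasCompactSupport ψ₂) (i j : Fin 3) (f : H) :
    inner ℂ (toL2 fun x => ψ₁ x • e j - ψ₂ x • e i) f =
      (compL2 j f : 𝓢'(V3, ℂ)) (testSchwartz ψ₁ h₁ h₁') -
      (compL2 i f : 𝓢'(V3, ℂ)) (testSchwartz ψ₂ h₂ h₂') := by
  have hm : MemLp (fun x => ψ₁ x • e j - ψ₂ x • e i) 2 (volume : Measure V3) :=
    memLp_test ((h₁.continuous.smul continuous_const).sub (h₂.continuous.smul continuous_const))
      (h₁'.smul_right.sub h₂'.smul_right)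
  rw [Lp.toTemperedDistribution_apply, Lp.toTemperedDistribution_apply,
    ← integral_sub (integrable_schwartz_smul _ (Lp.memLp _))
      (integrable_schwartz_smul _ (Lp.memLp _)), L2.inner_def]
  refine integral_congr_ae ?_
  filter_upwards [coeFn_toL2 hm, coeFn_compL2 j f, coeFn_compL2 i f] with x a1 a2 a3
  rw [a1, a2, a3, PiLp.inner_apply]
  simp only [complexify_apply, testSchwartz_apply, e, PiLp.sub_apply, PiLp.smul_apply,
    PiLp.single_apply, smul_eq_mul, mul_ite, mul_one, mul_zero, Complex.ofReal_sub,
    RCLike.inner_apply, map_sub, mul_sub, Finset.sum_sub_distrib, apply_ite Complex.ofReal,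
    Complex.ofReal_zero, apply_ite (starRingEnd ℂ), map_zero, Complex.conj_ofReal,
    Finset.sum_ite_eq', Finset.mem_univ, if_true]
  ring

theorem lineDeriv_fourier (κ : 𝓢(V3, ℂ)) (j : Fin 3) :
    ∂_{e j} (𝓕 κ) = -𝓕 (SchwartzMap.smulLeftCLM ℂ (dsym j) κ) := by
  have h1 : (-(2 * Real.pi * Complex.I) • SchwartzMap.smulLeftCLM ℂ (inner ℝ · (e j)) κ) =
      -SchwartzMap.smulLeftCLM ℂ (dsym j) κ := by
    ext ζ
    have : (inner ℝ · (e j) : V3 → ℝ).HasTemperateGrowth := by fun_prop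
    rw [smul_apply, SchwartzMap.smulLeftCLM_apply_apply this, neg_apply,
      SchwartzMap.smulLeftCLM_apply_apply (dsym_hasTemperateGrowth j), inner_e]
    simp [dsym]
    ring
  rw [SchwartzMap.lineDerivOp_fourier_eq, h1]
  exact map_neg (SchwartzMap.fourierTransformCLM ℂ) _

/-- If `A = 𝓕 B - ∑_k (2πi ζ_k) 𝓕 (F_k)` annihilates the curl fields, that is, if
`B - ∑_k ∂_k F_k` does, then `A` is parallel to `ζ`. -/
theorem fourier_parallel {B : H} {F : Fin 3 → H} (i j : Fin 3)
    (h : ∀ (ψ : V3 → ℝ), ContDiff ℝ ∞ ψ → HasCompactSupport ψ →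
      inner ℂ (toL2 (curlField ψ i j)) B +
        ∑ k, inner ℂ (toL2 fun x => fderiv ℝ (curlField ψ i j) x (e k)) (F k) = 0) :
    ∀ᵐ ζ : V3, dsym i ζ * ((𝓕 B : H) ζ j - ∑ k, dsym k ζ * (𝓕 (F k) : H) ζ j) =
      dsym j ζ * ((𝓕 B : H) ζ i - ∑ k, dsym k ζ * (𝓕 (F k) : H) ζ i) := by
  let T : 𝓢'(V3, ℂ) := ∂_{e j} (compL2 i B : 𝓢'(V3, ℂ)) - ∂_{e i} (compL2 j B : 𝓢'(V3, ℂ)) +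
    ∑ k, (∂_{e i} (∂_{e k} (compL2 j (F k) : 𝓢'(V3, ℂ))) -
      ∂_{e j} (∂_{e k} (compL2 i (F k) : 𝓢'(V3, ℂ))))
  have hTκ : ∀ κ, T κ = (compL2 j B : 𝓢'(V3, ℂ)) (∂_{e i} κ) - (compL2 i B : 𝓢'(V3, ℂ)) (∂_{e j} κ)
      + ∑ k, ((compL2 j (F k) : 𝓢'(V3, ℂ)) (∂_{e k} (∂_{e i} κ)) -
        (compL2 i (F k) : 𝓢'(V3, ℂ)) (∂_{e k} (∂_{e j} κ))) := by
    intro κ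
    simp only [T, Fin.sum_univ_three, add_apply, sub_apply,
      TemperedDistribution.lineDerivOp_apply_apply, map_neg]
    ring
  have hT : T = 0 := by
    refine tempered_eq_zero _ fun ψ h₁ h₂ => ?_
    rw [hTκ, ← h ψ h₁ h₂]
    congr 1
    · simp only [lineDeriv_testSchwartz]
      rw [← inner_toL2_combination]
      rfl
    · refine Finset.sum_congr rfl fun k _ => ?_
      simp only [lineDeriv_testSchwartz]
      rw [← inner_toL2_combination]
      simp only [fderiv_curlField h₁]
  have hB : ∀ (κ : 𝓢(V3, ℂ)) (i : Fin 3) (f : H), (compL2 i f : 𝓢'(V3, ℂ)) (𝓕 κ) =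
      ∫ ζ, κ ζ * (𝓕 f : H) ζ i := by
    intro κ i f
    rw [Lp.toTemperedDistribution_apply, integral_fourier_smul_Lp, compL2, fourier_compLp]
    refine integral_congr_ae ?_
    filter_upwards [coeFn_compL2 i (𝓕 f : H)] with ζ hζ
    rw [compL2] at hζ
    rw [hζ, smul_eq_mul]
  have hm : ∀ (i : Fin 3) (f : H), MemLp (fun ζ => (𝓕 f : H) ζ i) 2 volume := fun i f =>
    (projC i).comp_memLp' (Lp.memLp _)
  have hd : ∀ j, Continuous (dsym j) := continuous_dsym
  have hloc : ∀ (i : Fin 3) (b : V3 → ℂ) (f : H), Continuous b →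
      LocallyIntegrable fun ζ => b ζ * (𝓕 f : H) ζ i := fun i b f hb =>
    locallyIntegrable_smul_Lp hb (hm i f)
  -- both sides as finite sums of products of a polynomial and an `L²` function
  have hS : (fun ζ => (dsym i ζ * (𝓕 B : H) ζ j - dsym j ζ * (𝓕 B : H) ζ i) -
      ∑ k, ((dsym k ζ * dsym i ζ) * (𝓕 (F k) : H) ζ j - (dsym k ζ * dsym j ζ) * (𝓕 (F k) : H) ζ i))
      =ᵐ[volume] fun _ => 0 := by
    refine ae_eq_of_forall_schwartz ?_ (locallyIntegrable_const 0) fun κ => ?_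
    · simp only [Fin.sum_univ_three]
      refine ((hloc _ _ _ (hd i)).sub (hloc _ _ _ (hd j))).sub (((?_ : LocallyIntegrable _ _).add
        (?_ : LocallyIntegrable _ _)).add (?_ : LocallyIntegrable _ _))
      all_goals exact (hloc _ _ _ ((hd _).mul (hd _))).sub (hloc _ _ _ ((hd _).mul (hd _)))
    · have h1 := congrArg (fun T : 𝓢'(V3, ℂ) => T (𝓕 κ)) hT
      simp only [hTκ, lineDeriv_fourier, LineDeriv.lineDerivOp_neg, map_neg, neg_neg, hB, zero_apply,
        SchwartzMap.smulLeftCLM_apply_apply (dsym_hasTemperateGrowth _), smul_eq_mul] at h1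
      have hI : ∀ (κ : 𝓢(V3, ℂ)) (i : Fin 3) (f : H),
          Integrable fun ζ => κ ζ * (𝓕 f : H) ζ i := fun κ i f =>
        integrable_schwartz_smul κ (hm i f)
      have hI1 : ∀ (i j : Fin 3) (f : H),
          Integrable fun ζ => dsym i ζ * κ ζ * (𝓕 f : H) ζ j := by
        intro i j f
        have := hI (SchwartzMap.smulLeftCLM ℂ (dsym i) κ) j f
        simpa only [SchwartzMap.smulLeftCLM_apply_apply (dsym_hasTemperateGrowth _), smul_eq_mul]
          using this
      have hI2 : ∀ (k i j : Fin 3) (f : H),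
          Integrable fun ζ => dsym k ζ * (dsym i ζ * κ ζ) * (𝓕 f : H) ζ j := by
        intro k i j f
        have := hI (SchwartzMap.smulLeftCLM ℂ (dsym k) (SchwartzMap.smulLeftCLM ℂ (dsym i) κ)) j f
        simpa only [SchwartzMap.smulLeftCLM_apply_apply (dsym_hasTemperateGrowth _), smul_eq_mul]
          using this
      have hI3 : Integrable fun ζ => ∑ k, (dsym k ζ * (dsym i ζ * κ ζ) * (𝓕 (F k) : H) ζ j -
          dsym k ζ * (dsym j ζ * κ ζ) * (𝓕 (F k) : H) ζ i) :=
        integrable_finsetSum _ fun k _ => (hI2 k i j _).sub (hI2 k j i _)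
      have hI4 : Integrable fun ζ => dsym i ζ * κ ζ * (𝓕 B : H) ζ j -
          dsym j ζ * κ ζ * (𝓕 B : H) ζ i := (hI1 i j _).sub (hI1 j i _)
      have e1 : ∫ ζ, κ ζ • ((dsym i ζ * (𝓕 B : H) ζ j - dsym j ζ * (𝓕 B : H) ζ i) -
          ∑ k, ((dsym k ζ * dsym i ζ) * (𝓕 (F k) : H) ζ j -
            (dsym k ζ * dsym j ζ) * (𝓕 (F k) : H) ζ i)) =
          ∫ ζ, ((dsym i ζ * κ ζ * (𝓕 B : H) ζ j - dsym j ζ * κ ζ * (𝓕 B : H) ζ i) -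
            ∑ k, (dsym k ζ * (dsym i ζ * κ ζ) * (𝓕 (F k) : H) ζ j -
              dsym k ζ * (dsym j ζ * κ ζ) * (𝓕 (F k) : H) ζ i)) := by
        congr 1
        ext ζ
        simp only [Fin.sum_univ_three, smul_eq_mul]
        ring
      have hI5 : ∀ k, Integrable fun ζ => dsym k ζ * (dsym i ζ * κ ζ) * (𝓕 (F k) : H) ζ j -
          dsym k ζ * (dsym j ζ * κ ζ) * (𝓕 (F k) : H) ζ i := fun k =>
        (hI2 k i j _).sub (hI2 k j i _)
      rw [e1, integral_sub hI4 hI3, integral_sub (hI1 i j _) (hI1 j i _),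
        integral_finsetSum _ fun k _ => hI5 k]
      simp only [integral_sub (hI2 _ _ _ _) (hI2 _ _ _ _), smul_zero, integral_zero]
      linear_combination -h1
  filter_upwards [hS] with ζ hζ
  simp only [Fin.sum_univ_three] at hζ ⊢
  linear_combination hζ

end FourierMomentum

/-! ### The evolution of the Fourier transform of the velocity -/

section Evolution

variable {u₀ : V3 → V3} {u : ℝ → V3 → V3} {G : ℝ → V3 → V3 →L[ℝ] V3}

/-- The symbol `|2πζ|²` of `-Δ`. -/
def lap (ζ : V3) : ℝ := (2 * Real.pi * ‖ζ‖) ^ 2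

theorem lap_nonneg (ζ : V3) : 0 ≤ lap ζ := sq_nonneg _

theorem continuous_lap : Continuous lap := by
  unfold lap
  fun_prop

theorem sum_dsym_mul_dsym (ζ : V3) : ∑ k, dsym k ζ * dsym k ζ = -(lap ζ : ℂ) := by
  have h : ‖ζ‖ ^ 2 = ∑ k, ζ k ^ 2 := by
    rw [EuclideanSpace.norm_sq_eq]
    simp
  rw [lap, mul_pow, h]
  simp only [dsym, Fin.sum_univ_three]
  push_cast
  linear_combination (4 * (Real.pi : ℂ) ^ 2 * ((ζ 0 : ℂ) ^ 2 + (ζ 1 : ℂ) ^ 2 + (ζ 2 : ℂ) ^ 2)) *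
    Complex.I_sq

/-- The truncation of a symbol at radius `R`. -/
def cut (R : ℝ) (c : V3 → ℂ) (ζ : V3) : ℂ := if ‖ζ‖ ≤ R then c ζ else 0

theorem measurable_cut (R : ℝ) {c : V3 → ℂ} (hc : Measurable c) : Measurable (cut R c) :=
  Measurable.ite (measurableSet_le measurable_norm measurable_const) hc measurable_const

theorem exists_norm_cut_le (R : ℝ) {c : V3 → ℂ} (hc : Continuous c) : ∃ K, ∀ ζ, ‖cut R c ζ‖ ≤ K := by
  obtain ⟨K, hK⟩ := (isCompact_closedBall (0 : V3) R).exists_bound_of_continuousOn hc.continuousOn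
  refine ⟨max K 0, fun ζ => ?_⟩
  rw [cut]
  split_ifs with h
  · exact (hK ζ (by simpa using h)).trans (le_max_left _ _)
  · simp

theorem memLp_top_cut (R : ℝ) {c : V3 → ℂ} (hc : Continuous c) : MemLp (cut R c) ⊤ volume := by
  obtain ⟨K, hK⟩ := exists_norm_cut_le R hc
  exact memLp_top_of_bdd (measurable_cut R hc.measurable) hK

/-- `-Δ` truncated at radius `R`, as an operator in frequency space. -/
def lapCut (R : ℝ) : H →L[ℂ] H :=
  mulC (cut R fun ζ => (lap ζ : ℂ)) (memLp_top_cut R (Complex.continuous_ofReal.comp continuous_lap))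

/-- The Fourier transform on `L²` as a bounded operator. -/
def fourierL : H →L[ℂ] H := (Lp.fourierTransformₗᵢ V3 C3).toContinuousLinearEquiv

@[simp] theorem fourierL_apply (f : H) : fourierL f = 𝓕 f := rfl

theorem inner_eq_integral_sum (f g : H) :
    inner ℂ f g = ∫ ζ, ∑ j, (starRingEnd ℂ) (f ζ j) * g ζ j := by
  rw [L2.inner_def]
  congr 1
  ext ζ
  rw [PiLp.inner_apply]
  simp [mul_comm]

theorem integrable_inner_sum (f g : H) :
    Integrable fun ζ => ∑ j, (starRingEnd ℂ) (f ζ j) * g ζ j := by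
  refine (L2.integrable_inner (𝕜 := ℂ) f g).congr (Eventually.of_forall fun ζ => ?_)
  simp only [PiLp.inner_apply]
  simp [mul_comm]

theorem ae_ne_zero : ∀ᵐ ζ : V3, ζ ≠ 0 := by
  simp [ae_iff, measure_singleton]

/-- The momentum equation tested, in frequency space, against a solenoidal field with compact
support: the pressure disappears. -/
theorem IsLerayHopfWith.inner_fourier_vel_sub (h : IsLerayHopfWith u₀ u G) (hb : BoundedBeforeOne u)
    {f : H} (hf : ∀ᵐ ζ : V3, ∑ j, (ζ j : ℂ) * f ζ j = 0) {R : ℝ}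
    (hR : ∀ᵐ ζ : V3, R < ‖ζ‖ → f ζ = 0) {s t : ℝ} (hs : 0 < s) (hst : s ≤ t) (ht : t < 1) :
    inner ℂ f (𝓕 (vel u t) - 𝓕 (vel u s) : H) = -∫ σ in s..t,
      (inner ℂ f (lapCut R (𝓕 (vel u σ))) + inner ℂ f (𝓕 (conv u G σ) : H)) := by
  have hsub : Icc s t ⊆ Ioo 0 1 := Icc_subset_Ioo_unit hs ht
  have hD : ∀ k, IntervalIntegrable (pderiv G k) volume s t := fun k =>
    (intervalIntegrable_iff_integrableOn_Icc_of_le hst).mpr ((h.integrable_pderiv k).mono_set hsub)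
  have hΓ : IntervalIntegrable (conv u G) volume s t :=
    (intervalIntegrable_iff_integrableOn_Icc_of_le hst).mpr (h.integrableOn_conv hb hs ht)
  have hV : IntervalIntegrable (vel u) volume s t :=
    (intervalIntegrable_iff_integrableOn_Icc_of_le hst).mpr (h.integrable_vel.mono_set hsub)
  have hL : ∀ {L : H →L[ℂ] ℂ} {φ : ℝ → H}, IntervalIntegrable φ volume s t →
      IntervalIntegrable (fun σ => L (φ σ)) volume s t := fun {L φ} hφ =>
    ⟨L.integrable_comp hφ.1, L.integrable_comp hφ.2⟩
  have hLc : ∀ (L : H →L[ℂ] ℂ) {φ : ℝ → H}, IntervalIntegrable φ volume s t →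
      L (∫ σ in s..t, φ σ) = ∫ σ in s..t, L (φ σ) := fun L φ hφ =>
    (L.intervalIntegral_comp_comm hφ).symm
  let F : Fin 3 → H := fun k => ∫ σ in s..t, pderiv G k σ
  let B : H := vel u t - vel u s + ∫ σ in s..t, conv u G σ
  have hpar : ∀ i j, ∀ᵐ ζ : V3,
      dsym i ζ * ((𝓕 B : H) ζ j - ∑ k, dsym k ζ * (𝓕 (F k) : H) ζ j) =
      dsym j ζ * ((𝓕 B : H) ζ i - ∑ k, dsym k ζ * (𝓕 (F k) : H) ζ i) := by
    refine fun i j => fourier_parallel i j fun ψ h₁ h₂ => ?_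
    have h3 := h.inner_vel_sub hb (contDiff_curlField h₁ i j) (hasCompactSupport_curlField h₂ i j)
      (div_curlField h₁ i j) hs hst ht
    have i1 : ∀ k, IntervalIntegrable (fun σ =>
        inner ℂ (toL2 fun x => fderiv ℝ (curlField ψ i j) x (e k)) (pderiv G k σ)) volume s t :=
      fun k => hL (L := innerSL ℂ _) (hD k)
    have i2 : IntervalIntegrable (fun σ => inner ℂ (toL2 (curlField ψ i j)) (conv u G σ))
      volume s t := hL (L := innerSL ℂ _) hΓ
    have i3 : IntervalIntegrable (fun σ => ∑ k,
        inner ℂ (toL2 fun x => fderiv ℝ (curlField ψ i j) x (e k)) (pderiv G k σ)) volume s t := by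
      convert! IntervalIntegrable.sum Finset.univ fun k _ => i1 k using 1
    have e1 : ∀ (a : H) {φ : ℝ → H}, IntervalIntegrable φ volume s t →
        inner ℂ a (∫ σ in s..t, φ σ) = ∫ σ in s..t, inner ℂ a (φ σ) := fun a φ hφ =>
      hLc (innerSL ℂ a) hφ
    rw [intervalIntegral.integral_add i3 i2, intervalIntegral.integral_finsetSum fun k _ => i1 k]
      at h3
    rw [inner_add_right, h3, e1 _ hΓ]
    simp only [F, e1 _ (hD _)]
    ring
  -- `f` is orthogonal to the part of the identity that is parallel to `ζ`
  have horth : ∀ᵐ ζ : V3, ∑ j, (starRingEnd ℂ) (f ζ j) * (𝓕 B : H) ζ j =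
      ∑ k, ∑ j, (starRingEnd ℂ) (f ζ j) * (cut R (dsym k) ζ * (𝓕 (F k) : H) ζ j) := by
    filter_upwards [ae_all_iff.mpr fun i => ae_all_iff.mpr (hpar i), hf, hR, ae_ne_zero]
      with ζ h1 h2 h3 h4
    by_cases hζ : ‖ζ‖ ≤ R
    · have h5 : ∀ i j, (ζ i : ℂ) * ((𝓕 B : H) ζ j - ∑ k, dsym k ζ * (𝓕 (F k) : H) ζ j) =
          (ζ j : ℂ) * ((𝓕 B : H) ζ i - ∑ k, dsym k ζ * (𝓕 (F k) : H) ζ i) := by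
        intro i j
        have h6 := h1 i j
        have hc : (2 * Real.pi * Complex.I : ℂ) ≠ 0 := by simp [Real.pi_ne_zero]
        simp only [dsym, mul_assoc] at h6 ⊢
        refine mul_left_cancel₀ hc ?_
        simpa only [mul_assoc] using h6
      set A : Fin 3 → ℂ := fun j => (𝓕 B : H) ζ j - ∑ k, dsym k ζ * (𝓕 (F k) : H) ζ j with hA
      have h6 : ∑ j, (ζ j : ℂ) * (starRingEnd ℂ) (f ζ j) = 0 := by
        have := congrArg (starRingEnd ℂ) h2
        simpa using this
      have h7 : ((‖ζ‖ ^ 2 : ℝ) : ℂ) * ∑ j, (starRingEnd ℂ) (f ζ j) * A j = 0 := by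
        have hn : ‖ζ‖ ^ 2 = ∑ k, ζ k ^ 2 := by
          rw [EuclideanSpace.norm_sq_eq]
          simp
        rw [hn]
        push_cast
        have g1 : (∑ k, (ζ k : ℂ) ^ 2) * ∑ j, (starRingEnd ℂ) (f ζ j) * A j =
            (∑ k, (ζ k : ℂ) * A k) * ∑ j, (ζ j : ℂ) * (starRingEnd ℂ) (f ζ j) := by
          rw [Finset.sum_mul_sum, Finset.sum_mul_sum]
          refine Finset.sum_congr rfl fun i _ => Finset.sum_congr rfl fun j _ => ?_
          have := h5 i j
          linear_combination (ζ i : ℂ) * (starRingEnd ℂ) (f ζ j) * this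
        rw [g1, h6, mul_zero]
      have h8 := (mul_eq_zero.mp h7).resolve_left (by
        simpa using h4)
      have h9 : ∑ k, ∑ j, (starRingEnd ℂ) (f ζ j) * (cut R (dsym k) ζ * (𝓕 (F k) : H) ζ j) =
          ∑ j, (starRingEnd ℂ) (f ζ j) * ∑ k, dsym k ζ * (𝓕 (F k) : H) ζ j := by
        rw [Finset.sum_comm]
        refine Finset.sum_congr rfl fun j _ => ?_
        rw [Finset.mul_sum]
        refine Finset.sum_congr rfl fun k _ => ?_
        rw [cut, if_pos hζ]
      rw [h9, ← sub_eq_zero, ← Finset.sum_sub_distrib, ← h8]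
      exact Finset.sum_congr rfl fun j _ => (mul_sub _ _ _).symm
    · rw [h3 (not_le.mp hζ)]
      simp
  let Mk : Fin 3 → H →L[ℂ] H := fun k => mulC (cut R (dsym k)) (memLp_top_cut R (continuous_dsym k))
  have hMk : ∀ k (g : H), ∀ᵐ ζ : V3, ∀ j, (Mk k g) ζ j = cut R (dsym k) ζ * g ζ j := by
    intro k g
    filter_upwards [coeFn_mulC (memLp_top_cut R (continuous_dsym k)) g] with ζ hζ j
    simp only [Mk]
    rw [hζ]
    rfl
  have e1 : inner ℂ f (𝓕 B : H) = ∑ k, inner ℂ f (Mk k (𝓕 (F k))) := by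
    rw [inner_eq_integral_sum, integral_congr_ae horth]
    simp only [inner_eq_integral_sum]
    rw [← integral_finsetSum _ fun k _ => integrable_inner_sum _ _]
    refine integral_congr_ae ?_
    filter_upwards [ae_all_iff.mpr fun k => hMk k (𝓕 (F k))] with ζ hζ
    simp only [hζ]
  have e2 : (𝓕 B : H) = (𝓕 (vel u t) - 𝓕 (vel u s) : H) + fourierL (∫ σ in s..t, conv u G σ) := by
    change fourierL B = fourierL _ - fourierL _ + _
    rw [map_add, map_sub]
  have e3 : inner ℂ f (fourierL (∫ σ in s..t, conv u G σ)) =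
      ∫ σ in s..t, inner ℂ f (𝓕 (conv u G σ) : H) := hLc ((innerSL ℂ f).comp fourierL) hΓ
  have e4 : ∀ k, inner ℂ f (Mk k (𝓕 (F k))) =
      ∫ σ in s..t, inner ℂ f (Mk k (𝓕 (pderiv G k σ))) := fun k =>
    hLc ((innerSL ℂ f).comp ((Mk k).comp fourierL)) (hD k)
  have i1 : ∀ k, IntervalIntegrable (fun σ => inner ℂ f (Mk k (𝓕 (pderiv G k σ)))) volume s t :=
    fun k => hL (L := (innerSL ℂ f).comp ((Mk k).comp fourierL)) (hD k)
  have i2 : IntervalIntegrable (fun σ => inner ℂ f (𝓕 (conv u G σ) : H)) volume s t :=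
    hL (L := (innerSL ℂ f).comp fourierL) hΓ
  have i3 : IntervalIntegrable (fun σ => inner ℂ f (lapCut R (𝓕 (vel u σ)))) volume s t :=
    hL (L := (innerSL ℂ f).comp ((lapCut R).comp fourierL)) hV
  have e5 : ∑ k, ∫ σ in s..t, inner ℂ f (Mk k (𝓕 (pderiv G k σ))) =
      - ∫ σ in s..t, inner ℂ f (lapCut R (𝓕 (vel u σ))) := by
    rw [← intervalIntegral.integral_finsetSum fun k _ => i1 k, ← intervalIntegral.integral_neg]
    refine intervalIntegral.integral_congr_ae ?_
    have hae : ∀ᵐ σ ∂(volume.restrict (Icc s t)), (∀ k, MemLp (fun x => G σ x (e k)) 2 volume) ∧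
        IsWeakGradient (u σ) (G σ) :=
      ae_mono (Measure.restrict_mono hsub le_rfl) (h.ae_memLp_pderiv.and h.weak_grad)
    rw [ae_restrict_iff' measurableSet_Icc] at hae
    filter_upwards [hae] with σ hσ hσ'
    rw [uIoc_of_le hst] at hσ'
    have hσI := Ioc_subset_Icc_self hσ'
    obtain ⟨h1, h2⟩ := hσ hσI
    have h3 : ∀ k, (𝓕 (pderiv G k σ) : H) =ᵐ[volume] fun ζ => dsym k ζ • (𝓕 (vel u σ) : H) ζ :=
      fun k => fourier_weakGradient (h.memLp' (hsub hσI)) h1 h2 k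
    simp only [inner_eq_integral_sum]
    rw [← integral_finsetSum _ fun k _ => integrable_inner_sum _ _, ← integral_neg]
    refine integral_congr_ae ?_
    filter_upwards [ae_all_iff.mpr h3, ae_all_iff.mpr fun k => hMk k (𝓕 (pderiv G k σ)),
      coeFn_mulC (memLp_top_cut R (Complex.continuous_ofReal.comp continuous_lap)) (𝓕 (vel u σ) : H)]
      with ζ a1 a2 a3
    have a4 : (lapCut R (𝓕 (vel u σ)) : H) ζ = cut R (fun ζ => (lap ζ : ℂ)) ζ • (𝓕 (vel u σ) : H) ζ :=
      a3
    simp only [a2, a4, a1, cut]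
    split_ifs
    · rw [Finset.sum_comm, ← Finset.sum_neg_distrib]
      refine Finset.sum_congr rfl fun j _ => ?_
      simp only [PiLp.smul_apply, smul_eq_mul]
      have := sum_dsym_mul_dsym ζ
      change _ = -((starRingEnd ℂ) (f ζ j) * ((lap ζ : ℂ) * (𝓕 (vel u σ) : H) ζ j))
      rw [← Finset.mul_sum, ← mul_neg, ← neg_mul, ← this, Finset.sum_mul]
      simp only [mul_assoc]
    · simp
  rw [intervalIntegral.integral_add i3 i2, ← e3]
  rw [e2, inner_add_right] at e1
  simp only [e4, e5] at e1
  linear_combination e1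

end Evolution

/-! ### Energy identities in frequency space -/

section FrequencyEnergy

/-- A function with quadratically small increments with respect to a continuous monotone function
is constant. -/
theorem eq_of_abs_sub_le_sq {D Y : ℝ → ℝ} {s t C : ℝ} (hst : s ≤ t) (hY : ContinuousOn Y (Icc s t))
    (h : ∀ a ∈ Icc s t, ∀ b ∈ Icc s t, |D b - D a| ≤ C * (Y b - Y a) ^ 2) (hYst : Y s ≤ Y t) :
    D t = D s := by
  have hsurj : ∀ y ∈ Icc (Y s) (Y t), ∃ x ∈ Icc s t, Y x = y := fun y hy =>
    intermediate_value_Icc hst hY hy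
  choose! x hx hxy using hsurj
  -- `D` is a function of `Y`, with zero derivative
  let g : ℝ → ℝ := fun y => D (x y)
  have hg : ∀ y ∈ Icc (Y s) (Y t), HasDerivWithinAt g 0 (Icc (Y s) (Y t)) y := by
    intro y hy
    have h1 : (fun z => g z - g y) =O[𝓝[Icc (Y s) (Y t)] y] fun z => ‖z - y‖ ^ 2 := by
      refine Asymptotics.IsBigO.of_bound C ?_
      filter_upwards [self_mem_nhdsWithin] with z hz
      have := h _ (hx y hy) _ (hx z hz)
      rw [hxy y hy, hxy z hz] at this
      simpa using this
    have h2 := (h1.hasFDerivWithinAt hy one_lt_two).hasDerivWithinAt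
    have h3 := h2.add_const (g y)
    simpa using h3
  have h1 := constant_of_derivWithin_zero (fun y hy => (hg y hy).differentiableWithinAt)
    (fun y hy => by
      rcases hYst.eq_or_lt with h0 | h0
      · exact absurd hy (by simp [h0])
      · exact (hg y (Ico_subset_Icc_self hy)).derivWithin (uniqueDiffOn_Icc h0 y (Ico_subset_Icc_self hy)))
    (Y t) ⟨hYst, le_rfl⟩
  have h2 : ∀ r ∈ Icc s t, Y r ∈ Icc (Y s) (Y t) → g (Y r) = D r := by
    intro r hr hr'
    have := h _ hr _ (hx (Y r) hr')
    rw [hxy _ hr', sub_self] at this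
    have h0 : |D (x (Y r)) - D r| ≤ 0 := by simpa using this
    exact sub_eq_zero.mp (abs_nonpos_iff.mp h0)
  rw [h2 t ⟨hst, le_rfl⟩ ⟨hYst, le_rfl⟩, h2 s ⟨le_rfl, hst⟩ ⟨le_rfl, hYst⟩] at h1
  exact h1

variable {u₀ : V3 → V3} {u : ℝ → V3 → V3} {G : ℝ → V3 → V3 →L[ℝ] V3}

/-- The Fourier transform of the velocity. -/
def velF (u : ℝ → V3 → V3) (t : ℝ) : H := 𝓕 (vel u t)

/-- The Fourier transform of the convection term. -/
def convF (u : ℝ → V3 → V3) (G : ℝ → V3 → V3 →L[ℝ] V3) (t : ℝ) : H := 𝓕 (conv u G t)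

/-- `∑_j ζ_j f_j = 0`, for Fourier transforms of solenoidal fields. -/
def IsSolenoidal (f : H) : Prop := ∀ᵐ ζ : V3, ∑ j, (ζ j : ℂ) * f ζ j = 0

theorem IsSolenoidal.mulC {f : H} (hf : IsSolenoidal f) {b : V3 → ℂ} (hb : MemLp b ⊤ volume) :
    IsSolenoidal (mulC b hb f) := by
  filter_upwards [hf, coeFn_mulC hb f] with ζ h1 h2
  rw [h2]
  have : ∑ j, (ζ j : ℂ) * (b ζ • f ζ) j = b ζ * ∑ j, (ζ j : ℂ) * f ζ j := by
    rw [Finset.mul_sum]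
    refine Finset.sum_congr rfl fun j _ => ?_
    simp only [PiLp.smul_apply, smul_eq_mul]
    ring
  rw [this, h1, mul_zero]

theorem IsSolenoidal.add {f g : H} (hf : IsSolenoidal f) (hg : IsSolenoidal g) :
    IsSolenoidal (f + g) := by
  filter_upwards [hf, hg, Lp.coeFn_add f g] with ζ h1 h2 h3
  rw [h3]
  simp only [Pi.add_apply, PiLp.add_apply, mul_add, Finset.sum_add_distrib, h1, h2, add_zero]

theorem IsSolenoidal.sub {f g : H} (hf : IsSolenoidal f) (hg : IsSolenoidal g) :
    IsSolenoidal (f - g) := by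
  filter_upwards [hf, hg, Lp.coeFn_sub f g] with ζ h1 h2 h3
  rw [h3]
  simp only [Pi.sub_apply, PiLp.sub_apply, mul_sub, Finset.sum_sub_distrib, h1, h2, sub_zero]

theorem mulC_eq_zero_of {b : V3 → ℂ} (hb : MemLp b ⊤ volume) {R : ℝ}
    (hR : ∀ ζ, R < ‖ζ‖ → b ζ = 0) (f : H) : ∀ᵐ ζ : V3, R < ‖ζ‖ → mulC b hb f ζ = 0 := by
  filter_upwards [coeFn_mulC hb f] with ζ h1 h2
  rw [h1, hR ζ h2, zero_smul]

theorem memLp_top_ofReal {b : V3 → ℝ} (hm : Measurable b) {K : ℝ} (hK : ∀ ζ, |b ζ| ≤ K) :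
    MemLp (fun ζ => (b ζ : ℂ)) ⊤ (volume : Measure V3) :=
  memLp_top_of_bdd (Complex.measurable_ofReal.comp hm) (K := K) fun ζ => by simpa using hK ζ

theorem inner_mulC_left {b : V3 → ℝ} (hb : MemLp (fun ζ => (b ζ : ℂ)) ⊤ volume) (f g : H) :
    inner ℂ (mulC _ hb f) g = inner ℂ f (mulC _ hb g) := by
  rw [L2.inner_def, L2.inner_def]
  refine integral_congr_ae ?_
  filter_upwards [coeFn_mulC hb f, coeFn_mulC hb g] with ζ h1 h2
  rw [h1, h2, inner_smul_left, inner_smul_right, Complex.conj_ofReal]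

theorem inner_mulC_self {b : V3 → ℝ} (hb : MemLp (fun ζ => (b ζ : ℂ)) ⊤ volume) (f : H) :
    (inner ℂ (mulC _ hb f) f).re = ∫ ζ, b ζ * ‖f ζ‖ ^ 2 := by
  have : inner ℂ (mulC _ hb f) f = ((∫ ζ, b ζ * ‖f ζ‖ ^ 2 : ℝ) : ℂ) := by
    rw [L2.inner_def, ← integral_complex_ofReal]
    refine integral_congr_ae ?_
    filter_upwards [coeFn_mulC hb f] with ζ h1
    rw [h1, inner_smul_left, Complex.conj_ofReal, inner_self_eq_norm_sq_to_K]
    simp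
  rw [this, Complex.ofReal_re]

namespace IsLerayHopfWith

theorem isSolenoidal_velF (h : IsLerayHopfWith u₀ u G) {t : ℝ} (ht : t ∈ Ioo (0 : ℝ) 1) :
    IsSolenoidal (velF u t) :=
  fourier_weaklyDivFree (h.memLp' ht) (h.div_free t ht)

theorem integrable_velF (h : IsLerayHopfWith u₀ u G) {s t : ℝ} (hs : 0 < s) (hst : s ≤ t)
    (ht : t < 1) : IntervalIntegrable (velF u) volume s t := by
  have := (intervalIntegrable_iff_integrableOn_Icc_of_le hst).mpr
    (h.integrable_vel.mono_set (Icc_subset_Ioo_unit hs ht))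
  exact ⟨fourierL.integrable_comp this.1, fourierL.integrable_comp this.2⟩

theorem integrable_convF (h : IsLerayHopfWith u₀ u G) (hb : BoundedBeforeOne u) {s t : ℝ}
    (hs : 0 < s) (hst : s ≤ t) (ht : t < 1) : IntervalIntegrable (convF u G) volume s t := by
  have := (intervalIntegrable_iff_integrableOn_Icc_of_le hst).mpr (h.integrableOn_conv hb hs ht)
  exact ⟨fourierL.integrable_comp this.1, fourierL.integrable_comp this.2⟩

/-- The right-hand side of the evolution equation of `𝓕 u` at frequencies below `R`, up to the
pressure. -/
def _root_.NSE.rhsF (u : ℝ → V3 → V3) (G : ℝ → V3 → V3 →L[ℝ] V3) (R t : ℝ) : H :=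
  lapCut R (velF u t) + convF u G t

theorem integrable_rhsF (h : IsLerayHopfWith u₀ u G) (hb : BoundedBeforeOne u) (R : ℝ) {s t : ℝ}
    (hs : 0 < s) (hst : s ≤ t) (ht : t < 1) : IntervalIntegrable (rhsF u G R) volume s t := by
  have h1 := h.integrable_velF hs hst ht
  exact IntervalIntegrable.add (f := fun t => lapCut R (velF u t))
    ⟨(lapCut R).integrable_comp h1.1, (lapCut R).integrable_comp h1.2⟩
    (h.integrable_convF hb hs hst ht)

theorem re_inner_velF_sub (h : IsLerayHopfWith u₀ u G) (hb : BoundedBeforeOne u) {f : H}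
    (hf : IsSolenoidal f) {R : ℝ} (hR : ∀ᵐ ζ : V3, R < ‖ζ‖ → f ζ = 0) {s t : ℝ} (hs : 0 < s)
    (hst : s ≤ t) (ht : t < 1) :
    (inner ℂ f (velF u t - velF u s)).re = -∫ σ in s..t, (inner ℂ f (rhsF u G R σ)).re := by
  have h1 := h.inner_fourier_vel_sub hb hf hR hs hst ht
  have h2 : IntervalIntegrable (fun σ => inner ℂ f (rhsF u G R σ)) volume s t :=
    ⟨(innerSL ℂ f).integrable_comp (h.integrable_rhsF hb R hs hst ht).1,
      (innerSL ℂ f).integrable_comp (h.integrable_rhsF hb R hs hst ht).2⟩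
  have h3 := Complex.reCLM.intervalIntegral_comp_comm h2
  have h4 : inner ℂ f (velF u t - velF u s) = -∫ σ in s..t, inner ℂ f (rhsF u G R σ) := by
    refine h1.trans ?_
    simp only [rhsF, inner_add_right]
    rfl
  rw [h4, Complex.neg_re]
  exact congrArg Neg.neg h3.symm

/-- The low frequencies of the velocity form an absolutely continuous curve in `L²`. -/
theorem norm_cut_velF_sub_le (h : IsLerayHopfWith u₀ u G) (hb : BoundedBeforeOne u) (R : ℝ)
    {s t : ℝ} (hs : 0 < s) (hst : s ≤ t) (ht : t < 1) :
    ‖mulC (cut R fun _ => 1) (memLp_top_cut R continuous_const) (velF u t - velF u s)‖ ≤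
      ∫ σ in s..t, ‖rhsF u G R σ‖ := by
  set P := mulC (cut R fun _ => 1) (memLp_top_cut R continuous_const)
  set f := P (velF u t - velF u s) with hf
  have hsol : IsSolenoidal f := ((h.isSolenoidal_velF ⟨hs.trans_le hst, ht⟩).sub
    (h.isSolenoidal_velF ⟨hs, hst.trans_lt ht⟩)).mulC _
  have hR : ∀ᵐ ζ : V3, R < ‖ζ‖ → f ζ = 0 :=
    mulC_eq_zero_of _ (fun ζ hζ => by simp [cut, not_le.mpr hζ]) _
  have h1 := h.re_inner_velF_sub hb hsol hR hs hst ht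
  have h2 : (inner ℂ f (velF u t - velF u s)).re = ‖f‖ ^ 2 := by
    have : inner ℂ f (velF u t - velF u s) = inner ℂ f f := by
      rw [L2.inner_def, L2.inner_def]
      refine integral_congr_ae ?_
      filter_upwards [coeFn_mulC (memLp_top_cut R continuous_const) (velF u t - velF u s)]
        with ζ h3
      change f ζ = _ at h3
      rw [h3, cut]
      split_ifs <;> simp
    rw [this, inner_self_eq_norm_sq_to_K]
    norm_cast
  have hI := (h.integrable_rhsF hb R hs hst ht).norm
  have h3 : ‖f‖ ^ 2 ≤ ‖f‖ * ∫ σ in s..t, ‖rhsF u G R σ‖ := by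
    rw [← h2, h1, ← intervalIntegral.integral_const_mul]
    refine (le_abs_self _).trans ?_
    rw [abs_neg, ← Real.norm_eq_abs]
    refine intervalIntegral.norm_integral_le_of_norm_le hst ?_ (hI.const_mul _)
    refine Eventually.of_forall fun σ _ => ?_
    exact (Complex.abs_re_le_norm _).trans (norm_inner_le_norm (𝕜 := ℂ) _ _)
  rcases (norm_nonneg f).eq_or_lt with h0 | h0
  · exact h0.symm.le.trans (intervalIntegral.integral_nonneg hst fun _ _ => norm_nonneg _)
  · rw [sq] at h3
    exact le_of_mul_le_mul_left h3 h0

theorem norm_velF (u : ℝ → V3 → V3) (t : ℝ) : ‖velF u t‖ = ‖vel u t‖ := Lp.norm_fourier_eq _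

theorem integrable_re_inner_mulC (h : IsLerayHopfWith u₀ u G)
    {s t : ℝ} (hs : 0 < s) (hst : s ≤ t) (ht : t < 1) (B : H →L[ℂ] H) {Z : ℝ → H}
    (hZ : IntervalIntegrable Z volume s t) :
    IntervalIntegrable (fun σ => (inner ℂ (B (velF u σ)) (Z σ)).re) volume s t := by
  obtain ⟨M, hM0, hM⟩ := h.exists_norm_vel_le
  have h1 := h.integrable_velF hs hst ht
  rw [intervalIntegrable_iff_integrableOn_Ioc_of_le hst] at h1 hZ ⊢
  have hm : AEStronglyMeasurable (fun σ => (inner ℂ (B (velF u σ)) (Z σ)).re)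
      (volume.restrict (Ioc s t)) :=
    Complex.continuous_re.comp_aestronglyMeasurable
      ((B.continuous.comp_aestronglyMeasurable h1.1).inner hZ.1)
  refine (hZ.norm.const_mul (‖B‖ * M)).mono' hm ?_
  filter_upwards [ae_restrict_mem measurableSet_Ioc] with σ hσ
  calc ‖(inner ℂ (B (velF u σ)) (Z σ)).re‖ ≤ ‖inner ℂ (B (velF u σ)) (Z σ)‖ :=
        Complex.abs_re_le_norm _
    _ ≤ ‖B (velF u σ)‖ * ‖Z σ‖ := norm_inner_le_norm _ _
    _ ≤ ‖B‖ * M * ‖Z σ‖ := by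
        gcongr
        refine B.le_of_opNorm_le_of_le le_rfl ?_
        rw [norm_velF]
        exact hM σ ⟨(hs.trans hσ.1).le, hσ.2.trans_lt ht⟩

/-- The energy identity with a bounded weight `b` of compact support in frequency space. The
equation for `𝓕 u` holds only up to the pressure, so `𝓕 u` need not be the primitive of `rhsF`; it
is tested, on each interval `[a, c]`, against the solenoidal field `b (𝓕 u(a) + 𝓕 u(c))`, with an
error that is quadratically small. -/
theorem energy_identity_cut (h : IsLerayHopfWith u₀ u G) (hb : BoundedBeforeOne u) {b : V3 → ℝ}
    (hm : Measurable b) {K : ℝ} (hK : ∀ ζ, |b ζ| ≤ K) {R : ℝ} (hR : ∀ ζ, R < ‖ζ‖ → b ζ = 0)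
    {s t : ℝ} (hs : 0 < s) (hst : s ≤ t) (ht : t < 1) :
    (∫ ζ, b ζ * ‖velF u t ζ‖ ^ 2) - (∫ ζ, b ζ * ‖velF u s ζ‖ ^ 2) =
      -2 * ∫ σ in s..t, (inner ℂ (mulC _ (memLp_top_ofReal hm hK) (velF u σ)) (rhsF u G R σ)).re := by
  set B := mulC _ (memLp_top_ofReal hm hK) with hB
  set P := mulC (cut R fun _ => 1) (memLp_top_cut R continuous_const) with hP
  have hK0 : 0 ≤ K := (abs_nonneg _).trans (hK 0)
  have hBP : ∀ f, ‖B f‖ ≤ K * ‖P f‖ := by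
    intro f
    refine Lp.norm_le_mul_norm_of_ae_le_mul ?_
    filter_upwards [coeFn_mulC (memLp_top_ofReal hm hK) f,
      coeFn_mulC (memLp_top_cut R continuous_const) f] with ζ h1 h2
    rw [h1, h2, norm_smul, norm_smul, cut]
    split_ifs with hζ
    · simpa using mul_le_mul_of_nonneg_right (hK ζ) (norm_nonneg (f ζ))
    · simp [hR ζ (not_le.mp hζ)]
  have hI : ∀ {a c : ℝ}, a ∈ Icc s t → c ∈ Icc s t → a ≤ c →
      IntervalIntegrable (fun σ => (inner ℂ (B (velF u σ)) (rhsF u G R σ)).re) volume a c := by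
    intro a c ha hc hac
    exact h.integrable_re_inner_mulC (hs.trans_le ha.1) hac (hc.2.trans_lt ht) B
      (h.integrable_rhsF hb R (hs.trans_le ha.1) hac (hc.2.trans_lt ht))
  have hN := (h.integrable_rhsF hb R hs hst ht).norm
  have hNac : ∀ {a c : ℝ}, a ∈ Icc s t → c ∈ Icc s t → a ≤ c →
      IntervalIntegrable (fun σ => ‖rhsF u G R σ‖) volume a c := fun ha hc hac =>
    (h.integrable_rhsF hb R (hs.trans_le ha.1) hac (hc.2.trans_lt ht)).norm
  -- the energy identity says that `D` is constant
  let D : ℝ → ℝ := fun τ => (inner ℂ (B (velF u τ)) (velF u τ)).re +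
    2 * ∫ σ in s..τ, (inner ℂ (B (velF u σ)) (rhsF u G R σ)).re
  let Y : ℝ → ℝ := fun τ => ∫ σ in s..τ, ‖rhsF u G R σ‖
  have hsI : s ∈ Icc s t := ⟨le_rfl, hst⟩
  have htI : t ∈ Icc s t := ⟨hst, le_rfl⟩
  have hYsub : ∀ {a c : ℝ}, a ∈ Icc s t → c ∈ Icc s t → a ≤ c →
      Y c - Y a = ∫ σ in a..c, ‖rhsF u G R σ‖ := by
    intro a c ha hc hac
    have := intervalIntegral.integral_add_adjacent_intervals (hNac hsI ha ha.1) (hNac ha hc hac)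
    simp only [Y]
    linarith
  have hinc : ∀ {a c : ℝ}, a ∈ Icc s t → c ∈ Icc s t → a ≤ c →
      |D c - D a| ≤ (2 * K) * (Y c - Y a) ^ 2 := by
    intro a c ha hc hac
    have ha0 : 0 < a := hs.trans_le ha.1
    have hc1 : c < 1 := hc.2.trans_lt ht
    set f := B (velF u c + velF u a) with hf
    have hsol : IsSolenoidal f := ((h.isSolenoidal_velF ⟨ha0.trans_le hac, hc1⟩).add
      (h.isSolenoidal_velF ⟨ha0, hac.trans_lt hc1⟩)).mulC _
    have hfR : ∀ᵐ ζ : V3, R < ‖ζ‖ → f ζ = 0 :=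
      mulC_eq_zero_of _ (fun ζ hζ => by rw [hR ζ hζ, Complex.ofReal_zero]) _
    have h1 := h.re_inner_velF_sub hb hsol hfR ha0 hac hc1
    have h2 : (inner ℂ f (velF u c - velF u a)).re = (inner ℂ (B (velF u c)) (velF u c)).re -
        (inner ℂ (B (velF u a)) (velF u a)).re := by
      have h3 : (inner ℂ (B (velF u a)) (velF u c)).re = (inner ℂ (B (velF u c)) (velF u a)).re := by
        rw [hB, inner_mulC_left, ← inner_conj_symm, Complex.conj_re]
      rw [hf, map_add, inner_add_left, inner_sub_right, inner_sub_right]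
      simp only [Complex.add_re, Complex.sub_re, h3]
      ring
    have h3 := intervalIntegral.integral_add_adjacent_intervals (hI hsI ha ha.1) (hI ha hc hac)
    have hIf : IntervalIntegrable (fun σ => (inner ℂ f (rhsF u G R σ)).re) volume a c := by
      have h4 := h.integrable_rhsF hb R ha0 hac hc1
      exact ⟨Complex.reCLM.integrable_comp ((innerSL ℂ f).integrable_comp h4.1),
        Complex.reCLM.integrable_comp ((innerSL ℂ f).integrable_comp h4.2)⟩
    have h4 : D c - D a = ∫ σ in a..c, (2 * (inner ℂ (B (velF u σ)) (rhsF u G R σ)).re -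
        (inner ℂ f (rhsF u G R σ)).re) := by
      rw [intervalIntegral.integral_sub ((hI ha hc hac).const_mul 2) hIf,
        intervalIntegral.integral_const_mul]
      simp only [D]
      linarith
    rw [h4, ← Real.norm_eq_abs]
    have h5 : ∀ σ ∈ Ioc a c, ‖2 * (inner ℂ (B (velF u σ)) (rhsF u G R σ)).re -
        (inner ℂ f (rhsF u G R σ)).re‖ ≤ 2 * K * (Y c - Y a) * ‖rhsF u G R σ‖ := by
      intro σ hσ
      have hσI : σ ∈ Icc s t := ⟨ha.1.trans hσ.1.le, hσ.2.trans hc.2⟩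
      have hYn : ∀ {a c : ℝ}, a ∈ Icc s t → c ∈ Icc s t → a ≤ c → 0 ≤ Y c - Y a := by
        intro a c ha hc hac
        rw [hYsub ha hc hac]
        exact intervalIntegral.integral_nonneg hac fun _ _ => norm_nonneg _
      have g1 : ‖B (velF u c - velF u σ)‖ ≤ K * (Y c - Y a) := by
        refine (hBP _).trans (mul_le_mul_of_nonneg_left ?_ hK0)
        refine (h.norm_cut_velF_sub_le hb R (ha0.trans hσ.1) hσ.2 hc1).trans ?_
        rw [← hYsub hσI hc hσ.2]
        linarith [hYn ha hσI hσ.1.le]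
      have g2 : ‖B (velF u σ - velF u a)‖ ≤ K * (Y c - Y a) := by
        refine (hBP _).trans (mul_le_mul_of_nonneg_left ?_ hK0)
        refine (h.norm_cut_velF_sub_le hb R ha0 hσ.1.le (hσ.2.trans_lt hc1)).trans ?_
        rw [← hYsub ha hσI hσ.1.le]
        linarith [hYn hσI hc hσ.2]
      have g3 : 2 * (inner ℂ (B (velF u σ)) (rhsF u G R σ)).re - (inner ℂ f (rhsF u G R σ)).re =
          (inner ℂ (B (velF u σ - velF u a) - B (velF u c - velF u σ)) (rhsF u G R σ)).re := by
        rw [hf]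
        simp only [map_add, map_sub, inner_add_left, inner_sub_left, Complex.add_re, Complex.sub_re]
        ring
      rw [g3]
      calc _ ≤ ‖inner ℂ (B (velF u σ - velF u a) - B (velF u c - velF u σ)) (rhsF u G R σ)‖ :=
            Complex.abs_re_le_norm _
        _ ≤ ‖B (velF u σ - velF u a) - B (velF u c - velF u σ)‖ * ‖rhsF u G R σ‖ :=
            norm_inner_le_norm _ _
        _ ≤ 2 * K * (Y c - Y a) * ‖rhsF u G R σ‖ := by
            gcongr
            refine (norm_sub_le _ _).trans ?_
            linarith
    refine (intervalIntegral.norm_integral_le_of_norm_le hac (Eventually.of_forall h5)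
      ((hNac ha hc hac).const_mul _)).trans ?_
    rw [intervalIntegral.integral_const_mul, ← hYsub ha hc hac]
    exact le_of_eq (by ring)
  have hYc : ContinuousOn Y (Icc s t) := by
    have := intervalIntegral.continuousOn_primitive_interval' hN (a := s) left_mem_uIcc
    rwa [uIcc_of_le hst] at this
  have key := eq_of_abs_sub_le_sq hst hYc (D := D) (C := 2 * K) (fun a ha c hc => by
    rcases le_total a c with hac | hac
    · exact hinc ha hc hac
    · rw [abs_sub_comm, ← neg_sub (Y a), neg_sq]
      exact hinc hc ha hac) (by
    have := hYsub hsI htI hst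
    have h0 := intervalIntegral.integral_nonneg hst (μ := volume)
      (f := fun σ => ‖rhsF u G R σ‖) fun _ _ => norm_nonneg _
    linarith)
  simp only [D, intervalIntegral.integral_same, hB, inner_mulC_self] at key
  simp only [hB]
  linarith

end IsLerayHopfWith

end FrequencyEnergy

/-! ### Propagation of `H¹` regularity -/

section Regularity

/-- The projection onto the frequencies above `R`. -/
def highCut (R : ℝ) : H →L[ℂ] H :=
  mulC (fun ζ => if R < ‖ζ‖ then 1 else 0) (memLp_top_of_bdd (K := 1)
    (Measurable.ite (measurableSet_lt measurable_const measurable_norm) measurable_const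
      measurable_const) fun ζ => by split_ifs <;> simp)

theorem coeFn_highCut (R : ℝ) (f : H) :
    highCut R f =ᵐ[volume] fun ζ => if R < ‖ζ‖ then f ζ else 0 := by
  filter_upwards [coeFn_mulC (memLp_top_of_bdd (b := fun ζ : V3 => if R < ‖ζ‖ then 1 else 0) (K := 1)
    (Measurable.ite (measurableSet_lt measurable_const measurable_norm) measurable_const
      measurable_const) fun ζ => by split_ifs <;> simp) f] with ζ hζ
  change highCut R f ζ = _ at hζ
  rw [hζ]
  split_ifs <;> simp

theorem norm_highCut_le (R : ℝ) (f : H) : ‖highCut R f‖ ≤ ‖f‖ := by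
  refine norm_le_of_ae_norm_le ?_
  filter_upwards [coeFn_highCut R f] with ζ hζ
  rw [hζ]
  split_ifs <;> simp

theorem tendsto_integral_high {f : V3 → ℝ} (hf : Integrable f) :
    Tendsto (fun n : ℕ => ∫ ζ, if (n : ℝ) < ‖ζ‖ then f ζ else 0) atTop (𝓝 0) := by
  have h := tendsto_integral_of_dominated_convergence (μ := (volume : Measure V3))
    (F := fun (n : ℕ) ζ => if (n : ℝ) < ‖ζ‖ then f ζ else 0) (f := fun _ => 0) (fun ζ => ‖f ζ‖)
    (fun n => by
      have hs : MeasurableSet {ζ : V3 | (n : ℝ) < ‖ζ‖} :=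
        measurableSet_lt measurable_const measurable_norm
      exact (hf.indicator hs).1)
    hf.norm (fun n => Eventually.of_forall fun ζ => by
      split_ifs <;> simp)
    (Eventually.of_forall fun ζ => by
      refine tendsto_const_nhds.congr' ?_
      filter_upwards [eventually_ge_atTop ⌈‖ζ‖⌉₊] with n hn
      rw [if_neg]
      exact not_lt.mpr ((Nat.le_ceil _).trans (by exact_mod_cast hn)))
  simpa using h

theorem norm_sq_highCut (R : ℝ) (f : H) :
    ‖highCut R f‖ ^ 2 = ∫ ζ, if R < ‖ζ‖ then ‖f ζ‖ ^ 2 else 0 := by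
  rw [norm_sq_L2]
  refine integral_congr_ae ?_
  filter_upwards [coeFn_highCut R f] with ζ hζ
  rw [hζ]
  split_ifs <;> simp

/-- The symbol `|2πζ|²` restricted to an annulus. -/
def lapAnn (R R' : ℝ) (ζ : V3) : ℝ := if R < ‖ζ‖ ∧ ‖ζ‖ ≤ R' then lap ζ else 0

theorem measurable_lapAnn (R R' : ℝ) : Measurable (lapAnn R R') :=
  Measurable.ite ((measurableSet_lt measurable_const measurable_norm).inter
    (measurableSet_le measurable_norm measurable_const)) continuous_lap.measurable measurable_const

theorem abs_lapAnn_le (R R' : ℝ) (ζ : V3) : |lapAnn R R' ζ| ≤ (2 * Real.pi * R') ^ 2 := by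
  rw [lapAnn]
  split_ifs with h
  · rw [abs_of_nonneg (lap_nonneg ζ), lap]
    gcongr
    exact h.2
  · simp
    positivity

variable {u₀ : V3 → V3} {u : ℝ → V3 → V3} {G : ℝ → V3 → V3 →L[ℝ] V3}

namespace IsLerayHopfWith

theorem ae_integrable_lap (h : IsLerayHopfWith u₀ u G) :
    ∀ᵐ t ∂(volume.restrict (Ioo (0 : ℝ) 1)), Integrable fun ζ => lap ζ * ‖velF u t ζ‖ ^ 2 := by
  filter_upwards [h.ae_memLp_pderiv, h.weak_grad, ae_restrict_mem measurableSet_Ioo] with t h1 h2 h3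
  have h4 : ∀ k, (𝓕 (pderiv G k t) : H) =ᵐ[volume] fun ζ => dsym k ζ • velF u t ζ := fun k =>
    fourier_weakGradient (h.memLp' h3) h1 h2 k
  have h5 : Integrable fun ζ => ∑ k, ‖(𝓕 (pderiv G k t) : H) ζ‖ ^ 2 :=
    integrable_finsetSum _ fun k _ => integrable_norm_sq _
  refine h5.congr ?_
  filter_upwards [ae_all_iff.mpr h4] with ζ hζ
  simp only [hζ, norm_smul, mul_pow, ← Finset.sum_mul]
  congr 1
  have hn : ‖ζ‖ ^ 2 = ∑ k, ζ k ^ 2 := by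
    rw [EuclideanSpace.norm_sq_eq]
    simp
  rw [lap, mul_pow, hn, Finset.mul_sum]
  refine Finset.sum_congr rfl fun k _ => ?_
  simp [dsym, mul_pow]

/-- A time at which `u` is in `H¹`, before any given time. -/
theorem exists_good_time (h : IsLerayHopfWith u₀ u G) {t : ℝ} (ht0 : 0 < t) (ht1 : t < 1) :
    ∃ s, 0 < s ∧ s < t ∧ Integrable fun ζ => lap ζ * ‖velF u s ζ‖ ^ 2 := by
  have h1 : ∀ᵐ s ∂(volume.restrict (Ioo (0 : ℝ) t)), Integrable fun ζ => lap ζ * ‖velF u s ζ‖ ^ 2 :=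
    ae_mono (Measure.restrict_mono (Ioo_subset_Ioo_right ht1.le) le_rfl) h.ae_integrable_lap
  have h2 : NeBot (ae (volume.restrict (Ioo (0 : ℝ) t))) := by
    rw [ae_neBot, Ne, Measure.restrict_eq_zero]
    simp [ht0]
  obtain ⟨s, h3, h4⟩ := (h1.and (ae_restrict_mem measurableSet_Ioo)).exists
  exact ⟨s, h4.1, h4.2, h3⟩

theorem memLp_convF (h : IsLerayHopfWith u₀ u G) (hb : BoundedBeforeOne u) {s r : ℝ} (hs : 0 < s)
    (hr : r < 1) : MemLp (convF u G) 2 (volume.restrict (Icc s r)) :=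
  fourierL.comp_memLp' (h.memLp_conv hb hs hr)

theorem integrable_norm_sq_highCut (h : IsLerayHopfWith u₀ u G) (hb : BoundedBeforeOne u) (R : ℝ)
    {s t : ℝ} (hs : 0 < s) (hst : s ≤ t) (ht : t < 1) :
    IntervalIntegrable (fun σ => ‖highCut R (convF u G σ)‖ ^ 2) volume s t := by
  rw [intervalIntegrable_iff_integrableOn_Icc_of_le hst]
  have h1 := (highCut R).comp_memLp' (h.memLp_convF hb hs ht)
  exact (memLp_two_iff_integrable_sq_norm h1.1).mp h1

/-- A bound for the part of `‖∇u(t)‖²` with frequencies above `R`, for times in `[s, r]`. -/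
def _root_.NSE.tailBound (u : ℝ → V3 → V3) (G : ℝ → V3 → V3 →L[ℝ] V3) (s r R : ℝ) : ℝ :=
  (∫ ζ, if R < ‖ζ‖ then lap ζ * ‖velF u s ζ‖ ^ 2 else 0) +
    1 / 2 * ∫ σ in s..r, ‖highCut R (convF u G σ)‖ ^ 2

theorem tendsto_tailBound (h : IsLerayHopfWith u₀ u G) (hb : BoundedBeforeOne u) {s r : ℝ}
    (hs : 0 < s) (hsr : s ≤ r) (hr : r < 1) (hg : Integrable fun ζ => lap ζ * ‖velF u s ζ‖ ^ 2) :
    Tendsto (fun n : ℕ => tailBound u G s r n) atTop (𝓝 0) := by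
  have h1 := tendsto_integral_high hg
  have hm : MemLp (convF u G) 2 (volume.restrict (Ioc s r)) :=
    (h.memLp_convF hb hs hr).mono_measure (Measure.restrict_mono Ioc_subset_Icc_self le_rfl)
  have h2 : Tendsto (fun n : ℕ => ∫ σ in s..r, ‖highCut n (convF u G σ)‖ ^ 2) atTop
      (𝓝 (∫ σ in s..r, (0 : ℝ))) := by
    refine intervalIntegral.tendsto_integral_filter_of_dominated_convergence
      (fun σ => ‖convF u G σ‖ ^ 2) ?_ ?_ ?_ ?_
    · refine Eventually.of_forall fun n => ?_
      rw [uIoc_of_le hsr]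
      exact ((highCut n).continuous.comp_aestronglyMeasurable hm.1).norm.pow 2
    · refine Eventually.of_forall fun n => Eventually.of_forall fun σ _ => ?_
      rw [Real.norm_of_nonneg (by positivity)]
      gcongr
      exact norm_highCut_le _ _
    · rw [intervalIntegrable_iff_integrableOn_Ioc_of_le hsr]
      exact (memLp_two_iff_integrable_sq_norm hm.1).mp hm
    · refine Eventually.of_forall fun σ _ => ?_
      simp only [norm_sq_highCut]
      exact tendsto_integral_high (integrable_norm_sq _)
  have h3 := h1.add (h2.const_mul (1 / 2))
  simp only [intervalIntegral.integral_zero, mul_zero, add_zero] at h3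
  exact h3

/-- The dissipation absorbs the convection term: with `B = |2πζ|² 𝓕 u` on the annulus,
`-2 |B|² - 2 Re ⟨B, 𝓕 (u · ∇u)⟩ ≤ ½ |𝓕 (u · ∇u)|²`. -/
theorem integral_lapAnn_le (h : IsLerayHopfWith u₀ u G) (hb : BoundedBeforeOne u) {s t r : ℝ}
    (hs : 0 < s) (hst : s ≤ t) (htr : t ≤ r) (hr : r < 1)
    (hg : Integrable fun ζ => lap ζ * ‖velF u s ζ‖ ^ 2) (R R' : ℝ) :
    ∫ ζ, lapAnn R R' ζ * ‖velF u t ζ‖ ^ 2 ≤ tailBound u G s r R := by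
  have ht : t < 1 := htr.trans_lt hr
  have hm := measurable_lapAnn R R'
  have hK := abs_lapAnn_le R R'
  have h1 := h.energy_identity_cut hb hm hK (R := R') (fun ζ hζ => by
    rw [lapAnn, if_neg]
    exact fun h' => h'.2.not_gt hζ) hs hst ht
  set B := mulC _ (memLp_top_ofReal hm hK) with hB
  have hI1 := h.integrable_re_inner_mulC hs hst ht B (h.integrable_rhsF hb R' hs hst ht)
  have hI2 := h.integrable_norm_sq_highCut hb R hs hst ht
  have h2 : ∀ σ, -2 * (inner ℂ (B (velF u σ)) (rhsF u G R' σ)).re ≤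
      1 / 2 * ‖highCut R (convF u G σ)‖ ^ 2 := by
    intro σ
    have e1 : inner ℂ (B (velF u σ)) (lapCut R' (velF u σ)) =
        inner ℂ (B (velF u σ)) (B (velF u σ)) := by
      rw [L2.inner_def, L2.inner_def]
      refine integral_congr_ae ?_
      filter_upwards [coeFn_mulC (memLp_top_ofReal hm hK) (velF u σ),
        coeFn_mulC (memLp_top_cut R' (Complex.continuous_ofReal.comp continuous_lap)) (velF u σ)]
        with ζ a1 a2
      change B (velF u σ) ζ = _ at a1
      change lapCut R' (velF u σ) ζ = cut R' (fun ζ => (lap ζ : ℂ)) ζ • _ at a2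
      rw [a1, a2, cut, lapAnn]
      by_cases hζ : R < ‖ζ‖ ∧ ‖ζ‖ ≤ R'
      · rw [if_pos hζ, if_pos hζ.2]
      · rw [if_neg hζ]
        simp
    have e2 : inner ℂ (B (velF u σ)) (convF u G σ) =
        inner ℂ (B (velF u σ)) (highCut R (convF u G σ)) := by
      rw [L2.inner_def, L2.inner_def]
      refine integral_congr_ae ?_
      filter_upwards [coeFn_mulC (memLp_top_ofReal hm hK) (velF u σ),
        coeFn_highCut R (convF u G σ)] with ζ a1 a2
      change B (velF u σ) ζ = _ at a1
      rw [a1, a2, lapAnn]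
      by_cases hζ : R < ‖ζ‖
      · rw [if_pos hζ]
      · rw [if_neg hζ, if_neg fun h' => hζ h'.1]
        simp
    have e3 : (inner ℂ (B (velF u σ)) (B (velF u σ))).re = ‖B (velF u σ)‖ ^ 2 := by
      rw [inner_self_eq_norm_sq_to_K]
      norm_cast
    have e4 : |(inner ℂ (B (velF u σ)) (highCut R (convF u G σ))).re| ≤
        ‖B (velF u σ)‖ * ‖highCut R (convF u G σ)‖ :=
      (Complex.abs_re_le_norm _).trans (norm_inner_le_norm _ _)
    rw [rhsF, inner_add_right, Complex.add_re, e1, e2, e3]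
    nlinarith [neg_abs_le (inner ℂ (B (velF u σ)) (highCut R (convF u G σ))).re,
      sq_nonneg (2 * ‖B (velF u σ)‖ - ‖highCut R (convF u G σ)‖)]
  have h3 : ∫ ζ, lapAnn R R' ζ * ‖velF u s ζ‖ ^ 2 ≤
      ∫ ζ, if R < ‖ζ‖ then lap ζ * ‖velF u s ζ‖ ^ 2 else 0 := by
    have hs : MeasurableSet {ζ : V3 | R < ‖ζ‖} := measurableSet_lt measurable_const measurable_norm
    refine integral_mono_of_nonneg (Eventually.of_forall fun ζ => ?_) (hg.indicator hs)
      (Eventually.of_forall fun ζ => ?_)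
    · simp only [lapAnn, Pi.zero_apply]
      split_ifs
      · exact mul_nonneg (lap_nonneg ζ) (by positivity)
      · simp
    · have := mul_nonneg (lap_nonneg ζ) (sq_nonneg ‖velF u s ζ‖)
      simp only [lapAnn]
      by_cases h1 : R < ‖ζ‖
      · by_cases h2 : ‖ζ‖ ≤ R'
        · simp [h1, h2]
        · simpa [h1, h2] using this
      · simp [h1]
  have h4 : -2 * ∫ σ in s..t, (inner ℂ (B (velF u σ)) (rhsF u G R' σ)).re ≤
      1 / 2 * ∫ σ in s..r, ‖highCut R (convF u G σ)‖ ^ 2 := by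
    rw [← intervalIntegral.integral_const_mul, ← intervalIntegral.integral_const_mul]
    refine (intervalIntegral.integral_mono_on hst (hI1.const_mul _) (hI2.const_mul _)
      fun σ _ => h2 σ).trans ?_
    refine intervalIntegral.integral_mono_interval le_rfl hst htr
      (Eventually.of_forall fun σ => by positivity)
      ((h.integrable_norm_sq_highCut hb R hs (hst.trans htr) hr).const_mul _)
  rw [tailBound]
  linarith

/-- `u(t) ∈ H¹` for all times, with a uniform bound for the high frequencies of the gradient. -/
theorem integrable_lap (h : IsLerayHopfWith u₀ u G) (hb : BoundedBeforeOne u) {s t r : ℝ}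
    (hs : 0 < s) (hst : s ≤ t) (htr : t ≤ r) (hr : r < 1)
    (hg : Integrable fun ζ => lap ζ * ‖velF u s ζ‖ ^ 2) :
    (Integrable fun ζ => lap ζ * ‖velF u t ζ‖ ^ 2) ∧
      ∀ R, ∫ ζ, (if R < ‖ζ‖ then lap ζ * ‖velF u t ζ‖ ^ 2 else 0) ≤ tailBound u G s r R := by
  have hU := integrable_norm_sq (velF u t)
  have hcov : AECover (volume : Measure V3) atTop fun n : ℕ => Metric.closedBall (0 : V3) n :=
    aecover_closedBall tendsto_natCast_atTop_atTop
  have hset : ∀ (R : ℝ) (n : ℕ), ∫ ζ in Metric.closedBall (0 : V3) n,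
      (if R < ‖ζ‖ then lap ζ * ‖velF u t ζ‖ ^ 2 else 0) = ∫ ζ, lapAnn R n ζ * ‖velF u t ζ‖ ^ 2 := by
    intro R n
    rw [← integral_indicator measurableSet_closedBall]
    congr 1
    ext ζ
    simp only [indicator, Metric.mem_closedBall, dist_zero_right, lapAnn]
    by_cases h1 : R < ‖ζ‖ <;> by_cases h2 : ‖ζ‖ ≤ n <;> simp [h1, h2]
  have hint : ∀ n : ℕ, IntegrableOn (fun ζ => lap ζ * ‖velF u t ζ‖ ^ 2)
      (Metric.closedBall (0 : V3) n) := by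
    intro n
    rw [← integrable_indicator_iff measurableSet_closedBall]
    have : ((Metric.closedBall (0 : V3) n).indicator fun ζ => lap ζ * ‖velF u t ζ‖ ^ 2) =
        fun ζ => lapAnn (-1) n ζ * ‖velF u t ζ‖ ^ 2 := by
      ext ζ
      have h1 : -1 < ‖ζ‖ := by linarith [norm_nonneg ζ]
      simp only [indicator, Metric.mem_closedBall, dist_zero_right, lapAnn, h1, true_and]
      split_ifs <;> simp
    rw [this]
    exact hU.bdd_mul (c := (2 * Real.pi * n) ^ 2) (measurable_lapAnn _ _).aestronglyMeasurable
      (Eventually.of_forall fun ζ => abs_lapAnn_le _ _ ζ)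
  have h1 : Integrable fun ζ => lap ζ * ‖velF u t ζ‖ ^ 2 := by
    refine hcov.integrable_of_integral_bounded_of_nonneg_ae (tailBound u G s r (-1)) hint
      (Eventually.of_forall fun ζ => mul_nonneg (lap_nonneg ζ) (by positivity))
      (Eventually.of_forall fun n => ?_)
    refine le_trans (le_of_eq ?_) (h.integral_lapAnn_le hb hs hst htr hr hg (-1) n)
    rw [← hset]
    congr 1
    ext ζ
    rw [if_pos (by linarith [norm_nonneg ζ])]
  refine ⟨h1, fun R => ?_⟩
  have h2 : Integrable fun ζ => if R < ‖ζ‖ then lap ζ * ‖velF u t ζ‖ ^ 2 else 0 :=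
    h1.indicator (measurableSet_lt measurable_const measurable_norm)
  refine le_of_tendsto (hcov.integral_tendsto_of_countably_generated h2)
    (Eventually.of_forall fun n => ?_)
  rw [hset]
  exact h.integral_lapAnn_le hb hs hst htr hr hg R n

end IsLerayHopfWith

end Regularity

/-! ### Continuity in `H¹` -/

section ContinuityH1

/-- The weight `1 + |2πζ|` of `H¹`. -/
def wgt (ζ : V3) : ℝ := 1 + 2 * Real.pi * ‖ζ‖

theorem one_le_wgt (ζ : V3) : 1 ≤ wgt ζ := by
  have : 0 ≤ 2 * Real.pi * ‖ζ‖ := by positivity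
  rw [wgt]
  linarith

theorem wgt_pos (ζ : V3) : 0 < wgt ζ := one_pos.trans_le (one_le_wgt ζ)

theorem continuous_wgt : Continuous wgt := by
  unfold wgt
  fun_prop

theorem lap_le_wgt_sq (ζ : V3) : lap ζ ≤ wgt ζ ^ 2 := by
  have : 0 ≤ 2 * Real.pi * ‖ζ‖ := by positivity
  rw [wgt, lap]
  gcongr
  linarith

theorem norm_dsym_le (j : Fin 3) (ζ : V3) : ‖dsym j ζ‖ ≤ 2 * Real.pi * ‖ζ‖ := by
  have h1 : ‖dsym j ζ‖ = 2 * Real.pi * ‖ζ j‖ := by simp [dsym, abs_of_pos Real.pi_pos]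
  rw [h1]
  gcongr
  exact PiLp.norm_apply_le ζ j

theorem norm_dsym_le_wgt (j : Fin 3) (ζ : V3) : ‖dsym j ζ‖ ≤ wgt ζ :=
  (norm_dsym_le j ζ).trans (by rw [wgt]; linarith)

open Classical in
/-- The class of `(1 + |2πζ|) f` in `L²` (and `0` if this is not square integrable). -/
def weighted (f : H) : H :=
  if h : MemLp (fun ζ => (wgt ζ : ℂ) • f ζ) 2 (volume : Measure V3) then h.toLp else 0

theorem memLp_wgt {f : H} (h : Integrable fun ζ => lap ζ * ‖f ζ‖ ^ 2) :
    MemLp (fun ζ => (wgt ζ : ℂ) • f ζ) 2 volume := by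
  have hm : AEStronglyMeasurable (fun ζ => (wgt ζ : ℂ) • f ζ) volume :=
    ((Complex.continuous_ofReal.comp continuous_wgt).aestronglyMeasurable).smul (Lp.memLp f).1
  rw [memLp_two_iff_integrable_sq_norm hm]
  refine (((integrable_norm_sq f).const_mul 2).add (h.const_mul 2)).mono' (hm.norm.pow 2)
    (Eventually.of_forall fun ζ => ?_)
  rw [Real.norm_of_nonneg (by positivity), norm_smul, mul_pow, Complex.norm_real, Real.norm_eq_abs,
    sq_abs]
  have h1 : wgt ζ ^ 2 ≤ 2 + 2 * lap ζ := by
    rw [wgt, lap]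
    nlinarith [sq_nonneg (1 - 2 * Real.pi * ‖ζ‖)]
  calc wgt ζ ^ 2 * ‖f ζ‖ ^ 2 ≤ (2 + 2 * lap ζ) * ‖f ζ‖ ^ 2 := by gcongr
    _ = 2 * ‖f ζ‖ ^ 2 + 2 * (lap ζ * ‖f ζ‖ ^ 2) := by ring

theorem coeFn_weighted {f : H} (h : Integrable fun ζ => lap ζ * ‖f ζ‖ ^ 2) :
    weighted f =ᵐ[volume] fun ζ => (wgt ζ : ℂ) • f ζ := by
  rw [weighted, dif_pos (memLp_wgt h)]
  exact MemLp.coeFn_toLp _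

theorem memLp_top_inv_wgt : MemLp (fun ζ => (((wgt ζ)⁻¹ : ℝ) : ℂ)) ⊤ (volume : Measure V3) :=
  memLp_top_ofReal (b := fun ζ => (wgt ζ)⁻¹) (K := 1)
    (continuous_wgt.inv₀ fun ζ => (wgt_pos ζ).ne').measurable fun ζ => by
      rw [abs_of_pos (inv_pos.mpr (wgt_pos ζ))]
      exact inv_le_one_of_one_le₀ (one_le_wgt ζ)

/-- Division by the weight. -/
def unweight : H →L[ℂ] H := mulC _ memLp_top_inv_wgt

theorem unweight_weighted {f : H} (h : Integrable fun ζ => lap ζ * ‖f ζ‖ ^ 2) :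
    unweight (weighted f) = f := by
  apply Lp.ext
  filter_upwards [coeFn_weighted h, coeFn_mulC memLp_top_inv_wgt (weighted f)] with ζ h1 h2
  change unweight (weighted f) ζ = _ at h2
  rw [h2, h1, smul_smul, ← Complex.ofReal_mul, inv_mul_cancel₀ (wgt_pos ζ).ne', Complex.ofReal_one,
    one_smul]

/-- Closeness in `H¹` from closeness of the low frequencies in `L²` and smallness of the high
frequencies in `H¹`. -/
theorem norm_weighted_sub_le {f g : H} (hf : Integrable fun ζ => lap ζ * ‖f ζ‖ ^ 2)
    (hg : Integrable fun ζ => lap ζ * ‖g ζ‖ ^ 2) {R : ℝ} (hR : 1 ≤ R) {T : ℝ}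
    (hfT : ∫ ζ, (if R < ‖ζ‖ then lap ζ * ‖f ζ‖ ^ 2 else 0) ≤ T)
    (hgT : ∫ ζ, (if R < ‖ζ‖ then lap ζ * ‖g ζ‖ ^ 2 else 0) ≤ T) :
    ‖weighted f - weighted g‖ ≤ (1 + 2 * Real.pi * R) *
      ‖mulC (cut R fun _ => 1) (memLp_top_cut R continuous_const) (f - g)‖ + 4 * √T := by
  set P := mulC (cut R fun _ => 1) (memLp_top_cut R continuous_const) with hP
  have hPv : ∀ k : H, P k =ᵐ[volume] fun ζ => if ‖ζ‖ ≤ R then k ζ else 0 := by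
    intro k
    filter_upwards [coeFn_mulC (memLp_top_cut R continuous_const) k] with ζ hζ
    change P k ζ = _ at hζ
    rw [hζ, cut]
    split_ifs <;> simp
  have h1 : weighted f - weighted g = P (weighted f - weighted g) +
      (highCut R (weighted f) - highCut R (weighted g)) := by
    rw [← map_sub]
    apply Lp.ext
    filter_upwards [hPv (weighted f - weighted g), coeFn_highCut R (weighted f - weighted g),
      Lp.coeFn_add (P (weighted f - weighted g)) (highCut R (weighted f - weighted g))]
      with ζ a1 a2 a3
    rw [a3, Pi.add_apply, a1, a2]
    by_cases hζ : ‖ζ‖ ≤ R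
    · rw [if_pos hζ, if_neg (not_lt.mpr hζ), add_zero]
    · rw [if_neg hζ, if_pos (not_le.mp hζ), zero_add]
  have h2 : ‖P (weighted f - weighted g)‖ ≤ (1 + 2 * Real.pi * R) * ‖P (f - g)‖ := by
    refine Lp.norm_le_mul_norm_of_ae_le_mul ?_
    filter_upwards [hPv (weighted f - weighted g), hPv (f - g), coeFn_weighted hf,
      coeFn_weighted hg, Lp.coeFn_sub (weighted f) (weighted g), Lp.coeFn_sub f g]
      with ζ a1 a2 a3 a4 a5 a6
    rw [a1, a2]
    split_ifs with hζ
    · rw [a5, a6, Pi.sub_apply, Pi.sub_apply, a3, a4, ← smul_sub, norm_smul, Complex.norm_real,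
        Real.norm_of_nonneg (wgt_pos ζ).le, wgt]
      gcongr
    · simp
  have h3 : ∀ {k : H}, Integrable (fun ζ => lap ζ * ‖k ζ‖ ^ 2) →
      ∫ ζ, (if R < ‖ζ‖ then lap ζ * ‖k ζ‖ ^ 2 else 0) ≤ T → ‖highCut R (weighted k)‖ ≤ 2 * √T := by
    intro k hk hkT
    have hT : 0 ≤ T := le_trans (integral_nonneg fun ζ => by
      change (0 : ℝ) ≤ if R < ‖ζ‖ then lap ζ * ‖k ζ‖ ^ 2 else 0
      split_ifs
      · exact mul_nonneg (lap_nonneg ζ) (by positivity)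
      · exact le_rfl) hkT
    refine abs_le_of_sq_le_sq' ?_ (by positivity) |>.2
    rw [mul_pow, Real.sq_sqrt hT, norm_sq_highCut]
    calc ∫ ζ, (if R < ‖ζ‖ then ‖weighted k ζ‖ ^ 2 else 0)
        ≤ ∫ ζ, 4 * (if R < ‖ζ‖ then lap ζ * ‖k ζ‖ ^ 2 else 0) := by
          have hs : MeasurableSet {ζ : V3 | R < ‖ζ‖} :=
            measurableSet_lt measurable_const measurable_norm
          refine integral_mono_ae ((integrable_norm_sq _).indicator hs)
            ((hk.indicator hs).const_mul 4) ?_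
          filter_upwards [coeFn_weighted hk] with ζ hζ
          change (if R < ‖ζ‖ then ‖weighted k ζ‖ ^ 2 else 0) ≤ 4 *
            (if R < ‖ζ‖ then lap ζ * ‖k ζ‖ ^ 2 else 0)
          split_ifs with hR'
          · rw [hζ, norm_smul, mul_pow, Complex.norm_real, Real.norm_of_nonneg (wgt_pos ζ).le,
              ← mul_assoc]
            gcongr
            have h1 : 1 ≤ 2 * Real.pi * ‖ζ‖ := by
              nlinarith [Real.pi_gt_three, norm_nonneg ζ]
            rw [wgt, lap]
            nlinarith
          · simp
      _ = 4 * ∫ ζ, (if R < ‖ζ‖ then lap ζ * ‖k ζ‖ ^ 2 else 0) := integral_const_mul _ _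
      _ ≤ 2 ^ 2 * T := by linarith
  rw [h1]
  refine (norm_add_le _ _).trans (add_le_add h2 ((norm_sub_le _ _).trans ?_))
  linarith [h3 hf hfT, h3 hg hgT]

variable {u₀ : V3 → V3} {u : ℝ → V3 → V3} {G : ℝ → V3 → V3 →L[ℝ] V3}

namespace IsLerayHopfWith

theorem integrable_lap' (h : IsLerayHopfWith u₀ u G) (hb : BoundedBeforeOne u) {t : ℝ}
    (ht : t ∈ Ioo (0 : ℝ) 1) : Integrable fun ζ => lap ζ * ‖velF u t ζ‖ ^ 2 := by
  obtain ⟨s, hs, hst, hg⟩ := h.exists_good_time ht.1 ht.2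
  exact (h.integrable_lap hb hs hst.le le_rfl ht.2 hg).1

/-- The velocity is a continuous curve in `H¹`: its low frequencies are continuous in `L²`, and its
high frequencies are uniformly small in `H¹`. -/
theorem continuousOn_weighted (h : IsLerayHopfWith u₀ u G) (hb : BoundedBeforeOne u) :
    ContinuousOn (fun t => weighted (velF u t)) (Ioo 0 1) := by
  intro t₀ ht₀
  refine ContinuousAt.continuousWithinAt ?_
  obtain ⟨s, hs, hst, hg⟩ := h.exists_good_time ht₀.1 ht₀.2
  obtain ⟨r, hr, hr1⟩ := exists_between ht₀.2
  have hsr : s ≤ r := (hst.trans hr).le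
  rw [Metric.continuousAt_iff']
  intro ε hε
  have h1 : Tendsto (fun n : ℕ => 4 * √(tailBound u G s r n)) atTop (𝓝 0) := by
    have := ((Real.continuous_sqrt.tendsto 0).comp (h.tendsto_tailBound hb hs hsr hr1 hg)).const_mul 4
    simpa using this
  obtain ⟨n, hn, hn1⟩ := ((h1.eventually (gt_mem_nhds (half_pos hε))).and
    (eventually_ge_atTop 1)).exists
  let Y : ℝ → ℝ := fun t => ∫ σ in s..t, ‖rhsF u G n σ‖
  have hI := (h.integrable_rhsF hb n hs hsr hr1).norm
  have hYc : ContinuousOn Y (Icc s r) := by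
    have := intervalIntegral.continuousOn_primitive_interval' hI (a := s) left_mem_uIcc
    rwa [uIcc_of_le hsr] at this
  have hnhds : Icc s r ∈ 𝓝 t₀ := Icc_mem_nhds hst hr
  have hY0 : Tendsto (fun t => (1 + 2 * Real.pi * n) * |Y t - Y t₀|) (𝓝 t₀) (𝓝 0) := by
    have h2 : Tendsto (fun t => Y t - Y t₀) (𝓝 t₀) (𝓝 0) := by
      have := (hYc.continuousAt hnhds).tendsto.sub_const (Y t₀)
      simpa using this
    have h3 := h2.abs.const_mul (1 + 2 * Real.pi * n)
    simpa using h3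
  filter_upwards [hnhds, hY0.eventually (gt_mem_nhds (half_pos hε))] with t ht hYt
  have hYs : ∀ {a c : ℝ}, a ∈ Icc s r → c ∈ Icc s r → a ≤ c →
      ∫ σ in a..c, ‖rhsF u G n σ‖ = Y c - Y a := by
    intro a c ha hc hac
    have := intervalIntegral.integral_add_adjacent_intervals
      (h.integrable_rhsF hb n hs ha.1 (ha.2.trans_lt hr1)).norm
      (h.integrable_rhsF hb n (hs.trans_le ha.1) hac (hc.2.trans_lt hr1)).norm
    simp only [Y]
    linarith
  have ht₀' : t₀ ∈ Icc s r := ⟨hst.le, hr.le⟩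
  have hP : ‖mulC (cut n fun _ => 1) (memLp_top_cut n continuous_const)
      (velF u t - velF u t₀)‖ ≤ |Y t - Y t₀| := by
    rcases le_total t t₀ with hle | hle
    · rw [← neg_sub, map_neg, norm_neg, abs_sub_comm]
      refine (h.norm_cut_velF_sub_le hb n (hs.trans_le ht.1) hle ht₀.2).trans ?_
      rw [hYs ht ht₀' hle]
      exact le_abs_self _
    · refine (h.norm_cut_velF_sub_le hb n ht₀.1 hle (ht.2.trans_lt hr1)).trans ?_
      rw [hYs ht₀' ht hle]
      exact le_abs_self _
  obtain ⟨g1, g2⟩ := h.integrable_lap hb hs ht.1 ht.2 hr1 hg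
  obtain ⟨g3, g4⟩ := h.integrable_lap hb hs hst.le hr.le hr1 hg
  rw [dist_eq_norm]
  refine (norm_weighted_sub_le g1 g3 (by exact_mod_cast hn1) (g2 n) (g4 n)).trans_lt ?_
  have : (1 + 2 * Real.pi * n) * ‖mulC (cut n fun _ => 1) (memLp_top_cut n continuous_const)
      (velF u t - velF u t₀)‖ ≤ (1 + 2 * Real.pi * n) * |Y t - Y t₀| := by gcongr
  linarith

theorem continuousOn_velF (h : IsLerayHopfWith u₀ u G) (hb : BoundedBeforeOne u) :
    ContinuousOn (velF u) (Ioo 0 1) :=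
  (unweight.continuous.comp_continuousOn (h.continuousOn_weighted hb)).congr fun _ ht =>
    (unweight_weighted (h.integrable_lap' hb ht)).symm

theorem continuousOn_vel (h : IsLerayHopfWith u₀ u G) (hb : BoundedBeforeOne u) :
    ContinuousOn (vel u) (Ioo 0 1) := by
  intro t ht
  have h1 := h.continuousOn_velF hb t ht
  have h2 := ((Lp.fourierTransformₗᵢ V3 C3).symm.continuous.tendsto (velF u t)).comp h1
  have h3 : ∀ t, (Lp.fourierTransformₗᵢ V3 C3).symm (velF u t) = vel u t := fun t =>
    (Lp.fourierTransformₗᵢ V3 C3).symm_apply_apply (vel u t)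
  simpa only [ContinuousWithinAt, Function.comp_def, h3] using h2

end IsLerayHopfWith

end ContinuityH1

/-! ### The derivative of weighted energies -/

section WeightedEnergy

theorem memLp_top_dsym_div_wgt (j : Fin 3) :
    MemLp (fun ζ => dsym j ζ * (((wgt ζ)⁻¹ : ℝ) : ℂ)) ⊤ (volume : Measure V3) :=
  memLp_top_of_bdd (K := 1) ((continuous_dsym j).mul (Complex.continuous_ofReal.comp
    (continuous_wgt.inv₀ fun ζ => (wgt_pos ζ).ne'))).measurable fun ζ => by
      rw [norm_mul, Complex.norm_real, Real.norm_of_nonneg (inv_nonneg.mpr (wgt_pos ζ).le),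
        ← div_eq_mul_inv, div_le_one (wgt_pos ζ)]
      exact norm_dsym_le_wgt j ζ

/-- The `j`-th partial derivative of a function in `H¹`, in frequency space. -/
def grd (j : Fin 3) (f : H) : H := mulC _ (memLp_top_dsym_div_wgt j) (weighted f)

theorem coeFn_grd {f : H} (h : Integrable fun ζ => lap ζ * ‖f ζ‖ ^ 2) (j : Fin 3) :
    grd j f =ᵐ[volume] fun ζ => dsym j ζ • f ζ := by
  filter_upwards [coeFn_mulC (memLp_top_dsym_div_wgt j) (weighted f), coeFn_weighted h] with ζ h1 h2
  change grd j f ζ = _ at h1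
  rw [h1, h2, smul_smul, mul_assoc, ← Complex.ofReal_mul, inv_mul_cancel₀ (wgt_pos ζ).ne',
    Complex.ofReal_one, mul_one]

/-- The `j`-th column of the tensor `w ⊗ w`, as an element of `L²`. -/
def flux (w : V3 → V3) (j : Fin 3) : H := toL2 fun x => w x j • w x

theorem memLp_flux {w : V3 → V3} (hw : MemLp w 2 volume) {M : ℝ} (hM : ∀ᵐ x, ‖w x‖ ≤ M) (j : Fin 3) :
    MemLp (fun x => w x j • w x) 2 volume := by
  refine hw.of_le_mul (c := M) ?_ ?_
  · exact ((EuclideanSpace.proj j : V3 →L[ℝ] ℝ).continuous.comp_aestronglyMeasurable hw.1).smul hw.1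
  · filter_upwards [hM] with x hx
    rw [norm_smul]
    gcongr
    exact (PiLp.norm_apply_le _ _).trans hx

theorem coeFn_flux {w : V3 → V3} (hw : MemLp w 2 volume) {M : ℝ} (hM : ∀ᵐ x, ‖w x‖ ≤ M)
    (j : Fin 3) : flux w j =ᵐ[volume] fun x => (w x j : ℂ) • complexify (w x) := by
  filter_upwards [coeFn_toL2 (memLp_flux hw hM j)] with x hx
  change flux w j x = _ at hx
  rw [hx]
  ext i
  simp

theorem norm_flux_sub_le {w v : V3 → V3} (hw : MemLp w 2 volume) (hv : MemLp v 2 volume) {M : ℝ}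
    (hwM : ∀ᵐ x, ‖w x‖ ≤ M) (hvM : ∀ᵐ x, ‖v x‖ ≤ M) (j : Fin 3) :
    ‖flux w j - flux v j‖ ≤ 2 * M * ‖toL2 w - toL2 v‖ := by
  refine Lp.norm_le_mul_norm_of_ae_le_mul ?_
  filter_upwards [coeFn_flux hw hwM j, coeFn_flux hv hvM j, coeFn_toL2 hw, coeFn_toL2 hv,
    Lp.coeFn_sub (flux w j) (flux v j), Lp.coeFn_sub (toL2 w) (toL2 v), hwM, hvM]
    with x a1 a2 a3 a4 a5 a6 a7 a8
  rw [a5, a6, Pi.sub_apply, Pi.sub_apply, a1, a2, a3, a4]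
  have e1 : (w x j : ℂ) • complexify (w x) - (v x j : ℂ) • complexify (v x) =
      (w x j : ℂ) • (complexify (w x) - complexify (v x)) +
        ((complexify (w x) - complexify (v x)) j) • complexify (v x) := by
    ext i
    simp
    ring
  have b1 : ‖(w x j : ℂ)‖ ≤ M := by
    rw [Complex.norm_real]
    exact (PiLp.norm_apply_le _ _).trans a7
  have b2 : ‖complexify (v x)‖ ≤ M := by rwa [norm_complexify]
  have b3 := norm_coord_le (complexify (w x) - complexify (v x)) j
  rw [e1]
  refine (norm_add_le _ _).trans ?_
  rw [norm_smul, norm_smul]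
  have c1 := mul_le_mul_of_nonneg_right b1 (norm_nonneg (complexify (w x) - complexify (v x)))
  have c2 := mul_le_mul b3 b2 (norm_nonneg _) (norm_nonneg _)
  linarith

/-- `Re ∑_j ∫ b \overline{∂_j w} · (w_j w)` in frequency space, with the Fourier multiplier `b`. -/
def trilinear (b : V3 → ℝ) (w : V3 → V3) : ℝ :=
  ∑ j, (∫ ζ, (b ζ : ℂ) * inner ℂ (grd j (𝓕 (toL2 w)) ζ) ((𝓕 (flux w j) : H) ζ)).re

theorem integral_mul_inner_eq {b : V3 → ℝ} (hb : MemLp (fun ζ => (b ζ : ℂ)) ⊤ volume) (f g : H) :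
    ∫ ζ, (b ζ : ℂ) * inner ℂ (f ζ) (g ζ) = inner ℂ (mulC _ hb f) g := by
  rw [L2.inner_def]
  refine integral_congr_ae ?_
  filter_upwards [coeFn_mulC hb f] with ζ hζ
  rw [hζ, inner_smul_left, Complex.conj_ofReal]

theorem integrable_mul_inner {b : V3 → ℝ} (hb : MemLp (fun ζ => (b ζ : ℂ)) ⊤ volume) (f g : H) :
    Integrable fun ζ => (b ζ : ℂ) * inner ℂ (f ζ) (g ζ) := by
  refine (L2.integrable_inner (𝕜 := ℂ) (mulC _ hb f) g).congr ?_
  filter_upwards [coeFn_mulC hb f] with ζ hζ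
  rw [hζ, inner_smul_left, Complex.conj_ofReal]

theorem conj_dsym (j : Fin 3) (ζ : V3) : (starRingEnd ℂ) (dsym j ζ) = -dsym j ζ := by
  simp [dsym, Complex.conj_ofNat]

/-- Testing a divergence against `b f`. -/
theorem re_integral_divergence {b : V3 → ℝ} (hb : MemLp (fun ζ => (b ζ : ℂ)) ⊤ volume) {f Γ : H}
    {Q : Fin 3 → H} (hf : Integrable fun ζ => lap ζ * ‖f ζ‖ ^ 2)
    (hΓ : Γ =ᵐ[volume] fun ζ => ∑ j, dsym j ζ • Q j ζ) :
    ∫ ζ, (b ζ : ℂ) * inner ℂ (f ζ) (Γ ζ) = -∑ j, ∫ ζ, (b ζ : ℂ) * inner ℂ (grd j f ζ) (Q j ζ) := by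
  rw [← integral_finsetSum _ fun j _ => integrable_mul_inner hb _ _, ← integral_neg]
  refine integral_congr_ae ?_
  filter_upwards [hΓ, ae_all_iff.mpr (coeFn_grd hf)] with ζ h1 h2
  simp only [h1, h2, inner_sum, inner_smul_left, inner_smul_right, conj_dsym]
  rw [Finset.mul_sum, ← Finset.sum_neg_distrib]
  refine Finset.sum_congr rfl fun j _ => ?_
  ring

theorem tendsto_integral_low {E : Type*} [NormedAddCommGroup E] [NormedSpace ℝ E] {f : V3 → E}
    (hf : Integrable f) :
    Tendsto (fun n : ℕ => ∫ ζ, if ‖ζ‖ ≤ n then f ζ else 0) atTop (𝓝 (∫ ζ, f ζ)) := by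
  refine tendsto_integral_of_dominated_convergence (fun ζ => ‖f ζ‖) (fun n => ?_) hf.norm
    (fun n => Eventually.of_forall fun ζ => ?_) (Eventually.of_forall fun ζ => ?_)
  · have hs : MeasurableSet {ζ : V3 | ‖ζ‖ ≤ n} := measurableSet_le measurable_norm measurable_const
    exact (hf.indicator hs).1
  · split_ifs <;> simp
  · refine tendsto_const_nhds.congr' ?_
    filter_upwards [eventually_ge_atTop ⌈‖ζ‖⌉₊] with n hn
    rw [if_pos]
    exact (Nat.le_ceil _).trans (by exact_mod_cast hn)

theorem integrable_mul_lap {b : V3 → ℝ} (hm : Measurable b) {K : ℝ} (hK : ∀ ζ, |b ζ| ≤ K) {f : H}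
    (hf : Integrable fun ζ => lap ζ * ‖f ζ‖ ^ 2) :
    Integrable fun ζ => b ζ * (lap ζ * ‖f ζ‖ ^ 2) :=
  hf.bdd_mul (c := K) hm.aestronglyMeasurable (Eventually.of_forall hK)

theorem integral_lap_le_norm_weighted {f : H} (hf : Integrable fun ζ => lap ζ * ‖f ζ‖ ^ 2) :
    ∫ ζ, lap ζ * ‖f ζ‖ ^ 2 ≤ ‖weighted f‖ ^ 2 := by
  rw [norm_sq_L2]
  refine integral_mono_ae hf (integrable_norm_sq _) ?_
  filter_upwards [coeFn_weighted hf] with ζ hζ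
  rw [hζ, norm_smul, mul_pow, Complex.norm_real, Real.norm_eq_abs, sq_abs]
  gcongr
  exact lap_le_wgt_sq ζ

variable {u₀ : V3 → V3} {u : ℝ → V3 → V3} {G : ℝ → V3 → V3 →L[ℝ] V3}

namespace IsLerayHopfWith

theorem continuousOn_flux (h : IsLerayHopfWith u₀ u G) (hb : BoundedBeforeOne u) (j : Fin 3) :
    ContinuousOn (fun t => flux (u t) j) (Ioo 0 1) := by
  intro t₀ ht₀
  refine ContinuousAt.continuousWithinAt ?_
  obtain ⟨s, hs, hst⟩ := exists_between ht₀.1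
  obtain ⟨r, hr, hr1⟩ := exists_between ht₀.2
  obtain ⟨M, hM⟩ := hb s r hs hr1
  have hc := ((h.continuousOn_vel hb).continuousAt (Ioo_mem_nhds ht₀.1 ht₀.2)).tendsto.sub_const
    (vel u t₀)
  rw [sub_self] at hc
  rw [ContinuousAt, tendsto_iff_norm_sub_tendsto_zero]
  have hc2 := hc.norm.const_mul (2 * M)
  rw [norm_zero, mul_zero] at hc2
  refine squeeze_zero' (Eventually.of_forall fun _ => norm_nonneg _) ?_ hc2
  filter_upwards [Icc_mem_nhds hst hr] with t ht
  exact norm_flux_sub_le (h.memLp' (Icc_subset_Ioo_unit hs hr1 ht)) (h.memLp' ht₀) (hM t ht)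
    (hM t₀ ⟨hst.le, hr.le⟩) j

theorem ae_convF_eq (h : IsLerayHopfWith u₀ u G) (hb : BoundedBeforeOne u) :
    ∀ᵐ t ∂(volume.restrict (Ioo (0 : ℝ) 1)),
      convF u G t =ᵐ[volume] fun ζ => ∑ j, dsym j ζ • (𝓕 (flux (u t) j) : H) ζ := by
  filter_upwards [h.ae_memLp_pderiv, h.weak_grad, h.ae_memLp_conv hb,
    ae_restrict_mem measurableSet_Ioo] with t h1 h2 h3 ht
  obtain ⟨M, hM⟩ := hb.exists_bound ht
  have hu := h.memLp' ht
  refine fourier_convection (D := fun j => pderiv G j t) hu hM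
    (fun j => fourier_weakGradient hu h1 h2 j) (h.isSolenoidal_velF ht) ?_
    fun j => coeFn_flux hu hM j
  filter_upwards [coeFn_toL2 h3, ae_all_iff.mpr fun j => coeFn_toL2 (h1 j)] with x a1 a2
  change conv u G t x = _ at a1
  rw [a1, clm_apply_eq_sum (G t x) (u t x), ← complexifyL_apply, map_sum]
  refine Finset.sum_congr rfl fun j _ => ?_
  change _ = (u t x j : ℂ) • (toL2 fun x => G t x (e j) : H) x
  rw [a2, map_smul]
  rfl

/-- The rate of change of the energy with weight `b`. -/
def _root_.NSE.rate (u : ℝ → V3 → V3) (b : V3 → ℝ) (t : ℝ) : ℝ :=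
  -2 * (∫ ζ, b ζ * (lap ζ * ‖velF u t ζ‖ ^ 2)) + 2 * trilinear b (u t)

theorem continuousOn_rate (h : IsLerayHopfWith u₀ u G) (hb : BoundedBeforeOne u) {b : V3 → ℝ}
    (hm : Measurable b) {K : ℝ} (hK : ∀ ζ, |b ζ| ≤ K) : ContinuousOn (rate u b) (Ioo 0 1) := by
  have hbm := memLp_top_ofReal hm hK
  have hV := h.continuousOn_weighted hb
  refine ContinuousOn.add (continuousOn_const.mul ?_) (continuousOn_const.mul ?_)
  · let c : V3 → ℝ := fun ζ => b ζ * lap ζ * (wgt ζ ^ 2)⁻¹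
    have hcm : Measurable c := (hm.mul continuous_lap.measurable).mul
      (continuous_wgt.measurable.pow_const 2).inv
    have hcK : ∀ ζ, |c ζ| ≤ K := by
      intro ζ
      have h1 : lap ζ * (wgt ζ ^ 2)⁻¹ ≤ 1 := by
        rw [← div_eq_mul_inv, div_le_one (pow_pos (wgt_pos ζ) 2)]
        exact lap_le_wgt_sq ζ
      have h2 : 0 ≤ lap ζ * (wgt ζ ^ 2)⁻¹ := mul_nonneg (lap_nonneg ζ) (by positivity)
      simp only [c]
      rw [mul_assoc, abs_mul, abs_of_nonneg h2]
      calc |b ζ| * (lap ζ * (wgt ζ ^ 2)⁻¹) ≤ |b ζ| * 1 := by gcongr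
        _ ≤ K := by rw [mul_one]; exact hK ζ
    have hcc := memLp_top_ofReal hcm hcK
    refine ContinuousOn.congr (f := fun t =>
      (inner ℂ (mulC _ hcc (weighted (velF u t))) (weighted (velF u t))).re) ?_ fun t ht => ?_
    · exact Complex.continuous_re.comp_continuousOn
        (((mulC _ hcc).continuous.comp_continuousOn hV).inner (𝕜 := ℂ) hV)
    · simp only [inner_mulC_self]
      refine integral_congr_ae ?_
      filter_upwards [coeFn_weighted (h.integrable_lap' hb ht)] with ζ hζ
      simp only [c]
      rw [hζ, norm_smul, mul_pow, Complex.norm_real, Real.norm_eq_abs, sq_abs]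
      have := (wgt_pos ζ).ne'
      field_simp
  · refine continuousOn_finsetSum _ fun j _ => ?_
    simp only [integral_mul_inner_eq hbm]
    refine Complex.continuous_re.comp_continuousOn (ContinuousOn.inner (𝕜 := ℂ) ?_ ?_)
    · exact (mulC _ hbm).continuous.comp_continuousOn
        ((mulC _ (memLp_top_dsym_div_wgt j)).continuous.comp_continuousOn hV)
    · exact fourierL.continuous.comp_continuousOn (h.continuousOn_flux hb j)

/-- The energy identity with a bounded weight `b` in frequency space. -/
theorem energy_identity (h : IsLerayHopfWith u₀ u G) (hb : BoundedBeforeOne u) {b : V3 → ℝ}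
    (hm : Measurable b) {K : ℝ} (hK : ∀ ζ, |b ζ| ≤ K) {s t : ℝ} (hs : 0 < s) (hst : s ≤ t)
    (ht : t < 1) :
    (∫ ζ, b ζ * ‖velF u t ζ‖ ^ 2) - (∫ ζ, b ζ * ‖velF u s ζ‖ ^ 2) = ∫ σ in s..t, rate u b σ := by
  have hK0 : 0 ≤ K := (abs_nonneg _).trans (hK 0)
  have hbm := memLp_top_ofReal hm hK
  have hsub : Ioc s t ⊆ Ioo 0 1 := Ioc_subset_Icc_self.trans (Icc_subset_Ioo_unit hs ht)
  let bn : ℕ → V3 → ℝ := fun n ζ => if ‖ζ‖ ≤ n then b ζ else 0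
  have hbnm : ∀ n, Measurable (bn n) := fun n =>
    Measurable.ite (measurableSet_le measurable_norm measurable_const) hm measurable_const
  have hbnK : ∀ n ζ, |bn n ζ| ≤ K := by
    intro n ζ
    simp only [bn]
    split_ifs
    · exact hK ζ
    · simpa using hK0
  have hid := fun n : ℕ => h.energy_identity_cut hb (hbnm n) (hbnK n) (R := n)
    (fun ζ hζ => by simp only [bn]; rw [if_neg (not_le.mpr hζ)]) hs hst ht
  -- the integrand of the limit
  let f : ℝ → V3 → ℂ := fun σ ζ => ((b ζ * (lap ζ * ‖velF u σ ζ‖ ^ 2) : ℝ) : ℂ) +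
    (b ζ : ℂ) * inner ℂ (velF u σ ζ) (convF u G σ ζ)
  have hf : ∀ σ ∈ Ioo (0 : ℝ) 1, Integrable (f σ) := fun σ hσ =>
    (integrable_mul_lap hm hK (h.integrable_lap' hb hσ)).ofReal.add (integrable_mul_inner hbm _ _)
  have hFn : ∀ (n : ℕ) (σ : ℝ), inner ℂ (mulC _ (memLp_top_ofReal (hbnm n) (hbnK n)) (velF u σ))
      (rhsF u G n σ) = ∫ ζ, if ‖ζ‖ ≤ n then f σ ζ else 0 := by
    intro n σ
    rw [L2.inner_def]
    refine integral_congr_ae ?_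
    filter_upwards [coeFn_mulC (memLp_top_ofReal (hbnm n) (hbnK n)) (velF u σ),
      coeFn_mulC (memLp_top_cut n (Complex.continuous_ofReal.comp continuous_lap)) (velF u σ),
      Lp.coeFn_add (lapCut n (velF u σ)) (convF u G σ)] with ζ a1 a2 a3
    change lapCut n (velF u σ) ζ = cut n (fun ζ => (lap ζ : ℂ)) ζ • _ at a2
    rw [a1, rhsF, a3, Pi.add_apply, a2, cut]
    simp only [bn, f]
    split_ifs
    · rw [inner_smul_left, inner_add_right, inner_smul_right, inner_self_eq_norm_sq_to_K,
        Complex.conj_ofReal]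
      push_cast
      simp only [Complex.coe_algebraMap]
      ring
    · simp
  have lim1 : ∀ {σ : ℝ}, Tendsto (fun n => ∫ ζ, bn n ζ * ‖velF u σ ζ‖ ^ 2) atTop
      (𝓝 (∫ ζ, b ζ * ‖velF u σ ζ‖ ^ 2)) := by
    intro σ
    have h1 : Integrable fun ζ => b ζ * ‖velF u σ ζ‖ ^ 2 :=
      (integrable_norm_sq _).bdd_mul (c := K) hm.aestronglyMeasurable (Eventually.of_forall hK)
    have h2 := tendsto_integral_low h1
    simpa only [bn, ite_mul, zero_mul] using h2
  have hmV : AEStronglyMeasurable (fun σ => ‖weighted (velF u σ)‖ ^ 2)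
      (volume.restrict (Ioc s t)) := by
    have := ((h.continuousOn_weighted hb).mono (Icc_subset_Ioo_unit hs ht)).norm.pow 2
    exact (this.mono Ioc_subset_Icc_self).aestronglyMeasurable measurableSet_Ioc
  have lim2 : Tendsto (fun n : ℕ => ∫ σ in s..t, (inner ℂ (mulC _ (memLp_top_ofReal (hbnm n) (hbnK n))
      (velF u σ)) (rhsF u G n σ)).re) atTop (𝓝 (∫ σ in s..t, (∫ ζ, f σ ζ).re)) := by
    refine intervalIntegral.tendsto_integral_filter_of_dominated_convergence
      (fun σ => K * ‖weighted (velF u σ)‖ ^ 2 + K * (‖velF u σ‖ ^ 2 + ‖convF u G σ‖ ^ 2)) ?_ ?_ ?_ ?_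
    · refine Eventually.of_forall fun n => ?_
      have := h.integrable_re_inner_mulC hs hst ht (mulC _ (memLp_top_ofReal (hbnm n) (hbnK n)))
        (h.integrable_rhsF hb n hs hst ht)
      rw [intervalIntegrable_iff] at this
      exact this.1
    · refine Eventually.of_forall fun n => Eventually.of_forall fun σ hσ => ?_
      rw [uIoc_of_le hst] at hσ
      have hg := h.integrable_lap' hb (hsub hσ)
      have hfi := hf σ (hsub hσ)
      have hs : MeasurableSet {ζ : V3 | ‖ζ‖ ≤ n} := measurableSet_le measurable_norm measurable_const
      have hsq : Integrable fun ζ => K * (‖velF u σ ζ‖ ^ 2 + ‖convF u G σ ζ‖ ^ 2) :=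
        ((integrable_norm_sq _).add (integrable_norm_sq _)).const_mul K
      calc ‖(inner ℂ (mulC _ (memLp_top_ofReal (hbnm n) (hbnK n)) (velF u σ)) (rhsF u G n σ)).re‖
          ≤ ‖∫ ζ, if ‖ζ‖ ≤ n then f σ ζ else 0‖ := by
            rw [hFn]
            exact Complex.abs_re_le_norm _
        _ ≤ ∫ ζ, (K * (lap ζ * ‖velF u σ ζ‖ ^ 2) +
              K * (‖velF u σ ζ‖ ^ 2 + ‖convF u G σ ζ‖ ^ 2)) := by
            refine norm_integral_le_of_norm_le ((hg.const_mul K).add hsq)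
              (Eventually.of_forall fun ζ => ?_)
            have p1 : 0 ≤ lap ζ * ‖velF u σ ζ‖ ^ 2 := mul_nonneg (lap_nonneg ζ) (by positivity)
            split_ifs
            · refine (norm_add_le _ _).trans (add_le_add ?_ ?_)
              · rw [Complex.norm_real, norm_mul, Real.norm_eq_abs, Real.norm_of_nonneg p1]
                gcongr
                exact hK ζ
              · rw [norm_mul, Complex.norm_real, Real.norm_eq_abs]
                have p2 := norm_inner_le_norm (𝕜 := ℂ) (velF u σ ζ) (convF u G σ ζ)
                have p3 : ‖velF u σ ζ‖ * ‖convF u G σ ζ‖ ≤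
                    ‖velF u σ ζ‖ ^ 2 + ‖convF u G σ ζ‖ ^ 2 := by
                  nlinarith [sq_nonneg (‖velF u σ ζ‖ - ‖convF u G σ ζ‖), norm_nonneg (velF u σ ζ),
                    norm_nonneg (convF u G σ ζ)]
                exact mul_le_mul (hK ζ) (p2.trans p3) (norm_nonneg _) hK0
            · rw [norm_zero]
              positivity
        _ ≤ _ := by
            rw [integral_add (hg.const_mul K) hsq, integral_const_mul, integral_const_mul,
              integral_add (integrable_norm_sq _) (integrable_norm_sq _), ← norm_sq_L2, ← norm_sq_L2]
            gcongr
            exact integral_lap_le_norm_weighted hg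
    · rw [intervalIntegrable_iff_integrableOn_Ioc_of_le hst]
      refine Integrable.add (Integrable.const_mul ?_ _) (Integrable.const_mul (Integrable.add ?_ ?_) _)
      · have := ((h.continuousOn_weighted hb).mono (Icc_subset_Ioo_unit hs ht)).norm.pow 2
        exact this.integrableOn_Icc.mono_set Ioc_subset_Icc_self
      · have := ((h.continuousOn_velF hb).mono (Icc_subset_Ioo_unit hs ht)).norm.pow 2
        exact this.integrableOn_Icc.mono_set Ioc_subset_Icc_self
      · have h1 := h.memLp_convF hb hs ht
        have h2 := (memLp_two_iff_integrable_sq_norm h1.1).mp h1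
        exact IntegrableOn.mono_set h2 Ioc_subset_Icc_self
    · refine Eventually.of_forall fun σ hσ => ?_
      rw [uIoc_of_le hst] at hσ
      simp only [hFn]
      exact (Complex.continuous_re.tendsto _).comp (tendsto_integral_low (hf σ (hsub hσ)))
  have key := tendsto_nhds_unique (lim1.sub lim1) ((lim2.const_mul (-2)).congr fun n => (hid n).symm)
  rw [key, ← intervalIntegral.integral_const_mul]
  refine intervalIntegral.integral_congr_ae ?_
  have hae : ∀ᵐ σ ∂(volume.restrict (Ioc s t)),
      convF u G σ =ᵐ[volume] fun ζ => ∑ j, dsym j ζ • (𝓕 (flux (u σ) j) : H) ζ :=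
    ae_mono (Measure.restrict_mono hsub le_rfl) (h.ae_convF_eq hb)
  rw [ae_restrict_iff' measurableSet_Ioc] at hae
  filter_upwards [hae] with σ hσ hσ'
  rw [uIoc_of_le hst] at hσ'
  have hg := h.integrable_lap' hb (hsub hσ')
  have e1 : ∫ ζ, f σ ζ = ((∫ ζ, b ζ * (lap ζ * ‖velF u σ ζ‖ ^ 2) : ℝ) : ℂ) -
      ∑ j, ∫ ζ, (b ζ : ℂ) * inner ℂ (grd j (velF u σ) ζ) ((𝓕 (flux (u σ) j) : H) ζ) := by
    simp only [f]
    refine (integral_add (integrable_mul_lap hm hK hg).ofReal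
      (integrable_mul_inner hbm (velF u σ) (convF u G σ))).trans ?_
    rw [re_integral_divergence hbm hg (hσ hσ'), integral_complex_ofReal, sub_eq_add_neg]
  rw [e1, rate, trilinear]
  simp only [Complex.sub_re, Complex.ofReal_re, Complex.re_sum]
  change _ = -2 * _ + 2 * ∑ j, (∫ ζ, (b ζ : ℂ) *
    inner ℂ (grd j (velF u σ) ζ) ((𝓕 (flux (u σ) j) : H) ζ)).re
  ring

/-- The integrand of the energy identity is continuous in time because `u` is a continuous curve in
`H¹`. -/
theorem hasDerivAt_weighted_energy (h : IsLerayHopfWith u₀ u G) (hb : BoundedBeforeOne u)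
    {b : V3 → ℝ} (hm : Measurable b) {K : ℝ} (hK : ∀ ζ, |b ζ| ≤ K) {t : ℝ} (ht : t ∈ Ioo (0 : ℝ) 1) :
    HasDerivAt (fun t => ∫ ζ, b ζ * ‖velF u t ζ‖ ^ 2) (rate u b t) t := by
  obtain ⟨s, hs, hst⟩ := exists_between ht.1
  have hc := h.continuousOn_rate hb hm hK
  have h1 : HasDerivAt (fun t => ∫ σ in s..t, rate u b σ) (rate u b t) t := by
    refine intervalIntegral.integral_hasDerivAt_right ?_
      (hc.stronglyMeasurableAtFilter isOpen_Ioo t ht) (hc.continuousAt (Ioo_mem_nhds ht.1 ht.2))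
    refine ContinuousOn.intervalIntegrable (hc.mono ?_)
    rw [uIcc_of_le hst.le]
    exact Icc_subset_Ioo_unit hs ht.2
  refine (h1.const_add (∫ ζ, b ζ * ‖velF u s ζ‖ ^ 2)).congr_of_eventuallyEq ?_
  filter_upwards [Ioo_mem_nhds hst ht.2] with r hr
  rw [← h.energy_identity hb hm hK hs hr.1.le hr.2]
  ring

end IsLerayHopfWith

end WeightedEnergy

/-! ### The symbol of the energy -/

section Symbol

/-- The symbol `χ² + 1 - φ²` of the energy: by Plancherel, `energy` is the integral of
`|F w|²` against it. -/
def symb (φ : V3 → ℝ) (α : ℝ) (ξ : V3) : ℝ := chi φ α ξ ^ 2 + (1 - φ ξ ^ 2)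

/-- The radial derivative `ξ · ∇` of `symb`, away from the sphere `|ξ| = 1/2 + α`. -/
def radialSymb (φ : V3 → ℝ) (α : ℝ) (ξ : V3) : ℝ :=
  if ‖ξ‖ < 1 / 2 + α then (1 + 4 * α) * ‖ξ‖ ^ (1 + 4 * α)
  else -(1 - (1 / 2 + α) ^ (1 + 4 * α)) * (2 * φ ξ * fderiv ℝ φ ξ ξ)

variable {φ : V3 → ℝ} {α : ℝ}

theorem chi_sq (hα : α ∈ Ioo (0 : ℝ) (1 / 8)) (ξ : V3) :
    chi φ α ξ ^ 2 = min ‖ξ‖ (1 / 2 + α) ^ (1 + 4 * α) * φ ξ ^ 2 := by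
  have key : ∀ x : ℝ, 0 ≤ x → (x ^ (1 / 2 + 2 * α)) ^ 2 = x ^ (1 + 4 * α) := fun x hx => by
    rw [← Real.rpow_natCast, ← Real.rpow_mul hx]
    congr 1
    push_cast
    ring
  rw [chi]
  split_ifs with h
  · rw [mul_pow, key _ (norm_nonneg _), min_eq_left h]
  · rw [mul_pow, key _ (by linarith [hα.1]), min_eq_right (not_le.mp h).le]

theorem rpow_mem_Icc {x p : ℝ} (hx : x ∈ Icc (0 : ℝ) 1) (hp : 0 ≤ p) : x ^ p ∈ Icc (0 : ℝ) 1 :=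
  ⟨Real.rpow_nonneg hx.1 _, Real.rpow_le_one hx.1 hx.2 hp⟩

theorem min_mem_Icc (hα : α ∈ Ioo (0 : ℝ) (1 / 8)) (ξ : V3) :
    min ‖ξ‖ (1 / 2 + α) ∈ Icc (0 : ℝ) 1 :=
  ⟨le_min (norm_nonneg _) (by linarith [hα.1]), (min_le_right _ _).trans (by linarith [hα.2])⟩

theorem symb_eq_min (hα : α ∈ Ioo (0 : ℝ) (1 / 8)) (ξ : V3) :
    symb φ α ξ = 1 - φ ξ ^ 2 * (1 - min ‖ξ‖ (1 / 2 + α) ^ (1 + 4 * α)) := by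
  rw [symb, chi_sq hα]
  ring

theorem min_rpow_mem_Icc (hα : α ∈ Ioo (0 : ℝ) (1 / 8)) (ξ : V3) :
    min ‖ξ‖ (1 / 2 + α) ^ (1 + 4 * α) ∈ Icc (0 : ℝ) 1 :=
  rpow_mem_Icc (min_mem_Icc hα ξ) (by linarith [hα.1])

theorem _root_.NSE.IsCutoff.sq_mem (hφ : IsCutoff φ) (ξ : V3) : φ ξ ^ 2 ∈ Icc (0 : ℝ) 1 :=
  ⟨sq_nonneg _, pow_le_one₀ (hφ.mem_unit ξ).1 (hφ.mem_unit ξ).2⟩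

theorem one_sub_sq_le_symb (ξ : V3) : 1 - φ ξ ^ 2 ≤ symb φ α ξ := by
  rw [symb]
  linarith [sq_nonneg (chi φ α ξ)]

theorem symb_nonneg (hφ : IsCutoff φ) (ξ : V3) : 0 ≤ symb φ α ξ :=
  (sub_nonneg.mpr (hφ.sq_mem ξ).2).trans (one_sub_sq_le_symb ξ)

theorem one_sub_symb_mem (hφ : IsCutoff φ) (hα : α ∈ Ioo (0 : ℝ) (1 / 8)) (ξ : V3) :
    1 - symb φ α ξ ∈ Icc (0 : ℝ) 1 := by
  rw [symb_eq_min hα, sub_sub_cancel]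
  have h1 := hφ.sq_mem ξ
  have h2 := min_rpow_mem_Icc hα ξ
  exact ⟨mul_nonneg h1.1 (by linarith [h2.2]), mul_le_one₀ h1.2 (by linarith [h2.2]) (by linarith [h2.1])⟩

theorem abs_symb_le (hφ : IsCutoff φ) (hα : α ∈ Ioo (0 : ℝ) (1 / 8)) (ξ : V3) :
    |symb φ α ξ| ≤ 1 := by
  rw [abs_of_nonneg (symb_nonneg hφ ξ)]
  linarith [(one_sub_symb_mem hφ hα ξ).1]

theorem symb_eq_one (hφ : IsCutoff φ) (hα : α ∈ Ioo (0 : ℝ) (1 / 8)) {ξ : V3} (h : 2 ≤ ‖ξ‖) :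
    symb φ α ξ = 1 := by
  rw [symb_eq_min hα, hφ.eq_zero ξ h]
  ring

/-- For `|ξ| ≤ 1/2 + α` the factor `1/4` is not needed; beyond, it makes the left-hand side at most
`(1/2)^(1 + 4α)`, below the plateau of `min(|ξ|, 1/2 + α)^(1 + 4α)`. -/
theorem rpow_le_symb (hφ : IsCutoff φ) (hα : α ∈ Ioo (0 : ℝ) (1 / 8)) {ξ : V3} (h : ‖ξ‖ ≤ 2) :
    (‖ξ‖ / 4) ^ (1 + 4 * α) ≤ symb φ α ξ := by
  have h1 : (‖ξ‖ / 4) ^ (1 + 4 * α) ≤ min ‖ξ‖ (1 / 2 + α) ^ (1 + 4 * α) := by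
    have h0 := norm_nonneg ξ
    refine Real.rpow_le_rpow (by positivity) (le_min ?_ ?_) (by linarith [hα.1])
    · linarith
    · linarith [hα.1]
  have h2 := hφ.sq_mem ξ
  have h3 := min_rpow_mem_Icc hα ξ
  rw [symb_eq_min hα]
  nlinarith [h1, mul_nonneg (sub_nonneg.mpr h2.2) (sub_nonneg.mpr h3.2)]

theorem symb_pos (hφ : IsCutoff φ) (hα : α ∈ Ioo (0 : ℝ) (1 / 8)) {ξ : V3} (h : ξ ≠ 0) :
    0 < symb φ α ξ := by
  rcases le_total ‖ξ‖ 2 with h2 | h2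
  · exact (Real.rpow_pos_of_pos (by have := norm_pos_iff.mpr h; positivity) _).trans_le
      (rpow_le_symb hφ hα h2)
  · rw [symb_eq_one hφ hα h2]
    exact one_pos

/-- Where `φ` does not vanish, one derivative is controlled by the square root of the symbol. -/
theorem norm_sq_mul_le_symb (hφ : IsCutoff φ) (hα : α ∈ Ioo (0 : ℝ) (1 / 8)) {ξ : V3}
    (h : ‖ξ‖ ≤ 2) : ‖ξ‖ ^ 2 ≤ 16 * symb φ α ξ := by
  have h0 := norm_nonneg ξ
  have h1 : (‖ξ‖ / 4) ^ (2 : ℝ) ≤ (‖ξ‖ / 4) ^ (1 + 4 * α) :=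
    Real.rpow_le_rpow_of_exponent_ge' (by positivity) (by linarith) (by linarith [hα.1])
      (by linarith [hα.2])
  rw [Real.rpow_two] at h1
  have := rpow_le_symb hφ hα h
  linarith

theorem symb_eq (hφ : IsCutoff φ) (hα : α ∈ Ioo (0 : ℝ) (1 / 8)) (ξ : V3) :
    symb φ α ξ = 1 - (1 - (1 / 2 + α) ^ (1 + 4 * α)) * φ ξ ^ 2 -
      ((1 / 2 + α) ^ (1 + 4 * α) - min ‖ξ‖ (1 / 2 + α) ^ (1 + 4 * α)) := by
  rw [symb_eq_min hα]
  rcases le_total ‖ξ‖ (1 / 2 + α) with h | h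
  · rw [hφ.eq_one ξ (by linarith [hα.2])]
    ring
  · rw [min_eq_right h]
    ring

theorem abs_rpow_sub_rpow_le {p x y : ℝ} (hp : 1 ≤ p) (hx : x ∈ Icc (0 : ℝ) 1)
    (hy : y ∈ Icc (0 : ℝ) 1) : |x ^ p - y ^ p| ≤ p * |x - y| := by
  have h := (convex_Icc (0 : ℝ) 1).norm_image_sub_le_of_norm_hasDerivWithin_le
    (f := fun x : ℝ => x ^ p) (f' := fun x => p * x ^ (p - 1)) (C := p)
    (fun z _ => (Real.hasDerivAt_rpow_const (Or.inr hp)).hasDerivWithinAt)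
    (fun z hz => ?_) hy hx
  · simpa [Real.norm_eq_abs] using h
  · have := rpow_mem_Icc hz (sub_nonneg.mpr hp)
    rw [Real.norm_of_nonneg (mul_nonneg (by linarith) this.1)]
    exact mul_le_of_le_one_right (by linarith) this.2

theorem exists_lipschitz_symb (hφ : IsCutoff φ) (hα : α ∈ Ioo (0 : ℝ) (1 / 8)) :
    ∃ K : ℝ, 0 ≤ K ∧ ∀ ξ η, |symb φ α ξ - symb φ α η| ≤ K * ‖ξ - η‖ := by
  have hc : HasCompactSupport φ := by
    refine HasCompactSupport.intro (isCompact_closedBall (0 : V3) 2) fun ξ h => hφ.eq_zero ξ ?_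
    rw [mem_closedBall_zero_iff, not_le] at h
    exact h.le
  obtain ⟨L, hL⟩ := hφ.smooth.lipschitzWith_of_hasCompactSupport hc (by simp)
  have hc1 : (1 / 2 + α) ^ (1 + 4 * α) ∈ Icc (0 : ℝ) 1 :=
    rpow_mem_Icc ⟨by linarith [hα.1], by linarith [hα.2]⟩ (by linarith [hα.1])
  refine ⟨2 * L + 2, by positivity, fun ξ η => ?_⟩
  have h1 : |φ ξ - φ η| ≤ L * ‖ξ - η‖ := by
    simpa [Real.dist_eq, dist_eq_norm] using hL.dist_le_mul ξ η
  have h2 : |min ‖ξ‖ (1 / 2 + α) ^ (1 + 4 * α) - min ‖η‖ (1 / 2 + α) ^ (1 + 4 * α)| ≤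
      2 * ‖ξ - η‖ := by
    refine (abs_rpow_sub_rpow_le (by linarith [hα.1]) (min_mem_Icc hα ξ) (min_mem_Icc hα η)).trans ?_
    have h3 : |min ‖ξ‖ (1 / 2 + α) - min ‖η‖ (1 / 2 + α)| ≤ ‖ξ - η‖ := by
      refine (abs_min_sub_min_le_max _ _ _ _).trans ?_
      rw [sub_self, abs_zero, max_eq_left (abs_nonneg _)]
      exact abs_norm_sub_norm_le _ _
    exact mul_le_mul (by linarith [hα.2]) h3 (abs_nonneg _) (by norm_num)
  have h4 : |φ ξ ^ 2 - φ η ^ 2| ≤ 2 * (L * ‖ξ - η‖) := by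
    rw [sq_sub_sq, abs_mul]
    have a1 := hφ.mem_unit ξ
    have a2 := hφ.mem_unit η
    refine mul_le_mul ?_ h1 (abs_nonneg _) (by norm_num)
    rw [abs_of_nonneg (by linarith [a1.1, a2.1])]
    linarith [a1.2, a2.2]
  rw [symb_eq hφ hα, symb_eq hφ hα]
  set c1 := (1 / 2 + α) ^ (1 + 4 * α)
  have h5 : (1 - c1) * |φ ξ ^ 2 - φ η ^ 2| ≤ |φ ξ ^ 2 - φ η ^ 2| :=
    mul_le_of_le_one_left (abs_nonneg _) (by linarith [hc1.1])
  have h6 : |(1 - c1) * (φ ξ ^ 2 - φ η ^ 2)| = (1 - c1) * |φ ξ ^ 2 - φ η ^ 2| := by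
    rw [abs_mul, abs_of_nonneg (by linarith [hc1.2])]
  rw [show ∀ a b c d : ℝ, 1 - (1 - c1) * a - (c1 - b) - (1 - (1 - c1) * c - (c1 - d)) =
    (b - d) - (1 - c1) * (a - c) by intros; ring]
  refine (abs_sub _ _).trans ?_
  rw [h6]
  linarith

theorem continuous_symb (hφ : IsCutoff φ) (hα : α ∈ Ioo (0 : ℝ) (1 / 8)) :
    Continuous (symb φ α) := by
  obtain ⟨K, hK0, hK⟩ := exists_lipschitz_symb hφ hα
  exact (LipschitzWith.of_dist_le_mul (K := ⟨K, hK0⟩) fun ξ η => by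
    rw [Real.dist_eq, dist_eq_norm]; exact hK ξ η).continuous

theorem hasDerivAt_symb_smul (hφ : IsCutoff φ) (hα : α ∈ Ioo (0 : ℝ) (1 / 8)) {ξ : V3}
    (hξ : ‖ξ‖ ≠ 1 / 2 + α) :
    HasDerivAt (fun s : ℝ => symb φ α (s • ξ)) (radialSymb φ α ξ) 1 := by
  have hcont : ContinuousAt (fun s : ℝ => ‖s • ξ‖) 1 := by fun_prop
  rcases hξ.lt_or_gt with h | h
  · have hev : (fun s : ℝ => symb φ α (s • ξ)) =ᶠ[𝓝 1] fun s => s ^ (1 + 4 * α) * ‖ξ‖ ^ (1 + 4 * α) := by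
      have h1 : ∀ᶠ s : ℝ in 𝓝 1, ‖s • ξ‖ < 1 / 2 + α :=
        hcont.eventually_lt_const (by simpa using h)
      filter_upwards [h1, lt_mem_nhds (one_pos (α := ℝ))] with s hs hs0
      rw [symb_eq_min hα, hφ.eq_one _ (by linarith [hα.2]), min_eq_left hs.le, norm_smul,
        Real.norm_of_nonneg hs0.le, Real.mul_rpow hs0.le (norm_nonneg _)]
      ring
    refine HasDerivAt.congr_of_eventuallyEq ?_ hev
    have := (Real.hasDerivAt_rpow_const (x := 1) (p := 1 + 4 * α) (Or.inl one_ne_zero)).mul_const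
      (‖ξ‖ ^ (1 + 4 * α))
    rw [radialSymb, if_pos h]
    simpa using this
  · have hev : (fun s : ℝ => symb φ α (s • ξ)) =ᶠ[𝓝 1]
        fun s => 1 - (1 - (1 / 2 + α) ^ (1 + 4 * α)) * φ (s • ξ) ^ 2 := by
      have h1 : ∀ᶠ s : ℝ in 𝓝 1, 1 / 2 + α < ‖s • ξ‖ :=
        hcont.eventually_const_lt (by simpa using h)
      filter_upwards [h1] with s hs
      rw [symb_eq_min hα, min_eq_right hs.le]
      ring
    refine HasDerivAt.congr_of_eventuallyEq ?_ hev
    have h2 : HasDerivAt (fun s : ℝ => φ (s • ξ)) (fderiv ℝ φ ξ ξ) 1 := by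
      have h3 : HasDerivAt (fun s : ℝ => s • ξ) ξ 1 := by
        simpa using (hasDerivAt_id (1 : ℝ)).smul_const ξ
      have h4 : HasFDerivAt φ (fderiv ℝ φ ξ) ((1 : ℝ) • ξ) := by
        rw [one_smul]
        exact (hφ.smooth.differentiable (by simp) ξ).hasFDerivAt
      exact h4.comp_hasDerivAt 1 h3
    have := ((h2.pow 2).const_mul (1 - (1 / 2 + α) ^ (1 + 4 * α))).const_sub 1
    rw [radialSymb, if_neg h.not_gt]
    refine HasDerivAt.congr_deriv this ?_
    simp only [one_smul, Nat.cast_ofNat, show (2 - 1 : ℕ) = 1 from rfl, pow_one, neg_mul]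

/-- The algebraic inequality behind the decay. For `|ξ| < 1/2 + α` the symbol is
`|ξ|^(1 + 4α)`, and the scaling alone gives the rate `2α`; for `|ξ| > 1/2 + α` the symbol is
radially increasing and the dissipation wins, because `2 (1/2 + α)² > 1/2 + 2α`. -/
theorem linear_symb_le (hφ : IsCutoff φ) (hα : α ∈ Ioo (0 : ℝ) (1 / 8)) {ξ : V3}
    (hξ : ‖ξ‖ ≠ 1 / 2 + α) :
    (1 / 2) * (symb φ α ξ - radialSymb φ α ξ) - 2 * (symb φ α ξ * ‖ξ‖ ^ 2) ≤
      -(2 * α) * symb φ α ξ - 2 * α ^ 2 * (symb φ α ξ * ‖ξ‖ ^ 2) := by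
  have h0 := symb_nonneg (α := α) hφ ξ
  have hα0 := hα.1
  have hα1 := hα.2
  rcases hξ.lt_or_gt with h | h
  · have h1 : symb φ α ξ = ‖ξ‖ ^ (1 + 4 * α) := by
      rw [symb_eq_min hα, hφ.eq_one _ (by linarith), min_eq_left h.le]
      ring
    have h2 : radialSymb φ α ξ = (1 + 4 * α) * symb φ α ξ := by
      rw [h1, radialSymb, if_pos h]
    have h3 : 0 ≤ symb φ α ξ * ‖ξ‖ ^ 2 := by positivity
    have h4 : α ^ 2 ≤ 1 := by nlinarith
    rw [h2]
    nlinarith [mul_nonneg h3 (sub_nonneg.mpr h4)]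
  · have hc1 : (1 / 2 + α) ^ (1 + 4 * α) ∈ Icc (0 : ℝ) 1 :=
      rpow_mem_Icc ⟨by linarith, by linarith⟩ (by linarith)
    have h1 : 0 ≤ radialSymb φ α ξ := by
      rw [radialSymb, if_neg h.not_gt]
      have h2 := mul_nonneg (mul_nonneg zero_le_two (hφ.mem_unit ξ).1)
        (neg_nonneg.mpr (hφ.decreasing ξ))
      have h3 := mul_nonneg (sub_nonneg.mpr hc1.2) h2
      linarith
    have h2 : (1 / 2 + α) ^ 2 ≤ ‖ξ‖ ^ 2 := by
      gcongr
    have h3 : 1 / 2 + 2 * α ≤ (2 - 2 * α ^ 2) * ‖ξ‖ ^ 2 := by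
      have : (2 - 2 * α ^ 2) * (1 / 2 + α) ^ 2 ≤ (2 - 2 * α ^ 2) * ‖ξ‖ ^ 2 := by
        apply mul_le_mul_of_nonneg_left h2
        nlinarith
      have h5 : (1 / 2 + α) ^ 2 ≤ 1 := by nlinarith
      nlinarith [mul_nonneg (sq_nonneg α) (sub_nonneg.mpr h5)]
    have h4 := mul_le_mul_of_nonneg_left h3 h0
    nlinarith

end Symbol

/-! ### Estimates of the low frequencies -/

section LowFrequency

theorem lintegral_norm_rpow_neg_ne_top {q : ℝ} (hq : q < 3) :
    ∫⁻ ζ : V3, (if ‖ζ‖ ≤ 1 then ENNReal.ofReal (‖ζ‖ ^ (-q)) else 0) ≠ ⊤ := by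
  have h1 : Integrable (fun ζ : V3 => (fun r : ℝ => if r ≤ 1 then r ^ (-q) else 0) ‖ζ‖) := by
    refine (integrable_fun_norm_addHaar (volume : Measure V3)
      (f := fun r : ℝ => if r ≤ 1 then r ^ (-q) else 0)).mpr ?_
    have h2 : IntegrableOn (fun y : ℝ => y ^ (2 - q)) (Ioc 0 1) :=
      (intervalIntegrable_iff_integrableOn_Ioc_of_le zero_le_one).mp
        (intervalIntegral.intervalIntegrable_rpow' (by linarith))
    have h3 := (h2.integrable_indicator measurableSet_Ioc).integrableOn (s := Ioi 0)
    refine h3.congr_fun (fun y hy => ?_) measurableSet_Ioi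
    have hy0 : 0 < y := hy
    simp only [indicator, mem_Ioc, hy0, true_and, finrank_euclideanSpace, Fintype.card_fin]
    split_ifs
    · rw [smul_eq_mul, sub_eq_add_neg, Real.rpow_add hy0]
      norm_num
    · simp
  refine (lt_of_le_of_lt (lintegral_mono fun ζ => ?_) h1.lintegral_lt_top).ne
  by_cases h : ‖ζ‖ ≤ 1 <;> simp [h]

variable {φ : V3 → ℝ} {α : ℝ}

/-- The energy of a field with Fourier transform `f`. -/
def symbEnergy (φ : V3 → ℝ) (α : ℝ) (f : H) : ℝ :=
  ∫ ζ, symb φ α ((2 * Real.pi) • ζ) * ‖f ζ‖ ^ 2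

theorem symbEnergy_nonneg (hφ : IsCutoff φ) (f : H) : 0 ≤ symbEnergy φ α f :=
  integral_nonneg fun _ => mul_nonneg (symb_nonneg hφ _) (sq_nonneg _)

theorem measurable_symb_comp (hφ : IsCutoff φ) (hα : α ∈ Ioo (0 : ℝ) (1 / 8)) (c : ℝ) :
    Measurable fun ζ : V3 => symb φ α (c • ζ) :=
  ((continuous_symb hφ hα).comp (continuous_const_smul c)).measurable

theorem integrable_symb_mul (hφ : IsCutoff φ) (hα : α ∈ Ioo (0 : ℝ) (1 / 8)) (c : ℝ) (f : H) :
    Integrable fun ζ => symb φ α (c • ζ) * ‖f ζ‖ ^ 2 :=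
  (integrable_norm_sq f).bdd_mul (c := 1) (measurable_symb_comp hφ hα c).aestronglyMeasurable
    (Eventually.of_forall fun _ => abs_symb_le hφ hα _)

/-- The reciprocal of the symbol at low frequencies. -/
def invSymb (φ : V3 → ℝ) (α : ℝ) (ζ : V3) : ℝ≥0∞ :=
  if ‖(2 * Real.pi) • ζ‖ ≤ 2 then ENNReal.ofReal (symb φ α ((2 * Real.pi) • ζ))⁻¹ else 0

theorem measurable_invSymb (hφ : IsCutoff φ) (hα : α ∈ Ioo (0 : ℝ) (1 / 8)) :
    Measurable (invSymb φ α) := by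
  refine Measurable.ite (measurableSet_le (by fun_prop) measurable_const) ?_ measurable_const
  exact (measurable_symb_comp hφ hα _).inv.ennreal_ofReal

theorem norm_two_pi_smul (ζ : V3) : ‖(2 * Real.pi) • ζ‖ = 2 * Real.pi * ‖ζ‖ := by
  rw [norm_smul, Real.norm_of_nonneg (by positivity)]

theorem invSymb_le (hφ : IsCutoff φ) (hα : α ∈ Ioo (0 : ℝ) (1 / 8)) {ζ : V3} (hζ : ζ ≠ 0) :
    invSymb φ α ζ ≤ if ‖ζ‖ ≤ 1 then ENNReal.ofReal (‖ζ‖ ^ (-(1 + 4 * α))) else 0 := by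
  have hπ := Real.pi_gt_three
  have h0 : 0 < ‖ζ‖ := norm_pos_iff.mpr hζ
  rw [invSymb]
  split_ifs with h1 h2 h2
  · have h3 := rpow_le_symb hφ hα h1
    have h4 : ‖ζ‖ ^ (1 + 4 * α) ≤ (‖(2 * Real.pi) • ζ‖ / 4) ^ (1 + 4 * α) := by
      refine Real.rpow_le_rpow h0.le ?_ (by linarith [hα.1])
      rw [norm_two_pi_smul]
      nlinarith
    rw [Real.rpow_neg h0.le]
    exact ENNReal.ofReal_le_ofReal (inv_anti₀ (Real.rpow_pos_of_pos h0 _) (h4.trans h3))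
  · rw [norm_two_pi_smul] at h1
    exact absurd (by nlinarith) h2
  · exact bot_le
  · exact le_rfl

theorem lintegral_invSymb_ne_top (hφ : IsCutoff φ) (hα : α ∈ Ioo (0 : ℝ) (1 / 8)) :
    ∫⁻ ζ, invSymb φ α ζ ≠ ⊤ := by
  refine (lt_of_le_of_lt (lintegral_mono_ae ?_) (lintegral_norm_rpow_neg_ne_top
    (q := 1 + 4 * α) (by linarith [hα.2])).lt_top).ne
  filter_upwards [ae_ne_zero] with ζ hζ using invSymb_le hφ hα hζ

/-- The restriction to `α < 1/8` enters here: the exponent `2 (1 + 4α)` has to be less than `3`. -/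
theorem lintegral_invSymb_sq_ne_top (hφ : IsCutoff φ) (hα : α ∈ Ioo (0 : ℝ) (1 / 8)) :
    ∫⁻ ζ, invSymb φ α ζ ^ 2 ≠ ⊤ := by
  refine (lt_of_le_of_lt (lintegral_mono_ae ?_) (lintegral_norm_rpow_neg_ne_top
    (q := 2 * (1 + 4 * α)) (by linarith [hα.2])).lt_top).ne
  filter_upwards [ae_ne_zero] with ζ hζ
  refine (pow_le_pow_left' (invSymb_le hφ hα hζ) 2).trans ?_
  split_ifs
  · rw [← ENNReal.ofReal_pow (Real.rpow_nonneg (norm_nonneg _) _), ← Real.rpow_natCast,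
      ← Real.rpow_mul (norm_nonneg _)]
    refine ENNReal.ofReal_le_ofReal (le_of_eq ?_)
    congr 1
    push_cast
    ring
  · simp

theorem lintegral_symb_mul (hφ : IsCutoff φ) (hα : α ∈ Ioo (0 : ℝ) (1 / 8)) (f : H) :
    ∫⁻ ζ, ENNReal.ofReal (symb φ α ((2 * Real.pi) • ζ) * ‖f ζ‖ ^ 2) =
      ENNReal.ofReal (symbEnergy φ α f) :=
  (ofReal_integral_eq_lintegral_ofReal (integrable_symb_mul hφ hα _ f)
    (Eventually.of_forall fun _ => mul_nonneg (symb_nonneg hφ _) (sq_nonneg _))).symm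

/-- `F` has frequencies in `|ξ| ≤ 2` only, where its Fourier transform is at most `B |f|`. -/
def IsLowFrequency (B : ℝ) (f F : H) : Prop :=
  ∀ᵐ ζ, ‖(𝓕 F : H) ζ‖ ≤ if ‖(2 * Real.pi) • ζ‖ ≤ 2 then B * ‖f ζ‖ else 0

theorem IsLowFrequency.enorm_le (hφ : IsCutoff φ) (hα : α ∈ Ioo (0 : ℝ) (1 / 8)) {B : ℝ}
    (hB : 0 ≤ B) {f F : H} (hF : IsLowFrequency B f F) :
    ∀ᵐ ζ, ‖(𝓕 F : H) ζ‖ₑ ≤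
      (ENNReal.ofReal (B ^ 2) * ENNReal.ofReal (symb φ α ((2 * Real.pi) • ζ) * ‖f ζ‖ ^ 2)) ^
        (1 / 2 : ℝ) * invSymb φ α ζ ^ (1 / 2 : ℝ) := by
  filter_upwards [hF, ae_ne_zero] with ζ h1 h2
  rw [invSymb]
  split_ifs at h1 ⊢ with h
  · have hs := symb_pos hφ hα (smul_ne_zero (by positivity) h2 : (2 * Real.pi) • ζ ≠ 0)
    rw [← ENNReal.mul_rpow_of_nonneg _ _ (by norm_num), ← ENNReal.ofReal_mul (sq_nonneg _),
      ← ENNReal.ofReal_mul (by positivity)]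
    have e1 : B ^ 2 * (symb φ α ((2 * Real.pi) • ζ) * ‖f ζ‖ ^ 2) *
        (symb φ α ((2 * Real.pi) • ζ))⁻¹ = (B * ‖f ζ‖) ^ 2 := by
      field_simp
    rw [e1, ENNReal.ofReal_rpow_of_nonneg (sq_nonneg _) (by norm_num), ← Real.sqrt_eq_rpow,
      Real.sqrt_sq (by positivity), ← ofReal_norm]
    exact ENNReal.ofReal_le_ofReal h1
  · rw [norm_le_zero_iff.mp h1]
    simp

/-- Low frequencies are bounded, and bounded in `L⁴`, by the square root of the energy. -/
theorem exists_lowFrequency_bound (hφ : IsCutoff φ) (hα : α ∈ Ioo (0 : ℝ) (1 / 8)) :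
    ∃ K : ℝ, 0 ≤ K ∧ ∀ {B : ℝ}, 0 ≤ B → ∀ {f F : H}, IsLowFrequency B f F →
      (∀ᵐ x, ‖F x‖ₑ ≤ ENNReal.ofReal (K * B * √(symbEnergy φ α f))) ∧
      ∫⁻ x, ‖F x‖ₑ ^ 4 ≤ ENNReal.ofReal (K * B * √(symbEnergy φ α f)) ^ 4 := by
  set I1 := (∫⁻ ζ, invSymb φ α ζ).toReal
  set I2 := (∫⁻ ζ, invSymb φ α ζ ^ 2).toReal
  refine ⟨√I1 + 2 * √(√I2), by positivity, fun {B} hB {f F} hF => ?_⟩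
  set E := symbEnergy φ α f with hE
  have hE0 : 0 ≤ E := symbEnergy_nonneg hφ f
  have hk := measurable_invSymb hφ hα
  have hg : AEMeasurable fun ζ => ENNReal.ofReal (symb φ α ((2 * Real.pi) • ζ) * ‖f ζ‖ ^ 2) :=
    (integrable_symb_mul hφ hα _ f).1.aemeasurable.ennreal_ofReal
  -- a measurable representative of the energy density
  obtain ⟨g, hgm, hg'⟩ := hg
  have hgI : ∫⁻ ζ, ENNReal.ofReal (B ^ 2) * g ζ = ENNReal.ofReal (B ^ 2 * E) := by
    rw [lintegral_const_mul _ hgm, ← lintegral_congr_ae hg', lintegral_symb_mul hφ hα,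
      ← ENNReal.ofReal_mul (sq_nonneg _)]
  have hpt : ∀ᵐ ζ, ‖(𝓕 F : H) ζ‖ₑ ≤
      (ENNReal.ofReal (B ^ 2) * g ζ) ^ (1 / 2 : ℝ) * invSymb φ α ζ ^ (1 / 2 : ℝ) := by
    filter_upwards [hF.enorm_le hφ hα hB, hg'] with ζ h1 h2
    rwa [h2] at h1
  have hI1 : ∫⁻ ζ, invSymb φ α ζ = ENNReal.ofReal I1 :=
    (ENNReal.ofReal_toReal (lintegral_invSymb_ne_top hφ hα)).symm
  have hI2 : ∫⁻ ζ, invSymb φ α ζ ^ 2 = ENNReal.ofReal I2 :=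
    (ENNReal.ofReal_toReal (lintegral_invSymb_sq_ne_top hφ hα)).symm
  have hI10 : 0 ≤ I1 := ENNReal.toReal_nonneg
  have hI20 : 0 ≤ I2 := ENNReal.toReal_nonneg
  have hgm' := hgm.const_mul (ENNReal.ofReal (B ^ 2))
  constructor
  · have h1 := lintegral_le_of_le_sqrt hgm' hk hpt
    rw [hgI, hI1, ENNReal.ofReal_rpow_of_nonneg (by positivity) (by norm_num),
      ENNReal.ofReal_rpow_of_nonneg hI10 (by norm_num), ← Real.sqrt_eq_rpow, ← Real.sqrt_eq_rpow,
      ← ENNReal.ofReal_mul (Real.sqrt_nonneg _), Real.sqrt_mul (sq_nonneg _), Real.sqrt_sq hB] at h1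
    have hint : Integrable (𝓕 F : H) := ⟨(Lp.memLp _).1, h1.trans_lt ENNReal.ofReal_lt_top⟩
    filter_upwards [norm_le_integral_fourier hint] with x hx
    rw [← ofReal_norm]
    refine ENNReal.ofReal_le_ofReal (hx.trans ?_)
    rw [integral_norm_eq_lintegral_enorm hint.1]
    refine (ENNReal.toReal_le_of_le_ofReal (by positivity) h1).trans ?_
    have : 0 ≤ 2 * √(√I2) * (B * √E) := by positivity
    nlinarith
  · have h1 := lintegral_pow_four_le hgm' hk (by rw [hgI]; exact ENNReal.ofReal_ne_top)
      (lintegral_invSymb_ne_top hφ hα) (lintegral_invSymb_sq_ne_top hφ hα) hpt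
    refine h1.trans ?_
    have e9 : (9 : ℝ≥0∞) = ENNReal.ofReal 9 := by norm_num
    rw [hgI, hI2, e9, ← ENNReal.ofReal_pow (by positivity), ← ENNReal.ofReal_mul (by positivity),
      ← ENNReal.ofReal_mul (by positivity), ← ENNReal.ofReal_pow (by positivity)]
    refine ENNReal.ofReal_le_ofReal ?_
    have h2 : 2 * √(√I2) * B * √E ≤ (√I1 + 2 * √(√I2)) * B * √E := by
      have : 0 ≤ √I1 * B * √E := by positivity
      nlinarith
    refine le_trans ?_ (pow_le_pow_left₀ (by positivity) h2 4)
    have e1 : √(√I2) ^ 4 = I2 := by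
      rw [show √(√I2) ^ 4 = (√(√I2) ^ 2) ^ 2 by ring, Real.sq_sqrt (Real.sqrt_nonneg _),
        Real.sq_sqrt hI20]
    have e2 : √E ^ 4 = E ^ 2 := by
      rw [show √E ^ 4 = (√E ^ 2) ^ 2 by ring, Real.sq_sqrt hE0]
    have e3 : (2 * √(√I2) * B * √E) ^ 4 = 16 * ((B ^ 2 * E) ^ 2 * I2) := by
      rw [show (2 * √(√I2) * B * √E) ^ 4 = 16 * (B ^ 4 * √E ^ 4 * √(√I2) ^ 4) by ring, e1, e2]
      ring
    rw [e3]
    have : 0 ≤ (B ^ 2 * E) ^ 2 * I2 := by positivity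
    linarith

end LowFrequency

/-! ### Multipliers and the nonlinear term -/

section Nonlinear

theorem memLp_top_symbol {σ : V3 → ℝ} (hm : Measurable σ) {K : ℝ} (hK : ∀ ξ, |σ ξ| ≤ K) :
    MemLp (fun ζ => (σ ((2 * Real.pi) • ζ) : ℂ)) ⊤ (volume : Measure V3) :=
  memLp_top_ofReal (b := fun ζ => σ ((2 * Real.pi) • ζ)) (hm.comp (measurable_const_smul _))
    fun _ => hK _

theorem fourier_multiplier {σ : V3 → ℝ} (hm : Measurable σ) {K : ℝ} (hK : ∀ ξ, |σ ξ| ≤ K) (g : H) :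
    (𝓕 (multiplier σ g) : H) =ᵐ[volume]
      fun ζ => (σ ((2 * Real.pi) • ζ) : ℂ) • (𝓕 g : H) ζ := by
  rw [multiplier, FourierTransform.fourier_fourierInv_eq, mulL2_eq (memLp_top_symbol hm hK)]
  exact coeFn_mulC _ _

theorem norm_sq_multiplier {σ : V3 → ℝ} (hm : Measurable σ) {K : ℝ} (hK : ∀ ξ, |σ ξ| ≤ K) (g : H) :
    ‖multiplier σ g‖ ^ 2 = ∫ ζ, σ ((2 * Real.pi) • ζ) ^ 2 * ‖(𝓕 g : H) ζ‖ ^ 2 := by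
  rw [← Lp.norm_fourier_eq, norm_sq_L2]
  refine integral_congr_ae ?_
  filter_upwards [fourier_multiplier hm hK g] with ζ hζ
  rw [hζ, norm_smul, mul_pow, Complex.norm_real, Real.norm_eq_abs, sq_abs]

theorem fourier_injective {f g : H} (h : (𝓕 f : H) = 𝓕 g) : f = g :=
  (Lp.fourierTransformₗᵢ V3 C3).injective h

variable {φ : V3 → ℝ} {α : ℝ}

theorem _root_.NSE.IsCutoff.measurable (hφ : IsCutoff φ) : Measurable φ :=
  hφ.smooth.continuous.measurable

theorem _root_.NSE.IsCutoff.abs_le (hφ : IsCutoff φ) (ξ : V3) : |φ ξ| ≤ 1 :=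
  _root_.abs_le.mpr ⟨by linarith [(hφ.mem_unit ξ).1], (hφ.mem_unit ξ).2⟩

theorem _root_.NSE.IsCutoff.abs_one_sub_le (hφ : IsCutoff φ) (ξ : V3) : |1 - φ ξ| ≤ 1 :=
  _root_.abs_le.mpr ⟨by linarith [(hφ.mem_unit ξ).2], by linarith [(hφ.mem_unit ξ).1]⟩

theorem multiplier_add_multiplier (hφ : IsCutoff φ) (g : H) :
    multiplier φ g + multiplier (fun ξ => 1 - φ ξ) g = g := by
  apply fourier_injective
  rw [FourierAdd.fourier_add]
  apply Lp.ext
  filter_upwards [Lp.coeFn_add (𝓕 (multiplier φ g) : H) (𝓕 (multiplier (fun ξ => 1 - φ ξ) g)),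
    fourier_multiplier hφ.measurable hφ.abs_le g,
    fourier_multiplier (hφ.measurable.const_sub 1) hφ.abs_one_sub_le g] with ζ h1 h2 h3
  rw [h1, Pi.add_apply, h2, h3, ← add_smul]
  simp

theorem norm_sq_high_le (hφ : IsCutoff φ) (hα : α ∈ Ioo (0 : ℝ) (1 / 8)) (g : H) :
    ‖multiplier (fun ξ => 1 - φ ξ) g‖ ^ 2 ≤ symbEnergy φ α (𝓕 g) := by
  rw [norm_sq_multiplier (hφ.measurable.const_sub 1) hφ.abs_one_sub_le, symbEnergy]
  refine integral_mono_of_nonneg (Eventually.of_forall fun ζ => by positivity)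
    (integrable_symb_mul hφ hα _ _) (Eventually.of_forall fun ζ => ?_)
  refine mul_le_mul_of_nonneg_right (le_trans ?_ (one_sub_sq_le_symb _)) (sq_nonneg _)
  have := hφ.mem_unit ((2 * Real.pi) • ζ)
  nlinarith [this.1, this.2]

theorem isLowFrequency_low (hφ : IsCutoff φ) (g : H) :
    IsLowFrequency 1 (𝓕 g) (multiplier φ g) := by
  filter_upwards [fourier_multiplier hφ.measurable hφ.abs_le g] with ζ h
  rw [h, norm_smul, Complex.norm_real, Real.norm_eq_abs]
  split_ifs with h2
  · exact mul_le_mul_of_nonneg_right (hφ.abs_le _) (norm_nonneg _)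
  · rw [hφ.eq_zero _ (not_le.mp h2).le]
    simp

/-- Energy conservation by the nonlinear term: `∫ (w · ∇w) · w = 0` for solenoidal `w`. -/
theorem trilinear_one {w : V3 → V3} (hw : MemLp w 2 volume) {M : ℝ} (hM : ∀ᵐ x, ‖w x‖ ≤ M)
    (hf : Integrable fun ζ => lap ζ * ‖(𝓕 (toL2 w) : H) ζ‖ ^ 2)
    (hs : IsSolenoidal (𝓕 (toL2 w))) : trilinear (fun _ => 1) w = 0 := by
  let D : Fin 3 → H := fun j => 𝓕⁻ (grd j (𝓕 (toL2 w)))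
  have hFD : ∀ j, (𝓕 (D j) : H) = grd j (𝓕 (toL2 w)) := fun j => FourierTransform.fourier_fourierInv_eq _
  have hD : ∀ j, (𝓕 (D j) : H) =ᵐ[volume] fun ζ => dsym j ζ • (𝓕 (toL2 w) : H) ζ := fun j => by
    rw [hFD]
    exact coeFn_grd hf j
  have hΓm : MemLp (fun x => ∑ j, (w x j : ℂ) • D j x) 2 volume :=
    memLp_finsetSum _ fun j _ => memLp_coord_smul hw.1 hM (Lp.memLp (D j)) j
  have hΓ := hΓm.coeFn_toLp
  set Γ : H := hΓm.toLp
  have hFΓ := fourier_convection hw hM hD hs hΓ fun j => coeFn_flux hw hM j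
  have hb1 : MemLp (fun _ : V3 => ((1 : ℝ) : ℂ)) ⊤ volume := memLp_top_const _
  have key := re_integral_divergence hb1 hf hFΓ
  have e1 : ∀ f g : H, ∫ ζ, ((1 : ℝ) : ℂ) * inner ℂ (f ζ) (g ζ) = inner ℂ f g := fun f g => by
    rw [L2.inner_def]
    simp
  have e2 : (inner ℂ (toL2 w) Γ : ℂ) = ∑ j, inner ℂ (flux w j) (D j) := by
    simp only [L2.inner_def]
    rw [← integral_finsetSum _ fun j _ => L2.integrable_inner _ _]
    refine integral_congr_ae ?_
    filter_upwards [hΓ, coeFn_toL2 hw, ae_all_iff.mpr fun j => coeFn_flux hw hM j] with x h1 h2 h3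
    rw [h1, h2, inner_sum]
    refine Finset.sum_congr rfl fun j _ => ?_
    rw [h3, inner_smul_left, inner_smul_right, Complex.conj_ofReal]
  simp only [e1, ← hFD, Lp.inner_fourier_eq] at key
  rw [e2] at key
  have h4 := congrArg Complex.re key
  rw [Complex.neg_re, Complex.re_sum, Complex.re_sum] at h4
  simp only [trilinear, e1, ← hFD, Lp.inner_fourier_eq]
  have h5 : ∀ j, (inner ℂ (flux w j) (D j) : ℂ).re = (inner ℂ (D j) (flux w j) : ℂ).re := fun j => by
    rw [← inner_conj_symm, Complex.conj_re]
  simp only [h5] at h4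
  linarith

theorem enorm_inner_le (f g : H) : ‖(inner ℂ f g : ℂ)‖ₑ ≤ ∫⁻ x, ‖f x‖ₑ * ‖g x‖ₑ := by
  rw [L2.inner_def]
  refine (enorm_integral_le_lintegral_enorm _).trans (lintegral_mono fun x => ?_)
  rw [← ofReal_norm, ← ofReal_norm, ← ofReal_norm, ← ENNReal.ofReal_mul (norm_nonneg _)]
  exact ENNReal.ofReal_le_ofReal (norm_inner_le_norm (𝕜 := ℂ) _ _)

theorem lintegral_enorm_sq (f : H) : ∫⁻ x, ‖f x‖ₑ ^ 2 = ‖f‖ₑ ^ 2 := by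
  rw [← enorm_norm_sq_L2 (Lp.memLp f), Lp.toLp_coeFn]

theorem lintegral_mul_sq_le (f g : H) {a b : ℝ≥0∞} (hf : ‖f‖ₑ ≤ a)
    (hg : ∫⁻ x, ‖g x‖ₑ ^ 4 ≤ b ^ 4) : ∫⁻ x, ‖f x‖ₑ * ‖g x‖ₑ ^ 2 ≤ a * b ^ 2 := by
  have hfm := (Lp.memLp f).1.enorm
  have hgm := ((Lp.memLp g).1.enorm).pow_const 2
  have h := ENNReal.lintegral_mul_le_Lp_mul_Lq volume Real.HolderConjugate.two_two hfm hgm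
  refine h.trans (mul_le_mul' ?_ ?_)
  · simp only [ENNReal.rpow_two]
    rw [lintegral_enorm_sq, ← ENNReal.rpow_two, ← ENNReal.rpow_mul]
    simpa using hf
  · simp only [ENNReal.rpow_two, ← pow_mul]
    refine (ENNReal.rpow_le_rpow hg (by norm_num)).trans (le_of_eq ?_)
    rw [← ENNReal.rpow_natCast, ← ENNReal.rpow_mul, ← ENNReal.rpow_natCast]
    norm_num

/-- The nonlinear term is at most of order `3/2` in the energy. As `∫ (w · ∇w) · w = 0`, the symbol
may be replaced by `1 - symb`, which is supported in the low frequencies. -/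
theorem exists_trilinear_bound (hφ : IsCutoff φ) (hα : α ∈ Ioo (0 : ℝ) (1 / 8)) :
    ∃ C : ℝ, 0 ≤ C ∧ ∀ {w : V3 → V3}, MemLp w 2 volume → ∀ {M : ℝ}, (∀ᵐ x, ‖w x‖ ≤ M) →
      (Integrable fun ζ => lap ζ * ‖(𝓕 (toL2 w) : H) ζ‖ ^ 2) → IsSolenoidal (𝓕 (toL2 w)) →
      |trilinear (fun ζ => symb φ α ((2 * Real.pi) • ζ)) w| ≤
        C * √(symbEnergy φ α (𝓕 (toL2 w))) ^ 3 := by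
  obtain ⟨K, hK0, hK⟩ := exists_lowFrequency_bound hφ hα
  refine ⟨3 * (8 * K ^ 2 + 4 * K), by positivity, fun {w} hw {M} hM hf hs => ?_⟩
  set f : H := 𝓕 (toL2 w) with hfdef
  set E := symbEnergy φ α f with hE
  have hE0 : 0 ≤ E := symbEnergy_nonneg hφ f
  have hb : MemLp (fun ζ => (symb φ α ((2 * Real.pi) • ζ) : ℂ)) ⊤ volume :=
    memLp_top_symbol (continuous_symb hφ hα).measurable (abs_symb_le hφ hα)
  have hb1 : MemLp (fun _ : V3 => ((1 : ℝ) : ℂ)) ⊤ volume := memLp_top_const _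
  have hψ : MemLp (fun ζ => ((1 - symb φ α ((2 * Real.pi) • ζ) : ℝ) : ℂ)) ⊤ volume :=
    memLp_top_symbol (σ := fun ξ => 1 - symb φ α ξ) ((continuous_symb hφ hα).measurable.const_sub 1)
      (K := 1) fun ξ => by
        rw [abs_of_nonneg (one_sub_symb_mem hφ hα ξ).1]
        exact (one_sub_symb_mem hφ hα ξ).2
  have hsplit : trilinear (fun ζ => symb φ α ((2 * Real.pi) • ζ)) w =
      -trilinear (fun ζ => 1 - symb φ α ((2 * Real.pi) • ζ)) w := by
    rw [← zero_sub, ← trilinear_one hw hM hf hs]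
    simp only [trilinear]
    rw [← Finset.sum_sub_distrib]
    refine Finset.sum_congr rfl fun j _ => ?_
    rw [← Complex.sub_re, ← integral_sub (integrable_mul_inner hb1 _ _)
      (integrable_mul_inner hψ _ _)]
    congr 2
    ext ζ
    push_cast
    ring
  -- `A j` is `∂_j w` with the multiplier `1 - symb`
  let A : Fin 3 → H := fun j => 𝓕⁻ (mulC _ hψ (grd j f))
  have hFA : ∀ j, (𝓕 (A j) : H) =ᵐ[volume]
      fun ζ => ((1 - symb φ α ((2 * Real.pi) • ζ) : ℝ) : ℂ) • dsym j ζ • f ζ := fun j => by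
    simp only [A]
    rw [FourierTransform.fourier_fourierInv_eq]
    filter_upwards [coeFn_mulC hψ (grd j f), coeFn_grd hf j] with ζ h1 h2
    rw [h1, h2]
  have hnorm : ∀ j, ∀ᵐ ζ, ‖(𝓕 (A j) : H) ζ‖ ≤
      if ‖(2 * Real.pi) • ζ‖ ≤ 2 then ‖(2 * Real.pi) • ζ‖ * ‖f ζ‖ else 0 := fun j => by
    filter_upwards [hFA j] with ζ h1
    have h2 := one_sub_symb_mem hφ hα ((2 * Real.pi) • ζ)
    rw [h1, norm_smul, norm_smul, Complex.norm_real, Real.norm_of_nonneg h2.1]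
    split_ifs with h
    · have h3 := norm_dsym_le j ζ
      rw [← norm_two_pi_smul] at h3
      exact (mul_le_of_le_one_left (by positivity) h2.2).trans
        (mul_le_mul_of_nonneg_right h3 (norm_nonneg _))
    · rw [symb_eq_one hφ hα (not_le.mp h).le]
      simp
  have hAlow : ∀ j, IsLowFrequency 2 f (A j) := fun j => by
    filter_upwards [hnorm j] with ζ h1
    refine h1.trans ?_
    split_ifs with h
    · exact mul_le_mul_of_nonneg_right h (norm_nonneg _)
    · exact le_rfl
  have hA2 : ∀ j, ‖A j‖ₑ ≤ ENNReal.ofReal (4 * √E) := fun j => by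
    rw [← ofReal_norm]
    refine ENNReal.ofReal_le_ofReal (abs_le_of_sq_le_sq' ?_ (by positivity)).2
    rw [mul_pow, Real.sq_sqrt hE0, ← Lp.norm_fourier_eq, norm_sq_L2, hE, symbEnergy,
      ← integral_const_mul]
    refine integral_mono_ae (integrable_norm_sq _) ((integrable_symb_mul hφ hα _ _).const_mul _) ?_
    filter_upwards [hnorm j] with ζ h1
    have h2 := mul_nonneg (symb_nonneg (α := α) hφ ((2 * Real.pi) • ζ)) (sq_nonneg ‖f ζ‖)
    split_ifs at h1 with h
    · have h3 := mul_le_mul_of_nonneg_right (norm_sq_mul_le_symb hφ hα h) (sq_nonneg ‖f ζ‖)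
      have h4 := pow_le_pow_left₀ (norm_nonneg _) h1 2
      rw [mul_pow] at h4
      linarith
    · rw [norm_le_zero_iff.mp h1]
      simp only [norm_zero]
      linarith
  have hlow := (hK zero_le_one (isLowFrequency_low hφ (toL2 w))).2
  rw [← hfdef, mul_one, ← hE] at hlow
  have hhigh : ‖multiplier (fun ξ => 1 - φ ξ) (toL2 w)‖ₑ ^ 2 ≤ ENNReal.ofReal E := by
    rw [← ofReal_norm, ← ENNReal.ofReal_pow (norm_nonneg _)]
    exact ENNReal.ofReal_le_ofReal (norm_sq_high_le hφ hα (toL2 w))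
  set l := multiplier φ (toL2 w)
  set r := multiplier (fun ξ => 1 - φ ξ) (toL2 w)
  have hbound : ∀ j, ‖(inner ℂ (A j) (flux w j) : ℂ)‖ ≤ (8 * K ^ 2 + 4 * K) * √E ^ 3 := fun j => by
    -- with `w = l + r`: the low frequencies `l` are in `L⁴` and `A j` in `L²`, the high
    -- frequencies `r` in `L²` and `A j` in `L^∞`
    have h1 : ∫⁻ x, ‖A j x‖ₑ * ‖flux w j x‖ₑ ≤
        2 * (∫⁻ x, ‖A j x‖ₑ * ‖l x‖ₑ ^ 2) + 2 * ∫⁻ x, ‖A j x‖ₑ * ‖r x‖ₑ ^ 2 := by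
      have hm : AEMeasurable (fun x => ‖A j x‖ₑ * ‖l x‖ₑ ^ 2) volume :=
        (Lp.memLp (A j)).1.enorm.mul (((Lp.memLp l).1.enorm).pow_const 2)
      rw [← lintegral_const_mul' _ _ (by norm_num), ← lintegral_const_mul' _ _ (by norm_num),
        ← lintegral_add_left' (hm.const_mul 2)]
      refine lintegral_mono_ae ?_
      have hadd : l + r = toL2 w := multiplier_add_multiplier hφ (toL2 w)
      filter_upwards [coeFn_flux hw hM j, coeFn_toL2 hw, Lp.coeFn_add l r] with x h1 h2 h3
      rw [hadd, h2, Pi.add_apply] at h3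
      have h4 : ‖flux w j x‖ ≤ 2 * ‖l x‖ ^ 2 + 2 * ‖r x‖ ^ 2 := by
        rw [h1, norm_smul]
        have h5 : ‖(w x j : ℂ)‖ ≤ ‖complexify (w x)‖ := norm_coord_le (complexify (w x)) j
        have h6 := norm_add_le (l x) (r x)
        rw [← h3] at h6
        have h7 := mul_le_mul_of_nonneg_right h5 (norm_nonneg (complexify (w x)))
        nlinarith [norm_nonneg (complexify (w x)), norm_nonneg (l x), norm_nonneg (r x),
          sq_nonneg (‖l x‖ - ‖r x‖)]
      have h5 : ‖flux w j x‖ₑ ≤ 2 * ‖l x‖ₑ ^ 2 + 2 * ‖r x‖ₑ ^ 2 := by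
        have h6 := ENNReal.ofReal_le_ofReal h4
        rw [ENNReal.ofReal_add (by positivity) (by positivity), ENNReal.ofReal_mul zero_le_two,
          ENNReal.ofReal_mul zero_le_two, ENNReal.ofReal_pow (norm_nonneg _),
          ENNReal.ofReal_pow (norm_nonneg _), ofReal_norm, ofReal_norm, ofReal_norm] at h6
        simpa using h6
      calc ‖A j x‖ₑ * ‖flux w j x‖ₑ ≤ ‖A j x‖ₑ * (2 * ‖l x‖ₑ ^ 2 + 2 * ‖r x‖ₑ ^ 2) := by gcongr
        _ = _ := by ring
    have h2 : ∫⁻ x, ‖A j x‖ₑ * ‖l x‖ₑ ^ 2 ≤ ENNReal.ofReal (4 * √E) * ENNReal.ofReal (K * √E) ^ 2 :=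
      lintegral_mul_sq_le _ _ (hA2 j) hlow
    have h3 : ∫⁻ x, ‖A j x‖ₑ * ‖r x‖ₑ ^ 2 ≤ ENNReal.ofReal (K * 2 * √E) * ENNReal.ofReal E := by
      refine (lintegral_mono_ae (g := fun x => ENNReal.ofReal (K * 2 * √E) * ‖r x‖ₑ ^ 2) ?_).trans ?_
      · filter_upwards [(hK zero_le_two (hAlow j)).1] with x hx
        exact mul_le_mul_left hx _
      · rw [lintegral_const_mul' _ _ ENNReal.ofReal_ne_top, lintegral_enorm_sq]
        gcongr
    have h4 := (enorm_inner_le (A j) (flux w j)).trans (h1.trans (add_le_add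
      (mul_le_mul_right h2 2) (mul_le_mul_right h3 2)))
    have e2 : ∀ x : ℝ≥0∞, 2 * x = ENNReal.ofReal 2 * x := fun x => by norm_num
    rw [e2, e2, ← ENNReal.ofReal_pow (by positivity), ← ENNReal.ofReal_mul (by positivity),
      ← ENNReal.ofReal_mul (by positivity), ← ENNReal.ofReal_mul (by positivity),
      ← ENNReal.ofReal_mul (by positivity), ← ENNReal.ofReal_add (by positivity) (by positivity),
      ← ofReal_norm, ENNReal.ofReal_le_ofReal_iff (by positivity)] at h4
    refine h4.trans (le_of_eq ?_)
    have e3 : E = √E ^ 2 := (Real.sq_sqrt hE0).symm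
    rw [show 2 * (K * 2 * √E * E) = 2 * (K * 2 * √E * √E ^ 2) by rw [← e3]]
    ring
  rw [hsplit, abs_neg]
  have hterm : ∀ j, ∫ ζ, ((1 - symb φ α ((2 * Real.pi) • ζ) : ℝ) : ℂ) *
      inner ℂ (grd j f ζ) ((𝓕 (flux w j) : H) ζ) = inner ℂ (A j) (flux w j) := fun j => by
    rw [integral_mul_inner_eq hψ, ← Lp.inner_fourier_eq (A j)]
    simp only [A]
    rw [FourierTransform.fourier_fourierInv_eq]
  change |∑ j, (∫ ζ, ((1 - symb φ α ((2 * Real.pi) • ζ) : ℝ) : ℂ) *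
      inner ℂ (grd j f ζ) ((𝓕 (flux w j) : H) ζ)).re| ≤ _
  simp only [hterm]
  refine (Finset.abs_sum_le_sum_abs _ _).trans ?_
  calc ∑ j, |(inner ℂ (A j) (flux w j) : ℂ).re| ≤ ∑ _j : Fin 3, (8 * K ^ 2 + 4 * K) * √E ^ 3 :=
        Finset.sum_le_sum fun j _ => (Complex.abs_re_le_norm _).trans (hbound j)
    _ = _ := by simp; ring

end Nonlinear

/-! ### Differentiation of the energy -/

section EnergyDerivative

variable {φ : V3 → ℝ} {α : ℝ}

theorem integrable_wgt_mul {f : H} (hf : Integrable fun ζ => lap ζ * ‖f ζ‖ ^ 2) :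
    Integrable fun ζ => wgt ζ * ‖f ζ‖ ^ 2 := by
  refine (((integrable_norm_sq f).const_mul 2).add hf).mono'
    (continuous_wgt.aestronglyMeasurable.mul (integrable_norm_sq f).1)
    (Eventually.of_forall fun ζ => ?_)
  rw [Real.norm_of_nonneg (mul_nonneg (wgt_pos ζ).le (sq_nonneg _))]
  have h1 : wgt ζ ≤ 2 + lap ζ := by
    rw [wgt, lap]
    nlinarith [sq_nonneg (2 * Real.pi * ‖ζ‖ - 1)]
  calc wgt ζ * ‖f ζ‖ ^ 2 ≤ (2 + lap ζ) * ‖f ζ‖ ^ 2 := by gcongr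
    _ = _ := by simp only [Pi.add_apply]; ring

theorem ae_norm_ne {r : ℝ} (hr : r ≠ 0) : ∀ᵐ ζ : V3, ‖ζ‖ ≠ r := by
  have h := Measure.addHaar_sphere_of_ne_zero (volume : Measure V3) 0 hr
  rw [ae_iff]
  convert h using 2
  ext ζ
  simp

theorem abs_symb_smul_sub_le {K : ℝ} (hK0 : 0 ≤ K)
    (hK : ∀ ξ η, |symb φ α ξ - symb φ α η| ≤ K * ‖ξ - η‖) (s r : ℝ) (ζ : V3) :
    |symb φ α ((2 * Real.pi * s) • ζ) - symb φ α ((2 * Real.pi * r) • ζ)| ≤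
      K * wgt ζ * |s - r| := by
  refine (hK _ _).trans ?_
  rw [← sub_smul, ← mul_sub, norm_smul, norm_mul, Real.norm_of_nonneg (by positivity : 0 ≤ 2 * Real.pi),
    Real.norm_eq_abs]
  have h1 : 2 * Real.pi * ‖ζ‖ ≤ wgt ζ := by rw [wgt]; linarith
  calc K * (2 * Real.pi * |s - r| * ‖ζ‖) = K * (2 * Real.pi * ‖ζ‖) * |s - r| := by ring
    _ ≤ K * wgt ζ * |s - r| := by gcongr

/-- The symbol is Lipschitz continuous, and differentiable except on the sphere `|ξ| = 1/2 + α`,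
which is a null set. -/
theorem hasDerivAt_symb_integral (hφ : IsCutoff φ) (hα : α ∈ Ioo (0 : ℝ) (1 / 8)) {f : H}
    (hf : Integrable fun ζ => lap ζ * ‖f ζ‖ ^ 2) {s₀ : ℝ} (hs : 0 < s₀) :
    (Integrable fun ζ => s₀⁻¹ * radialSymb φ α ((2 * Real.pi * s₀) • ζ) * ‖f ζ‖ ^ 2) ∧
    HasDerivAt (fun s => ∫ ζ, symb φ α ((2 * Real.pi * s) • ζ) * ‖f ζ‖ ^ 2)
      (∫ ζ, s₀⁻¹ * radialSymb φ α ((2 * Real.pi * s₀) • ζ) * ‖f ζ‖ ^ 2) s₀ := by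
  obtain ⟨K, hK0, hK⟩ := exists_lipschitz_symb hφ hα
  have hα0 := hα.1
  have hd : ∀ᵐ ζ : V3, HasDerivAt (fun s => symb φ α ((2 * Real.pi * s) • ζ) * ‖f ζ‖ ^ 2)
      (s₀⁻¹ * radialSymb φ α ((2 * Real.pi * s₀) • ζ) * ‖f ζ‖ ^ 2) s₀ := by
    filter_upwards [ae_norm_ne (r := (1 / 2 + α) / (2 * Real.pi * s₀)) (by positivity)] with ζ hζ
    refine HasDerivAt.mul_const ?_ _
    have h1 : ‖(2 * Real.pi * s₀) • ζ‖ ≠ 1 / 2 + α := by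
      rw [norm_smul, Real.norm_of_nonneg (by positivity)]
      intro h
      exact hζ (by rw [← h]; field_simp)
    have h2 := hasDerivAt_symb_smul hφ hα h1
    have h3 : HasDerivAt (fun s => s₀⁻¹ * s) s₀⁻¹ s₀ := by
      simpa using (hasDerivAt_id s₀).const_mul s₀⁻¹
    have h4 : s₀⁻¹ * s₀ = 1 := inv_mul_cancel₀ hs.ne'
    rw [← h4] at h2
    have h5 := h2.comp s₀ h3
    rw [mul_comm s₀⁻¹]
    refine h5.congr_of_eventuallyEq (Eventually.of_forall fun s => ?_)
    simp only [Function.comp_apply, smul_smul]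
    congr 2
    field_simp
  have hFm : ∀ s : ℝ, Integrable fun ζ => symb φ α ((2 * Real.pi * s) • ζ) * ‖f ζ‖ ^ 2 := fun s =>
    integrable_symb_mul hφ hα _ f
  -- the derivative is measurable as a limit of difference quotients
  have hm' : AEStronglyMeasurable
      (fun ζ => s₀⁻¹ * radialSymb φ α ((2 * Real.pi * s₀) • ζ) * ‖f ζ‖ ^ 2) volume := by
    have hseq : Tendsto (fun n : ℕ => s₀ + 1 / ((n : ℝ) + 1)) atTop (𝓝[≠] s₀) := by
      refine tendsto_nhdsWithin_iff.mpr ⟨?_, Eventually.of_forall fun n => ?_⟩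
      · simpa using tendsto_one_div_add_atTop_nhds_zero_nat.const_add s₀
      · have : (0 : ℝ) < 1 / ((n : ℝ) + 1) := by positivity
        simp only [mem_compl_iff, mem_singleton_iff]
        linarith
    refine aestronglyMeasurable_of_tendsto_ae atTop (f := fun (n : ℕ) ζ =>
      slope (fun s => symb φ α ((2 * Real.pi * s) • ζ) * ‖f ζ‖ ^ 2) s₀ (s₀ + 1 / ((n : ℝ) + 1)))
      (fun n => ?_) ?_
    · simp only [slope_def_field]
      exact (((hFm _).sub (hFm _)).div_const _).1
    · filter_upwards [hd] with ζ hζ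
      exact (hasDerivAt_iff_tendsto_slope.mp hζ).comp hseq
  have hbi : Integrable fun ζ => K * (wgt ζ * ‖f ζ‖ ^ 2) := (integrable_wgt_mul hf).const_mul K
  refine hasDerivAt_integral_of_dominated_loc_of_lip (bound := fun ζ => K * (wgt ζ * ‖f ζ‖ ^ 2))
    univ_mem (Eventually.of_forall fun s => (hFm s).1) (hFm s₀) hm'
    (Eventually.of_forall fun ζ => ?_) hbi hd
  refine (LipschitzWith.of_dist_le_mul fun s r => ?_).lipschitzOnWith
  have h0 : 0 ≤ K * (wgt ζ * ‖f ζ‖ ^ 2) :=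
    mul_nonneg hK0 (mul_nonneg (wgt_pos ζ).le (sq_nonneg _))
  rw [Real.coe_nnabs, abs_of_nonneg h0, Real.dist_eq, Real.dist_eq, ← sub_mul, abs_mul,
    abs_of_nonneg (sq_nonneg ‖f ζ‖)]
  calc _ ≤ K * wgt ζ * |s - r| * ‖f ζ‖ ^ 2 :=
        mul_le_mul_of_nonneg_right (abs_symb_smul_sub_le hK0 hK s r ζ) (sq_nonneg _)
    _ = _ := by ring

theorem integral_norm_mul_norm_le_L2 (f g : H) : ∫ ζ, ‖f ζ‖ * ‖g ζ‖ ≤ ‖f‖ * ‖g‖ := by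
  have h := integral_mul_le_Lp_mul_Lq_of_nonneg (μ := (volume : Measure V3))
    Real.HolderConjugate.two_two (f := fun ζ => ‖f ζ‖) (g := fun ζ => ‖g ζ‖)
    (Eventually.of_forall fun _ => norm_nonneg _) (Eventually.of_forall fun _ => norm_nonneg _)
    (by simpa using (Lp.memLp f).norm) (by simpa using (Lp.memLp g).norm)
  simp only [Real.rpow_two, ← norm_sq_L2, ← Real.sqrt_eq_rpow, Real.sqrt_sq (norm_nonneg _)] at h
  exact h

theorem integrable_norm_mul_norm (f g : H) : Integrable fun ζ => ‖f ζ‖ * ‖g ζ‖ :=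
  (Lp.memLp f).norm.integrable_mul (Lp.memLp g).norm

theorem wgt_mul_abs_le {f g : H} (hf : Integrable fun ζ => lap ζ * ‖f ζ‖ ^ 2)
    (hg : Integrable fun ζ => lap ζ * ‖g ζ‖ ^ 2) {d : H} (hd : d = weighted f - weighted g) :
    ∀ᵐ ζ, wgt ζ * |‖f ζ‖ ^ 2 - ‖g ζ‖ ^ 2| ≤ ‖d ζ‖ * ‖f ζ‖ + ‖d ζ‖ * ‖g ζ‖ := by
  filter_upwards [Lp.coeFn_sub (weighted f) (weighted g), coeFn_weighted hf, coeFn_weighted hg]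
    with ζ e1 e2 e3
  rw [← hd, Pi.sub_apply, e2, e3, ← smul_sub] at e1
  rw [e1, norm_smul, Complex.norm_real, Real.norm_of_nonneg (wgt_pos ζ).le]
  set a := f ζ
  set b := g ζ
  rw [sq_sub_sq, abs_mul, abs_of_nonneg (add_nonneg (norm_nonneg a) (norm_nonneg b))]
  have h3 := abs_norm_sub_norm_le a b
  have h4 := mul_le_mul_of_nonneg_left h3
    (mul_nonneg (wgt_pos ζ).le (add_nonneg (norm_nonneg a) (norm_nonneg b)))
  linarith

theorem integrable_wgt_mul_abs {f g : H} (hf : Integrable fun ζ => lap ζ * ‖f ζ‖ ^ 2)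
    (hg : Integrable fun ζ => lap ζ * ‖g ζ‖ ^ 2) :
    Integrable fun ζ => wgt ζ * |‖f ζ‖ ^ 2 - ‖g ζ‖ ^ 2| := by
  refine ((integrable_norm_mul_norm (weighted f - weighted g) f).add
    (integrable_norm_mul_norm (weighted f - weighted g) g)).mono'
    (continuous_wgt.aestronglyMeasurable.mul
      ((integrable_norm_sq f).sub (integrable_norm_sq g)).1.norm) ?_
  filter_upwards [wgt_mul_abs_le hf hg rfl] with ζ h
  rw [Real.norm_of_nonneg (mul_nonneg (wgt_pos ζ).le (abs_nonneg _))]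
  exact h

theorem integral_wgt_mul_abs_le {f g : H} (hf : Integrable fun ζ => lap ζ * ‖f ζ‖ ^ 2)
    (hg : Integrable fun ζ => lap ζ * ‖g ζ‖ ^ 2) :
    ∫ ζ, wgt ζ * |‖f ζ‖ ^ 2 - ‖g ζ‖ ^ 2| ≤ ‖weighted f - weighted g‖ * (‖f‖ + ‖g‖) := by
  have h1 := integrable_norm_mul_norm (weighted f - weighted g) f
  have h2 := integrable_norm_mul_norm (weighted f - weighted g) g
  refine (integral_mono_ae (integrable_wgt_mul_abs hf hg) (h1.add h2)
    (wgt_mul_abs_le hf hg rfl)).trans ?_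
  rw [mul_add]
  exact (integral_add h1 h2).trans_le
    (add_le_add (integral_norm_mul_norm_le_L2 _ _) (integral_norm_mul_norm_le_L2 _ _))

variable {u₀ : V3 → V3} {u : ℝ → V3 → V3} {G : ℝ → V3 → V3 →L[ℝ] V3}

/-- The derivative of `s E` with respect to the scale `s = (1 - t)^(1/2)`. Both the symbol and the
velocity depend on `s`. -/
theorem IsLerayHopfWith.hasDerivAt_symb_energy (h : IsLerayHopfWith u₀ u G)
    (hb : BoundedBeforeOne u) (hφ : IsCutoff φ) (hα : α ∈ Ioo (0 : ℝ) (1 / 8)) {s₀ : ℝ}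
    (hs : s₀ ∈ Ioo (0 : ℝ) 1) :
    HasDerivAt (fun s => ∫ ζ, symb φ α ((2 * Real.pi * s) • ζ) * ‖velF u (1 - s ^ 2) ζ‖ ^ 2)
      ((∫ ζ, s₀⁻¹ * radialSymb φ α ((2 * Real.pi * s₀) • ζ) * ‖velF u (1 - s₀ ^ 2) ζ‖ ^ 2) +
        rate u (fun ζ => symb φ α ((2 * Real.pi * s₀) • ζ)) (1 - s₀ ^ 2) * (-(2 * s₀))) s₀ := by
  obtain ⟨K, hK0, hK⟩ := exists_lipschitz_symb hφ hα
  have hmem : ∀ s ∈ Ioo (0 : ℝ) 1, 1 - s ^ 2 ∈ Ioo (0 : ℝ) 1 := fun s hs =>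
    ⟨by nlinarith [hs.1, hs.2], by nlinarith [hs.1, hs.2]⟩
  set f₀ := velF u (1 - s₀ ^ 2) with hf₀
  have hl₀ : Integrable fun ζ => lap ζ * ‖f₀ ζ‖ ^ 2 := h.integrable_lap' hb (hmem s₀ hs)
  have hA := (hasDerivAt_symb_integral hφ hα hl₀ hs.1).2
  have hB : HasDerivAt
      (fun s => ∫ ζ, symb φ α ((2 * Real.pi * s₀) • ζ) * ‖velF u (1 - s ^ 2) ζ‖ ^ 2)
      (rate u (fun ζ => symb φ α ((2 * Real.pi * s₀) • ζ)) (1 - s₀ ^ 2) * (-(2 * s₀))) s₀ := by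
    have h1 := h.hasDerivAt_weighted_energy hb (measurable_symb_comp hφ hα (2 * Real.pi * s₀))
      (fun ζ => abs_symb_le hφ hα _) (hmem s₀ hs)
    have h2 : HasDerivAt (fun s : ℝ => 1 - s ^ 2) (-(2 * s₀)) s₀ := by
      simpa using ((hasDerivAt_id s₀).pow 2).const_sub 1
    exact h1.comp s₀ h2
  -- the mixed increment of the symbol and of `|𝓕 u|²` is `o(s - s₀)`: the symbol is Lipschitz
  -- with constant of order `|ζ|`, and `u` is continuous in `H¹`
  let R : ℝ → ℝ := fun s => ∫ ζ, (symb φ α ((2 * Real.pi * s) • ζ) -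
    symb φ α ((2 * Real.pi * s₀) • ζ)) * (‖velF u (1 - s ^ 2) ζ‖ ^ 2 - ‖f₀ ζ‖ ^ 2)
  let err : ℝ → ℝ := fun s => K * (‖weighted (velF u (1 - s ^ 2)) - weighted f₀‖ *
    (‖velF u (1 - s ^ 2)‖ + ‖f₀‖))
  have hRle : ∀ s ∈ Ioo (0 : ℝ) 1, |R s| ≤ err s * |s - s₀| := fun s hs' => by
    have hl := h.integrable_lap' hb (hmem s hs')
    calc |R s| ≤ ∫ ζ, (K * |s - s₀|) * (wgt ζ * |‖velF u (1 - s ^ 2) ζ‖ ^ 2 - ‖f₀ ζ‖ ^ 2|) := by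
          rw [← Real.norm_eq_abs]
          refine norm_integral_le_of_norm_le ((integrable_wgt_mul_abs hl hl₀).const_mul _)
            (Eventually.of_forall fun ζ => ?_)
          rw [norm_mul, Real.norm_eq_abs, Real.norm_eq_abs]
          calc _ ≤ K * wgt ζ * |s - s₀| * |‖velF u (1 - s ^ 2) ζ‖ ^ 2 - ‖f₀ ζ‖ ^ 2| :=
                mul_le_mul_of_nonneg_right (abs_symb_smul_sub_le hK0 hK s s₀ ζ) (abs_nonneg _)
            _ = _ := by ring
      _ = (K * |s - s₀|) * ∫ ζ, wgt ζ * |‖velF u (1 - s ^ 2) ζ‖ ^ 2 - ‖f₀ ζ‖ ^ 2| :=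
          integral_const_mul _ _
      _ ≤ (K * |s - s₀|) * (‖weighted (velF u (1 - s ^ 2)) - weighted f₀‖ *
            (‖velF u (1 - s ^ 2)‖ + ‖f₀‖)) := by
          gcongr
          exact integral_wgt_mul_abs_le hl hl₀
      _ = _ := by simp only [err]; ring
  have herr : Tendsto err (𝓝 s₀) (𝓝 0) := by
    have hc : ContinuousAt (fun s : ℝ => 1 - s ^ 2) s₀ := by fun_prop
    have hn := Ioo_mem_nhds (hmem s₀ hs).1 (hmem s₀ hs).2
    have h1 : Tendsto (fun s : ℝ => weighted (velF u (1 - s ^ 2))) (𝓝 s₀) (𝓝 (weighted f₀)) :=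
      ((h.continuousOn_weighted hb).continuousAt hn).tendsto.comp hc.tendsto
    have h2 : Tendsto (fun s : ℝ => velF u (1 - s ^ 2)) (𝓝 s₀) (𝓝 f₀) :=
      ((h.continuousOn_velF hb).continuousAt hn).tendsto.comp hc.tendsto
    have h3 := ((h1.sub_const (weighted f₀)).norm.mul (h2.norm.add_const ‖f₀‖)).const_mul K
    simpa using h3
  have hR0 : R s₀ = 0 := by simp [R]
  have hR : HasDerivAt R 0 s₀ := by
    rw [hasDerivAt_iff_isLittleO]
    simp only [hR0, sub_zero, smul_zero]
    refine Asymptotics.isLittleO_iff.mpr fun c hc => ?_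
    filter_upwards [Ioo_mem_nhds hs.1 hs.2, herr.eventually_lt_const hc] with s h1 h2
    rw [Real.norm_eq_abs, Real.norm_eq_abs]
    exact (hRle s h1).trans (mul_le_mul_of_nonneg_right h2.le (abs_nonneg _))
  have hsum := ((hA.add hB).add hR).sub_const (∫ ζ, symb φ α ((2 * Real.pi * s₀) • ζ) * ‖f₀ ζ‖ ^ 2)
  rw [add_zero] at hsum
  refine hsum.congr_of_eventuallyEq (Eventually.of_forall fun s => ?_)
  have i1 := integrable_symb_mul hφ hα (2 * Real.pi * s) (velF u (1 - s ^ 2))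
  have i2 := integrable_symb_mul hφ hα (2 * Real.pi * s) f₀
  have i3 := integrable_symb_mul hφ hα (2 * Real.pi * s₀) (velF u (1 - s ^ 2))
  have i4 := integrable_symb_mul hφ hα (2 * Real.pi * s₀) f₀
  have e1 : R s = (∫ ζ, symb φ α ((2 * Real.pi * s) • ζ) * ‖velF u (1 - s ^ 2) ζ‖ ^ 2) -
      (∫ ζ, symb φ α ((2 * Real.pi * s) • ζ) * ‖f₀ ζ‖ ^ 2) -
      ((∫ ζ, symb φ α ((2 * Real.pi * s₀) • ζ) * ‖velF u (1 - s ^ 2) ζ‖ ^ 2) -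
      ∫ ζ, symb φ α ((2 * Real.pi * s₀) • ζ) * ‖f₀ ζ‖ ^ 2) := by
    rw [← integral_sub i1 i2, ← integral_sub i3 i4]
    refine Eq.trans (integral_congr_ae (Eventually.of_forall fun ζ => ?_))
      (integral_sub (i1.sub i2) (i3.sub i4))
    ring
  simp only [Pi.add_apply]
  rw [e1]
  ring

end EnergyDerivative

/-! ### Self-similar variables -/

section Scaling

/-- The rescaled field `c v(c y)`. -/
def dilate (c : ℝ) (v : V3 → V3) (y : V3) : V3 := c • v (c • y)

variable {c : ℝ} {v : V3 → V3}

theorem memLp_dilate (hc : 0 < c) (hv : MemLp v 2 volume) : MemLp (dilate c v) 2 volume :=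
  (MemLp_comp_smul (p := 2) hc hv).const_smul c

theorem ae_norm_dilate_le (hc : 0 < c) {M : ℝ} (hM : ∀ᵐ x, ‖v x‖ ≤ M) :
    ∀ᵐ x, ‖dilate c v x‖ ≤ c * M := by
  filter_upwards [ae_comp_smul hc hM] with x hx
  rw [dilate, norm_smul, Real.norm_of_nonneg hc.le]
  gcongr

theorem fourier_of_ae_eq (hc : 0 < c) {a : ℂ} {f g : H}
    (h : g =ᵐ[volume] fun x => a • f (c • x)) :
    (𝓕 g : H) =ᵐ[volume] fun ζ => (a * ((c ^ 3)⁻¹ : ℝ)) • (𝓕 f : H) (c⁻¹ • ζ) := by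
  have h1 : g =ᵐ[volume] fun x => (a • f : H) (c • x) := by
    filter_upwards [h, ae_comp_smul hc (Lp.coeFn_smul a f)] with x h1 h2
    rw [h1, h2, Pi.smul_apply]
  have h2 := fourier_comp_smul hc h1
  have h3 : (𝓕 (a • f) : H) = a • 𝓕 f := FourierTransform.fourier_smul a f
  rw [h3] at h2
  filter_upwards [h2, ae_comp_smul (inv_pos.mpr hc) (Lp.coeFn_smul a (𝓕 f : H))] with ζ h4 h5
  rw [h4, h5, Pi.smul_apply, ← Complex.coe_smul, smul_smul, mul_comm]

theorem fourier_dilate (hc : 0 < c) (hv : MemLp v 2 volume) :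
    (𝓕 (toL2 (dilate c v)) : H) =ᵐ[volume]
      fun ζ => (((c ^ 2)⁻¹ : ℝ) : ℂ) • (𝓕 (toL2 v) : H) (c⁻¹ • ζ) := by
  have h1 : toL2 (dilate c v) =ᵐ[volume] fun x => (c : ℂ) • toL2 v (c • x) := by
    filter_upwards [coeFn_toL2 (memLp_dilate hc hv), ae_comp_smul hc (coeFn_toL2 hv)] with x h1 h2
    rw [h1, h2]
    ext i
    simp [dilate, complexify]
  filter_upwards [fourier_of_ae_eq hc h1] with ζ h2
  rw [h2]
  congr 1
  push_cast
  field_simp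

theorem fourier_flux_dilate (hc : 0 < c) (hv : MemLp v 2 volume) {M : ℝ} (hM : ∀ᵐ x, ‖v x‖ ≤ M)
    (j : Fin 3) :
    (𝓕 (flux (dilate c v) j) : H) =ᵐ[volume]
      fun ζ => ((c⁻¹ : ℝ) : ℂ) • (𝓕 (flux v j) : H) (c⁻¹ • ζ) := by
  have h1 : flux (dilate c v) j =ᵐ[volume] fun x => ((c ^ 2 : ℝ) : ℂ) • flux v j (c • x) := by
    filter_upwards [coeFn_flux (memLp_dilate hc hv) (ae_norm_dilate_le hc hM) j,
      ae_comp_smul hc (coeFn_flux hv hM j)] with x h1 h2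
    rw [h1, h2]
    ext i
    simp [dilate, complexify]
    ring
  filter_upwards [fourier_of_ae_eq hc h1] with ζ h2
  rw [h2]
  congr 1
  push_cast
  field_simp

theorem fourier_dilate_smul (hc : 0 < c) (hv : MemLp v 2 volume) :
    ∀ᵐ η, (𝓕 (toL2 (dilate c v)) : H) (c • η) =
      (((c ^ 2)⁻¹ : ℝ) : ℂ) • (𝓕 (toL2 v) : H) η := by
  filter_upwards [ae_comp_smul hc (fourier_dilate hc hv)] with η h
  rw [h, inv_smul_smul₀ hc.ne']

theorem integral_eq_comp_smul {E : Type*} [NormedAddCommGroup E] [NormedSpace ℝ E] (hc : 0 < c)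
    (f : V3 → E) : ∫ ζ, f ζ = c ^ 3 • ∫ η, f (c • η) := by
  rw [integral_comp_smul_V3 hc, smul_inv_smul₀ (by positivity)]

theorem integral_norm_sq_dilate (hc : 0 < c) (hv : MemLp v 2 volume) (F : V3 → ℝ) :
    ∫ ζ, F ζ * ‖(𝓕 (toL2 (dilate c v)) : H) ζ‖ ^ 2 =
      c⁻¹ * ∫ η, F (c • η) * ‖(𝓕 (toL2 v) : H) η‖ ^ 2 := by
  rw [integral_eq_comp_smul hc, smul_eq_mul, ← integral_const_mul, ← integral_const_mul]
  refine integral_congr_ae ?_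
  filter_upwards [fourier_dilate_smul hc hv] with η h
  rw [h, norm_smul, Complex.norm_real, Real.norm_of_nonneg (by positivity)]
  field_simp

theorem lap_smul (c : ℝ) (η : V3) : lap (c • η) = c ^ 2 * lap η := by
  rw [lap, lap, norm_smul, Real.norm_eq_abs, mul_pow, mul_pow, mul_pow, mul_pow, sq_abs]
  ring

theorem integrable_lap_dilate (hc : 0 < c) (hv : MemLp v 2 volume)
    (hl : Integrable fun η => lap η * ‖(𝓕 (toL2 v) : H) η‖ ^ 2) :
    Integrable fun ζ => lap ζ * ‖(𝓕 (toL2 (dilate c v)) : H) ζ‖ ^ 2 := by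
  rw [← integrable_comp_smul_iff volume _ hc.ne']
  refine (hl.const_mul (c ^ 2)⁻¹).congr ?_
  filter_upwards [fourier_dilate_smul hc hv] with η h
  rw [h, lap_smul, norm_smul, Complex.norm_real, Real.norm_of_nonneg (by positivity)]
  field_simp

theorem isSolenoidal_dilate (hc : 0 < c) (hv : MemLp v 2 volume)
    (h : IsSolenoidal (𝓕 (toL2 v))) : IsSolenoidal (𝓕 (toL2 (dilate c v))) := by
  filter_upwards [fourier_dilate hc hv, ae_comp_smul (inv_pos.mpr hc) h] with ζ h1 h2
  have h3 : ∑ j, (ζ j : ℂ) * (𝓕 (toL2 (dilate c v)) : H) ζ j =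
      (c : ℂ) * (((c ^ 2)⁻¹ : ℝ) : ℂ) *
        ∑ j, (((c⁻¹ • ζ) j : ℝ) : ℂ) * (𝓕 (toL2 v) : H) (c⁻¹ • ζ) j := by
    rw [h1, Finset.mul_sum]
    refine Finset.sum_congr rfl fun j _ => ?_
    simp only [PiLp.smul_apply, smul_eq_mul]
    have : (c : ℂ) ≠ 0 := by exact_mod_cast hc.ne'
    push_cast
    field_simp
  rw [h3, h2, mul_zero]

theorem dsym_smul (j : Fin 3) (η : V3) : dsym j (c • η) = (c : ℂ) * dsym j η := by
  simp only [dsym, PiLp.smul_apply, smul_eq_mul]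
  push_cast
  ring

/-- The factor `c` is `c³` from the three fields and `c` from the derivative, times `c⁻³` from the
volume. -/
theorem trilinear_dilate (hc : 0 < c) (hv : MemLp v 2 volume) {M : ℝ} (hM : ∀ᵐ x, ‖v x‖ ≤ M)
    (hl : Integrable fun η => lap η * ‖(𝓕 (toL2 v) : H) η‖ ^ 2) (b : V3 → ℝ) :
    trilinear b (dilate c v) = c * trilinear (fun η => b (c • η)) v := by
  rw [trilinear, trilinear, Finset.mul_sum]
  refine Finset.sum_congr rfl fun j _ => ?_
  rw [integral_eq_comp_smul hc, Complex.smul_re, ← Complex.re_ofReal_mul, smul_eq_mul,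
    ← Complex.re_ofReal_mul, ← integral_const_mul, ← integral_const_mul]
  congr 1
  refine integral_congr_ae ?_
  filter_upwards [ae_comp_smul hc (coeFn_grd (integrable_lap_dilate hc hv hl) j),
    fourier_dilate_smul hc hv, coeFn_grd hl j,
    ae_comp_smul hc (fourier_flux_dilate hc hv hM j)] with η h1 h2 h3 h4
  rw [h1, h2, h3, h4, inv_smul_smul₀ hc.ne', dsym_smul, smul_smul, inner_smul_left, inner_smul_left,
    inner_smul_right, map_mul, map_mul, Complex.conj_ofReal, Complex.conj_ofReal]
  have : (c : ℂ) ≠ 0 := by exact_mod_cast hc.ne'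
  push_cast
  field_simp

theorem rescale_eq (u : ℝ → V3 → V3) (τ : ℝ) :
    rescale u τ = dilate (Real.exp (-τ / 2)) (u (1 - Real.exp (-τ / 2) ^ 2)) := by
  have : Real.exp (-τ / 2) ^ 2 = Real.exp (-τ) := by
    rw [← Real.exp_nat_mul]
    congr 1
    push_cast
    ring
  rw [this]
  rfl

variable {φ : V3 → ℝ} {α : ℝ}

theorem abs_chi_le (hφ : IsCutoff φ) (hα : α ∈ Ioo (0 : ℝ) (1 / 8)) (ξ : V3) :
    |chi φ α ξ| ≤ 1 := by
  have h1 := chi_sq (φ := φ) hα ξ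
  have h2 := min_rpow_mem_Icc hα ξ
  have h3 := hφ.sq_mem ξ
  rw [← abs_one, ← sq_le_sq, h1, one_pow]
  exact mul_le_one₀ h2.2 h3.1 h3.2

theorem measurable_chi (hφ : IsCutoff φ) : Measurable (chi φ α) := by
  refine Measurable.ite (measurableSet_le measurable_norm measurable_const) ?_ ?_
  · exact (measurable_norm.pow_const _).mul hφ.measurable
  · exact hφ.measurable.const_mul _

/-- Plancherel, with the frequency `ξ = 2πζ` of the kernel `e^(-ix·ξ)`. -/
theorem energy_eq (hφ : IsCutoff φ) (hα : α ∈ Ioo (0 : ℝ) (1 / 8)) (u : ℝ → V3 → V3) (τ : ℝ) :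
    energy φ α u τ = symbEnergy φ α (𝓕 (toL2 (rescale u τ))) := by
  have hm : Measurable fun ξ => √(1 - φ ξ ^ 2) := (hφ.measurable.pow_const 2).const_sub 1 |>.sqrt
  have hK : ∀ ξ, |√(1 - φ ξ ^ 2)| ≤ 1 := fun ξ => by
    rw [abs_of_nonneg (Real.sqrt_nonneg _), Real.sqrt_le_one]
    linarith [(hφ.sq_mem ξ).1]
  have hi : ∀ {σ : V3 → ℝ}, Measurable σ → (∀ ξ, |σ ξ| ≤ 1) → Integrable fun ζ =>
      σ ((2 * Real.pi) • ζ) ^ 2 * ‖(𝓕 (toL2 (rescale u τ)) : H) ζ‖ ^ 2 := fun {σ} h1 h2 =>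
    (integrable_norm_sq _).bdd_mul (c := 1)
      ((h1.comp (measurable_const_smul _)).pow_const 2).aestronglyMeasurable
      (Eventually.of_forall fun ζ => by
        rw [norm_pow, Real.norm_eq_abs]
        exact pow_le_one₀ (abs_nonneg _) (h2 _))
  rw [energy, lowTilde, highTilde, norm_sq_multiplier (measurable_chi hφ) (abs_chi_le hφ hα),
    norm_sq_multiplier hm hK,
    ← integral_add (hi (measurable_chi hφ) (abs_chi_le hφ hα)) (hi hm hK)]
  refine integral_congr_ae (Eventually.of_forall fun ζ => ?_)
  simp only [symb]
  rw [Real.sq_sqrt (sub_nonneg.mpr (hφ.sq_mem _).2)]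
  ring

theorem energy_nonneg (φ : V3 → ℝ) (α : ℝ) (u : ℝ → V3 → V3) (τ : ℝ) : 0 ≤ energy φ α u τ := by
  rw [energy]
  positivity

/-- The dissipation of the energy: the energy of `∇w`. -/
def dissipation (φ : V3 → ℝ) (α : ℝ) (u : ℝ → V3 → V3) (τ : ℝ) : ℝ :=
  ∫ ζ, symb φ α ((2 * Real.pi) • ζ) * lap ζ * ‖(𝓕 (toL2 (rescale u τ)) : H) ζ‖ ^ 2

theorem dissipation_nonneg (hφ : IsCutoff φ) (u : ℝ → V3 → V3) (τ : ℝ) :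
    0 ≤ dissipation φ α u τ :=
  integral_nonneg fun _ =>
    mul_nonneg (mul_nonneg (symb_nonneg hφ _) (lap_nonneg _)) (sq_nonneg _)

variable {u₀ : V3 → V3} {u : ℝ → V3 → V3} {G : ℝ → V3 → V3 →L[ℝ] V3}

theorem exp_neg_half_mem {τ : ℝ} (hτ : 0 < τ) : Real.exp (-τ / 2) ∈ Ioo (0 : ℝ) 1 :=
  ⟨Real.exp_pos _, Real.exp_lt_one_iff.mpr (by linarith)⟩

theorem one_sub_exp_sq_mem {τ : ℝ} (hτ : 0 < τ) :
    1 - Real.exp (-τ / 2) ^ 2 ∈ Ioo (0 : ℝ) 1 := by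
  have h := exp_neg_half_mem hτ
  exact ⟨by nlinarith [h.1, h.2], by nlinarith [h.1, h.2]⟩

namespace IsLerayHopfWith

theorem memLp_rescale (h : IsLerayHopfWith u₀ u G) {τ : ℝ} (hτ : 0 ≤ τ) :
    MemLp (rescale u τ) 2 volume := by
  have h1 : Real.exp (-τ) ≤ 1 := Real.exp_le_one_iff.mpr (by linarith)
  exact memLp_dilate (Real.exp_pos _) (h.memLp _ ⟨by linarith, by linarith [Real.exp_pos (-τ)]⟩)

theorem ae_norm_rescale_le (hb : BoundedBeforeOne u) {τ : ℝ} (hτ : 0 < τ) :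
    ∃ M, ∀ᵐ x, ‖rescale u τ x‖ ≤ M := by
  have ht := one_sub_exp_sq_mem hτ
  obtain ⟨M, hM⟩ := hb _ _ ht.1 ht.2
  rw [rescale_eq]
  exact ⟨_, ae_norm_dilate_le (Real.exp_pos _) (hM _ ⟨le_rfl, le_rfl⟩)⟩

theorem integrable_lap_rescale (h : IsLerayHopfWith u₀ u G) (hb : BoundedBeforeOne u) {τ : ℝ}
    (hτ : 0 < τ) : Integrable fun ζ => lap ζ * ‖(𝓕 (toL2 (rescale u τ)) : H) ζ‖ ^ 2 := by
  have ht := one_sub_exp_sq_mem hτ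
  rw [rescale_eq]
  exact integrable_lap_dilate (Real.exp_pos _) (h.memLp' ht) (h.integrable_lap' hb ht)

theorem isSolenoidal_rescale (h : IsLerayHopfWith u₀ u G) {τ : ℝ} (hτ : 0 < τ) :
    IsSolenoidal (𝓕 (toL2 (rescale u τ))) := by
  have ht := one_sub_exp_sq_mem hτ
  rw [rescale_eq]
  exact isSolenoidal_dilate (Real.exp_pos _) (h.memLp' ht) (h.isSolenoidal_velF ht)

/-- The energy in terms of `u` at time `t = 1 - e^(-τ)`; here `e^(-τ/2) = (1 - t)^(1/2)`. -/
theorem energy_eq_scaled (h : IsLerayHopfWith u₀ u G) (hφ : IsCutoff φ)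
    (hα : α ∈ Ioo (0 : ℝ) (1 / 8)) {τ : ℝ} (hτ : 0 ≤ τ) :
    energy φ α u τ = (Real.exp (-τ / 2))⁻¹ *
      ∫ ζ, symb φ α ((2 * Real.pi * Real.exp (-τ / 2)) • ζ) *
        ‖velF u (1 - Real.exp (-τ / 2) ^ 2) ζ‖ ^ 2 := by
  have h1 : Real.exp (-τ / 2) ∈ Ioc (0 : ℝ) 1 :=
    ⟨Real.exp_pos _, Real.exp_le_one_iff.mpr (by linarith)⟩
  have h2 : 1 - Real.exp (-τ / 2) ^ 2 ∈ Ico (0 : ℝ) 1 :=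
    ⟨by nlinarith [h1.1, h1.2], by nlinarith [h1.1, h1.2]⟩
  rw [energy_eq hφ hα, rescale_eq, symbEnergy,
    integral_norm_sq_dilate (Real.exp_pos _) (h.memLp _ h2)
      fun ζ => symb φ α ((2 * Real.pi) • ζ)]
  simp only [smul_smul]
  rfl

/-- The derivative of the energy consists of the radial derivative of the symbol, the viscous term
and the nonlinear term; the first two are estimated together by `linear_symb_le`. -/
theorem hasDerivAt_energy (h : IsLerayHopfWith u₀ u G) (hb : BoundedBeforeOne u)
    (hφ : IsCutoff φ) (hα : α ∈ Ioo (0 : ℝ) (1 / 8)) {τ : ℝ} (hτ : 0 < τ) :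
    ∃ E' : ℝ, HasDerivAt (energy φ α u) E' τ ∧
      E' ≤ -(2 * α) * energy φ α u τ - 2 * α ^ 2 * dissipation φ α u τ +
        2 * trilinear (fun ζ => symb φ α ((2 * Real.pi) • ζ)) (rescale u τ) := by
  have ht := one_sub_exp_sq_mem hτ
  have hs := exp_neg_half_mem hτ
  have hE := h.energy_eq_scaled hφ hα hτ.le
  have hds : HasDerivAt (fun τ : ℝ => Real.exp (-τ / 2)) (-(1 / 2) * Real.exp (-τ / 2)) τ := by
    have h1 : HasDerivAt (fun τ : ℝ => -τ / 2) (-(1 / 2)) τ := by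
      simpa [neg_div] using ((hasDerivAt_id τ).neg).div_const 2
    simpa [mul_comm] using h1.exp
  let N₀ : ℝ → ℝ := fun s => s⁻¹ *
    ∫ ζ, symb φ α ((2 * Real.pi * s) • ζ) * ‖velF u (1 - s ^ 2) ζ‖ ^ 2
  have hev : energy φ α u =ᶠ[𝓝 τ] N₀ ∘ fun τ => Real.exp (-τ / 2) := by
    filter_upwards [lt_mem_nhds hτ] with r hr using h.energy_eq_scaled hφ hα (le_of_lt hr)
  have hN := (hasDerivAt_inv hs.1.ne').mul (h.hasDerivAt_symb_energy hb hφ hα hs)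
  change HasDerivAt N₀ _ _ at hN
  have hM : ∃ M, ∀ᵐ x, ‖u (1 - Real.exp (-τ / 2) ^ 2) x‖ ≤ M :=
    let ⟨M, hM⟩ := hb _ _ ht.1 ht.2
    ⟨M, hM _ ⟨le_rfl, le_rfl⟩⟩
  obtain ⟨M, hM⟩ := hM
  have hv := h.memLp' ht
  have hl := h.integrable_lap' hb ht
  have htri : trilinear (fun ζ => symb φ α ((2 * Real.pi) • ζ)) (rescale u τ) =
      Real.exp (-τ / 2) * trilinear (fun ζ => symb φ α ((2 * Real.pi * Real.exp (-τ / 2)) • ζ))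
        (u (1 - Real.exp (-τ / 2) ^ 2)) := by
    rw [rescale_eq, trilinear_dilate hs.1 hv hM hl]
    simp only [smul_smul]
  have hD : dissipation φ α u τ = (Real.exp (-τ / 2))⁻¹ * ∫ ζ,
      symb φ α ((2 * Real.pi * Real.exp (-τ / 2)) • ζ) * (Real.exp (-τ / 2) ^ 2 *
        (lap ζ * ‖velF u (1 - Real.exp (-τ / 2) ^ 2) ζ‖ ^ 2)) := by
    rw [dissipation, rescale_eq, integral_norm_sq_dilate hs.1 hv
      fun ζ => symb φ α ((2 * Real.pi) • ζ) * lap ζ]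
    simp only [smul_smul, lap_smul, mul_assoc]
    rfl
  refine ⟨_, (hN.comp τ hds).congr_of_eventuallyEq hev, ?_⟩
  rw [htri, hE, hD, rate]
  set s := Real.exp (-τ / 2)
  have hs0 : 0 < s := hs.1
  set f := velF u (1 - s ^ 2)
  set T := trilinear (fun ζ => symb φ α ((2 * Real.pi * s) • ζ)) (u (1 - s ^ 2))
  have i1 := integrable_symb_mul hφ hα (2 * Real.pi * s) f
  have i2 := (hasDerivAt_symb_integral hφ hα hl hs0).1
  have i3 := integrable_mul_lap (measurable_symb_comp hφ hα (2 * Real.pi * s))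
    (fun ζ => abs_symb_le hφ hα _) hl
  have i4 : Integrable fun ζ => symb φ α ((2 * Real.pi * s) • ζ) * (s ^ 2 * (lap ζ * ‖f ζ‖ ^ 2)) :=
    (i3.const_mul (s ^ 2)).congr (Eventually.of_forall fun ζ => by ring)
  have e4 : ∫ ζ, symb φ α ((2 * Real.pi * s) • ζ) * (s ^ 2 * (lap ζ * ‖f ζ‖ ^ 2)) =
      s ^ 2 * ∫ ζ, symb φ α ((2 * Real.pi * s) • ζ) * (lap ζ * ‖f ζ‖ ^ 2) := by
    rw [← integral_const_mul]
    congr 1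
    ext ζ
    ring
  have e2 : ∫ ζ, s⁻¹ * radialSymb φ α ((2 * Real.pi * s) • ζ) * ‖f ζ‖ ^ 2 =
      s⁻¹ * ∫ ζ, radialSymb φ α ((2 * Real.pi * s) • ζ) * ‖f ζ‖ ^ 2 := by
    rw [← integral_const_mul]
    congr 1
    ext ζ
    ring
  have i2' : Integrable fun ζ => radialSymb φ α ((2 * Real.pi * s) • ζ) * ‖f ζ‖ ^ 2 :=
    (i2.const_mul s).congr (Eventually.of_forall fun ζ => by field_simp)
  have i12 : Integrable fun ζ => (1 / 2) * (symb φ α ((2 * Real.pi * s) • ζ) * ‖f ζ‖ ^ 2 -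
      radialSymb φ α ((2 * Real.pi * s) • ζ) * ‖f ζ‖ ^ 2) := (i1.sub i2').const_mul (1 / 2)
  have key : (1 / 2) * ((∫ ζ, symb φ α ((2 * Real.pi * s) • ζ) * ‖f ζ‖ ^ 2) -
        ∫ ζ, radialSymb φ α ((2 * Real.pi * s) • ζ) * ‖f ζ‖ ^ 2) -
      2 * ∫ ζ, symb φ α ((2 * Real.pi * s) • ζ) * (s ^ 2 * (lap ζ * ‖f ζ‖ ^ 2)) ≤
      -(2 * α) * (∫ ζ, symb φ α ((2 * Real.pi * s) • ζ) * ‖f ζ‖ ^ 2) -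
        2 * α ^ 2 * ∫ ζ, symb φ α ((2 * Real.pi * s) • ζ) * (s ^ 2 * (lap ζ * ‖f ζ‖ ^ 2)) := by
    rw [← integral_sub i1 i2', ← integral_const_mul, ← integral_const_mul, ← integral_const_mul,
      ← integral_const_mul, ← integral_sub i12 (i4.const_mul 2),
      ← integral_sub (i1.const_mul (-(2 * α))) (i4.const_mul (2 * α ^ 2))]
    refine integral_mono_ae (i12.sub (i4.const_mul 2))
      ((i1.const_mul (-(2 * α))).sub (i4.const_mul (2 * α ^ 2))) ?_
    filter_upwards [ae_norm_ne (r := (1 / 2 + α) / (2 * Real.pi * s))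
      (by have := hα.1; positivity)] with ζ hζ
    have h1 : ‖(2 * Real.pi * s) • ζ‖ ≠ 1 / 2 + α := by
      rw [norm_smul, Real.norm_of_nonneg (by positivity)]
      intro h
      exact hζ (by rw [← h]; field_simp)
    have h2 := mul_le_mul_of_nonneg_right (linear_symb_le hφ hα h1) (sq_nonneg ‖f ζ‖)
    have h3 : ‖(2 * Real.pi * s) • ζ‖ ^ 2 = s ^ 2 * lap ζ := by
      rw [norm_smul, Real.norm_of_nonneg (by positivity), lap]
      ring
    rw [h3] at h2
    linarith
  rw [e2]
  rw [e4] at key ⊢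
  set N := ∫ ζ, symb φ α ((2 * Real.pi * s) • ζ) * ‖f ζ‖ ^ 2
  set R := ∫ ζ, radialSymb φ α ((2 * Real.pi * s) • ζ) * ‖f ζ‖ ^ 2
  set L := ∫ ζ, symb φ α ((2 * Real.pi * s) • ζ) * (lap ζ * ‖f ζ‖ ^ 2)
  have h5 := mul_le_mul_of_nonneg_left key (inv_pos.mpr hs0).le
  have e5 : (-(s ^ 2)⁻¹ * N + s⁻¹ * (s⁻¹ * R + (-2 * L + 2 * T) * -(2 * s))) * (-(1 / 2) * s) =
      s⁻¹ * (1 / 2 * (N - R) - 2 * (s ^ 2 * L)) + 2 * (s * T) := by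
    field_simp
    ring
  rw [e5]
  linarith

end IsLerayHopfWith

end Scaling

/-! ### Decay of the energy -/

section Decay

/-- A barrier argument: the differential inequality `E' ≤ -a E` is known only where `E` is below a
threshold, which it starts below and hence never reaches. -/
theorem le_exp_of_deriv_le_below {E : ℝ → ℝ} {a b : ℝ} (ha : 0 ≤ a) (hE : ∀ τ, 0 ≤ E τ)
    (hc : ContinuousOn E (Ici 0)) (hd : ∀ τ, 0 < τ → DifferentiableAt ℝ E τ)
    (hle : ∀ τ, 0 < τ → E τ ≤ b → deriv E τ ≤ -a * E τ) (h0 : E 0 < b) {τ : ℝ} (hτ : 0 ≤ τ) :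
    E τ ≤ Real.exp (-a * τ) * E 0 := by
  have hlt : ∀ τ, 0 ≤ τ → E τ < b := by
    by_contra! hcon
    obtain ⟨r, hr0, hr⟩ := hcon
    have hcl : IsCompact (Icc 0 r ∩ E ⁻¹' Ici b) :=
      isCompact_Icc.of_isClosed_subset ((hc.mono Icc_subset_Ici_self).preimage_isClosed_of_isClosed
        isClosed_Icc isClosed_Ici) inter_subset_left
    obtain ⟨T, ⟨hT, hTb⟩, hmin⟩ := hcl.exists_isLeast ⟨r, ⟨hr0, le_rfl⟩, hr⟩
    have hbelow : ∀ x ∈ Ioo 0 T, E x < b := fun x hx => by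
      by_contra! hx'
      exact (hmin ⟨⟨hx.1.le, hx.2.le.trans hT.2⟩, hx'⟩).not_gt hx.2
    have hanti : AntitoneOn E (Icc 0 T) := by
      refine antitoneOn_of_deriv_nonpos (convex_Icc 0 T) (hc.mono Icc_subset_Ici_self) ?_ ?_
      · rw [interior_Icc]
        exact fun x hx => (hd x hx.1).differentiableWithinAt
      · rw [interior_Icc]
        intro x hx
        refine (hle x hx.1 (hbelow x hx).le).trans ?_
        have := mul_nonneg ha (hE x)
        linarith
    have h1 : E T ≤ E 0 := hanti ⟨le_rfl, hT.1⟩ ⟨hT.1, le_rfl⟩ hT.1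
    have h2 : b ≤ E T := hTb
    linarith
  have hder : ∀ x, 0 < x → HasDerivAt (fun τ => Real.exp (a * τ) * E τ)
      (Real.exp (a * x) * a * E x + Real.exp (a * x) * deriv E x) x := fun x hx => by
    have h1 : HasDerivAt (fun τ => a * τ) a x := by simpa using (hasDerivAt_id x).const_mul a
    exact h1.exp.mul (hd x hx).hasDerivAt
  have hanti : AntitoneOn (fun τ => Real.exp (a * τ) * E τ) (Ici 0) := by
    refine antitoneOn_of_deriv_nonpos (convex_Ici 0)
      ((by fun_prop : Continuous fun τ => Real.exp (a * τ)).continuousOn.mul hc) ?_ ?_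
    · rw [interior_Ici]
      exact fun x hx => (hder x hx).differentiableAt.differentiableWithinAt
    · rw [interior_Ici]
      intro x hx
      rw [(hder x hx).deriv]
      have h1 := hle x hx (hlt x (le_of_lt hx)).le
      have h2 := mul_le_mul_of_nonneg_left h1 (Real.exp_pos (a * x)).le
      linarith
  have h3 := hanti (mem_Ici.mpr le_rfl) (mem_Ici.mpr hτ) hτ
  simp only [mul_zero, Real.exp_zero, one_mul] at h3
  have h4 := mul_le_mul_of_nonneg_left h3 (Real.exp_pos (-a * τ)).le
  rw [← mul_assoc, ← Real.exp_add] at h4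
  simpa using h4

variable {φ : V3 → ℝ} {α : ℝ} {u₀ : V3 → V3} {u : ℝ → V3 → V3} {G : ℝ → V3 → V3 →L[ℝ] V3}

namespace IsLerayHopfWith

theorem memLp_initial (h : IsLerayHopfWith u₀ u G) : MemLp u₀ 2 volume :=
  (memLp_congr_ae h.initial).mp (h.memLp 0 ⟨le_rfl, one_pos⟩)

theorem energy_zero_le (h : IsLerayHopfWith u₀ u G) (hφ : IsCutoff φ)
    (hα : α ∈ Ioo (0 : ℝ) (1 / 8)) : energy φ α u 0 ≤ ∫ x, ‖u₀ x‖ ^ 2 := by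
  have h1 : ‖vel u 0‖ ^ 2 = ∫ x, ‖u₀ x‖ ^ 2 := by
    rw [vel, toL2_congr h.initial, norm_sq_toL2 h.memLp_initial]
  rw [h.energy_eq_scaled hφ hα le_rfl, ← h1, ← norm_velF, norm_sq_L2]
  simp only [neg_zero, zero_div, Real.exp_zero, inv_one, one_mul, one_pow, sub_self]
  refine integral_mono (integrable_symb_mul hφ hα _ _) (integrable_norm_sq _) fun ζ => ?_
  exact mul_le_of_le_one_left (sq_nonneg _) ((le_abs_self _).trans (abs_symb_le hφ hα _))

theorem tendsto_velF_zero (h : IsLerayHopfWith u₀ u G) :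
    Tendsto (velF u) (𝓝[>] 0) (𝓝 (velF u 0)) := by
  have h1 : Tendsto (vel u) (𝓝[>] 0) (𝓝 (vel u 0)) := by
    rw [tendsto_iff_edist_tendsto_0]
    refine h.initial_L2.congr' ?_
    filter_upwards [Ioo_mem_nhdsGT (one_pos (α := ℝ))] with t ht
    rw [edist_eq_enorm_sub, vel, vel, toL2_congr h.initial,
      ← toL2_sub (h.memLp' ht) h.memLp_initial]
    exact (enorm_toL2 ((h.memLp' ht).sub h.memLp_initial)).symm
  exact ((Lp.fourierTransformₗᵢ V3 C3).continuous.tendsto (vel u 0)).comp h1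

/-- The energy is continuous at `τ = 0` because the initial datum is attained in `L²`. -/
theorem tendsto_energy_zero (h : IsLerayHopfWith u₀ u G) (hφ : IsCutoff φ)
    (hα : α ∈ Ioo (0 : ℝ) (1 / 8)) :
    Tendsto (energy φ α u) (𝓝[>] 0) (𝓝 (energy φ α u 0)) := by
  have hs : Tendsto (fun τ : ℝ => Real.exp (-τ / 2)) (𝓝[>] 0) (𝓝 1) := by
    have : Continuous fun τ : ℝ => Real.exp (-τ / 2) := by fun_prop
    simpa using (this.tendsto 0).mono_left nhdsWithin_le_nhds
  have ht : Tendsto (fun τ : ℝ => 1 - Real.exp (-τ / 2) ^ 2) (𝓝[>] 0) (𝓝[>] 0) := by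
    refine tendsto_nhdsWithin_iff.mpr ⟨by simpa using (hs.pow 2).const_sub 1, ?_⟩
    filter_upwards [self_mem_nhdsWithin] with τ hτ using (one_sub_exp_sq_mem hτ).1
  have hU := h.tendsto_velF_zero.comp ht
  set f₀ := velF u 0
  have h1 : Tendsto (fun τ : ℝ => ∫ ζ, symb φ α ((2 * Real.pi * Real.exp (-τ / 2)) • ζ) * ‖f₀ ζ‖ ^ 2)
      (𝓝[>] 0) (𝓝 (∫ ζ, symb φ α ((2 * Real.pi * 1) • ζ) * ‖f₀ ζ‖ ^ 2)) := by
    refine tendsto_integral_filter_of_dominated_convergence (fun ζ => ‖f₀ ζ‖ ^ 2)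
      (Eventually.of_forall fun τ => (integrable_symb_mul hφ hα _ _).1)
      (Eventually.of_forall fun τ => Eventually.of_forall fun ζ => ?_) (integrable_norm_sq _)
      (Eventually.of_forall fun ζ => ?_)
    · rw [norm_mul, Real.norm_eq_abs, Real.norm_of_nonneg (sq_nonneg ‖f₀ ζ‖)]
      exact mul_le_of_le_one_left (sq_nonneg _) (abs_symb_le hφ hα _)
    · exact (((continuous_symb hφ hα).tendsto _).comp
        ((hs.const_mul (2 * Real.pi)).smul_const ζ)).mul_const _
  have h2 : Tendsto (fun τ : ℝ => ∫ ζ, symb φ α ((2 * Real.pi * Real.exp (-τ / 2)) • ζ) *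
      (‖velF u (1 - Real.exp (-τ / 2) ^ 2) ζ‖ ^ 2 - ‖f₀ ζ‖ ^ 2)) (𝓝[>] 0) (𝓝 0) := by
    have h3 : Tendsto (fun τ : ℝ => ‖velF u (1 - Real.exp (-τ / 2) ^ 2) - f₀‖ *
        ‖velF u (1 - Real.exp (-τ / 2) ^ 2)‖ + ‖velF u (1 - Real.exp (-τ / 2) ^ 2) - f₀‖ * ‖f₀‖)
        (𝓝[>] 0) (𝓝 0) := by
      have h4 := (hU.sub_const f₀).norm
      rw [sub_self, norm_zero] at h4
      simpa using (h4.mul hU.norm).add (h4.mul_const ‖f₀‖)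
    refine squeeze_zero_norm (fun τ => ?_) h3
    obtain ⟨f, hf⟩ : ∃ f, f = velF u (1 - Real.exp (-τ / 2) ^ 2) := ⟨_, rfl⟩
    rw [← hf]
    have i1 := integrable_norm_mul_norm (f - f₀) f
    have i2 := integrable_norm_mul_norm (f - f₀) f₀
    refine (norm_integral_le_of_norm_le (i1.add i2) ?_).trans ((integral_add i1 i2).trans_le
      (add_le_add (integral_norm_mul_norm_le_L2 _ _) (integral_norm_mul_norm_le_L2 _ _)))
    filter_upwards [Lp.coeFn_sub f f₀] with ζ hζ
    rw [Pi.sub_apply] at hζ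
    have h5 := abs_norm_sub_norm_le (f ζ) (f₀ ζ)
    rw [← hζ] at h5
    rw [norm_mul, Real.norm_eq_abs, Real.norm_eq_abs]
    refine (mul_le_of_le_one_left (abs_nonneg _) (abs_symb_le hφ hα _)).trans ?_
    rw [sq_sub_sq, abs_mul, abs_of_nonneg (add_nonneg (norm_nonneg (f ζ)) (norm_nonneg (f₀ ζ)))]
    have h6 := mul_le_mul_of_nonneg_left h5 (add_nonneg (norm_nonneg (f ζ)) (norm_nonneg (f₀ ζ)))
    simp only [Pi.add_apply]
    linarith
  have h3 := (hs.inv₀ one_ne_zero).mul (h1.add h2)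
  have e0 : energy φ α u 0 = 1⁻¹ * ((∫ ζ, symb φ α ((2 * Real.pi * 1) • ζ) * ‖f₀ ζ‖ ^ 2) + 0) := by
    rw [h.energy_eq_scaled hφ hα le_rfl, add_zero]
    simp only [neg_zero, zero_div, Real.exp_zero, one_pow, sub_self, f₀]
  rw [e0]
  refine h3.congr' ?_
  filter_upwards [self_mem_nhdsWithin] with τ hτ
  rw [h.energy_eq_scaled hφ hα (le_of_lt hτ)]
  set f := velF u (1 - Real.exp (-τ / 2) ^ 2)
  have i1 := integrable_symb_mul hφ hα (2 * Real.pi * Real.exp (-τ / 2)) f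
  have i2 := integrable_symb_mul hφ hα (2 * Real.pi * Real.exp (-τ / 2)) f₀
  have e1 : ∫ ζ, symb φ α ((2 * Real.pi * Real.exp (-τ / 2)) • ζ) * (‖f ζ‖ ^ 2 - ‖f₀ ζ‖ ^ 2) =
      (∫ ζ, symb φ α ((2 * Real.pi * Real.exp (-τ / 2)) • ζ) * ‖f ζ‖ ^ 2) -
      ∫ ζ, symb φ α ((2 * Real.pi * Real.exp (-τ / 2)) • ζ) * ‖f₀ ζ‖ ^ 2 := by
    rw [← integral_sub i1 i2]
    congr 1
    ext ζ
    ring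
  rw [e1]
  ring

end IsLerayHopfWith

/-- Below a threshold the linear decay absorbs the nonlinear term. The factor `2` in the threshold
lets solutions with `E(0) ≤ δ₀` start strictly below it. -/
theorem exists_energy_threshold (hφ : IsCutoff φ) (hα : α ∈ Ioo (0 : ℝ) (1 / 8)) :
    ∃ δ₀ : ℝ, 0 < δ₀ ∧ ∀ {u₀ : V3 → V3} {u : ℝ → V3 → V3} {G : ℝ → V3 → V3 →L[ℝ] V3},
      IsLerayHopfWith u₀ u G → BoundedBeforeOne u → ∀ τ, 0 < τ →
        DifferentiableAt ℝ (energy φ α u) τ ∧ (energy φ α u τ ≤ 2 * δ₀ →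
          deriv (energy φ α u) τ ≤ -α * energy φ α u τ - 2 * α ^ 2 * dissipation φ α u τ) := by
  obtain ⟨C, hC0, hC⟩ := exists_trilinear_bound hφ hα
  have hα0 := hα.1
  -- `E ≤ 2 δ₀` gives `2 C √E ≤ α`, and `2 C E^(3/2)` is at most half of the linear decay `2 α E`
  refine ⟨(α / (2 * C + 1)) ^ 2 / 2, by positivity, fun {u₀ u G} h hb τ hτ => ?_⟩
  obtain ⟨E', hE', hle⟩ := h.hasDerivAt_energy hb hφ hα hτ
  refine ⟨hE'.differentiableAt, fun hsmall => ?_⟩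
  rw [hE'.deriv]
  obtain ⟨M, hM⟩ := IsLerayHopfWith.ae_norm_rescale_le hb hτ
  have h1 := hC (h.memLp_rescale hτ.le) hM (h.integrable_lap_rescale hb hτ)
    (h.isSolenoidal_rescale hτ)
  rw [← energy_eq hφ hα] at h1
  set E := energy φ α u τ
  have hE0 : 0 ≤ E := energy_nonneg φ α u τ
  have h2 : √E ≤ α / (2 * C + 1) := by
    rw [Real.sqrt_le_left (by positivity)]
    linarith
  have h3 : 2 * C * √E ≤ α := by
    rw [le_div_iff₀ (by positivity)] at h2
    nlinarith [Real.sqrt_nonneg E]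
  have h4 : 2 * (C * √E ^ 3) ≤ α * E := by
    calc 2 * (C * √E ^ 3) = 2 * C * √E * √E ^ 2 := by ring
      _ = 2 * C * √E * E := by rw [Real.sq_sqrt hE0]
      _ ≤ α * E := by gcongr
  have h5 := (le_abs_self _).trans h1
  linarith

end Decay

/-! ### Derivatives of the low and high frequencies -/

section Derivatives

variable {φ : V3 → ℝ} {α : ℝ}

theorem measurableSet_lowFrequency : MeasurableSet {ζ : V3 | ‖(2 * Real.pi) • ζ‖ ≤ 2} :=
  measurableSet_le (by fun_prop) measurable_const

theorem memLp_top_dsym_low (j : Fin 3) :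
    MemLp (fun ζ => if ‖(2 * Real.pi) • ζ‖ ≤ 2 then dsym j ζ else 0) ⊤ (volume : Measure V3) := by
  refine memLp_top_of_bdd (K := 2)
    (Measurable.ite measurableSet_lowFrequency (continuous_dsym j).measurable measurable_const)
    fun ζ => ?_
  split_ifs with h
  · have := norm_dsym_le j ζ
    rw [← norm_two_pi_smul] at this
    exact this.trans h
  · simp

/-- On `|ξ| ≤ 2` the symbol `i ξ_j` of `∂_j` is bounded by `2`. -/
theorem IsLowFrequency.exists_lineDeriv {B : ℝ} {f F : H} (hF : IsLowFrequency B f F) (j : Fin 3) :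
    ∃ g : H, (g : 𝓢'(V3, C3)) = ∂_{e j} (F : 𝓢'(V3, C3)) ∧ IsLowFrequency (2 * B) f g := by
  let g : H := 𝓕⁻ (mulC _ (memLp_top_dsym_low j) (𝓕 F))
  have hg : (𝓕 g : H) =ᵐ[volume]
      fun ζ => (if ‖(2 * Real.pi) • ζ‖ ≤ 2 then dsym j ζ else 0) • (𝓕 F : H) ζ := by
    simp only [g]
    rw [FourierTransform.fourier_fourierInv_eq]
    exact coeFn_mulC _ _
  refine ⟨g, eq_lineDeriv_iff.mpr ?_, ?_⟩
  · filter_upwards [hg, hF] with ζ h1 h2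
    rw [h1]
    split_ifs at h2 ⊢ with h
    · rfl
    · rw [norm_le_zero_iff.mp h2, smul_zero, smul_zero]
  · filter_upwards [hg, hF] with ζ h1 h2
    rw [h1, norm_smul]
    split_ifs at h2 ⊢ with h
    · have h3 := norm_dsym_le j ζ
      rw [← norm_two_pi_smul] at h3
      rw [mul_assoc]
      exact mul_le_mul (h3.trans h) h2 (norm_nonneg _) zero_le_two
    · simp

theorem IsLowFrequency.exists_iterate_lineDeriv {B : ℝ} {f F : H} (hF : IsLowFrequency B f F)
    (j : Fin 3) (n : ℕ) :
    ∃ g : H, (g : 𝓢'(V3, C3)) = (fun S : 𝓢'(V3, C3) => ∂_{e j} S)^[n] (F : 𝓢'(V3, C3)) ∧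
      IsLowFrequency (2 ^ n * B) f g := by
  induction n with
  | zero => exact ⟨F, rfl, by simpa using hF⟩
  | succ n ih =>
    obtain ⟨g, hg, hlow⟩ := ih
    obtain ⟨g', hg', hlow'⟩ := hlow.exists_lineDeriv j
    refine ⟨g', ?_, ?_⟩
    · rw [Function.iterate_succ_apply', ← hg, hg']
    · rw [pow_succ', mul_assoc]
      exact hlow'

theorem IsLowFrequency.exists_multiDeriv {B : ℝ} {f F : H} (hF : IsLowFrequency B f F)
    (β : Fin 3 → ℕ) :
    ∃ g : H, IsWeakDeriv β F g ∧ IsLowFrequency (2 ^ β 0 * (2 ^ β 1 * (2 ^ β 2 * B))) f g := by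
  obtain ⟨g₂, h₂, l₂⟩ := hF.exists_iterate_lineDeriv 2 (β 2)
  obtain ⟨g₁, h₁, l₁⟩ := l₂.exists_iterate_lineDeriv 1 (β 1)
  obtain ⟨g₀, h₀, l₀⟩ := l₁.exists_iterate_lineDeriv 0 (β 0)
  exact ⟨g₀, by rw [IsWeakDeriv, multiDeriv, ← h₂, ← h₁, h₀], l₀⟩

theorem sum_norm_dsym_sq (ζ : V3) : ∑ j, ‖dsym j ζ‖ ^ 2 = lap ζ := by
  have h1 : ∀ j, ‖dsym j ζ‖ ^ 2 = (2 * Real.pi) ^ 2 * ‖ζ j‖ ^ 2 := fun j => by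
    simp only [dsym, norm_mul, Complex.norm_real, Complex.norm_I, mul_one, mul_pow, sq_abs,
      Real.norm_eq_abs, Complex.norm_ofNat]
  simp only [h1]
  rw [← Finset.mul_sum, ← EuclideanSpace.norm_sq_eq, lap, mul_pow _ ‖ζ‖]

/-- The left-hand side has the symbol `(1 - φ)² |ξ|²`, and `(1 - φ)² ≤ 1 - φ² ≤ symb`. -/
theorem gradSq_high_le (hφ : IsCutoff φ) (hα : α ∈ Ioo (0 : ℝ) (1 / 8)) {g : H}
    (hl : Integrable fun ζ => lap ζ * ‖(𝓕 g : H) ζ‖ ^ 2) :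
    gradSq (multiplier (fun ξ => 1 - φ ξ) g) ≤
      ENNReal.ofReal (∫ ζ, symb φ α ((2 * Real.pi) • ζ) * lap ζ * ‖(𝓕 g : H) ζ‖ ^ 2) := by
  have hb : MemLp (fun ζ => ((1 - φ ((2 * Real.pi) • ζ) : ℝ) : ℂ)) ⊤ volume :=
    memLp_top_symbol (σ := fun ξ => 1 - φ ξ) (hφ.measurable.const_sub 1) hφ.abs_one_sub_le
  let D : Fin 3 → H := fun j => 𝓕⁻ (mulC _ hb (grd j (𝓕 g)))
  have hD : ∀ j, (𝓕 (D j) : H) =ᵐ[volume]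
      fun ζ => ((1 - φ ((2 * Real.pi) • ζ) : ℝ) : ℂ) • dsym j ζ • (𝓕 g : H) ζ := fun j => by
    simp only [D]
    rw [FourierTransform.fourier_fourierInv_eq]
    filter_upwards [coeFn_mulC hb (grd j (𝓕 g)), coeFn_grd hl j] with ζ h1 h2
    rw [h1, h2]
  -- `gradSq` is an infimum over weak gradients, of which `D` is one
  refine (iInf₂_le D fun j => eq_lineDeriv_iff.mpr ?_).trans ?_
  · filter_upwards [hD j, fourier_multiplier (hφ.measurable.const_sub 1) hφ.abs_one_sub_le g]
      with ζ h1 h2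
    rw [h1, h2, smul_comm]
  · rw [← ENNReal.ofReal_sum_of_nonneg fun j _ => sq_nonneg _]
    refine ENNReal.ofReal_le_ofReal ?_
    have h1 : ∀ j, ‖D j‖ ^ 2 = ∫ ζ, ‖(𝓕 (D j) : H) ζ‖ ^ 2 := fun j => by
      rw [← Lp.norm_fourier_eq, norm_sq_L2]
    simp only [h1]
    rw [← integral_finsetSum _ fun j _ => integrable_norm_sq _]
    have hi : Integrable fun ζ => symb φ α ((2 * Real.pi) • ζ) * lap ζ * ‖(𝓕 g : H) ζ‖ ^ 2 := by
      simp only [mul_assoc]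
      exact integrable_mul_lap (measurable_symb_comp hφ hα _) (fun ζ => abs_symb_le hφ hα _) hl
    refine integral_mono_ae (integrable_finsetSum _ fun j _ => integrable_norm_sq _) hi ?_
    filter_upwards [ae_all_iff.mpr hD] with ζ h2
    have h3 : ∀ j, ‖(𝓕 (D j) : H) ζ‖ ^ 2 =
        ‖dsym j ζ‖ ^ 2 * ((1 - φ ((2 * Real.pi) • ζ)) ^ 2 * ‖(𝓕 g : H) ζ‖ ^ 2) := fun j => by
      rw [h2 j, norm_smul, norm_smul, Complex.norm_real, Real.norm_eq_abs, mul_pow, mul_pow, sq_abs]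
      ring
    simp only [h3]
    rw [← Finset.sum_mul, sum_norm_dsym_sq]
    have h4 : (1 - φ ((2 * Real.pi) • ζ)) ^ 2 ≤ symb φ α ((2 * Real.pi) • ζ) := by
      refine le_trans ?_ (one_sub_sq_le_symb _)
      have := hφ.mem_unit ((2 * Real.pi) • ζ)
      nlinarith [this.1, this.2]
    have h5 := mul_le_mul_of_nonneg_right h4 (mul_nonneg (lap_nonneg ζ) (sq_nonneg ‖(𝓕 g : H) ζ‖))
    calc _ = (1 - φ ((2 * Real.pi) • ζ)) ^ 2 * (lap ζ * ‖(𝓕 g : H) ζ‖ ^ 2) := by ring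
      _ ≤ _ := h5
      _ = _ := by ring

end Derivatives

end NSE

end

theorem proposition3p2 (φ : NSE.V3 → ℝ) (hφ : NSE.IsCutoff φ)
    (α : ℝ) (hα : α ∈ Ioo (0 : ℝ) (1 / 8)) :
    ∃ δ₀ : ℝ, 0 < δ₀ ∧ ∃ (C : ℝ) (Cβ : (Fin 3 → ℕ) → ℝ),
      ∀ δ ∈ Ioc (0 : ℝ) δ₀, ∀ (u₀ : NSE.V3 → NSE.V3) (u : ℝ → NSE.V3 → NSE.V3),
        NSE.IsLerayHopf u₀ u → NSE.BoundedBeforeOne u →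
        -- small initial data have small energy
        ((∫ x, ‖u₀ x‖ ^ 2 ≤ δ) → NSE.energy φ α u 0 ≤ δ) ∧
        (NSE.energy φ α u 0 ≤ δ →
          -- decay of the energy
          (∀ τ : ℝ, 0 < τ → DifferentiableAt ℝ (NSE.energy φ α u) τ ∧
            deriv (NSE.energy φ α u) τ ≤ -α * NSE.energy φ α u τ) ∧
          (∀ τ : ℝ, 0 ≤ τ →
            NSE.energy φ α u τ ≤ Real.exp (-α * τ) * NSE.energy φ α u 0) ∧
          -- the decomposition
          (∀ τ : ℝ, 0 ≤ τ →
            NSE.toL2 (NSE.rescale u τ) = NSE.low φ u τ + NSE.high φ u τ) ∧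
          -- the low frequency part
          (∀ m : ℝ≥0∞, 4 ≤ m →
            (∀ τ : ℝ, 0 < τ → ∀ β : Fin 3 → ℕ,
              ∃ g : Lp NSE.C3 2 (volume : Measure NSE.V3),
                NSE.IsWeakDeriv β (NSE.low φ u τ) g ∧
                eLpNorm g m volume ≤ ENNReal.ofReal (Cβ β * √δ)) ∧
            Tendsto (fun τ : ℝ => eLpNorm (NSE.low φ u τ) m volume) atTop (𝓝 0)) ∧
          -- the high frequency part
          ((⨆ τ ∈ Ici (0 : ℝ), ENNReal.ofReal (‖NSE.high φ u τ‖ ^ 2))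
              + ∫⁻ τ in Ioi (0 : ℝ), NSE.gradSq (NSE.high φ u τ)
            ≤ ENNReal.ofReal (C * δ)) ∧
          Tendsto (fun τ : ℝ => ‖NSE.high φ u τ‖ ^ 2) atTop (𝓝 0)) := by
  obtain ⟨δ₀, hδ₀, hthr⟩ := NSE.exists_energy_threshold hφ hα
  obtain ⟨K, hK0, hK⟩ := NSE.exists_lowFrequency_bound hφ hα
  have hα0 := hα.1
  -- `1` for the supremum and `1 / (2α²)` for the dissipation; each derivative of a low frequency
  -- field costs a factor `2`
  refine ⟨δ₀, hδ₀, 1 + (2 * α ^ 2)⁻¹,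
    fun β => K * (2 ^ β 0 * (2 ^ β 1 * (2 ^ β 2 * 1))), ?_⟩
  rintro δ ⟨hδ, hδle⟩ u₀ u ⟨G, h⟩ hb
  refine ⟨(h.energy_zero_le hφ hα).trans, fun hE0 => ?_⟩
  set E := NSE.energy φ α u with hEdef
  have hEnn : ∀ τ, 0 ≤ E τ := NSE.energy_nonneg φ α u
  have hdiff : ∀ τ, 0 < τ → DifferentiableAt ℝ E τ := fun τ hτ => (hthr h hb τ hτ).1
  have hc0 : ContinuousWithinAt E (Ici 0) 0 := by
    rw [← Ioi_insert, continuousWithinAt_insert_self]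
    exact h.tendsto_energy_zero hφ hα
  have hcont : ContinuousOn E (Ici 0) := fun τ hτ => by
    rcases (mem_Ici.mp hτ).eq_or_lt with rfl | hτ'
    · exact hc0
    · exact (hdiff τ hτ').continuousAt.continuousWithinAt
  have hexp : ∀ τ, 0 ≤ τ → E τ ≤ Real.exp (-α * τ) * E 0 := fun τ hτ =>
    NSE.le_exp_of_deriv_le_below hα0.le hEnn hcont hdiff
      (fun r hr hsmall => by
        have h1 := (hthr h hb r hr).2 hsmall
        have h2 := NSE.dissipation_nonneg (α := α) hφ u r
        have h3 : 0 ≤ 2 * α ^ 2 * NSE.dissipation φ α u r := by positivity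
        linarith)
      (b := 2 * δ₀) (by linarith) hτ
  have hEle : ∀ τ, 0 ≤ τ → E τ ≤ δ := fun τ hτ => by
    have h1 : Real.exp (-α * τ) ≤ 1 :=
      Real.exp_le_one_iff.mpr (by have := mul_nonneg hα0.le hτ; linarith)
    exact ((hexp τ hτ).trans (mul_le_of_le_one_left (hEnn 0) h1)).trans hE0
  have hderiv : ∀ τ, 0 < τ →
      deriv E τ ≤ -α * E τ - 2 * α ^ 2 * NSE.dissipation φ α u τ := fun τ hτ =>
    (hthr h hb τ hτ).2 (by linarith [hEle τ hτ.le])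
  have hElim : Tendsto E atTop (𝓝 0) := by
    have h1 : Tendsto (fun τ : ℝ => Real.exp (-α * τ) * E 0) atTop (𝓝 0) := by
      have h2 : Tendsto (fun τ : ℝ => -α * τ) atTop atBot :=
        tendsto_id.const_mul_atTop_of_neg (by linarith)
      simpa using (Real.tendsto_exp_atBot.comp h2).mul_const (E 0)
    refine squeeze_zero' (Eventually.of_forall hEnn) ?_ h1
    filter_upwards [eventually_ge_atTop 0] with τ hτ using hexp τ hτ
  have hhigh : ∀ τ, ‖NSE.high φ u τ‖ ^ 2 ≤ E τ := fun τ => by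
    rw [hEdef, NSE.energy_eq hφ hα]
    exact NSE.norm_sq_high_le hφ hα _
  have hlow : ∀ τ, NSE.IsLowFrequency 1 (𝓕 (NSE.toL2 (NSE.rescale u τ))) (NSE.low φ u τ) :=
    fun τ => NSE.isLowFrequency_low hφ _
  have hbound : ∀ {B : ℝ}, 0 ≤ B → ∀ {τ : ℝ} {F : NSE.H},
      NSE.IsLowFrequency B (𝓕 (NSE.toL2 (NSE.rescale u τ))) F → ∀ {m : ℝ≥0∞}, 4 ≤ m →
      eLpNorm F m volume ≤ ENNReal.ofReal (K * B * √(E τ)) := fun {B} hB {τ F} hF {m} hm => by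
    have h1 := hK hB hF
    rw [← NSE.energy_eq hφ hα] at h1
    exact NSE.eLpNorm_le_of_four_of_top ENNReal.ofReal_ne_top h1.2 h1.1 hm
  refine ⟨fun τ hτ => ⟨hdiff τ hτ, ?_⟩, hexp,
    fun τ _ => (NSE.multiplier_add_multiplier hφ _).symm, fun m hm => ⟨fun τ hτ β => ?_, ?_⟩, ?_, ?_⟩
  · have h1 := NSE.dissipation_nonneg (α := α) hφ u τ
    have h2 : 0 ≤ 2 * α ^ 2 * NSE.dissipation φ α u τ := by positivity
    linarith [hderiv τ hτ]
  · obtain ⟨g, hg, hglow⟩ := (hlow τ).exists_multiDeriv β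
    refine ⟨g, hg, (hbound (by positivity) hglow hm).trans (ENNReal.ofReal_le_ofReal ?_)⟩
    gcongr
    exact hEle τ hτ.le
  · have h1 : Tendsto (fun τ => ENNReal.ofReal (K * 1 * √(E τ))) atTop (𝓝 0) := by
      have h2 := ((Real.continuous_sqrt.tendsto 0).comp hElim).const_mul (K * 1)
      rw [Real.sqrt_zero, mul_zero] at h2
      have h3 := (ENNReal.continuous_ofReal.tendsto 0).comp h2
      rwa [ENNReal.ofReal_zero] at h3
    exact tendsto_of_tendsto_of_tendsto_of_le_of_le tendsto_const_nhds h1 (fun _ => bot_le)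
      fun τ => hbound zero_le_one (hlow τ) hm
  · have hneg : ∀ τ ∈ Ioi (0 : ℝ), deriv E τ ≤ 0 := fun τ hτ => by
      have h1 := NSE.dissipation_nonneg (α := α) hφ u τ
      have h2 : 0 ≤ 2 * α ^ 2 * NSE.dissipation φ α u τ := by positivity
      have h3 := mul_nonneg hα0.le (hEnn τ)
      linarith [hderiv τ hτ]
    have hHD : ∀ τ ∈ Ioi (0 : ℝ), HasDerivAt E (deriv E τ) τ := fun τ hτ => (hdiff τ hτ).hasDerivAt
    have hint := integrableOn_Ioi_deriv_of_nonpos hc0 hHD hneg hElim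
    have hval := integral_Ioi_of_hasDerivAt_of_nonpos hc0 hHD hneg hElim
    -- `2α²` times the dissipation is at most `-E'`, whose integral is `E(0)`
    have hgrad : ∫⁻ τ in Ioi (0 : ℝ), NSE.gradSq (NSE.high φ u τ) ≤
        ENNReal.ofReal ((2 * α ^ 2)⁻¹ * δ) := by
      calc ∫⁻ τ in Ioi (0 : ℝ), NSE.gradSq (NSE.high φ u τ)
          ≤ ∫⁻ τ in Ioi (0 : ℝ), ENNReal.ofReal ((2 * α ^ 2)⁻¹ * -deriv E τ) := by
            refine setLIntegral_mono' measurableSet_Ioi fun τ hτ => ?_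
            refine (NSE.gradSq_high_le hφ hα (h.integrable_lap_rescale hb hτ)).trans
              (ENNReal.ofReal_le_ofReal ?_)
            rw [← div_eq_inv_mul, le_div_iff₀ (by positivity)]
            have h1 := hderiv τ hτ
            rw [NSE.dissipation] at h1
            have h3 := mul_nonneg hα0.le (hEnn τ)
            linarith
        _ = ENNReal.ofReal (∫ τ in Ioi (0 : ℝ), (2 * α ^ 2)⁻¹ * -deriv E τ) := by
            refine (ofReal_integral_eq_lintegral_ofReal (hint.neg.const_mul _) ?_).symm
            filter_upwards [ae_restrict_mem measurableSet_Ioi] with τ hτ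
            exact mul_nonneg (by positivity) (neg_nonneg.mpr (hneg τ hτ))
        _ ≤ ENNReal.ofReal ((2 * α ^ 2)⁻¹ * δ) := by
            rw [integral_const_mul, integral_neg, hval]
            refine ENNReal.ofReal_le_ofReal (mul_le_mul_of_nonneg_left ?_ (by positivity))
            linarith
    have hsup : (⨆ τ ∈ Ici (0 : ℝ), ENNReal.ofReal (‖NSE.high φ u τ‖ ^ 2)) ≤ ENNReal.ofReal δ :=
      iSup₂_le fun τ hτ => ENNReal.ofReal_le_ofReal ((hhigh τ).trans (hEle τ hτ))
    refine (add_le_add hsup hgrad).trans (le_of_eq ?_)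
    rw [← ENNReal.ofReal_add hδ.le (by positivity)]
    congr 1
    ring
  · exact squeeze_zero (fun τ => sq_nonneg _) hhigh hElim
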